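/- \textbf{Setting.} Let $d\in\mathbb N_0$, $\rho\in[0,1]$, $m_1,m_2\in\mathbb R$. Write $X=(x,\xi)$, $Y=(y,\eta)$, $Z=(z,\zeta)\in\mathbb R^d\times\mathbb R^d$, $\sigma(X,Y)=\xi\cdot y-x\cdot\eta$, $\langle\xi\rangle=(1+|\xi|^2)^{1/2}$, and $$S^m_\rho=\bigl\{f\in C^\infty(\mathbb R^{2d},\mathbb{C}) : \forall a,\alpha\in\mathbb N_0^d\ \exists C:\ |\partial_x^a\partial_\xi^\alpha f(x,\xi)|\le C\langle\xi\rangle^{m-|\alpha|\rho}\bigr\}.$$ Let $B=\frac12\sum_{k,l}B_{kl}\,dx_k\wedge dx_l$ be a magnetic field on $\mathbb R^d$ (a closed real two-form, $B_{kl}=-B_{lk}$) whose components are smooth and bounded with bounded derivatives of all orders. For $\varepsilon\in(0,1]$ let $\gamma^B_\varepsilon(x,y,z)$ be $\frac1\varepsilon$ times the flux of $B$ through the oriented triangle with corners $x-\frac\varepsilon2(y+z)$, $x+\frac\varepsilon2(y-z)$, $x+\frac\varepsilon2(y+z)$. With $(\mathcal F f)(X)=(2\pi)^{-d}\int e^{i\sigma(X,Y)}f(Y)\,dY=(\mathcal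 F^{-1}f)(X)$, the magnetic Weyl product for coupling constant $\lambda$ is the oscillatory integral $$(f\sharp^B g)(X)=\frac1{(2\pi)^{2d}}\int dY\int dZ\;e^{i\sigma(X,Y+Z)}\,e^{i\frac\varepsilon2\sigma(Y,Z)-i\lambda\gamma^B_\varepsilon(x,y,z)}\,(\mathcal F^{-1}f)(Y)\,(\mathcal F^{-1}g)(Z),$$ i.e. the limit as $\delta\downarrow0$ of the absolutely convergent integrals for $\chi_1(\delta\,\cdot)f$, $\chi_2(\delta\,\cdot)g$, for all Schwartz functions $\chi_1,\chi_2$ with $\chi_1(0)=\chi_2(0)=1$. Put $\mathcal L_0(Y,Z)=\frac12(\eta\cdot z-y\cdot\zeta)$ and, for $j\ge1$, $$\mathcal L_j(x,y,z)=\frac1{j!}\sum_{k,l,m_1,\dots,m_{j-1}=1}^d\partial_{x_{m_1}}\cdots\partial_{x_{m_{j-1}}}B_{kl}(x)\,y_kz_l\Bigl(-\frac12\Bigr)^{j+1}\frac1{(j+1)^2}\sum_{c=1}^j\binom{j+1}{c}\bigl((1-(-1)^{j+1})c-(1-(-1)^c)(j+1)\bigr)\,y_{m_1}\cdots y_{m_{c-1}}z_{m_c}\cdots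 z_{m_{j-1}}.$$ For $n,k\in\mathbb N_0$ let $$(f\sharp^Bg)_{(n,k)}(X)=\sum_{\substack{k_0+\sum_{j=1}^n jk_j=n\\ \sum_{j=1}^nk_j=k}}\frac{i^{k+k_0}}{k_0!\,k_1!\cdots k_n!}\;\mathcal L_0^{k_0}\bigl((\partial_\eta,\partial_y),(\partial_\zeta,\partial_z)\bigr)\prod_{j=1}^n\mathcal L_j^{k_j}(x,-i\partial_\eta,-i\partial_\zeta)\,f(Y)g(Z)\Big|_{Y=X=Z},$$ where $\mathcal L_0\bigl((\partial_\eta,\partial_y),(\partial_\zeta,\partial_z)\bigr)=\frac12(\partial_y\cdot\partial_\zeta-\partial_\eta\cdot\partial_z)$ and the derivatives do not act on the coefficients of the $\mathcal L_j$, which depend on $x$ only. \textbf{Corollary (expansion of $\sharp^B$ in $\varepsilon$).} Set $\lambda=1$ and let $f\in S^{m_1}_\rho$, $g\in S^{m_2}_\rho$. Then: (i) for all $n,k$, $(f\sharp^Bg)_{(n,k)}\in S^{m_1+m_2-(n+k)\rho}_\rho$, and for all $n$ $$(f\sharp^Bg)_{(n)}:=\sum_{k=0}^n(f\sharp^Bg)_{(n,k)}\in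 S^{m_1+m_2-n\rho}_\rho;$$ (ii) for every $\varepsilon\in(0,1]$ the oscillatory integral for $f\sharp^Bg$ exists at every point, $f\sharp^Bg\in S^{m_1+m_2}_\rho$, and for every $N\in\mathbb N_0$ $$R_{N}^{\varepsilon}:=f\sharp^Bg-\sum_{n=0}^N\varepsilon^n(f\sharp^Bg)_{(n)}\in S^{m_1+m_2-(N+1)\rho}_\rho;$$ (iii) $R^\varepsilon_N=O(\varepsilon^{N+1})$ in $S^{m_1+m_2-(N+1)\rho}_\rho$: for all $N$ and all multi-indices $a,\alpha$ there is $C$ such that for all $\varepsilon\in(0,1]$ and all $(x,\xi)$ $$|\partial_x^a\partial_\xi^\alpha R^\varepsilon_N(x,\xi)|\le C\,\varepsilon^{N+1}\langle\xi\rangle^{m_1+m_2-(N+1)\rho-|\alpha|\rho}.$$ -/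

import Mathlib

open scoped ContDiff SchwartzMap Topology

noncomputable section

namespace MagneticWeyl

/-- Configuration space `ℝ^d` with its Euclidean structure. -/
abbrev Config (d : ℕ) : Type := EuclideanSpace ℝ (Fin d)

/-- Phase space `ℝ^d × ℝ^d`; a point is `X = (x, ξ)`. -/
abbrev Phase (d : ℕ) : Type := Config d × Config d

/-- The standard basis vector `e_i` of `ℝ^d`. -/
def basisVec {d : ℕ} (i : Fin d) : Config d := EuclideanSpace.single i (1 : ℝ)

/-! ### Partial derivatives and Hörmander symbol classes -/

/-- The partial derivative `∂_{x_i} f`. -/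
def derivPos {d : ℕ} (i : Fin d) (f : Phase d → ℂ) : Phase d → ℂ :=
  fun X => fderiv ℝ f X (basisVec i, 0)

/-- The partial derivative `∂_{ξ_i} f`. -/
def derivMom {d : ℕ} (i : Fin d) (f : Phase d → ℂ) : Phase d → ℂ :=
  fun X => fderiv ℝ f X (0, basisVec i)

/-- `∂_x^a ∂_ξ^α f` for multi-indices `a, α ∈ ℕ₀^d`. -/
def partialDeriv {d : ℕ} (a α : Fin d → ℕ) (f : Phase d → ℂ) : Phase d → ℂ :=
  (List.finRange d).foldr (fun i h => (derivPos i)^[a i] h)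
    ((List.finRange d).foldr (fun i h => (derivMom i)^[α i] h) f)

/-- `⟨ξ⟩ = (1 + |ξ|²)^{1/2}`. -/
def japanese {d : ℕ} (ξ : Config d) : ℝ := Real.sqrt (1 + ‖ξ‖ ^ 2)

/-- The Hörmander class `S^m_ρ`: smooth `f` such that for all multi-indices `a, α` there is `C` with
`|∂_x^a ∂_ξ^α f(x, ξ)| ≤ C ⟨ξ⟩^{m - |α| ρ}`. -/
def IsHormander (d : ℕ) (ρ m : ℝ) (f : Phase d → ℂ) : Prop :=
  ContDiff ℝ ∞ f ∧
    ∀ a α : Fin d → ℕ, ∃ C : ℝ, ∀ X : Phase d,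
      ‖partialDeriv a α f X‖ ≤ C * japanese X.2 ^ (m - ((∑ i, α i : ℕ) : ℝ) * ρ)

/-! ### Magnetic fields and magnetic flux -/

/-- A magnetic field with `BC^∞` components: a closed two-form
`B = ½ ∑ B_{kl}(x) dx_k ∧ dx_l` whose components are smooth, bounded, and have bounded derivatives
of all orders. -/
structure IsMagneticField {d : ℕ} (B : Config d → Fin d → Fin d → ℝ) : Prop where
  smooth : ∀ k l, ContDiff ℝ ∞ (fun x => B x k l)
  bounded : ∀ k l, ∀ n : ℕ, ∃ C : ℝ, ∀ x, ‖iteratedFDeriv ℝ n (fun x => B x k l) x‖ ≤ C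
  antisymm : ∀ x k l, B x k l = - B x l k
  closed : ∀ x i k l,
    fderiv ℝ (fun x => B x k l) x (basisVec i) + fderiv ℝ (fun x => B x l i) x (basisVec k)
      + fderiv ℝ (fun x => B x i k) x (basisVec l) = 0

/-- The flux `Γ^B(a, b, c)` of the two-form `B` through the oriented triangle with corners
`a, b, c`, computed in the parametrisation `a + s (b - a) + t (c - b)`, `0 ≤ t ≤ s ≤ 1`. -/
def flux {d : ℕ} (B : Config d → Fin d → Fin d → ℝ) (a b c : Config d) : ℝ :=
  ∫ s in (0 : ℝ)..1, ∫ t in (0 : ℝ)..s,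
    ∑ k, ∑ l, B (a + s • (b - a) + t • (c - b)) k l * (b - a) k * (c - b) l

/-- The scaled flux `γ^B_ε(x, y, z)`: `1/ε` times the flux through the triangle with corners
`x - ε/2 (y + z)`, `x + ε/2 (y - z)`, `x + ε/2 (y + z)`. -/
def scaledFlux {d : ℕ} (ε : ℝ) (B : Config d → Fin d → Fin d → ℝ) (x y z : Config d) : ℝ :=
  ε⁻¹ * flux B (x - (ε / 2) • (y + z)) (x + (ε / 2) • (y - z)) (x + (ε / 2) • (y + z))

/-! ### The magnetic Weyl product -/

/-- The symplectic form `σ(X, Y) = ξ · y - x · η`, where `X = (x, ξ)` and `Y = (y, η)`. -/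
def symplecticForm {d : ℕ} (X Y : Phase d) : ℝ := inner ℝ X.2 Y.1 - inner ℝ X.1 Y.2

/-- The symplectic Fourier transform
`(F f)(X) = (2π)^{-d} ∫ e^{i σ(X, Y)} f(Y) dY`, which is its own inverse. -/
def symplecticFourier {d : ℕ} (f : Phase d → ℂ) (X : Phase d) : ℂ :=
  (((2 * Real.pi) ^ d)⁻¹ : ℝ) *
    ∫ Y : Phase d, Complex.exp (Complex.I * (symplecticForm X Y : ℂ)) * f Y

/-- The twister `T_{ε,λ}(x, Y, Z) = ε/2 σ(Y, Z) - λ γ^B_ε(x, y, z)`. -/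
def twister {d : ℕ} (ε lam : ℝ) (B : Config d → Fin d → Fin d → ℝ) (x : Config d)
    (Y Z : Phase d) : ℝ :=
  ε / 2 * symplecticForm Y Z - lam * scaledFlux ε B x Y.1 Z.1

/-- The integral formula for the magnetic Weyl product,
`(2π)^{-2d} ∫ dY ∫ dZ e^{i σ(X, Y + Z)} e^{i T_{ε,λ}(x, Y, Z)} (F⁻¹ f)(Y) (F⁻¹ g)(Z)`.
It converges absolutely for Schwartz functions `f, g`. -/
def weylIntegral {d : ℕ} (ε lam : ℝ) (B : Config d → Fin d → Fin d → ℝ) (f g : Phase d → ℂ)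
    (X : Phase d) : ℂ :=
  (((2 * Real.pi) ^ (2 * d))⁻¹ : ℝ) *
    ∫ Y : Phase d, ∫ Z : Phase d,
      Complex.exp (Complex.I * (symplecticForm X (Y + Z) : ℂ)) *
        Complex.exp (Complex.I * (twister ε lam B X.1 Y Z : ℂ)) *
        symplecticFourier f Y * symplecticFourier g Z

/-- For symbols, the integral formula is read as an oscillatory integral: it has the value `v` at
`X` if, for all Schwartz cut-offs `χ₁, χ₂` with `χ₁(0) = χ₂(0) = 1`, the absolutely convergent
integrals for the Schwartz functions `χ₁(δ ·) f` and `χ₂(δ ·) g` tend to `v` as `δ ↓ 0`. -/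
def HasMagneticWeylProduct {d : ℕ} (ε lam : ℝ) (B : Config d → Fin d → Fin d → ℝ)
    (f g : Phase d → ℂ) (X : Phase d) (v : ℂ) : Prop :=
  ∀ χ₁ χ₂ : 𝓢(Phase d, ℂ), χ₁ 0 = 1 → χ₂ 0 = 1 →
    Filter.Tendsto
      (fun δ : ℝ => weylIntegral ε lam B (fun W => χ₁ (δ • W) * f W) (fun W => χ₂ (δ • W) * g W) X)
      (𝓝[>] (0 : ℝ)) (𝓝 v)

open Classical in
/-- The magnetic Weyl product `f ♯^B g` with parameters `ε, λ`: the value of the oscillatory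
integral (and `0` at points where it does not exist). -/
def magneticWeylProduct {d : ℕ} (ε lam : ℝ) (B : Config d → Fin d → Fin d → ℝ)
    (f g : Phase d → ℂ) (X : Phase d) : ℂ :=
  if h : ∃ v, HasMagneticWeylProduct ε lam B f g X v then h.choose else 0

/-! ### The terms of the two-parameter expansion -/

/-- Names of the coordinates of `(Y, Z) = ((y, η), (z, ζ))`. -/
abbrev Coord (d : ℕ) : Type := (Fin d ⊕ Fin d) ⊕ (Fin d ⊕ Fin d)

/-- Polynomials in the coordinates `y, η, z, ζ`. -/
abbrev Poly (d : ℕ) : Type := MvPolynomial (Coord d) ℂ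

/-- The coordinate `y_i`. -/
def yVar {d : ℕ} (i : Fin d) : Poly d := MvPolynomial.X (Sum.inl (Sum.inl i))
/-- The coordinate `η_i`. -/
def etaVar {d : ℕ} (i : Fin d) : Poly d := MvPolynomial.X (Sum.inl (Sum.inr i))
/-- The coordinate `z_i`. -/
def zVar {d : ℕ} (i : Fin d) : Poly d := MvPolynomial.X (Sum.inr (Sum.inl i))
/-- The coordinate `ζ_i`. -/
def zetaVar {d : ℕ} (i : Fin d) : Poly d := MvPolynomial.X (Sum.inr (Sum.inr i))

/-- `𝓛_0(Y, Z) = ½ (η · z - y · ζ) = ½ σ(Y, Z)`. -/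
def polyL0 (d : ℕ) : Poly d :=
  MvPolynomial.C (1 / 2 : ℂ) * ∑ i : Fin d, (etaVar i * zVar i - yVar i * zetaVar i)

/-- `𝓛_j(x, y, z)` for `j ≥ 1`, a polynomial in `y, z` with coefficients depending on `x`:
`(1/j!) ∑_{k, l, m_1, …, m_{j-1}} ∂_{x_{m_1}} ⋯ ∂_{x_{m_{j-1}}} B_{kl}(x) y_k z_l (-1/2)^{j+1}
(j+1)^{-2} ∑_{c=1}^{j} binom(j+1, c) ((1 - (-1)^{j+1}) c - (1 - (-1)^c) (j+1))
y_{m_1} ⋯ y_{m_{c-1}} z_{m_c} ⋯ z_{m_{j-1}}`. -/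
def polyL {d : ℕ} (B : Config d → Fin d → Fin d → ℝ) (j : ℕ) (x : Config d) : Poly d :=
  ∑ k : Fin d, ∑ l : Fin d, ∑ mm : Fin (j - 1) → Fin d, ∑ c ∈ Finset.Icc 1 j,
    MvPolynomial.C
      (((1 / (j.factorial : ℝ)
        * iteratedFDeriv ℝ (j - 1) (fun x => B x k l) x (fun s => basisVec (mm s))
        * (-1 / 2) ^ (j + 1) * (1 / ((j : ℝ) + 1) ^ 2)
        * ((j + 1).choose c : ℝ)
        * ((1 - (-1) ^ (j + 1)) * (c : ℝ) - (1 - (-1) ^ c) * ((j : ℝ) + 1)) : ℝ)) : ℂ)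
      * yVar k * zVar l
      * ∏ s : Fin (j - 1), (if (s : ℕ) + 1 < c then yVar (mm s) else zVar (mm s))

/-- The tuples `(k_0, …, k_n)` with `k_0 + ∑_{j=1}^n j k_j = n` and `∑_{j=1}^n k_j = k`.
(The first condition forces every `k_j ≤ n`.) -/
def indexTuples (n k : ℕ) : Finset (Fin (n + 1) → ℕ) :=
  (Fintype.piFinset fun _ : Fin (n + 1) => Finset.range (n + 1)).filter fun κ =>
    κ 0 + ∑ j : Fin n, ((j : ℕ) + 1) * κ j.succ = n ∧ ∑ j : Fin n, κ j.succ = k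

/-- `∑ i^{k + k_0} / (k_0! ⋯ k_n!) 𝓛_0^{k_0} ∏_{j=1}^n 𝓛_j(x)^{k_j}`, summed over the tuples
`(k_0, …, k_n)` above. -/
def polyT {d : ℕ} (B : Config d → Fin d → Fin d → ℝ) (n k : ℕ) (x : Config d) : Poly d :=
  ∑ κ ∈ indexTuples n k,
    MvPolynomial.C (Complex.I ^ (k + κ 0) / ((∏ j : Fin (n + 1), (κ j).factorial : ℕ) : ℂ))
      * polyL0 d ^ κ 0 * ∏ j : Fin n, polyL B ((j : ℕ) + 1) x ^ κ j.succ

/-- Replace, in a polynomial, `y ↦ -i ∂_η`, `η ↦ i ∂_y`, `z ↦ -i ∂_ζ`, `ζ ↦ i ∂_z`, let the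
resulting (constant coefficient) differential operator act on `f(Y) g(Z)`, and put `Y = Z = X`.
In particular `η · z - y · ζ` becomes `∂_y · ∂_ζ - ∂_η · ∂_z`. -/
def applySymbols {d : ℕ} (P : Poly d) (f g : Phase d → ℂ) (X : Phase d) : ℂ :=
  ∑ m ∈ P.support, P.coeff m
    * ((-Complex.I) ^ (∑ i, m (Sum.inl (Sum.inl i))) * Complex.I ^ (∑ i, m (Sum.inl (Sum.inr i)))
      * partialDeriv (fun i => m (Sum.inl (Sum.inr i))) (fun i => m (Sum.inl (Sum.inl i))) f X)
    * ((-Complex.I) ^ (∑ i, m (Sum.inr (Sum.inl i))) * Complex.I ^ (∑ i, m (Sum.inr (Sum.inr i)))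
      * partialDeriv (fun i => m (Sum.inr (Sum.inr i))) (fun i => m (Sum.inr (Sum.inl i))) g X)

/-- The term `(f ♯^B g)_{(n,k)}` of the two-parameter expansion. -/
def expansionTerm {d : ℕ} (B : Config d → Fin d → Fin d → ℝ) (f g : Phase d → ℂ) (n k : ℕ)
    (X : Phase d) : ℂ :=
  applySymbols (polyT B n k X.1) f g X

end MagneticWeyl

end

/-!
# Expansion of the magnetic Weyl product in powers of `ε`

Let `w = (y, z)`, `θ = (η, ζ)`, and fix `X = (x, ξ)`. Carrying out partial Fourier transforms in the
momenta (`integral_exp_symplecticFourier`, `weylIntegral_eq`) rewrites the product, for Schwartz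
functions, as `(2π)^{-2d}` times
`∫∫ e^{-i w · θ} e^{-i γ_ε(x, w)} f(x - ε z / 2, ξ + η) g(x + ε y / 2, ξ + ζ) dw dθ`.
The parametrisation of the triangle (`scaledFlux_eq`) shows that the flux is a smooth function of
`x`, `u = ε w` and `w`, with no singularity at `ε = 0`. So the integrand is `e^{-i w · θ}` times an
amplitude `bigAmp B f g (X, u, (w, θ))` restricted to `u = ε w`, and `ε` occurs only through this
restriction (`oscFam`, `hasMagneticWeylProduct`).

All estimates are membership statements in the weighted classes `Cl` of families of smooth
functions, which contain the Hörmander classes (`isHormander_iff_cl`), amplitudes with their growth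
in `(u, w, θ)`, and rapidly decreasing functions. An amplitude need not be integrable, and a
derivative in `w` may even cost powers of `|w|`, the phase being quadratic in `w`. Derivatives in
`θ` cost nothing, however. Integrations by parts (`regOps`), first in `w`, which produce decay in
`θ`, and then in `θ`, which repair the growth in `w`, therefore turn the oscillatory integral into
an absolutely convergent one. This gives its existence, its independence of the cut-off
(`tendsto_osc`), bounds (`exists_norm_osc_le`) and differentiation in parameters (`dd_osc`). For
`ε > 0` the arguments of `f` and `g` control `(w, θ)` (`norm_le_pointL_pointR`), so that cutting off
`f` and `g` is one of the admissible regularisations.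

Each derivative in `ε` brings down a factor `w · ∂_u`. Under the oscillatory integral `w` becomes
`-i ∂_θ`, and derivatives in `θ` fall on `f` and `g` only, through `ξ + η` and `ξ + ζ`. Each
derivative in `ε` hence gains a factor `⟨ξ⟩^{-ρ}` (`oscFam_euler`, `eulerGain`), by Peetre's
inequality uniformly enough for the amplitude calculus. Taylor's theorem in `ε` with remainder of
order `N + 1` then gives the gain `ε^{N+1} ⟨ξ⟩^{-(N+1)ρ}`. Derivatives in `X` of the remainder are
remainders of the amplitudes `∂_X a`, so the gain holds in all seminorms (`Amp.cl_taylorRem`).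

It remains to identify the Taylor coefficients at `ε = 0`. For fixed `(w, θ)` the Taylor series of
the phase has the coefficients `𝓛_j(x, y, z)`: this is a computation of moments over the unit square
(`coefficient_identity`, `algHom_polyL`). The translations of `f` and `g` give the series
`exp(i ε 𝓛_0)` (`coeff_taylor_curveProd`). Expanding the exponential of the phase as a product of
exponentials of `i ε^j 𝓛_j` (`coeff_taylor_exp_mul`) yields the polynomials of the terms `(n, k)`,
with `y, z` as numbers and `η, ζ` acting as derivatives. The oscillatory integral turns `y, z` into
`-i ∂_η, -i ∂_ζ` and, by Fourier inversion (`osc_momentum`), evaluates at `θ = 0`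
(`partialSymbolSpec`), which is the definition of the terms of the expansion
(`oscFam_euler_iterate_zero`). That these terms are symbols of the asserted order is seen from the
number of momentum derivatives contained in each factor `𝓛_j` (`SymMul`, `sym_expansionTerm`).
-/

noncomputable section

namespace MagneticWeyl

/-! ### Weighted classes of smooth families -/

section Classes

variable {V V' : Type*} [NormedAddCommGroup V] [NormedSpace ℝ V]
  [NormedAddCommGroup V'] [NormedSpace ℝ V'] {κ κ' ι ι' : Type*}

/-- The derivative of `f` in the direction `v`. -/
def dd (v : V) (f : V → ℂ) : V → ℂ := fun x => fderiv ℝ f x v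

/-- The iterated derivative of `f` along a word of directions, the head of the word acting first. -/
def wd (e : κ → V) : List κ → (V → ℂ) → V → ℂ
  | [], f => f
  | k :: l, f => wd e l (dd (e k) f)

lemma contDiff_dd {f : V → ℂ} (hf : ContDiff ℝ ∞ f) (v : V) : ContDiff ℝ ∞ (dd v f) :=
  (hf.fderiv_right (m := ∞) (by simp)).clm_apply contDiff_const

lemma contDiff_wd (e : κ → V) (l : List κ) {f : V → ℂ} (hf : ContDiff ℝ ∞ f) :
    ContDiff ℝ ∞ (wd e l f) := by
  induction l generalizing f with
  | nil => exact hf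
  | cons k l ih => exact ih (contDiff_dd hf _)

lemma diff_of_smooth {f : V → ℂ} (hf : ContDiff ℝ ∞ f) : Differentiable ℝ f :=
  hf.differentiable (by simp)

lemma dd_add {f g : V → ℂ} (hf : ContDiff ℝ ∞ f) (hg : ContDiff ℝ ∞ g) (v : V) :
    dd v (f + g) = dd v f + dd v g := by
  funext x
  simp [dd, fderiv_add (diff_of_smooth hf x) (diff_of_smooth hg x)]

lemma dd_mul {f g : V → ℂ} (hf : ContDiff ℝ ∞ f) (hg : ContDiff ℝ ∞ g) (v : V) :
    dd v (f * g) = dd v f * g + f * dd v g := by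
  funext x
  simp [dd, fderiv_mul (diff_of_smooth hf x) (diff_of_smooth hg x)]
  ring

lemma dd_const_mul (c : ℂ) {f : V → ℂ} (hf : ContDiff ℝ ∞ f) (v : V) :
    dd v (fun x => c * f x) = fun x => c * dd v f x := by
  funext x
  simp [dd, fderiv_const_mul (diff_of_smooth hf x) c]

lemma dd_comm {f : V → ℂ} (hf : ContDiff ℝ ∞ f) (v v' : V) :
    dd v (dd v' f) = dd v' (dd v f) := by
  have key : ∀ a b : V, ∀ x, dd a (dd b f) x = fderiv ℝ (fderiv ℝ f) x a b := by
    intro a b x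
    have hd : DifferentiableAt ℝ (fderiv ℝ f) x :=
      (hf.fderiv_right (m := ∞) (by simp)).differentiable (by simp) x
    change fderiv ℝ (fun y => fderiv ℝ f y b) x a = _
    rw [fderiv_clm_apply hd (differentiableAt_const b)]
    simp
  funext x
  rw [key, key]
  have hs : IsSymmSndFDerivAt ℝ f x :=
    (hf.contDiffAt (x := x)).isSymmSndFDerivAt (n := ∞) (by simp only [minSmoothness_of_isRCLikeNormedField]; exact WithTop.coe_le_coe.2 (le_top (a := (2 : ℕ∞))))
  exact hs v v'

lemma wd_add (e : κ → V) (l : List κ) {f g : V → ℂ} (hf : ContDiff ℝ ∞ f) (hg : ContDiff ℝ ∞ g) :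
    wd e l (f + g) = wd e l f + wd e l g := by
  induction l generalizing f g with
  | nil => rfl
  | cons k l ih => simp only [wd, dd_add hf hg, ih (contDiff_dd hf _) (contDiff_dd hg _)]

lemma wd_const_mul (e : κ → V) (l : List κ) (c : ℂ) {f : V → ℂ} (hf : ContDiff ℝ ∞ f) :
    wd e l (fun x => c * f x) = fun x => c * wd e l f x := by
  induction l generalizing f with
  | nil => rfl
  | cons k l ih => simp only [wd, dd_const_mul c hf, ih (contDiff_dd hf _)]

lemma dd_zero (v : V) : dd v (0 : V → ℂ) = 0 := by
  funext x; simp [dd]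

lemma wd_zero (e : κ → V) (l : List κ) : wd e l (0 : V → ℂ) = 0 := by
  induction l with
  | nil => rfl
  | cons k l ih => simp only [wd, dd_zero, ih]

lemma contDiff_finset_sum {α : Type*} (s : Finset α) {f : α → V → ℂ}
    (hf : ∀ i ∈ s, ContDiff ℝ ∞ (f i)) : ContDiff ℝ ∞ (∑ i ∈ s, f i) := by
  have := ContDiff.sum (𝕜 := ℝ) (n := ∞) hf
  convert this using 1
  funext x; simp

lemma wd_sum (e : κ → V) (l : List κ) {α : Type*} (s : Finset α) {f : α → V → ℂ}
    (hf : ∀ i ∈ s, ContDiff ℝ ∞ (f i)) :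
    wd e l (∑ i ∈ s, f i) = ∑ i ∈ s, wd e l (f i) := by
  classical
  induction s using Finset.induction_on with
  | empty => simp [wd_zero]
  | insert a s ha ih =>
    rw [Finset.sum_insert ha, Finset.sum_insert ha, wd_add e l (hf a (by simp))
      (contDiff_finset_sum s fun i hi => hf i (by simp [hi])),
      ih fun i hi => hf i (by simp [hi])]

lemma wd_append (e : κ → V) (l l' : List κ) (f : V → ℂ) :
    wd e (l ++ l') f = wd e l' (wd e l f) := by
  induction l generalizing f with
  | nil => rfl
  | cons k l ih => simp only [List.cons_append, wd, ih]

/-- The class of families `a i` of smooth functions such that each iterated derivative along the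
directions `e k` is bounded, uniformly in `i`, by a constant times the weight `W i` and one factor
`ϖ k` for each derivative in the direction `e k`. Hörmander classes, amplitude classes and
the functions of rapid decay are all of this form. -/
structure Cl (e : κ → V) (ϖ : κ → V → ℝ) (W : ι → V → ℝ) (a : ι → V → ℂ) : Prop where
  smooth : ∀ i, ContDiff ℝ ∞ (a i)
  bound : ∀ l : List κ, ∃ C : ℝ, ∀ i v,
    ‖wd e l (a i) v‖ ≤ C * (W i v * (l.map fun k => ϖ k v).prod)

variable {e : κ → V} {ϖ : κ → V → ℝ} {W W₁ W₂ : ι → V → ℝ} {a b : ι → V → ℂ}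

lemma Cl.deriv (h : Cl e ϖ W a) (k : κ) :
    Cl e ϖ (fun i v => W i v * ϖ k v) (fun i => dd (e k) (a i)) := by
  refine ⟨fun i => contDiff_dd (h.smooth i) _, fun l => ?_⟩
  obtain ⟨C, hC⟩ := h.bound (k :: l)
  refine ⟨C, fun i v => (hC i v).trans_eq ?_⟩
  simp only [List.map_cons, List.prod_cons]
  ring

lemma Cl.bound_zero (h : Cl e ϖ W a) : ∃ C : ℝ, ∀ i v, ‖a i v‖ ≤ C * W i v := by
  obtain ⟨C, hC⟩ := h.bound []
  exact ⟨C, fun i v => by simpa [wd] using hC i v⟩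

lemma Cl.add (ha : Cl e ϖ W a) (hb : Cl e ϖ W b) : Cl e ϖ W (fun i => a i + b i) := by
  refine ⟨fun i => (ha.smooth i).add (hb.smooth i), fun l => ?_⟩
  obtain ⟨C, hC⟩ := ha.bound l
  obtain ⟨D, hD⟩ := hb.bound l
  refine ⟨C + D, fun i v => ?_⟩
  rw [wd_add e l (ha.smooth i) (hb.smooth i), add_mul]
  exact (norm_add_le _ _).trans (add_le_add (hC i v) (hD i v))

lemma Cl.const_mul (ha : Cl e ϖ W a) {c : ι → ℂ} {M : ℝ} (hc : ∀ i, ‖c i‖ ≤ M) :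
    Cl e ϖ W (fun i v => c i * a i v) := by
  refine ⟨fun i => contDiff_const.mul (ha.smooth i), fun l => ?_⟩
  obtain ⟨C, hC⟩ := ha.bound l
  refine ⟨M * C, fun i v => ?_⟩
  rw [wd_const_mul e l (c i) (ha.smooth i), norm_mul, mul_assoc]
  exact mul_le_mul (hc i) (hC i v) (norm_nonneg _) ((norm_nonneg _).trans (hc i))

lemma Cl.neg (ha : Cl e ϖ W a) : Cl e ϖ W (fun i v => - a i v) := by
  simpa using ha.const_mul (c := fun _ => -1) (M := 1) (by simp)

lemma Cl.mul (ha : Cl e ϖ W₁ a) (hb : Cl e ϖ W₂ b) :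
    Cl e ϖ (fun i v => W₁ i v * W₂ i v) (fun i => a i * b i) := by
  refine ⟨fun i => (ha.smooth i).mul (hb.smooth i), fun l => ?_⟩
  induction l generalizing a b W₁ W₂ with
  | nil =>
    obtain ⟨C, hC⟩ := ha.bound_zero
    obtain ⟨D, hD⟩ := hb.bound_zero
    refine ⟨C * D, fun i v => ?_⟩
    simp only [wd, Pi.mul_apply, norm_mul, List.map_nil, List.prod_nil, mul_one]
    calc ‖a i v‖ * ‖b i v‖ ≤ (C * W₁ i v) * (D * W₂ i v) :=
          mul_le_mul (hC i v) (hD i v) (norm_nonneg _) ((norm_nonneg _).trans (hC i v))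
      _ = _ := by ring
  | cons k l ih =>
    obtain ⟨C, hC⟩ := ih (ha.deriv k) hb
    obtain ⟨D, hD⟩ := ih ha (hb.deriv k)
    refine ⟨C + D, fun i v => ?_⟩
    have h1 : ContDiff ℝ ∞ (dd (e k) (a i) * b i) := (contDiff_dd (ha.smooth i) (e k)).mul (hb.smooth i)
    have h2 : ContDiff ℝ ∞ (a i * dd (e k) (b i)) :=
      (ha.smooth i).mul (contDiff_dd (hb.smooth i) (e k))
    simp only [wd, dd_mul (ha.smooth i) (hb.smooth i)]
    rw [wd_add e l h1 h2]
    refine (norm_add_le _ _).trans ((add_le_add (hC i v) (hD i v)).trans_eq ?_)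
    simp only [List.map_cons, List.prod_cons]
    ring

lemma prod_map_nonneg {V : Type*} {ϖ : κ → V → ℝ} (hϖ : ∀ k v, 0 ≤ ϖ k v) (l : List κ) (v : V) :
    0 ≤ (l.map fun k => ϖ k v).prod :=
  List.prod_nonneg fun x hx => by
    obtain ⟨k, -, rfl⟩ := List.mem_map.1 hx
    exact hϖ k v

lemma prod_map_le {V V' : Type*} {ϖ : κ → V → ℝ} {ϖ' : κ → V' → ℝ} {v : V} {v' : V'} (hϖ : ∀ k, 0 ≤ ϖ k v)
    (h : ∀ k, ϖ k v ≤ ϖ' k v') (l : List κ) :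
    (l.map fun k => ϖ k v).prod ≤ (l.map fun k => ϖ' k v').prod := by
  induction l with
  | nil => simp
  | cons k l ih =>
    simp only [List.map_cons, List.prod_cons]
    refine mul_le_mul (h k) ih ?_ ((hϖ k).trans (h k))
    exact List.prod_nonneg fun x hx => by
      obtain ⟨k, -, rfl⟩ := List.mem_map.1 hx
      exact hϖ k

/-- Enlarging the weights. -/
lemma Cl.mono {ϖ' : κ → V → ℝ} (ha : Cl e ϖ W₁ a) (hϖ : ∀ k v, 0 ≤ ϖ k v)
    (hϖϖ : ∀ k v, ϖ k v ≤ ϖ' k v) (hW : ∀ i v, 0 ≤ W₁ i v) {M : ℝ}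
    (hWW : ∀ i v, W₁ i v ≤ M * W₂ i v) : Cl e ϖ' W₂ a := by
  refine ⟨ha.smooth, fun l => ?_⟩
  obtain ⟨C, hC⟩ := ha.bound l
  refine ⟨|C| * M, fun i v => ?_⟩
  have h0 := prod_map_nonneg hϖ l v
  have h1 := prod_map_le (fun k => hϖ k v) (fun k => hϖϖ k v) l
  calc _ ≤ C * (W₁ i v * (l.map fun k => ϖ k v).prod) := hC i v
    _ ≤ |C| * (W₁ i v * (l.map fun k => ϖ k v).prod) :=
        mul_le_mul_of_nonneg_right (le_abs_self C) (mul_nonneg (hW i v) h0)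
    _ ≤ |C| * ((M * W₂ i v) * (l.map fun k => ϖ' k v).prod) := by
        refine mul_le_mul_of_nonneg_left ?_ (abs_nonneg C)
        exact mul_le_mul (hWW i v) h1 h0 ((hW i v).trans (hWW i v))
    _ = _ := by ring

lemma Cl.mono_weight (ha : Cl e ϖ W₁ a) (hϖ : ∀ k v, 0 ≤ ϖ k v) (hW : ∀ i v, 0 ≤ W₁ i v) {M : ℝ}
    (hWW : ∀ i v, W₁ i v ≤ M * W₂ i v) : Cl e ϖ W₂ a :=
  ha.mono hϖ (fun _ _ => le_rfl) hW hWW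

lemma Cl.congr (ha : Cl e ϖ W₁ a) (h : ∀ i v, W₁ i v = W₂ i v) (hab : ∀ i v, a i v = b i v) :
    Cl e ϖ W₂ b := by
  have h1 : W₁ = W₂ := by funext i v; exact h i v
  have h2 : a = b := by funext i v; exact hab i v
  exact h1 ▸ h2 ▸ ha

lemma Cl.const (hϖ : ∀ k v, 0 ≤ ϖ k v) {c : ι → ℂ} {M : ℝ} (hc : ∀ i, ‖c i‖ ≤ M) :
    Cl e ϖ (fun _ _ => 1) (fun i _ => c i) := by
  refine ⟨fun i => contDiff_const, fun l => ⟨M, fun i v => ?_⟩⟩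
  cases l with
  | nil => simpa [wd] using hc i
  | cons k l =>
    have : dd (e k) (fun _ : V => c i) = 0 := by funext x; simp [dd]
    simp only [wd, this, wd_zero]
    simpa using mul_nonneg ((norm_nonneg _).trans (hc i)) (prod_map_nonneg hϖ (k :: l) v)

lemma Cl.zero : Cl e ϖ W (fun _ _ => (0 : ℂ)) :=
  ⟨fun _ => contDiff_const, fun l => ⟨0, fun i v => by
    have := congrFun (wd_zero e l) v
    change ‖wd e l 0 v‖ ≤ _
    simp [this]⟩⟩

lemma Cl.sum {α : Type*} (s : Finset α) {f : α → ι → V → ℂ}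
    (hf : ∀ j ∈ s, Cl e ϖ W (f j)) : Cl e ϖ W (fun i v => ∑ j ∈ s, f j i v) := by
  classical
  induction s using Finset.induction_on with
  | empty => simpa using Cl.zero (W := W)
  | insert j s hj ih =>
    refine ((hf j (by simp)).add (ih fun i hi => hf i (by simp [hi]))).congr (fun _ _ => rfl)
      fun i v => ?_
    simp [Finset.sum_insert hj]

/-- Membership can be tested on the function and its first derivatives. -/
lemma Cl.of_deriv (hs : ∀ i, ContDiff ℝ ∞ (a i)) (h0 : ∃ C : ℝ, ∀ i v, ‖a i v‖ ≤ C * W i v)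
    (hd : ∀ k, Cl e ϖ (fun i v => W i v * ϖ k v) (fun i => dd (e k) (a i))) : Cl e ϖ W a := by
  refine ⟨hs, fun l => ?_⟩
  cases l with
  | nil =>
    obtain ⟨C, hC⟩ := h0
    exact ⟨C, fun i v => by simpa [wd] using hC i v⟩
  | cons k l =>
    obtain ⟨C, hC⟩ := (hd k).bound l
    refine ⟨C, fun i v => (hC i v).trans_eq ?_⟩
    simp only [List.map_cons, List.prod_cons]
    ring

lemma Cl.reindex (ha : Cl e ϖ W a) (π : ι' → ι) :
    Cl e ϖ (fun i => W (π i)) (fun i => a (π i)) :=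
  ⟨fun i => ha.smooth _, fun l => by
    obtain ⟨C, hC⟩ := ha.bound l
    exact ⟨C, fun i v => hC _ v⟩⟩

/-- A unimodular exponential `exp (i φ)` has order `0` as soon as each derivative `∂_k φ` has
the order `ϖ k`. -/
lemma Cl.cexp (hϖ : ∀ k v, 0 ≤ ϖ k v) {φ : ι → V → ℝ} (hs : ∀ i, ContDiff ℝ ∞ (φ i))
    (hd : ∀ k, Cl e ϖ (fun _ v => ϖ k v) (fun i => dd (e k) (fun v => (φ i v : ℂ)))) :
    Cl e ϖ (fun _ _ => 1) (fun i v => Complex.exp (Complex.I * φ i v)) := by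
  have hsc : ∀ i, ContDiff ℝ ∞ (fun v => (φ i v : ℂ)) := fun i =>
    Complex.ofRealCLM.contDiff.comp (hs i)
  have hE : ∀ i, ContDiff ℝ ∞ (fun v => Complex.exp (Complex.I * φ i v)) := fun i =>
    (contDiff_const.mul (hsc i)).cexp
  have hdE : ∀ i v, dd v (fun v => Complex.exp (Complex.I * φ i v)) =
      (fun x => Complex.I * dd v (fun v => (φ i v : ℂ)) x) *
        (fun v => Complex.exp (Complex.I * φ i v)) := by
    intro i v
    funext x
    have h1 : HasFDerivAt (fun v => Complex.I * (φ i v : ℂ)) _ x :=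
      ((diff_of_smooth (hsc i) x).hasFDerivAt).const_mul Complex.I
    simp only [dd, h1.cexp.fderiv]
    simp
    ring
  have key : ∀ (l : List κ) (W : ι → V → ℝ) (b : ι → V → ℂ), Cl e ϖ W b → ∃ C : ℝ, ∀ i v,
      ‖wd e l (b i * fun v => Complex.exp (Complex.I * φ i v)) v‖ ≤
        C * (W i v * (l.map fun k => ϖ k v).prod) := by
    intro l
    induction l with
    | nil =>
      intro W b hb
      obtain ⟨C, hC⟩ := hb.bound_zero
      refine ⟨C, fun i v => ?_⟩
      simp only [wd, Pi.mul_apply, norm_mul, mul_comm Complex.I,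
        Complex.norm_exp_ofReal_mul_I]
      simpa using hC i v
    | cons k l ih =>
      intro W b hb
      have hb' : Cl e ϖ (fun i v => W i v * ϖ k v) (fun i => dd (e k) (b i) +
          b i * fun v => Complex.I * dd (e k) (fun v => (φ i v : ℂ)) v) :=
        (hb.deriv k).add (hb.mul ((hd k).const_mul (c := fun _ => Complex.I) (M := 1) (by simp)))
      obtain ⟨C, hC⟩ := ih _ _ hb'
      refine ⟨C, fun i v => ?_⟩
      simp only [wd, dd_mul (hb.smooth i) (hE i), hdE]
      have : dd (e k) (b i) * (fun v => Complex.exp (Complex.I * φ i v)) +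
          b i * ((fun x => Complex.I * dd (e k) (fun v => (φ i v : ℂ)) x) *
            fun v => Complex.exp (Complex.I * φ i v)) =
          (dd (e k) (b i) + b i * fun v => Complex.I * dd (e k) (fun v => (φ i v : ℂ)) v) *
            fun v => Complex.exp (Complex.I * φ i v) := by ring
      rw [this]
      refine (hC i v).trans_eq ?_
      simp only [List.map_cons, List.prod_cons]
      ring
  refine ⟨hE, fun l => ?_⟩
  obtain ⟨C, hC⟩ := key l _ _ (Cl.const (e := e) hϖ (c := fun _ : ι => (1 : ℂ)) (M := 1) (by simp))
  refine ⟨C, fun i v => ?_⟩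
  have := hC i v
  rwa [show ((fun _ : V => (1 : ℂ)) * fun v => Complex.exp (Complex.I * φ i v)) =
    fun v => Complex.exp (Complex.I * φ i v) from by funext x; simp] at this

/-- Composition with affine maps `φ i` whose linear parts `L i` express the new directions in
terms of the old ones, compatibly with the weights. -/
lemma Cl.comp_affine [Fintype κ] {e' : κ' → V'} {ϖ' : κ' → V' → ℝ} (ha : Cl e ϖ W a)
    (hϖ : ∀ k v, 0 ≤ ϖ k v) (hϖ' : ∀ k v, 0 ≤ ϖ' k v) (hW : ∀ i v, 0 ≤ W i v) {π : ι' → ι}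
    {φ : ι' → V' → V} {L : ι' → V' →L[ℝ] V} (hφ : ∀ i v, HasFDerivAt (φ i) (L i) v)
    {c : ι' → κ' → κ → ℝ} (hL : ∀ i k', L i (e' k') = ∑ k, c i k' k • e k) {D : ℝ}
    (hc : ∀ i k' k v, |c i k' k| * ϖ k (φ i v) ≤ D * ϖ' k' v) :
    Cl e' ϖ' (fun i v => W (π i) (φ i v)) (fun i v => a (π i) (φ i v)) := by
  have hφs : ∀ i, ContDiff ℝ ∞ (φ i) := fun i => by
    have : φ i = fun v => φ i 0 + L i v := by
      have h1 : ∀ v, fderiv ℝ (φ i) v = fderiv ℝ (fun v => φ i 0 + L i v) v := fun v => by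
        rw [(hφ i v).fderiv, ((L i).hasFDerivAt.const_add _).fderiv]
      have h2 := eq_of_fderiv_eq (𝕜 := ℝ) (fun v => (hφ i v).differentiableAt)
        (fun v => ((L i).hasFDerivAt.const_add (φ i 0)).differentiableAt) h1 0 (by simp)
      exact h2
    rw [this]
    exact contDiff_const.add (L i).contDiff
  refine ⟨fun i => (ha.smooth _).comp (hφs i), fun l => ?_⟩
  induction l generalizing a W with
  | nil =>
    obtain ⟨C, hC⟩ := ha.bound_zero
    exact ⟨C, fun i v => by simpa [wd] using hC (π i) (φ i v)⟩
  | cons k' l ih =>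
    have hd : ∀ i, dd (e' k') (fun v => a (π i) (φ i v)) =
        ∑ k, fun v => (c i k' k : ℂ) * dd (e k) (a (π i)) (φ i v) := by
      intro i
      funext v
      have h1 : HasFDerivAt (fun v => a (π i) (φ i v)) _ v :=
        ((diff_of_smooth (ha.smooth (π i)) (φ i v)).hasFDerivAt).comp v (hφ i v)
      simp only [dd, h1.fderiv, ContinuousLinearMap.comp_apply, hL, map_sum, map_smul,
        Finset.sum_apply]
      simp
    choose C hC using fun k => ih (ha.deriv k) (fun i v => mul_nonneg (hW i v) (hϖ k v))
    refine ⟨∑ k, |C k| * D, fun i v => ?_⟩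
    simp only [wd, hd]
    have hsm : ∀ k, ContDiff ℝ ∞ (fun v => dd (e k) (a (π i)) (φ i v)) := fun k =>
      (contDiff_dd (ha.smooth _) _).comp (hφs i)
    rw [wd_sum e' l _ fun k _ => contDiff_const.mul (hsm k), Finset.sum_apply, Finset.sum_mul]
    refine (norm_sum_le _ _).trans (Finset.sum_le_sum fun k _ => ?_)
    rw [wd_const_mul e' l _ (hsm k), norm_mul, Complex.norm_real, Real.norm_eq_abs]
    have hp := prod_map_nonneg hϖ' l v
    have hw := hW (π i) (φ i v)
    have ho := hϖ k (φ i v)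
    have h2 : ‖wd e' l (fun v => dd (e k) (a (π i)) (φ i v)) v‖ ≤
        |C k| * (W (π i) (φ i v) * ϖ k (φ i v) * (l.map fun k => ϖ' k v).prod) :=
      (hC k i v).trans (mul_le_mul_of_nonneg_right (le_abs_self _) (by positivity))
    calc _ ≤ |c i k' k| * (|C k| * (W (π i) (φ i v) * ϖ k (φ i v) *
          (l.map fun k => ϖ' k v).prod)) := mul_le_mul_of_nonneg_left h2 (abs_nonneg _)
      _ = (|c i k' k| * ϖ k (φ i v)) * (|C k| * (W (π i) (φ i v) *
          (l.map fun k => ϖ' k v).prod)) := by ring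
      _ ≤ (D * ϖ' k' v) * (|C k| * (W (π i) (φ i v) * (l.map fun k => ϖ' k v).prod)) :=
          mul_le_mul_of_nonneg_right (hc i k' k v) (by positivity)
      _ = _ := by simp only [List.map_cons, List.prod_cons]; ring

end Classes

/-! ### Differentiation under the integral sign -/

section ParametricIntegral

open MeasureTheory

variable {V : Type*} [NormedAddCommGroup V] [NormedSpace ℝ V] [FiniteDimensional ℝ V]
  {κ ι T : Type*} [Fintype κ] [MeasurableSpace T] {μ : Measure T}

lemma clm_eq_sum_basis (b : Module.Basis κ ℝ V) (L : V →L[ℝ] ℂ) :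
    L = ∑ k, (LinearMap.toContinuousLinearMap (b.coord k)).smulRight (L (b k)) := by
  ext v
  conv_lhs => rw [← b.sum_repr v]
  simp only [map_sum, map_smul]
  simp

/-- Differentiation under the integral sign, with hypotheses on the derivatives along a basis. -/
lemma hasFDerivAt_integral_of_basis (b : Module.Basis κ ℝ V) {F : V → T → ℂ} {v₀ : V} {s : Set V}
    (hs : s ∈ 𝓝 v₀) (hd : ∀ t, Differentiable ℝ (fun v => F v t))
    (hm : ∀ v, AEStronglyMeasurable (F v) μ)
    (hm' : ∀ k, AEStronglyMeasurable (fun t => dd (b k) (fun v => F v t) v₀) μ)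
    {g : T → ℝ} (hg : Integrable g μ) (h0 : ∀ t, ‖F v₀ t‖ ≤ g t)
    (h1 : ∀ k t, ∀ v ∈ s, ‖dd (b k) (fun v => F v t) v‖ ≤ g t) :
    DifferentiableAt ℝ (fun v => ∫ t, F v t ∂μ) v₀ ∧
      ∀ k, dd (b k) (fun v => ∫ t, F v t ∂μ) v₀ = ∫ t, dd (b k) (fun v => F v t) v₀ ∂μ := by
  obtain ⟨C, hC0, hC⟩ := b.exists_opNorm_le (F := ℂ)
  have hgn : ∀ t, 0 ≤ g t := fun t => (norm_nonneg _).trans (h0 t)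
  have hm'' : AEStronglyMeasurable (fun t => fderiv ℝ (fun v => F v t) v₀) μ := by
    have : (fun t => fderiv ℝ (fun v => F v t) v₀) = fun t => ∑ k,
        (LinearMap.toContinuousLinearMap (b.coord k)).smulRight (dd (b k) (fun v => F v t) v₀) := by
      funext t
      exact clm_eq_sum_basis b _
    rw [this]
    refine Finset.aestronglyMeasurable_fun_sum _ fun k _ => ?_
    exact (ContinuousLinearMap.smulRightL ℝ V ℂ
      (LinearMap.toContinuousLinearMap (b.coord k))).continuous.comp_aestronglyMeasurable (hm' k)
  have hint' : Integrable (fun t => fderiv ℝ (fun v => F v t) v₀) μ := by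
    refine (hg.const_mul C).mono' hm'' (Filter.Eventually.of_forall fun t => ?_)
    exact hC (hgn t) fun k => h1 k t v₀ (mem_of_mem_nhds hs)
  have key := hasFDerivAt_integral_of_dominated_of_fderiv_le (𝕜 := ℝ) (μ := μ) (F := F)
    (F' := fun v t => fderiv ℝ (fun v => F v t) v) (bound := fun t => C * g t) hs
    (Filter.Eventually.of_forall hm) (hg.mono' (hm v₀) (Filter.Eventually.of_forall h0)) hm''
    (Filter.Eventually.of_forall fun t v hv => hC (hgn t) fun k => h1 k t v hv)
    (hg.const_mul C) (Filter.Eventually.of_forall fun t v _ => (hd t v).hasFDerivAt)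
  refine ⟨key.differentiableAt, fun k => ?_⟩
  simp only [dd, key.fderiv]
  rw [ContinuousLinearMap.integral_apply hint']

/-- A function is smooth if it belongs to a set of differentiable functions that is closed
under the derivatives along a basis. -/
lemma contDiff_of_closed_under_dd (b : Module.Basis κ ℝ V) (S : Set (V → ℂ))
    (hd : ∀ f ∈ S, Differentiable ℝ f) (hc : ∀ f ∈ S, ∀ k, dd (b k) f ∈ S) {f : V → ℂ}
    (hf : f ∈ S) : ContDiff ℝ ∞ f := by
  rw [contDiff_infty]
  intro n
  induction n generalizing f with
  | zero => exact contDiff_zero.2 (hd f hf).continuous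
  | succ n ih =>
    rw [show ((n + 1 : ℕ) : WithTop ℕ∞) = (n : WithTop ℕ∞) + 1 by push_cast; rfl,
      contDiff_succ_iff_fderiv]
    refine ⟨hd f hf, by simp, ?_⟩
    have : fderiv ℝ f = fun v => ∑ k,
        (LinearMap.toContinuousLinearMap (b.coord k)).smulRight (dd (b k) f v) := by
      funext v
      exact clm_eq_sum_basis b _
    rw [this]
    refine ContDiff.sum fun k _ => ?_
    exact (ContinuousLinearMap.smulRightL ℝ V ℂ
      (LinearMap.toContinuousLinearMap (b.coord k))).contDiff.comp (ih (hc f hf k))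

/-- Integrals over a parameter preserve the weighted classes. -/
lemma Cl.integral (b : Module.Basis κ ℝ V) {ϖ : κ → V → ℝ} {W : ι → V → ℝ} {g : T → ℝ}
    {a : ι → V → T → ℂ} (hϖ : ∀ k v, 0 ≤ ϖ k v) (hϖc : ∀ k, Continuous (ϖ k))
    (hW : ∀ i v, 0 ≤ W i v) (hWc : ∀ i, Continuous (W i)) (hg : Integrable g μ)
    (hg0 : ∀ t, 0 ≤ g t)
    (ha : Cl b ϖ (fun (p : ι × T) v => W p.1 v * g p.2) (fun p v => a p.1 v p.2))
    (hm : ∀ i l v, AEStronglyMeasurable (fun t => wd b l (fun v => a i v t) v) μ) :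
    Cl b ϖ W (fun i v => ∫ t, a i v t ∂μ) ∧
      ∀ i l v, wd b l (fun v => ∫ t, a i v t ∂μ) v = ∫ t, wd b l (fun v => a i v t) v ∂μ := by
  have step : ∀ i l, Differentiable ℝ (fun v => ∫ t, wd b l (fun v => a i v t) v ∂μ) ∧
      ∀ k v, dd (b k) (fun v => ∫ t, wd b l (fun v => a i v t) v ∂μ) v =
        ∫ t, wd b (l ++ [k]) (fun v => a i v t) v ∂μ := by
    intro i l
    choose C hC using ha.bound
    have hcont : ∀ l : List κ, Continuous fun v => W i v * (l.map fun k => ϖ k v).prod := by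
      intro l
      exact (hWc i).mul (continuous_list_prod l fun k _ => hϖc k)
    let bd : List κ → V → ℝ := fun l v => |C l| * (W i v * (l.map fun k => ϖ k v).prod)
    have hbd : ∀ l, Continuous (bd l) := fun l => continuous_const.mul (hcont l)
    have hbd0 : ∀ l v, 0 ≤ bd l v := fun l v =>
      mul_nonneg (abs_nonneg _) (mul_nonneg (hW i v) (prod_map_nonneg hϖ l v))
    have hb : ∀ l t v, ‖wd b l (fun v => a i v t) v‖ ≤ bd l v * g t := by
      intro l t v
      refine (hC l (i, t) v).trans ?_
      have h1 := hW i v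
      have h2 := hg0 t
      have h3 := prod_map_nonneg hϖ l v
      calc _ ≤ |C l| * (W i v * g t * (l.map fun k => ϖ k v).prod) :=
            mul_le_mul_of_nonneg_right (le_abs_self _) (by positivity)
        _ = _ := by ring
    have main : ∀ v₀, DifferentiableAt ℝ (fun v => ∫ t, wd b l (fun v => a i v t) v ∂μ) v₀ ∧
        ∀ k, dd (b k) (fun v => ∫ t, wd b l (fun v => a i v t) v ∂μ) v₀ =
          ∫ t, dd (b k) (fun v => wd b l (fun v => a i v t) v) v₀ ∂μ := by
      intro v₀
      let Z : V → ℝ := fun v => bd l v + ∑ k, bd (l ++ [k]) v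
      have hZ : Continuous Z := (hbd l).add (continuous_finsetSum _ fun k _ => hbd _)
      have hs : {v | Z v < Z v₀ + 1} ∈ 𝓝 v₀ :=
        (isOpen_lt hZ continuous_const).mem_nhds (by simp)
      have hwk : ∀ k t, dd (b k) (fun v => wd b l (fun v => a i v t) v) =
          wd b (l ++ [k]) (fun v => a i v t) := by
        intro k t
        rw [wd_append]
        rfl
      refine hasFDerivAt_integral_of_basis b hs
        (fun t => diff_of_smooth (contDiff_wd b l (ha.smooth (i, t)))) (fun v => hm i l v)
        (fun k => ?_) (g := fun t => (Z v₀ + 1) * g t) (hg.const_mul _) (fun t => ?_)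
        (fun k t v hv => ?_)
      · simp only [hwk]
        exact hm i _ v₀
      · refine (hb l t v₀).trans (mul_le_mul_of_nonneg_right ?_ (hg0 t))
        have : 0 ≤ ∑ k, bd (l ++ [k]) v₀ := Finset.sum_nonneg fun k _ => hbd0 _ _
        simp only [Z]
        linarith
      · rw [hwk]
        refine (hb _ t v).trans (mul_le_mul_of_nonneg_right ?_ (hg0 t))
        have h1 : bd (l ++ [k]) v ≤ ∑ k, bd (l ++ [k]) v :=
          Finset.single_le_sum (f := fun k => bd (l ++ [k]) v) (fun k _ => hbd0 _ _)
            (Finset.mem_univ k)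
        have h2 := hbd0 l v
        have h3 : Z v < Z v₀ + 1 := hv
        simp only [Z] at h3 ⊢
        linarith
    refine ⟨fun v => (main v).1, fun k v => ?_⟩
    rw [(main v).2 k]
    simp only [wd_append]
    rfl
  have hwd : ∀ i l v, wd b l (fun v => ∫ t, a i v t ∂μ) v =
      ∫ t, wd b l (fun v => a i v t) v ∂μ := by
    intro i
    have : ∀ l l', wd b l (fun v => ∫ t, wd b l' (fun v => a i v t) v ∂μ) =
        fun v => ∫ t, wd b (l' ++ l) (fun v => a i v t) v ∂μ := by
      intro l
      induction l with
      | nil => intro l'; simp [wd]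
      | cons k l ih =>
        intro l'
        have h1 : dd (b k) (fun v => ∫ t, wd b l' (fun v => a i v t) v ∂μ) =
            fun v => ∫ t, wd b (l' ++ [k]) (fun v => a i v t) v ∂μ := by
          funext v; exact (step i l').2 k v
        simp only [wd, h1, ih]
        simp
    intro l v
    exact congrFun (this l []) v
  refine ⟨⟨fun i => ?_, fun l => ?_⟩, hwd⟩
  · refine contDiff_of_closed_under_dd b
      (Set.range fun l => fun v => ∫ t, wd b l (fun v => a i v t) v ∂μ) ?_ ?_ ⟨[], rfl⟩
    · rintro _ ⟨l, rfl⟩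
      exact (step i l).1
    · rintro _ ⟨l, rfl⟩ k
      exact ⟨l ++ [k], by funext v; exact ((step i l).2 k v).symm⟩
  · obtain ⟨C, hC⟩ := ha.bound l
    refine ⟨|C| * ∫ t, g t ∂μ, fun i v => ?_⟩
    rw [hwd]
    have h1 := hW i v
    have h3 := prod_map_nonneg hϖ l v
    refine (norm_integral_le_of_norm_le (g := fun t =>
      (|C| * (W i v * (l.map fun k => ϖ k v).prod)) * g t) (hg.const_mul _)
      (Filter.Eventually.of_forall fun t => ?_)).trans_eq ?_
    · have h2 := hg0 t
      refine (hC (i, t) v).trans ?_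
      calc _ ≤ |C| * (W i v * g t * (l.map fun k => ϖ k v).prod) :=
            mul_le_mul_of_nonneg_right (le_abs_self _) (by positivity)
        _ = _ := by ring
    · rw [integral_const_mul]
      ring

end ParametricIntegral

/-! ### Standard members of the weighted classes -/

section Standard

variable {V : Type*} [NormedAddCommGroup V] [NormedSpace ℝ V] {κ ι : Type*}
  {e : κ → V} {ϖ : κ → V → ℝ}

lemma Cl.clm (c : V →L[ℝ] ℝ) {W : ι → V → ℝ} {C : ℝ} (h0 : ∀ i v, |c v| ≤ C * W i v)
    (h1 : ∀ i k v, |c (e k)| ≤ C * (W i v * ϖ k v)) :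
    Cl e ϖ W (fun (_ : ι) v => (c v : ℂ)) := by
  refine Cl.of_deriv (fun i => Complex.ofRealCLM.contDiff.comp c.contDiff)
    ⟨C, fun i v => by simpa using h0 i v⟩ fun k => ?_
  have hd : ∀ x, dd (e k) (fun v => (c v : ℂ)) x = (c (e k) : ℂ) := by
    intro x
    have : HasFDerivAt (fun v => (c v : ℂ)) (Complex.ofRealCLM.comp c) x :=
      (Complex.ofRealCLM.hasFDerivAt).comp x c.hasFDerivAt
    simp [dd, this.fderiv]
  refine ⟨fun i => contDiff_dd (Complex.ofRealCLM.contDiff.comp c.contDiff) _, fun l => ?_⟩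
  rw [show dd (e k) (fun v => (c v : ℂ)) = fun _ => (c (e k) : ℂ) from funext hd]
  cases l with
  | nil => exact ⟨C, fun i v => by simpa [wd] using h1 i k v⟩
  | cons j l =>
    refine ⟨0, fun i v => ?_⟩
    have : dd (e j) (fun _ : V => (c (e k) : ℂ)) = 0 := by funext x; simp [dd]
    simp [wd, this, wd_zero]

lemma one_add_I_mul_ne_zero (t : ℝ) : (1 + Complex.I * t : ℂ) ≠ 0 := by
  intro h
  have := congrArg Complex.re h
  simp at this

lemma norm_inv_one_add_I_mul (t : ℝ) : ‖(1 + Complex.I * t : ℂ)⁻¹‖ = (Real.sqrt (1 + t ^ 2))⁻¹ := by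
  rw [norm_inv, Complex.norm_def]
  congr 2
  simp [Complex.normSq_apply]
  ring

lemma norm_inv_one_add_I_mul_le_one (t : ℝ) : ‖(1 + Complex.I * t : ℂ)⁻¹‖ ≤ 1 := by
  rw [norm_inv_one_add_I_mul]
  exact inv_le_one_of_one_le₀ (Real.one_le_sqrt.2 (by nlinarith))

lemma contDiff_inv_one_add_I (c : V →L[ℝ] ℝ) :
    ContDiff ℝ ∞ (fun v => (1 + Complex.I * c v : ℂ)⁻¹) :=
  (contDiff_const.add (contDiff_const.mul (Complex.ofRealCLM.contDiff.comp c.contDiff))).inv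
    fun v => one_add_I_mul_ne_zero (c v)

lemma dd_inv_one_add_I_pow (c : V →L[ℝ] ℝ) (n : ℕ) (v : V) :
    dd v (fun x => ((1 + Complex.I * c x : ℂ)⁻¹) ^ n) =
      fun x => (-n * Complex.I * c v) * ((1 + Complex.I * c x : ℂ)⁻¹) ^ (n + 1) := by
  funext x
  have h1 : HasFDerivAt (fun v => (1 + Complex.I * c v : ℂ))
      (Complex.I • (Complex.ofRealCLM.comp c)) x :=
    (((Complex.ofRealCLM.hasFDerivAt).comp x c.hasFDerivAt).const_mul Complex.I).const_add 1
  have h2 := (((hasDerivAt_inv (one_add_I_mul_ne_zero (c x))).fun_pow n).hasFDerivAt.restrictScalars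
    ℝ).comp x h1
  have h3 : fderiv ℝ (fun x => ((1 + Complex.I * c x : ℂ)⁻¹) ^ n) x = _ := h2.fderiv
  simp only [dd, h3]
  cases n with
  | zero => simp
  | succ n =>
    simp
    field_simp [one_add_I_mul_ne_zero (c x)]
    ring

lemma Cl.inv_one_add_I (hϖ : ∀ k v, 1 ≤ ϖ k v) (c : V →L[ℝ] ℝ) :
    Cl e ϖ (fun (_ : ι) v => ‖(1 + Complex.I * c v : ℂ)⁻¹‖)
      (fun _ v => (1 + Complex.I * c v : ℂ)⁻¹) := by
  refine ⟨fun _ => contDiff_inv_one_add_I c, fun l => ?_⟩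
  have key : ∀ (l : List κ) (n : ℕ), ∃ K : ℂ,
      wd e l (fun x => ((1 + Complex.I * c x : ℂ)⁻¹) ^ n) =
        fun x => K * ((1 + Complex.I * c x : ℂ)⁻¹) ^ (n + l.length) := by
    intro l
    induction l with
    | nil => exact fun n => ⟨1, by simp [wd]⟩
    | cons k l ih =>
      intro n
      obtain ⟨K, hK⟩ := ih (n + 1)
      refine ⟨(-n * Complex.I * c (e k)) * K, ?_⟩
      simp only [wd, dd_inv_one_add_I_pow]
      rw [wd_const_mul e l _ ((contDiff_inv_one_add_I c).pow _), hK]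
      funext x
      simp only [List.length_cons]
      ring
  obtain ⟨K, hK⟩ := key l 1
  simp only [pow_one] at hK
  refine ⟨‖K‖, fun i v => ?_⟩
  rw [hK, norm_mul, norm_pow, pow_add, pow_one]
  refine mul_le_mul_of_nonneg_left ?_ (norm_nonneg _)
  refine mul_le_mul_of_nonneg_left ?_ (norm_nonneg _)
  refine (pow_le_one₀ (norm_nonneg _) (norm_inv_one_add_I_mul_le_one _)).trans ?_
  have : ∀ l : List κ, 1 ≤ (l.map fun k => ϖ k v).prod := by
    intro l
    induction l with
    | nil => simp
    | cons k l ih =>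
      simp only [List.map_cons, List.prod_cons]
      nlinarith [hϖ k v]
  exact this l

lemma exists_schwartz_wd (e : κ → V) (l : List κ) (ψ : 𝓢(V, ℂ)) :
    ∃ χ : 𝓢(V, ℂ), wd e l ψ = χ := by
  induction l generalizing ψ with
  | nil => exact ⟨ψ, rfl⟩
  | cons k l ih =>
    obtain ⟨χ, hχ⟩ := ih (LineDeriv.lineDerivOp (e k) ψ)
    refine ⟨χ, ?_⟩
    rw [← hχ]
    simp only [wd]
    congr 1

lemma exists_schwartz_decay (ψ : 𝓢(V, ℂ)) (N : ℕ) :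
    ∃ C : ℝ, ∀ v, ‖ψ v‖ ≤ C * ((1 + ‖v‖) ^ N)⁻¹ := by
  refine ⟨2 ^ N * (Finset.Iic (N, 0)).sup (fun m => SchwartzMap.seminorm ℝ m.1 m.2) ψ,
    fun v => ?_⟩
  have := SchwartzMap.one_add_le_sup_seminorm_apply (𝕜 := ℝ) (m := (N, 0)) (k := N) (n := 0) le_rfl
    le_rfl ψ v
  rw [← div_eq_mul_inv, le_div_iff₀ (by positivity)]
  simpa [mul_comm] using this

/-- Schwartz functions have rapidly decreasing derivatives of all orders. -/
lemma Cl.schwartz (ψ : 𝓢(V, ℂ)) (N : ℕ) :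
    Cl e (fun _ _ => 1) (fun (_ : ι) v => ((1 + ‖v‖) ^ N)⁻¹) (fun _ => ψ) := by
  refine ⟨fun _ => ψ.smooth ⊤, fun l => ?_⟩
  obtain ⟨χ, hχ⟩ := exists_schwartz_wd e l ψ
  obtain ⟨C, hC⟩ := exists_schwartz_decay χ N
  refine ⟨C, fun i v => ?_⟩
  rw [hχ]
  simpa using hC v

/-- There is a Schwartz function with value `1` at the origin. -/
lemma exists_schwartz_one (V : Type*) [NormedAddCommGroup V] [NormedSpace ℝ V]
    [FiniteDimensional ℝ V] : ∃ ψ : 𝓢(V, ℂ), ψ 0 = 1 := by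
  let b : ContDiffBump (0 : V) := ⟨1, 2, by norm_num, by norm_num⟩
  have h1 : HasCompactSupport (fun v => (b v : ℂ)) :=
    b.hasCompactSupport.comp_left (g := fun t : ℝ => (t : ℂ)) (by simp)
  have h2 : ContDiff ℝ ∞ (fun v => (b v : ℂ)) := Complex.ofRealCLM.contDiff.comp b.contDiff
  refine ⟨h1.toSchwartzMap h2, ?_⟩
  change ((b 0 : ℝ) : ℂ) = 1
  rw [b.one_of_mem_closedBall (by simp [b.rIn_pos.le])]
  simp

end Standard

/-! ### Coordinates on phase space and the oscillating kernel -/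

section Kernel

variable {d : ℕ}

/-- Names of the coordinates of phase space: positions on the left, momenta on the right. -/
abbrev PIdx (d : ℕ) : Type := Fin d ⊕ Fin d

/-- The standard basis of phase space. -/
def phaseBasis (d : ℕ) : Module.Basis (PIdx d) ℝ (Phase d) :=
  (EuclideanSpace.basisFun (Fin d) ℝ).toBasis.prod (EuclideanSpace.basisFun (Fin d) ℝ).toBasis

@[simp] lemma phaseBasis_inl (i : Fin d) : phaseBasis d (Sum.inl i) = (basisVec i, 0) := by
  simp [phaseBasis, basisVec]

@[simp] lemma phaseBasis_inr (i : Fin d) : phaseBasis d (Sum.inr i) = (0, basisVec i) := by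
  simp [phaseBasis, basisVec]

/-- The coordinate functionals of phase space. -/
def co : PIdx d → Phase d →L[ℝ] ℝ
  | Sum.inl i => (EuclideanSpace.proj i).comp (ContinuousLinearMap.fst ℝ _ _)
  | Sum.inr i => (EuclideanSpace.proj i).comp (ContinuousLinearMap.snd ℝ _ _)

@[simp] lemma co_inl (i : Fin d) (v : Phase d) : co (Sum.inl i) v = v.1 i := rfl
@[simp] lemma co_inr (i : Fin d) (v : Phase d) : co (Sum.inr i) v = v.2 i := rfl

lemma co_basis (j k : PIdx d) : co j (phaseBasis d k) = if j = k then 1 else 0 := by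
  rcases j with j | j <;> rcases k with k | k <;> simp [basisVec, PiLp.single_apply]

lemma abs_coord_le (v : Config d) (i : Fin d) : |v i| ≤ ‖v‖ := by
  simpa using PiLp.norm_apply_le v i

lemma abs_co_le (j : PIdx d) (v : Phase d) : |co j v| ≤ ‖v‖ := by
  rcases j with j | j
  · exact (abs_coord_le v.1 j).trans (norm_fst_le v)
  · exact (abs_coord_le v.2 j).trans (norm_snd_le v)

/-- The space of pairs `(w, θ)` of integration variables, `w = (y, z)` and `θ = (η, ζ)`. -/
abbrev Osp (d : ℕ) : Type := Phase d × Phase d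

/-- Coordinates of `(w, θ)`: those of `w` on the left, those of `θ` on the right. -/
abbrev OIdx (d : ℕ) : Type := PIdx d ⊕ PIdx d

/-- The standard basis of the space of pairs `(w, θ)`. -/
def ospBasis (d : ℕ) : Module.Basis (OIdx d) ℝ (Osp d) := (phaseBasis d).prod (phaseBasis d)

@[simp] lemma ospBasis_inl (j : PIdx d) : ospBasis d (Sum.inl j) = (phaseBasis d j, 0) := by
  simp [ospBasis]

@[simp] lemma ospBasis_inr (j : PIdx d) : ospBasis d (Sum.inr j) = (0, phaseBasis d j) := by
  simp [ospBasis]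

/-- The coordinate that is dual to a given one in the pairing `w · θ`. -/
def dco : OIdx d → Osp d →L[ℝ] ℝ
  | Sum.inl j => (co j).comp (ContinuousLinearMap.snd ℝ _ _)
  | Sum.inr j => (co j).comp (ContinuousLinearMap.fst ℝ _ _)

@[simp] lemma dco_inl (j : PIdx d) (s : Osp d) : dco (Sum.inl j) s = co j s.2 := rfl
@[simp] lemma dco_inr (j : PIdx d) (s : Osp d) : dco (Sum.inr j) s = co j s.1 := rfl

lemma dco_self (J : OIdx d) : dco J (ospBasis d J) = 0 := by
  rcases J with j | j <;> simp

lemma abs_dco_le (J : OIdx d) (s : Osp d) : |dco J s| ≤ ‖s‖ := by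
  rcases J with j | j
  · exact (abs_co_le j s.2).trans (norm_snd_le s)
  · exact (abs_co_le j s.1).trans (norm_fst_le s)

/-- The pairing `w · θ = y · η + z · ζ`. -/
def pairing (s : Osp d) : ℝ := inner ℝ s.1.1 s.2.1 + inner ℝ s.1.2 s.2.2

/-- The kernel `e^{-i w · θ}`. -/
def ek (s : Osp d) : ℂ := Complex.exp (-Complex.I * pairing s)

lemma contDiff_pairing : ContDiff ℝ ∞ (pairing (d := d)) := by
  unfold pairing
  exact ((contDiff_fst.comp contDiff_fst).inner ℝ (contDiff_fst.comp contDiff_snd)).add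
    ((contDiff_snd.comp contDiff_fst).inner ℝ (contDiff_snd.comp contDiff_snd))

lemma contDiff_ek : ContDiff ℝ ∞ (ek (d := d)) :=
  (contDiff_const.mul (Complex.ofRealCLM.contDiff.comp contDiff_pairing)).cexp

lemma norm_ek (s : Osp d) : ‖ek s‖ = 1 := by
  rw [ek, show -Complex.I * (pairing s : ℂ) = ((-pairing s : ℝ) : ℂ) * Complex.I by push_cast; ring,
    Complex.norm_exp_ofReal_mul_I]

lemma inner_basisVec_right (v : Config d) (i : Fin d) : inner ℝ v (basisVec i) = v i := by
  simp [basisVec, EuclideanSpace.inner_single_right]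

lemma inner_basisVec_left (v : Config d) (i : Fin d) : inner ℝ (basisVec i) v = v i := by
  simp [basisVec, EuclideanSpace.inner_single_left]

lemma dd_ek (J : OIdx d) : dd (ospBasis d J) ek = fun s => -Complex.I * dco J s * ek s := by
  funext s
  have h0 : HasFDerivAt (fun s : Osp d => s.1.1)
      ((ContinuousLinearMap.fst ℝ _ _).comp (ContinuousLinearMap.fst ℝ _ _)) s :=
    ((ContinuousLinearMap.fst ℝ (Config d) (Config d)).comp
      (ContinuousLinearMap.fst ℝ (Phase d) (Phase d))).hasFDerivAt
  have h1 : HasFDerivAt (fun s : Osp d => s.1.2)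
      ((ContinuousLinearMap.snd ℝ _ _).comp (ContinuousLinearMap.fst ℝ _ _)) s :=
    ((ContinuousLinearMap.snd ℝ (Config d) (Config d)).comp
      (ContinuousLinearMap.fst ℝ (Phase d) (Phase d))).hasFDerivAt
  have h2 : HasFDerivAt (fun s : Osp d => s.2.1)
      ((ContinuousLinearMap.fst ℝ _ _).comp (ContinuousLinearMap.snd ℝ _ _)) s :=
    ((ContinuousLinearMap.fst ℝ (Config d) (Config d)).comp
      (ContinuousLinearMap.snd ℝ (Phase d) (Phase d))).hasFDerivAt
  have h3 : HasFDerivAt (fun s : Osp d => s.2.2)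
      ((ContinuousLinearMap.snd ℝ _ _).comp (ContinuousLinearMap.snd ℝ _ _)) s :=
    ((ContinuousLinearMap.snd ℝ (Config d) (Config d)).comp
      (ContinuousLinearMap.snd ℝ (Phase d) (Phase d))).hasFDerivAt
  have hp : HasFDerivAt (pairing (d := d)) _ s := (h0.inner ℝ h2).add (h1.inner ℝ h3)
  have hq := ((Complex.ofRealCLM.hasFDerivAt.comp s hp).const_mul (-Complex.I)).cexp
  have hq' : fderiv ℝ ek s = _ := hq.fderiv
  simp only [dd, hq']
  rcases J with (i | i) | (i | i) <;>
    simp [ek, inner_basisVec_left, inner_basisVec_right] <;> ring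

end Kernel

/-! ### Oscillatory integrals: regularisation -/

section Regularisation

open MeasureTheory

variable {d : ℕ} {ι : Type*}

instance isAddHaarMeasure_phase : (volume : Measure (Phase d)).IsAddHaarMeasure := by
  rw [Measure.volume_eq_prod]; infer_instance

instance isAddHaarMeasure_osp : (volume : Measure (Osp d)).IsAddHaarMeasure :=
  Measure.prod.instIsAddHaarMeasure (volume : Measure (Phase d)) (volume : Measure (Phase d))

/-- The weight `((1 + |w|)(1 + |θ|))^N`. -/
def wS (N : ℕ) (s : Osp d) : ℝ := ((1 + ‖s.1‖) * (1 + ‖s.2‖)) ^ N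

/-- Growth caused by one derivative of an amplitude: a factor `(1 + |w|)^2` for a derivative
in `w`, and none for a derivative in `θ`. -/
def ϖS : OIdx d → Osp d → ℝ
  | Sum.inl _, s => (1 + ‖s.1‖) ^ 2
  | Sum.inr _, _ => 1

lemma one_le_base (s : Osp d) : 1 ≤ (1 + ‖s.1‖) * (1 + ‖s.2‖) := by
  nlinarith [norm_nonneg s.1, norm_nonneg s.2, mul_nonneg (norm_nonneg s.1) (norm_nonneg s.2)]

lemma one_le_wS (N : ℕ) (s : Osp d) : 1 ≤ wS N s := one_le_pow₀ (one_le_base s)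

lemma wS_pos (N : ℕ) (s : Osp d) : 0 < wS N s := zero_lt_one.trans_le (one_le_wS N s)

lemma wS_mono {M N : ℕ} (h : M ≤ N) (s : Osp d) : wS M s ≤ wS N s :=
  pow_le_pow_right₀ (one_le_base s) h

lemma wS_add (M N : ℕ) (s : Osp d) : wS (M + N) s = wS M s * wS N s := pow_add _ _ _

lemma one_le_ϖS (J : OIdx d) (s : Osp d) : 1 ≤ ϖS J s := by
  rcases J with j | j
  · exact one_le_pow₀ (by linarith [norm_nonneg s.1])
  · exact le_rfl

lemma ϖS_nonneg (J : OIdx d) (s : Osp d) : 0 ≤ ϖS J s := zero_le_one.trans (one_le_ϖS J s)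

lemma ϖS_le (J : OIdx d) (s : Osp d) : ϖS J s ≤ wS 2 s := by
  rcases J with j | j
  · change (1 + ‖s.1‖) ^ 2 ≤ _
    unfold wS
    gcongr
    nlinarith [norm_nonneg s.1, norm_nonneg s.2, mul_nonneg (norm_nonneg s.1) (norm_nonneg s.2)]
  · exact one_le_wS 2 s

lemma norm_le_base (s : Osp d) : 1 + ‖s‖ ≤ (1 + ‖s.1‖) * (1 + ‖s.2‖) := by
  have h1 := norm_nonneg s.1
  have h2 := norm_nonneg s.2
  rcases max_cases ‖s.1‖ ‖s.2‖ with h | h <;> rw [Prod.norm_def, h.1] <;> nlinarith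

lemma base_le_norm_sq (s : Osp d) : (1 + ‖s.1‖) * (1 + ‖s.2‖) ≤ (1 + ‖s‖) ^ 2 := by
  rw [sq]
  exact mul_le_mul (by linarith [norm_fst_le s]) (by linarith [norm_snd_le s])
    (by positivity) (by positivity)

/-- The weights `(1 + |w|)^{-2d-1} (1 + |θ|)^{-2d-1}` are integrable. -/
lemma integrable_inv_wS : Integrable (fun s : Osp d => (wS (2 * d + 1) s)⁻¹) := by
  have hfin : Module.finrank ℝ (Phase d) = 2 * d := by
    rw [Module.finrank_prod]; simp; ring
  have h : Integrable (fun v : Phase d => (1 + ‖v‖) ^ (-((2 * d + 1 : ℕ) : ℝ))) :=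
    integrable_one_add_norm (by rw [hfin]; push_cast; linarith)
  refine (h.mul_prod h).congr (Filter.Eventually.of_forall fun s => ?_)
  have h1 : 0 < 1 + ‖s.1‖ := by positivity
  have h2 : 0 < 1 + ‖s.2‖ := by positivity
  simp only [wS]
  rw [Real.rpow_neg h1.le, Real.rpow_neg h2.le, Real.rpow_natCast, Real.rpow_natCast, mul_pow,
    mul_inv]

/-- One integration by parts: `R_J b = (1 + i c_J)⁻¹ (b + ∂_J b)`, where `c_J` is the coordinate
dual to the `J`-th one. -/
def regOp (J : OIdx d) (b : Osp d → ℂ) : Osp d → ℂ :=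
  (fun s => (1 + Complex.I * dco J s : ℂ)⁻¹) * (b + dd (ospBasis d J) b)

/-- Repeated integrations by parts, the head of the list being applied first. -/
def regOps : List (OIdx d) → (Osp d → ℂ) → Osp d → ℂ
  | [], b => b
  | J :: l, b => regOps l (regOp J b)

lemma Cl.regOp {W : ι → Osp d → ℝ} {b : ι → Osp d → ℂ} (hb : Cl (ospBasis d) ϖS W b)
    (hW : ∀ i s, 0 ≤ W i s) (J : OIdx d) :
    Cl (ospBasis d) ϖS (fun i s => W i s * (‖(1 + Complex.I * dco J s : ℂ)⁻¹‖ * ϖS J s))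
      (fun i => regOp J (b i)) := by
  have h1 : Cl (ospBasis d) ϖS (fun i s => W i s * ϖS J s) b :=
    hb.mono_weight ϖS_nonneg hW (M := 1) fun i s => by
      rw [one_mul]
      exact le_mul_of_one_le_right (hW i s) (one_le_ϖS J s)
  exact ((Cl.inv_one_add_I one_le_ϖS (dco J)).mul (h1.add (hb.deriv J))).congr
    (fun i s => by ring) (fun i s => rfl)

lemma Cl.regOps {W : ι → Osp d → ℝ} {b : ι → Osp d → ℂ} (hb : Cl (ospBasis d) ϖS W b)
    (hW : ∀ i s, 0 ≤ W i s) (l : List (OIdx d)) :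
    Cl (ospBasis d) ϖS
      (fun i s => W i s * (l.map fun J => ‖(1 + Complex.I * dco J s : ℂ)⁻¹‖ * ϖS J s).prod)
      (fun i => regOps l (b i)) := by
  induction l generalizing W b with
  | nil => simpa [MagneticWeyl.regOps] using hb
  | cons J l ih =>
    refine (ih (hb.regOp hW J) fun i s => mul_nonneg (hW i s)
      (mul_nonneg (norm_nonneg _) (ϖS_nonneg J s))).congr (fun i s => ?_) (fun i s => rfl)
    simp only [List.map_cons, List.prod_cons]
    ring

/-- Each of the coordinates `κ`, repeated `K` times. -/
def repList {κ : Type*} [Fintype κ] (K : ℕ) : List κ :=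
  (List.replicate K (Finset.univ.toList : List κ)).flatten

lemma prod_map_repList {κ : Type*} [Fintype κ] (K : ℕ) (f : κ → ℝ) :
    ((repList K).map f).prod = (∏ k, f k) ^ K := by
  induction K with
  | zero => simp [repList]
  | succ K ih =>
    rw [repList, List.replicate_succ, List.flatten_cons, List.map_append, List.prod_append, pow_succ']
    congr 1
    exact Finset.prod_map_toList _ _

lemma one_add_sum_le_prod {κ : Type*} (t : Finset κ) (f : κ → ℝ) (hf : ∀ k, 0 ≤ f k) :
    1 + ∑ k ∈ t, f k ≤ ∏ k ∈ t, (1 + f k) := by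
  classical
  induction t using Finset.induction_on with
  | empty => simp
  | insert a t ha ih =>
    rw [Finset.sum_insert ha, Finset.prod_insert ha]
    have h0 : 0 ≤ ∑ k ∈ t, f k := Finset.sum_nonneg fun k _ => hf k
    nlinarith [hf a, mul_nonneg (hf a) h0, mul_le_mul_of_nonneg_left ih (hf a)]

lemma norm_sq_le_sum_co (v : Phase d) : ‖v‖ ^ 2 ≤ ∑ j, co j v ^ 2 := by
  have h1 : ‖v.1‖ ^ 2 = ∑ i, v.1 i ^ 2 := by simp [EuclideanSpace.norm_sq_eq]
  have h2 : ‖v.2‖ ^ 2 = ∑ i, v.2 i ^ 2 := by simp [EuclideanSpace.norm_sq_eq]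
  rw [Fintype.sum_sum_type]
  simp only [co_inl, co_inr]
  rw [← h1, ← h2]
  rcases max_cases ‖v.1‖ ‖v.2‖ with h | h <;> rw [Prod.norm_def, h.1]
  · nlinarith [norm_nonneg v.2]
  · nlinarith [norm_nonneg v.1]

/-- The product over all coordinates of the factors `|1 + i v_j|⁻¹` gains one power of `|v|`. -/
lemma prod_norm_inv_le (v : Phase d) :
    ∏ j, ‖(1 + Complex.I * co j v : ℂ)⁻¹‖ ≤ 2 * (1 + ‖v‖)⁻¹ := by
  have h1 : ∏ j, ‖(1 + Complex.I * co j v : ℂ)⁻¹‖ = (Real.sqrt (∏ j, (1 + co j v ^ 2)))⁻¹ := by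
    rw [Real.sqrt_eq_rpow, ← Real.finsetProd_rpow _ _ fun j _ => by positivity,
      ← Finset.prod_inv_distrib]
    refine Finset.prod_congr rfl fun j _ => ?_
    rw [norm_inv_one_add_I_mul, Real.sqrt_eq_rpow]
  have h2 : 1 + ‖v‖ ^ 2 ≤ ∏ j, (1 + co j v ^ 2) := by
    refine le_trans ?_ (one_add_sum_le_prod Finset.univ
      (fun j => co j v ^ 2) fun j => sq_nonneg _)
    linarith [norm_sq_le_sum_co v]
  have h3 : (1 + ‖v‖) / 2 ≤ Real.sqrt (∏ j, (1 + co j v ^ 2)) := by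
    refine Real.le_sqrt_of_sq_le (le_trans ?_ h2)
    nlinarith [sq_nonneg (‖v‖ - 1)]
  rw [h1]
  have h4 : 0 < (1 + ‖v‖) / 2 := by positivity
  calc _ ≤ ((1 + ‖v‖) / 2)⁻¹ := inv_anti₀ h4 h3
    _ = _ := by rw [inv_div]; rfl

/-- The order of the integrations by parts: first in `w`, often enough to make an amplitude of
growth `N` integrable in `θ`, and then in `θ`, to make it integrable in `w`. -/
def regList (d N : ℕ) : List (OIdx d) :=
  (repList (N + (2 * d + 1))).map Sum.inl ++
    (repList (N + (4 * d) * (N + (2 * d + 1)) + (2 * d + 1))).map Sum.inr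

/-- The integrations by parts in `w` gain `(1 + |θ|)^{-K}` at the cost of `(1 + |w|)^{4dK}`; those in
`θ` cost nothing and gain enough powers of `(1 + |w|)^{-1}` to outweigh this cost. -/
lemma prod_regList_le (N : ℕ) : ∃ C : ℝ, 0 ≤ C ∧ ∀ s : Osp d,
    wS N s * ((regList d N).map fun J => ‖(1 + Complex.I * dco J s : ℂ)⁻¹‖ * ϖS J s).prod ≤
      C * (wS (2 * d + 1) s)⁻¹ := by
  refine ⟨2 ^ (N + (2 * d + 1)) * 2 ^ (N + (4 * d) * (N + (2 * d + 1)) + (2 * d + 1)),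
    by positivity, fun s => ?_⟩
  set K := N + (2 * d + 1) with hK
  set M := N + (4 * d) * K + (2 * d + 1) with hM
  have hp1 : 0 < 1 + ‖s.1‖ := by positivity
  have hp2 : 0 < 1 + ‖s.2‖ := by positivity
  have e1 : ((repList (κ := PIdx d) K).map fun j =>
      ‖(1 + Complex.I * co j s.2 : ℂ)⁻¹‖ * (1 + ‖s.1‖) ^ 2).prod ≤
      (2 * (1 + ‖s.2‖)⁻¹) ^ K * (1 + ‖s.1‖) ^ (4 * d * K) := by
    rw [prod_map_repList, Finset.prod_mul_distrib, mul_pow, Finset.prod_const, ← pow_mul, ← pow_mul]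
    have : 2 * ((Finset.univ : Finset (PIdx d)).card * K) = 4 * d * K := by
      simp; ring
    rw [this]
    gcongr
    exact prod_norm_inv_le s.2
  have e2 : ((repList (κ := PIdx d) M).map fun j =>
      ‖(1 + Complex.I * co j s.1 : ℂ)⁻¹‖ * 1).prod ≤ (2 * (1 + ‖s.1‖)⁻¹) ^ M := by
    rw [prod_map_repList]
    simp only [mul_one]
    gcongr
    exact prod_norm_inv_le s.1
  have e0 : ((regList d N).map fun J => ‖(1 + Complex.I * dco J s : ℂ)⁻¹‖ * ϖS J s).prod =
      ((repList (κ := PIdx d) K).map fun j =>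
        ‖(1 + Complex.I * co j s.2 : ℂ)⁻¹‖ * (1 + ‖s.1‖) ^ 2).prod *
      ((repList (κ := PIdx d) M).map fun j => ‖(1 + Complex.I * co j s.1 : ℂ)⁻¹‖ * 1).prod := by
    rw [regList, List.map_append, List.prod_append, List.map_map, List.map_map]
    rfl
  rw [e0]
  have hnn : 0 ≤ ((repList (κ := PIdx d) M).map fun j =>
      ‖(1 + Complex.I * co j s.1 : ℂ)⁻¹‖ * 1).prod := by
    rw [prod_map_repList]; positivity
  calc _ ≤ wS N s * (((2 * (1 + ‖s.2‖)⁻¹) ^ K * (1 + ‖s.1‖) ^ (4 * d * K)) *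
        (2 * (1 + ‖s.1‖)⁻¹) ^ M) := by
        refine mul_le_mul_of_nonneg_left ?_ (wS_pos N s).le
        exact mul_le_mul e1 e2 hnn (by positivity)
    _ = _ := by
        simp only [wS, mul_pow, inv_pow, hM, hK, pow_add, mul_inv]
        field_simp

lemma regOps_integrable_bound {b : ι → Osp d → ℂ} {c : ι → ℝ} (hc : ∀ i, 0 ≤ c i) {N : ℕ}
    (hb : Cl (ospBasis d) ϖS (fun i s => c i * wS N s) b) :
    ∃ C : ℝ, ∀ i s, ‖regOps (regList d N) (b i) s‖ ≤ C * c i * (wS (2 * d + 1) s)⁻¹ := by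
  obtain ⟨C, hC⟩ := (hb.regOps (fun i s => mul_nonneg (hc i) (wS_pos N s).le)
    (regList d N)).bound_zero
  obtain ⟨D, hD0, hD⟩ := prod_regList_le (d := d) N
  refine ⟨|C| * D, fun i s => ?_⟩
  have hnn : 0 ≤ ((regList d N).map fun J => ‖(1 + Complex.I * dco J s : ℂ)⁻¹‖ * ϖS J s).prod :=
    List.prod_nonneg fun x hx => by
      obtain ⟨J, -, rfl⟩ := List.mem_map.1 hx
      exact mul_nonneg (norm_nonneg _) (ϖS_nonneg J s)
  refine (hC i s).trans ?_
  have h1 := hc i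
  have h2 := wS_pos N s
  calc _ ≤ |C| * (c i * wS N s * _) := mul_le_mul_of_nonneg_right (le_abs_self C) (by positivity)
    _ = |C| * c i * (wS N s * _) := by ring
    _ ≤ |C| * c i * (D * (wS (2 * d + 1) s)⁻¹) :=
        mul_le_mul_of_nonneg_left (hD s) (by positivity)
    _ = _ := by ring

/-- Functions that decrease rapidly, with all derivatives. -/
def Rapid (b : Osp d → ℂ) : Prop :=
  ∀ N : ℕ, Cl (ospBasis d) ϖS (fun (_ : Unit) s => (wS N s)⁻¹) (fun _ => b)

lemma Rapid.smooth {b : Osp d → ℂ} (hb : Rapid b) : ContDiff ℝ ∞ b := (hb 0).smooth ()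

lemma integrable_of_bound {b : Osp d → ℂ} (hb : Continuous b) {C : ℝ}
    (h : ∀ s, ‖b s‖ ≤ C * (wS (2 * d + 1) s)⁻¹) : Integrable b :=
  (integrable_inv_wS.const_mul C).mono' hb.aestronglyMeasurable (Filter.Eventually.of_forall h)

lemma Rapid.integrable {b : Osp d → ℂ} (hb : Rapid b) : Integrable b := by
  obtain ⟨C, hC⟩ := (hb (2 * d + 1)).bound_zero
  exact integrable_of_bound hb.smooth.continuous (hC ())

lemma integrable_ek_mul {b : Osp d → ℂ} (hb : Integrable b) : Integrable (fun s => ek s * b s) := by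
  refine (hb.norm).mono' (contDiff_ek.continuous.aestronglyMeasurable.mul hb.1)
    (Filter.Eventually.of_forall fun s => ?_)
  rw [norm_mul, norm_ek, one_mul]

/-- Multiplication by a function of polynomial growth, and more generally any change of the
weights by a power of the base weight, preserves rapid decrease. -/
lemma rapid_of_cl {b : Osp d → ℂ} {M : ℕ}
    (h : ∀ N : ℕ, Cl (ospBasis d) ϖS (fun (_ : Unit) s => wS M s * (wS N s)⁻¹) (fun _ => b)) :
    Rapid b := fun N =>
  (h (M + N)).congr (fun _ s => by
    rw [wS_add, mul_inv, ← mul_assoc, mul_inv_cancel₀ (wS_pos M s).ne', one_mul]) fun _ _ => rfl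

lemma Rapid.mul_cl {b a : Osp d → ℂ} (hb : Rapid b) {M : ℕ}
    (ha : Cl (ospBasis d) ϖS (fun (_ : Unit) s => wS M s) (fun _ => a)) : Rapid (a * b) :=
  rapid_of_cl fun N => ha.mul (hb N)

lemma Rapid.deriv {b : Osp d → ℂ} (hb : Rapid b) (J : OIdx d) : Rapid (dd (ospBasis d J) b) :=
  rapid_of_cl (M := 2) fun N => ((hb N).deriv J).mono_weight ϖS_nonneg
    (fun _ s => mul_nonneg (inv_nonneg.2 (wS_pos N s).le) (ϖS_nonneg J s)) (M := 1) fun _ s => by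
      rw [one_mul, mul_comm]
      exact mul_le_mul_of_nonneg_right (ϖS_le J s) (inv_nonneg.2 (wS_pos N s).le)

lemma Rapid.add {b a : Osp d → ℂ} (ha : Rapid a) (hb : Rapid b) : Rapid (a + b) :=
  fun N => (ha N).add (hb N)

lemma cl_dco (J : OIdx d) :
    Cl (ospBasis d) ϖS (fun (_ : ι) s => wS 1 s) (fun _ s => (dco J s : ℂ)) := by
  refine Cl.clm (dco J) (C := 1) (fun _ s => ?_) fun _ K s => ?_
  · rw [one_mul]
    refine (abs_dco_le J s).trans ?_
    simp only [wS, pow_one]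
    linarith [norm_le_base s]
  · rw [one_mul]
    have h1 : |dco J (ospBasis d K)| ≤ 1 := by
      rcases J with j | j <;> rcases K with k | k <;> simp [co_basis] <;> split_ifs <;> simp
    refine h1.trans ?_
    nlinarith [one_le_wS 1 s, one_le_ϖS K s]

lemma cl_inv_dco (J : OIdx d) : Cl (ospBasis d) ϖS (fun (_ : ι) s => wS 0 s)
    (fun _ s => (1 + Complex.I * dco J s : ℂ)⁻¹) :=
  (Cl.inv_one_add_I one_le_ϖS (dco J)).mono_weight ϖS_nonneg (fun _ _ => norm_nonneg _) (M := 1)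
    fun _ s => by simpa [wS] using norm_inv_one_add_I_mul_le_one (dco J s)

lemma Rapid.regOp {b : Osp d → ℂ} (hb : Rapid b) (J : OIdx d) : Rapid (regOp J b) :=
  (hb.add (hb.deriv J)).mul_cl (cl_inv_dco J)

/-- Integration by parts: multiplication by a coordinate turns into `-i` times the derivative in
the dual coordinate. -/
lemma integral_ek_dco_mul {b : Osp d → ℂ} (hb : Rapid b) (J : OIdx d) :
    ∫ s, ek s * (dco J s * b s) = ∫ s, ek s * (-Complex.I * dd (ospBasis d J) b s) := by
  have hd : Rapid (fun s => (dco J s : ℂ) * b s) := hb.mul_cl (cl_dco J)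
  have h := integral_mul_fderiv_eq_neg_fderiv_mul_of_integrable (μ := (volume : Measure (Osp d)))
    (f := ek) (g := b) (v := ospBasis d J) ?_ (integrable_ek_mul (hb.deriv J).integrable)
    (integrable_ek_mul hb.integrable) (fun s _ => contDiff_ek.differentiable (by simp) s)
    (fun s _ => diff_of_smooth hb.smooth s)
  · have h' : ∫ s, ek s * dd (ospBasis d J) b s = -∫ s, dd (ospBasis d J) ek s * b s := h
    rw [dd_ek] at h'
    have e1 : ∫ s, ek s * (-Complex.I * dd (ospBasis d J) b s) =
        -Complex.I * ∫ s, ek s * dd (ospBasis d J) b s := by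
      rw [← integral_const_mul]
      congr 1; funext s; ring
    have e2 : ∫ s, -Complex.I * (dco J s) * ek s * b s =
        -Complex.I * ∫ s, ek s * (dco J s * b s) := by
      rw [← integral_const_mul]
      congr 1; funext s; ring
    rw [e1, h', e2]
    ring_nf
    simp
  · have : (fun s => fderiv ℝ ek s (ospBasis d J) * b s) =
        fun s => -Complex.I * (ek s * (dco J s * b s)) := by
      funext s
      have := congrFun (dd_ek J) s
      simp only [dd] at this
      rw [this]; ring
    rw [this]
    exact (integrable_ek_mul hd.integrable).const_mul _

/-- One integration by parts does not change the integral: `∂_J e^{-i w · θ} = -i c_J e^{-i w · θ}`, and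
the factor `(1 + i c_J)⁻¹` does not depend on the coordinate in which the derivative is taken. -/
lemma integral_ek_regOp {b : Osp d → ℂ} (hb : Rapid b) (J : OIdx d) :
    ∫ s, ek s * regOp J b s = ∫ s, ek s * b s := by
  set c : Osp d → ℂ := (fun s => (1 + Complex.I * dco J s : ℂ)⁻¹) * b with hc
  have hcR : Rapid c := hb.mul_cl (cl_inv_dco J)
  have hdc : dd (ospBasis d J) c =
      fun s => (1 + Complex.I * dco J s : ℂ)⁻¹ * dd (ospBasis d J) b s := by
    have h0 := dd_inv_one_add_I_pow (dco J) 1 (ospBasis d J)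
    simp only [pow_one, dco_self] at h0
    rw [hc, dd_mul (contDiff_inv_one_add_I _) hb.smooth, h0]
    funext s
    simp
  have h := integral_ek_dco_mul hcR J
  have e1 : ∀ s, ek s * regOp J b s = ek s * c s +
      Complex.I * (ek s * (-Complex.I * dd (ospBasis d J) c s)) := by
    intro s
    have hI : Complex.I * (ek s * (-Complex.I * dd (ospBasis d J) c s)) =
        ek s * dd (ospBasis d J) c s := by
      linear_combination (-(ek s * dd (ospBasis d J) c s)) * Complex.I_mul_I
    rw [hI, hdc]
    simp only [regOp, hc, Pi.mul_apply, Pi.add_apply]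
    ring
  have e2 : ∀ s, ek s * b s = ek s * c s + Complex.I * (ek s * (dco J s * c s)) := by
    intro s
    have := one_add_I_mul_ne_zero (dco J s)
    simp only [hc, Pi.mul_apply]
    field_simp
  have i1 := integrable_ek_mul hcR.integrable
  have i2 : Integrable (fun s => ek s * (dco J s * c s)) :=
    integrable_ek_mul (hcR.mul_cl (cl_dco J)).integrable
  have i3 : Integrable (fun s => ek s * (-Complex.I * dd (ospBasis d J) c s)) :=
    integrable_ek_mul ((hcR.deriv J).integrable.const_mul _)
  simp_rw [e1, e2]
  rw [integral_add i1 (i3.const_mul _), integral_add i1 (i2.const_mul _), integral_const_mul,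
    integral_const_mul]
  congr 2
  exact h.symm

lemma integral_ek_regOps {b : Osp d → ℂ} (hb : Rapid b) (l : List (OIdx d)) :
    ∫ s, ek s * regOps l b s = ∫ s, ek s * b s := by
  induction l generalizing b with
  | nil => rfl
  | cons J l ih => rw [regOps, ih (hb.regOp J), integral_ek_regOp hb J]

lemma contDiff_regOps (l : List (OIdx d)) {P : Type*} [NormedAddCommGroup P] [NormedSpace ℝ P]
    {b : P → Osp d → ℂ} (hb : ContDiff ℝ ∞ (Function.uncurry b)) :
    ContDiff ℝ ∞ (Function.uncurry fun p => regOps l (b p)) := by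
  induction l generalizing b with
  | nil => exact hb
  | cons J l ih =>
    refine ih (b := fun p => regOp J (b p)) ?_
    have h1 : ContDiff ℝ ∞ (fun q : P × Osp d => fderiv ℝ (b q.1) q.2 (ospBasis d J)) := by
      refine ContDiff.clm_apply ?_ contDiff_const
      refine ContDiff.fderiv (f := fun q : P × Osp d => b q.1) (m := ∞) (n := ∞) ?_ contDiff_snd
        (by simp)
      exact hb.comp ((contDiff_fst.comp contDiff_fst).prodMk contDiff_snd)
    exact ((contDiff_inv_one_add_I (dco J)).comp contDiff_snd).mul (hb.add h1)

/-- The regularised oscillatory integral of an amplitude of growth `N`. -/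
def regInt (N : ℕ) (b : Osp d → ℂ) : ℂ := ∫ s, ek s * regOps (regList d N) b s

/-- The integrals of rapidly decreasing amplitudes that approximate an amplitude `b 0` smoothly
and with uniform bounds tend to the regularised oscillatory integral of `b 0`. -/
lemma tendsto_regInt {b : ℝ → Osp d → ℂ} {N : ℕ} (hs : ContDiff ℝ ∞ (Function.uncurry b))
    (hb : Cl (ospBasis d) ϖS (fun (_ : Set.Icc (0 : ℝ) 1) s => wS N s) (fun δ => b δ))
    (hr : ∀ δ ∈ Set.Ioc (0 : ℝ) 1, Rapid (b δ)) :
    Filter.Tendsto (fun δ => ∫ s, ek s * b δ s) (𝓝[>] 0) (𝓝 (regInt N (b 0))) := by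
  obtain ⟨C, hC⟩ := regOps_integrable_bound (c := fun _ => 1) (fun _ => zero_le_one)
    (hb.congr (fun _ s => (one_mul _).symm) fun _ _ => rfl)
  have hcont := (contDiff_regOps (regList d N) hs).continuous
  have hev : ∀ᶠ δ in 𝓝[>] (0 : ℝ), δ ∈ Set.Ioc (0 : ℝ) 1 :=
    Ioc_mem_nhdsGT zero_lt_one
  have h1 : Filter.Tendsto (fun δ => ∫ s, ek s * regOps (regList d N) (b δ) s) (𝓝[>] 0)
      (𝓝 (regInt N (b 0))) := by
    refine tendsto_integral_filter_of_dominated_convergence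
      (fun s => C * 1 * (wS (2 * d + 1) s)⁻¹) ?_ ?_ (integrable_inv_wS.const_mul _) ?_
    · refine Filter.Eventually.of_forall fun δ => Continuous.aestronglyMeasurable ?_
      exact contDiff_ek.continuous.mul (hcont.comp (Continuous.prodMk_right δ))
    · filter_upwards [hev] with δ hδ
      refine Filter.Eventually.of_forall fun s => ?_
      rw [norm_mul, norm_ek, one_mul]
      exact hC ⟨δ, hδ.1.le, hδ.2⟩ s
    · refine Filter.Eventually.of_forall fun s => ?_
      have h2 : Continuous fun δ => ek s * regOps (regList d N) (b δ) s :=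
        continuous_const.mul (hcont.comp (Continuous.prodMk_left s))
      exact (h2.tendsto 0).mono_left nhdsWithin_le_nhds
  refine h1.congr' ?_
  filter_upwards [hev] with δ hδ
  exact integral_ek_regOps (hr δ hδ) _

end Regularisation

/-! ### Oscillatory integrals: the functional and its calculus -/

section Osc

open MeasureTheory

variable {d : ℕ} {ι : Type*}

lemma dd_uncurry_left {P Q : Type*} [NormedAddCommGroup P] [NormedSpace ℝ P] [NormedAddCommGroup Q]
    [NormedSpace ℝ Q] {a : P → Q → ℂ} (ha : ContDiff ℝ ∞ (Function.uncurry a)) (u : P) (p : P)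
    (q : Q) : dd u (fun p => a p q) p = dd (u, 0) (Function.uncurry a) (p, q) := by
  have h1 : HasFDerivAt (fun p : P => (p, q)) (ContinuousLinearMap.inl ℝ P Q) p :=
    hasFDerivAt_prodMk_left p q
  have h2 := ((diff_of_smooth ha (p, q)).hasFDerivAt).comp p h1
  have h3 : fderiv ℝ (fun p => a p q) p = _ := h2.fderiv
  simp [dd, h3]

lemma dd_uncurry_right {P Q : Type*} [NormedAddCommGroup P] [NormedSpace ℝ P] [NormedAddCommGroup Q]
    [NormedSpace ℝ Q] {a : P → Q → ℂ} (ha : ContDiff ℝ ∞ (Function.uncurry a)) (v : Q) (p : P)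
    (q : Q) : dd v (a p) q = dd (0, v) (Function.uncurry a) (p, q) := by
  have h1 : HasFDerivAt (fun q : Q => (p, q)) (ContinuousLinearMap.inr ℝ P Q) q :=
    hasFDerivAt_prodMk_right p q
  have h2 := ((diff_of_smooth ha (p, q)).hasFDerivAt).comp q h1
  have h3 : fderiv ℝ (a p) q = _ := h2.fderiv
  simp [dd, h3]

lemma contDiff_uncurry_dd_left {P Q : Type*} [NormedAddCommGroup P] [NormedSpace ℝ P]
    [NormedAddCommGroup Q] [NormedSpace ℝ Q] {a : P → Q → ℂ}
    (ha : ContDiff ℝ ∞ (Function.uncurry a)) (u : P) :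
    ContDiff ℝ ∞ (Function.uncurry fun p q => dd u (fun p => a p q) p) := by
  have : (Function.uncurry fun p q => dd u (fun p => a p q) p) = dd (u, 0) (Function.uncurry a) := by
    funext ⟨p, q⟩; exact dd_uncurry_left ha u p q
  rw [this]
  exact contDiff_dd ha _

lemma contDiff_uncurry_dd_right {P Q : Type*} [NormedAddCommGroup P] [NormedSpace ℝ P]
    [NormedAddCommGroup Q] [NormedSpace ℝ Q] {a : P → Q → ℂ}
    (ha : ContDiff ℝ ∞ (Function.uncurry a)) (v : Q) :
    ContDiff ℝ ∞ (Function.uncurry fun p => dd v (a p)) := by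
  have : (Function.uncurry fun p => dd v (a p)) = dd (0, v) (Function.uncurry a) := by
    funext ⟨p, q⟩; exact dd_uncurry_right ha v p q
  rw [this]
  exact contDiff_dd ha _

lemma dd_swap {P Q : Type*} [NormedAddCommGroup P] [NormedSpace ℝ P] [NormedAddCommGroup Q]
    [NormedSpace ℝ Q] {a : P → Q → ℂ} (ha : ContDiff ℝ ∞ (Function.uncurry a)) (u : P) (v : Q)
    (p : P) (q : Q) : dd u (fun p => dd v (a p) q) p = dd v (fun q => dd u (fun p => a p q) p) q := by
  rw [dd_uncurry_left (contDiff_uncurry_dd_right ha v),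
    dd_uncurry_right (a := fun p q => dd u (fun p => a p q) p) (contDiff_uncurry_dd_left ha u)]
  have h1 : (Function.uncurry fun p => dd v (a p)) = dd (0, v) (Function.uncurry a) := by
    funext ⟨p, q⟩; exact dd_uncurry_right ha v p q
  have h2 : (Function.uncurry fun p q => dd u (fun p => a p q) p) = dd (u, 0) (Function.uncurry a) := by
    funext ⟨p, q⟩; exact dd_uncurry_left ha u p q
  rw [h1, h2, dd_comm ha]

/-- Derivatives with respect to parameters commute with the integrations by parts. -/
lemma dd_regOps {P : Type*} [NormedAddCommGroup P] [NormedSpace ℝ P] (l : List (OIdx d))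
    {a : P → Osp d → ℂ} (ha : ContDiff ℝ ∞ (Function.uncurry a)) (u p : P) (s : Osp d) :
    dd u (fun p => regOps l (a p) s) p = regOps l (fun s => dd u (fun p => a p s) p) s := by
  induction l generalizing a with
  | nil => rfl
  | cons J l ih =>
    have hJ : ContDiff ℝ ∞ (Function.uncurry fun p => regOp J (a p)) := contDiff_regOps [J] ha
    simp only [regOps]
    rw [ih hJ]
    congr 1
    funext s
    have h1 : ContDiff ℝ ∞ (fun p => a p s) := ha.comp (contDiff_prodMk_left s)
    have h2 : ContDiff ℝ ∞ (fun p => dd (ospBasis d J) (a p) s) :=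
      (contDiff_uncurry_dd_right ha _).comp (contDiff_prodMk_left s)
    have h3 := dd_const_mul (1 + Complex.I * dco J s : ℂ)⁻¹ (h1.add h2) u
    have h4 := congrFun (dd_add h1 h2 u) p
    simp only [regOp, Pi.mul_apply, Pi.add_apply]
    rw [congrFun h3 p]
    change _ * dd u ((fun p => a p s) + fun p => dd (ospBasis d J) (a p) s) p = _
    rw [h4, Pi.add_apply, dd_swap ha]

/-- Amplitudes of growth `N`: bounded by `((1 + |w|)(1 + |θ|))^N`, where each derivative in `w` may
cost `(1 + |w|)^2` and derivatives in `θ` cost nothing. -/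
def IsAmp (N : ℕ) (b : Osp d → ℂ) : Prop :=
  Cl (ospBasis d) ϖS (fun (_ : Unit) s => wS N s) (fun _ => b)

lemma IsAmp.smooth {N : ℕ} {b : Osp d → ℂ} (hb : IsAmp N b) : ContDiff ℝ ∞ b := Cl.smooth hb ()

lemma IsAmp.mono {M N : ℕ} (h : M ≤ N) {b : Osp d → ℂ} (hb : IsAmp M b) : IsAmp N b :=
  Cl.mono_weight hb ϖS_nonneg (fun _ s => (wS_pos M s).le) (M := 1) fun _ s => by
    rw [one_mul]; exact wS_mono h s

lemma IsAmp.mul {M N : ℕ} {a b : Osp d → ℂ} (ha : IsAmp M a) (hb : IsAmp N b) :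
    IsAmp (M + N) (a * b) :=
  (Cl.mul ha hb).congr (fun _ s => (wS_add M N s).symm) fun _ _ => rfl

lemma IsAmp.deriv {N : ℕ} {b : Osp d → ℂ} (hb : IsAmp N b) (J : OIdx d) :
    IsAmp (N + 2) (dd (ospBasis d J) b) :=
  (Cl.deriv hb J).mono_weight ϖS_nonneg
    (fun _ s => mul_nonneg (wS_pos N s).le (ϖS_nonneg J s)) (M := 1) fun _ s => by
      rw [one_mul, wS_add]
      exact mul_le_mul_of_nonneg_left (ϖS_le J s) (wS_pos N s).le

lemma Cl.isAmp {N : ℕ} {b : ι → Osp d → ℂ}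
    (hb : Cl (ospBasis d) ϖS (fun (_ : ι) s => wS N s) b) (i : ι) : IsAmp N (b i) :=
  hb.reindex fun _ => i

lemma contDiff_scaled (ψ : 𝓢(Osp d, ℂ)) :
    ContDiff ℝ ∞ (Function.uncurry fun (δ : ℝ) (s : Osp d) => ψ (δ • s)) :=
  (ψ.smooth ⊤).comp (contDiff_fst.smul contDiff_snd)

lemma cl_scaled {V κ : Type*} [NormedAddCommGroup V] [NormedSpace ℝ V] [Fintype κ] (e : κ → V)
    (ψ : 𝓢(V, ℂ)) (N : ℕ) :
    Cl e (fun _ _ => 1) (fun (δ : Set.Icc (0 : ℝ) 1) v => ((1 + ‖(δ : ℝ) • v‖) ^ N)⁻¹)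
      (fun δ v => ψ ((δ : ℝ) • v)) := by
  classical
  refine (Cl.schwartz (ι := Unit) (e := e) ψ N).comp_affine (π := fun _ => ())
    (φ := fun (δ : Set.Icc (0 : ℝ) 1) v => (δ : ℝ) • v)
    (L := fun δ => (δ : ℝ) • ContinuousLinearMap.id ℝ V) (fun _ _ => zero_le_one)
    (fun _ _ => zero_le_one) (fun _ _ => by positivity)
    (fun δ v => (hasFDerivAt_id v).const_smul (δ : ℝ))
    (c := fun δ k' k => if k = k' then (δ : ℝ) else 0) (fun δ k => by simp) (D := 1) ?_
  intro δ k' k v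
  split_ifs with h
  · simpa [abs_of_nonneg δ.2.1] using δ.2.2
  · simp

lemma cl_scaled_amp (ψ : 𝓢(Osp d, ℂ)) :
    Cl (ospBasis d) ϖS (fun (_ : Set.Icc (0 : ℝ) 1) s => wS 0 s) (fun δ s => ψ ((δ : ℝ) • s)) :=
  (cl_scaled (ospBasis d) ψ 0).mono (fun _ _ => zero_le_one) one_le_ϖS
    (fun _ _ => by positivity) (M := 1) fun _ _ => by simp [wS]

lemma rapid_scaled (ψ : 𝓢(Osp d, ℂ)) {δ : ℝ} (hδ : δ ∈ Set.Ioc (0 : ℝ) 1) :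
    Rapid (fun s : Osp d => ψ (δ • s)) := by
  intro N
  have h := (cl_scaled (ospBasis d) ψ (2 * N)).reindex
    (fun _ : Unit => (⟨δ, hδ.1.le, hδ.2⟩ : Set.Icc (0 : ℝ) 1))
  refine h.mono (fun _ _ => zero_le_one) one_le_ϖS (fun _ _ => by positivity)
    (M := (δ⁻¹) ^ (2 * N)) fun _ s => ?_
  have h1 : δ * (1 + ‖s‖) ≤ 1 + ‖δ • s‖ := by
    rw [norm_smul, Real.norm_eq_abs, abs_of_pos hδ.1]
    nlinarith [hδ.2]
  have h2 : wS N s ≤ (1 + ‖s‖) ^ (2 * N) := by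
    rw [wS, pow_mul]
    exact pow_le_pow_left₀ (by positivity) (base_le_norm_sq s) _
  have hδ0 := hδ.1
  calc ((1 + ‖δ • s‖) ^ (2 * N))⁻¹ ≤ ((δ * (1 + ‖s‖)) ^ (2 * N))⁻¹ := by gcongr
    _ = (δ⁻¹) ^ (2 * N) * ((1 + ‖s‖) ^ (2 * N))⁻¹ := by rw [mul_pow, mul_inv, inv_pow]
    _ ≤ _ := by
      have := wS_pos N s
      gcongr

/-- The Schwartz cut-off used to define oscillatory integrals. -/
def cutoff (d : ℕ) : 𝓢(Osp d, ℂ) := (exists_schwartz_one (Osp d)).choose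

lemma cutoff_zero : cutoff d 0 = 1 := (exists_schwartz_one (Osp d)).choose_spec

/-- The oscillatory integral `∫∫ e^{-i w · θ} b(w, θ) dw dθ`, defined with one particular cut-off. The
limit exists and does not depend on the cut-off if `b` is an amplitude (`tendsto_cutoff_osc`); for
other `b` the value may have no meaning. -/
def osc (b : Osp d → ℂ) : ℂ :=
  Filter.limUnder (𝓝[>] (0 : ℝ)) fun δ => ∫ s, ek s * (cutoff d (δ • s) * b s)

lemma tendsto_cutoff_regInt {N : ℕ} {b : Osp d → ℂ} (hb : IsAmp N b) (ψ : 𝓢(Osp d, ℂ))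
    (hψ : ψ 0 = 1) : Filter.Tendsto (fun δ : ℝ => ∫ s, ek s * (ψ (δ • s) * b s)) (𝓝[>] 0)
      (𝓝 (regInt N b)) := by
  have h := tendsto_regInt (b := fun (δ : ℝ) s => ψ (δ • s) * b s) (N := N)
    ((contDiff_scaled ψ).mul (hb.smooth.comp contDiff_snd))
    (((cl_scaled_amp ψ).mul (Cl.reindex hb fun _ => ())).congr (fun _ s => by simp [wS])
      fun _ _ => rfl)
    (fun δ hδ => by
      have := (rapid_scaled ψ hδ).mul_cl hb
      rwa [mul_comm] at this)
  simpa [hψ] using h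

lemma osc_eq_regInt {N : ℕ} {b : Osp d → ℂ} (hb : IsAmp N b) : osc b = regInt N b :=
  (tendsto_cutoff_regInt hb _ cutoff_zero).limUnder_eq

lemma tendsto_cutoff_osc {N : ℕ} {b : Osp d → ℂ} (hb : IsAmp N b) (ψ : 𝓢(Osp d, ℂ))
    (hψ : ψ 0 = 1) : Filter.Tendsto (fun δ : ℝ => ∫ s, ek s * (ψ (δ • s) * b s)) (𝓝[>] 0)
      (𝓝 (osc b)) := by
  rw [osc_eq_regInt hb]; exact tendsto_cutoff_regInt hb ψ hψ

/-- Any smooth and uniformly bounded approximation by rapidly decreasing amplitudes computes the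
oscillatory integral. -/
lemma tendsto_osc {b : ℝ → Osp d → ℂ} {N : ℕ} (hs : ContDiff ℝ ∞ (Function.uncurry b))
    (hb : Cl (ospBasis d) ϖS (fun (_ : Set.Icc (0 : ℝ) 1) s => wS N s) (fun δ => b δ))
    (hr : ∀ δ ∈ Set.Ioc (0 : ℝ) 1, Rapid (b δ)) :
    Filter.Tendsto (fun δ => ∫ s, ek s * b δ s) (𝓝[>] 0) (𝓝 (osc (b 0))) := by
  rw [osc_eq_regInt (hb.isAmp ⟨0, le_rfl, zero_le_one⟩)]
  exact tendsto_regInt hs hb hr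

lemma rapid_cutoff_mul {N : ℕ} {b : Osp d → ℂ} (hb : IsAmp N b) (ψ : 𝓢(Osp d, ℂ)) {δ : ℝ}
    (hδ : δ ∈ Set.Ioc (0 : ℝ) 1) : Rapid (fun s => ψ (δ • s) * b s) := by
  have := (rapid_scaled ψ hδ).mul_cl hb
  rwa [mul_comm] at this

lemma eventually_Ioc : ∀ᶠ δ in 𝓝[>] (0 : ℝ), δ ∈ Set.Ioc (0 : ℝ) 1 := Ioc_mem_nhdsGT zero_lt_one

lemma osc_add {N : ℕ} {a b : Osp d → ℂ} (ha : IsAmp N a) (hb : IsAmp N b) :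
    osc (a + b) = osc a + osc b := by
  refine tendsto_nhds_unique (tendsto_cutoff_osc (Cl.add ha hb) _ cutoff_zero) ?_
  refine ((tendsto_cutoff_osc ha _ cutoff_zero).add (tendsto_cutoff_osc hb _ cutoff_zero)).congr' ?_
  filter_upwards [eventually_Ioc] with δ hδ
  rw [← integral_add (integrable_ek_mul (rapid_cutoff_mul ha _ hδ).integrable)
    (integrable_ek_mul (rapid_cutoff_mul hb _ hδ).integrable)]
  congr 1; funext s; simp only [Pi.add_apply]; ring

lemma IsAmp.const_mul {N : ℕ} {b : Osp d → ℂ} (hb : IsAmp N b) (c : ℂ) :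
    IsAmp N (fun s => c * b s) := Cl.const_mul hb (c := fun _ => c) (M := ‖c‖) fun _ => le_rfl

lemma osc_const_mul {N : ℕ} {b : Osp d → ℂ} (hb : IsAmp N b) (c : ℂ) :
    osc (fun s => c * b s) = c * osc b := by
  refine tendsto_nhds_unique (tendsto_cutoff_osc (hb.const_mul c) _ cutoff_zero) ?_
  refine ((tendsto_cutoff_osc hb _ cutoff_zero).const_mul c).congr fun δ => ?_
  rw [← integral_const_mul]
  congr 1; funext s; ring

lemma osc_zero : osc (fun _ : Osp d => (0 : ℂ)) = 0 := by
  simpa using osc_const_mul (N := 0) (b := fun _ : Osp d => (0 : ℂ)) Cl.zero 0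

lemma IsAmp.sum {N : ℕ} {α : Type*} (t : Finset α) {f : α → Osp d → ℂ}
    (hf : ∀ j ∈ t, IsAmp N (f j)) : IsAmp N (fun s => ∑ j ∈ t, f j s) := Cl.sum t hf

lemma osc_sum {N : ℕ} {α : Type*} (t : Finset α) {f : α → Osp d → ℂ}
    (hf : ∀ j ∈ t, IsAmp N (f j)) : osc (fun s => ∑ j ∈ t, f j s) = ∑ j ∈ t, osc (f j) := by
  classical
  induction t using Finset.induction_on with
  | empty => simpa using osc_zero
  | insert j t hj ih =>
    simp only [Finset.sum_insert hj]
    rw [← ih fun i hi => hf i (by simp [hi])]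
    exact osc_add (hf j (by simp)) (IsAmp.sum t fun i hi => hf i (by simp [hi]))

/-- Oscillatory integrals of a family of amplitudes obey the bounds of the family. -/
lemma exists_norm_osc_le {b : ι → Osp d → ℂ} {c : ι → ℝ} (hc : ∀ i, 0 ≤ c i) {N : ℕ}
    (hb : Cl (ospBasis d) ϖS (fun i s => c i * wS N s) b) : ∃ C : ℝ, ∀ i, ‖osc (b i)‖ ≤ C * c i := by
  obtain ⟨C, hC⟩ := regOps_integrable_bound hc hb
  refine ⟨C * ∫ s : Osp d, (wS (2 * d + 1) s)⁻¹, fun i => ?_⟩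
  have hi : IsAmp N (b i) := (hb.reindex fun _ : Unit => i).mono_weight ϖS_nonneg
    (fun _ s => mul_nonneg (hc i) (wS_pos N s).le) fun _ s => le_rfl
  rw [osc_eq_regInt hi, regInt]
  refine (norm_integral_le_of_norm_le (integrable_inv_wS.const_mul (C * c i))
    (Filter.Eventually.of_forall fun s => ?_)).trans_eq ?_
  · rw [norm_mul, norm_ek, one_mul]
    exact hC i s
  · rw [integral_const_mul]; ring

/-- Multiplication of an amplitude by a coordinate amounts to `-i` times the derivative in the dual
coordinate. -/
lemma osc_dco_mul {N : ℕ} {b : Osp d → ℂ} (hb : IsAmp N b) (J : OIdx d) :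
    osc (fun s => dco J s * b s) = osc (fun s => -Complex.I * dd (ospBasis d J) b s) := by
  have h1 := tendsto_cutoff_osc (IsAmp.mul (M := 1) (cl_dco (ι := Unit) J) hb) _ cutoff_zero
  have hsm : ContDiff ℝ ∞ (Function.uncurry fun (δ : ℝ) s => cutoff d (δ • s) * b s) :=
    (contDiff_scaled (cutoff d)).mul (hb.smooth.comp contDiff_snd)
  have hcl : Cl (ospBasis d) ϖS (fun (_ : Set.Icc (0 : ℝ) 1) s => wS N s)
      (fun δ s => cutoff d ((δ : ℝ) • s) * b s) :=
    ((cl_scaled_amp (cutoff d)).mul (Cl.reindex hb fun _ => ())).congr (fun _ s => by simp [wS])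
      fun _ _ => rfl
  have hcl' : Cl (ospBasis d) ϖS (fun (_ : Set.Icc (0 : ℝ) 1) s => wS (N + 2) s)
      (fun δ s => -Complex.I * dd (ospBasis d J) (fun s => cutoff d ((δ : ℝ) • s) * b s) s) :=
    (((hcl.deriv J).const_mul (c := fun _ => -Complex.I) (M := 1) (by simp))).mono_weight ϖS_nonneg
      (fun _ s => mul_nonneg (wS_pos N s).le (ϖS_nonneg J s)) (M := 1) fun _ s => by
        rw [one_mul, wS_add]
        exact mul_le_mul_of_nonneg_left (ϖS_le J s) (wS_pos N s).le
  have h2 := tendsto_osc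
    (b := fun (δ : ℝ) s => -Complex.I * dd (ospBasis d J) (fun s => cutoff d (δ • s) * b s) s)
    (contDiff_const.mul (contDiff_uncurry_dd_right hsm _)) hcl' fun δ hδ => by
      have h := (rapid_cutoff_mul hb (cutoff d) hδ).deriv J
      exact fun M => (h M).const_mul (c := fun _ => -Complex.I) (M := 1) (by simp)
  simp only [zero_smul, cutoff_zero, one_mul] at h2
  refine tendsto_nhds_unique h1 (h2.congr' ?_)
  filter_upwards [eventually_Ioc] with δ hδ
  rw [← integral_ek_dco_mul (rapid_cutoff_mul hb (cutoff d) hδ) J]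
  congr 1; funext s; simp only [Pi.mul_apply]; ring

/-- Differentiation of an oscillatory integral with respect to parameters. -/
lemma dd_osc {P κ : Type*} [NormedAddCommGroup P] [NormedSpace ℝ P] [FiniteDimensional ℝ P]
    [Fintype κ] (bP : Module.Basis κ ℝ P) {a : P → Osp d → ℂ}
    (hs : ContDiff ℝ ∞ (Function.uncurry a)) {N : ℕ}
    (h0 : ∀ R : ℝ, Cl (ospBasis d) ϖS (fun (_ : {p : P // ‖p‖ ≤ R}) s => wS N s) (fun p => a p))
    (h1 : ∀ k, ∀ R : ℝ, Cl (ospBasis d) ϖS (fun (_ : {p : P // ‖p‖ ≤ R}) s => wS N s)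
      (fun p s => dd (bP k) (fun p => a p s) p)) :
    Differentiable ℝ (fun p => osc (a p)) ∧
      ∀ k p, dd (bP k) (fun p => osc (a p)) p = osc (fun s => dd (bP k) (fun p => a p s) p) := by
  have hA : ∀ p, IsAmp N (a p) := fun p => (h0 ‖p‖).isAmp ⟨p, le_rfl⟩
  have hA' : ∀ k p, IsAmp N (fun s => dd (bP k) (fun p => a p s) p) := fun k p =>
    (h1 k ‖p‖).isAmp ⟨p, le_rfl⟩
  have e0 : (fun p => osc (a p)) = fun p => ∫ s, ek s * regOps (regList d N) (a p) s := by
    funext p; rw [osc_eq_regInt (hA p)]; rfl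
  have hcont := contDiff_regOps (regList d N) hs
  have hdd : ∀ k p s, dd (bP k) (fun p => ek s * regOps (regList d N) (a p) s) p =
      ek s * regOps (regList d N) (fun s => dd (bP k) (fun p => a p s) p) s := by
    intro k p s
    have hc : ContDiff ℝ ∞ fun p => regOps (regList d N) (a p) s :=
      hcont.comp (contDiff_prodMk_left s)
    rw [dd_const_mul (ek s) hc, ← dd_regOps _ hs]
  have hcont' : ∀ k p, Continuous
      (regOps (regList d N) (fun s => dd (bP k) (fun p => a p s) p)) := fun k p =>
    (contDiff_regOps (regList d N) (contDiff_uncurry_dd_left hs (bP k))).continuous.comp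
      (Continuous.prodMk_right p)
  have key : ∀ p₀, DifferentiableAt ℝ
      (fun p => ∫ s, ek s * regOps (regList d N) (a p) s) p₀ ∧
      ∀ k, dd (bP k) (fun p => ∫ s, ek s * regOps (regList d N) (a p) s) p₀ =
        ∫ s, dd (bP k) (fun p => ek s * regOps (regList d N) (a p) s) p₀ := by
    intro p₀
    have hU : {p : P | ‖p‖ ≤ ‖p₀‖ + 1} ∈ 𝓝 p₀ := by
      refine Filter.mem_of_superset ((isOpen_lt continuous_norm continuous_const).mem_nhds
        (show ‖p₀‖ < ‖p₀‖ + 1 by linarith)) fun p hp => ?_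
      exact (show ‖p‖ < ‖p₀‖ + 1 from hp).le
    obtain ⟨C, hC⟩ := regOps_integrable_bound (c := fun _ => 1) (fun _ => zero_le_one)
      ((h0 (‖p₀‖ + 1)).congr (fun _ s => (one_mul _).symm) fun _ _ => rfl)
    choose D hD using fun k => regOps_integrable_bound (c := fun _ => 1) (fun _ => zero_le_one)
      ((h1 k (‖p₀‖ + 1)).congr (fun _ s => (one_mul _).symm) fun _ _ => rfl)
    have hnn : ∀ s : Osp d, 0 ≤ (wS (2 * d + 1) s)⁻¹ := fun s => inv_nonneg.2 (wS_pos _ s).le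
    refine hasFDerivAt_integral_of_basis bP hU (fun s => ?_) (fun p => ?_) (fun k => ?_)
      (g := fun s => (|C| + ∑ k, |D k|) * (wS (2 * d + 1) s)⁻¹) (integrable_inv_wS.const_mul _)
      (fun s => ?_) (fun k s p hp => ?_)
    · exact diff_of_smooth (contDiff_const.mul (hcont.comp (contDiff_prodMk_left s)))
    · exact (contDiff_ek.continuous.mul
        (hcont.continuous.comp (Continuous.prodMk_right p))).aestronglyMeasurable
    · simp only [hdd]
      exact (contDiff_ek.continuous.mul (hcont' k p₀)).aestronglyMeasurable
    · rw [norm_mul, norm_ek, one_mul]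
      refine (hC ⟨p₀, by linarith⟩ s).trans (mul_le_mul_of_nonneg_right ?_ (hnn s))
      have : 0 ≤ ∑ k, |D k| := Finset.sum_nonneg fun k _ => abs_nonneg _
      linarith [le_abs_self C]
    · rw [hdd, norm_mul, norm_ek, one_mul]
      refine (hD k ⟨p, hp⟩ s).trans (mul_le_mul_of_nonneg_right ?_ (hnn s))
      have : |D k| ≤ ∑ k, |D k| :=
        Finset.single_le_sum (f := fun k => |D k|) (fun k _ => abs_nonneg _) (Finset.mem_univ k)
      linarith [le_abs_self (D k), abs_nonneg C]
  rw [e0]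
  refine ⟨fun p => (key p).1, fun k p => ?_⟩
  rw [(key p).2 k, osc_eq_regInt (hA' k p), regInt]
  simp only [hdd]

end Osc

/-! ### Fourier inversion on phase space -/

section Fourier

open MeasureTheory FourierTransform

variable {d : ℕ}

/-- The Fourier transform `∫ e^{-i x · p} φ(x) dx`. -/
def ft (φ : Config d → ℂ) (p : Config d) : ℂ :=
  ∫ x, Complex.exp (-Complex.I * (inner ℝ x p : ℝ)) * φ x

lemma ft_eq (φ : Config d → ℂ) (p : Config d) : ft φ p = 𝓕 φ ((2 * Real.pi)⁻¹ • p) := by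
  rw [Real.fourier_eq', ft]
  congr 1; funext x
  rw [inner_smul_right, smul_eq_mul]
  congr 2
  have : (Real.pi : ℂ) ≠ 0 := by exact_mod_cast Real.pi_ne_zero
  push_cast
  field_simp

lemma integral_comp_two_pi_inv (f : Config d → ℂ) :
    ∫ p, f ((2 * Real.pi)⁻¹ • p) = ((2 * Real.pi) ^ d : ℝ) * ∫ p, f p := by
  rw [Measure.integral_comp_inv_smul_of_nonneg volume f (R := 2 * Real.pi) (by positivity)]
  simp

lemma integral_ft (φ : 𝓢(Config d, ℂ)) : ∫ p, ft φ p = ((2 * Real.pi) ^ d : ℝ) * φ 0 := by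
  simp_rw [ft_eq]
  rw [integral_comp_two_pi_inv]
  congr 1
  have h : 𝓕⁻ (𝓕 (φ : Config d → ℂ)) 0 = φ 0 := by
    rw [← SchwartzMap.fourier_coe, ← SchwartzMap.fourierInv_coe, FourierTransform.fourierInv_fourier_eq]
  rw [Real.fourierInv_eq'] at h
  simpa using h

lemma inv_pow_rescale (C q : ℝ) {c : ℝ} (hc : c ≠ 0) (N : ℕ) :
    C * (q ^ N)⁻¹ = C * c ^ N * ((c * q) ^ N)⁻¹ := by
  rw [mul_pow, mul_inv, mul_assoc, mul_inv_cancel_left₀ (pow_ne_zero N hc)]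

lemma exists_ft_decay (φ : 𝓢(Config d, ℂ)) (N : ℕ) :
    ∃ C : ℝ, ∀ p, ‖ft φ p‖ ≤ C * ((1 + ‖p‖) ^ N)⁻¹ := by
  obtain ⟨C, hC⟩ := exists_schwartz_decay (𝓕 φ) N
  refine ⟨|C| * (2 * Real.pi) ^ N, fun p => ?_⟩
  have hpi : 1 ≤ 2 * Real.pi := by linarith [Real.pi_gt_three]
  have h1 : 1 + ‖p‖ ≤ 2 * Real.pi * (1 + ‖(2 * Real.pi)⁻¹ • p‖) := by
    rw [norm_smul, Real.norm_eq_abs, abs_of_nonneg (by positivity), mul_add, ← mul_assoc,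
      mul_inv_cancel₀ (by positivity)]
    linarith
  rw [ft_eq, ← SchwartzMap.fourier_coe]
  refine (hC _).trans ?_
  calc C * ((1 + ‖(2 * Real.pi)⁻¹ • p‖) ^ N)⁻¹
      ≤ |C| * ((1 + ‖(2 * Real.pi)⁻¹ • p‖) ^ N)⁻¹ :=
        mul_le_mul_of_nonneg_right (le_abs_self C) (by positivity)
    _ = |C| * (2 * Real.pi) ^ N * ((2 * Real.pi * (1 + ‖(2 * Real.pi)⁻¹ • p‖)) ^ N)⁻¹ :=
        inv_pow_rescale _ _ (by positivity) N
    _ ≤ _ := by gcongr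

lemma continuous_ft (φ : 𝓢(Config d, ℂ)) : Continuous (ft φ) := by
  have : ft φ = fun p => 𝓕 φ ((2 * Real.pi)⁻¹ • p) := by
    funext p; rw [ft_eq, ← SchwartzMap.fourier_coe]
  rw [this]
  exact (𝓕 φ).continuous.comp (continuous_const_smul _)

lemma ft_scaled (φ : Config d → ℂ) {δ : ℝ} (hδ : 0 < δ) (p : Config d) :
    ft (fun x => φ (δ • x)) p = ((δ ^ d)⁻¹ : ℝ) * ft φ (δ⁻¹ • p) := by
  have h := Measure.integral_comp_smul_of_nonneg (volume : Measure (Config d))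
    (fun x => Complex.exp (-Complex.I * (inner ℝ x (δ⁻¹ • p) : ℝ)) * φ x) δ (hR := hδ.le)
  simp only [finrank_euclideanSpace_fin] at h
  rw [ft, ft, ← Complex.real_smul, ← h]
  congr 1; funext x
  rw [inner_smul_left, inner_smul_right]
  congr 3
  simp [hδ.ne']

lemma finrank_phase : Module.finrank ℝ (Phase d) = 2 * d := by
  rw [Module.finrank_prod]; simp; ring

lemma integrable_phase_weight : Integrable (fun v : Phase d => ((1 + ‖v‖) ^ (2 * d + 1))⁻¹) := by
  have h : Integrable (fun v : Phase d => (1 + ‖v‖) ^ (-((2 * d + 1 : ℕ) : ℝ))) :=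
    integrable_one_add_norm (by rw [finrank_phase]; push_cast; linarith)
  refine h.congr (Filter.Eventually.of_forall fun v => ?_)
  simp only
  rw [Real.rpow_neg (by positivity), Real.rpow_natCast]

lemma ek_eq_mul (s : Osp d) : ek s = Complex.exp (-Complex.I * (inner ℝ s.1.1 s.2.1 : ℝ)) *
    Complex.exp (-Complex.I * (inner ℝ s.1.2 s.2.2 : ℝ)) := by
  rw [ek, pairing, ← Complex.exp_add]
  congr 1; push_cast; ring

/-- A tensor product of bump functions. -/
lemma exists_tensor_cutoff (d : ℕ) : ∃ (φ : 𝓢(Config d, ℂ)) (χ : 𝓢(Phase d, ℂ)) (ψ : 𝓢(Osp d, ℂ)),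
    φ 0 = 1 ∧ χ 0 = 1 ∧ ∀ s, ψ s = φ s.1.1 * φ s.1.2 * χ s.2 := by
  let b : ContDiffBump (0 : Config d) := ⟨1, 2, by norm_num, by norm_num⟩
  let c : ContDiffBump (0 : Phase d) := ⟨1, 2, by norm_num, by norm_num⟩
  have hb : HasCompactSupport (fun v => (b v : ℂ)) :=
    b.hasCompactSupport.comp_left (g := fun t : ℝ => (t : ℂ)) (by simp)
  have hbs : ContDiff ℝ ∞ (fun v => (b v : ℂ)) := Complex.ofRealCLM.contDiff.comp b.contDiff
  have hc : HasCompactSupport (fun v => (c v : ℂ)) :=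
    c.hasCompactSupport.comp_left (g := fun t : ℝ => (t : ℂ)) (by simp)
  have hcs : ContDiff ℝ ∞ (fun v => (c v : ℂ)) := Complex.ofRealCLM.contDiff.comp c.contDiff
  have hp : HasCompactSupport (fun s : Osp d => (b s.1.1 : ℂ) * b s.1.2 * c s.2) := by
    refine HasCompactSupport.of_support_subset_isCompact
      (K := (tsupport (fun v => (b v : ℂ)) ×ˢ tsupport (fun v => (b v : ℂ))) ×ˢ
        tsupport (fun v => (c v : ℂ))) ((hb.isCompact.prod hb.isCompact).prod hc.isCompact) ?_
    intro s hs
    rw [Function.mem_support, mul_ne_zero_iff, mul_ne_zero_iff] at hs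
    exact ⟨⟨subset_tsupport _ hs.1.1, subset_tsupport _ hs.1.2⟩, subset_tsupport _ hs.2⟩
  have hps : ContDiff ℝ ∞ (fun s : Osp d => (b s.1.1 : ℂ) * b s.1.2 * c s.2) :=
    ((hbs.comp (contDiff_fst.comp contDiff_fst)).mul
      (hbs.comp (contDiff_snd.comp contDiff_fst))).mul (hcs.comp contDiff_snd)
  refine ⟨hb.toSchwartzMap hbs, hc.toSchwartzMap hcs, hp.toSchwartzMap hps, ?_, ?_, fun s => rfl⟩
  · change ((b 0 : ℝ) : ℂ) = 1
    rw [b.one_of_mem_closedBall (by simp [b.rIn_pos.le])]; simp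
  · change ((c 0 : ℝ) : ℂ) = 1
    rw [c.one_of_mem_closedBall (by simp [c.rIn_pos.le])]; simp

/-- Fourier inversion for oscillatory integrals: an amplitude that depends on `θ` only
is evaluated at `θ = 0`. -/
lemma osc_momentum {H : Phase d → ℂ} {N : ℕ} (hH : IsAmp N (fun s : Osp d => H s.2)) :
    osc (fun s : Osp d => H s.2) = ((2 * Real.pi) ^ (2 * d) : ℝ) * H 0 := by
  obtain ⟨φ, χ, ψ, hφ, hχ, hψ⟩ := exists_tensor_cutoff d
  have hψ0 : ψ 0 = 1 := by simp [hψ, hφ, hχ]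
  have hHc : Continuous H := by
    have : H = (fun s : Osp d => H s.2) ∘ fun θ => (0, θ) := rfl
    rw [this]
    exact hH.smooth.continuous.comp (Continuous.prodMk_right 0)
  have hlim := tendsto_cutoff_osc hH ψ hψ0
  -- the substitution `θ ↦ δ θ` turns the transform of the cut-off in `w` into an
  -- approximation of the Dirac measure
  have hstep : ∀ δ ∈ Set.Ioc (0 : ℝ) 1, ∫ s, ek s * (ψ (δ • s) * H s.2) =
      ∫ θ : Phase d, ft φ θ.1 * ft φ θ.2 * (χ (δ • δ • θ) * H (δ • θ)) := by
    intro δ hδ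
    have hint := integrable_ek_mul (rapid_cutoff_mul hH ψ hδ).integrable
    rw [Measure.volume_eq_prod, integral_prod_symm _ hint]
    have hinner : ∀ θ : Phase d, ∫ w : Phase d, ek (w, θ) * (ψ (δ • (w, θ)) * H θ) =
        ((δ ^ (2 * d))⁻¹ : ℝ) * (ft φ (δ⁻¹ • θ).1 * ft φ (δ⁻¹ • θ).2 *
          (χ (δ • δ • (δ⁻¹ • θ)) * H (δ • (δ⁻¹ • θ)))) := by
      intro θ
      have e1 : ∀ w : Phase d, ek (w, θ) * (ψ (δ • (w, θ)) * H θ) =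
          (χ (δ • θ) * H θ) * ((Complex.exp (-Complex.I * (inner ℝ w.1 θ.1 : ℝ)) * φ (δ • w.1)) *
            (Complex.exp (-Complex.I * (inner ℝ w.2 θ.2 : ℝ)) * φ (δ • w.2))) := by
        intro w
        rw [ek_eq_mul, hψ]
        simp only [Prod.smul_mk, Prod.smul_fst, Prod.smul_snd]
        ring
      simp_rw [e1]
      rw [integral_const_mul, Measure.volume_eq_prod,
        integral_prod_mul (fun y : Config d => Complex.exp (-Complex.I * (inner ℝ y θ.1 : ℝ)) *
          φ (δ • y)) (fun z : Config d => Complex.exp (-Complex.I * (inner ℝ z θ.2 : ℝ)) *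
          φ (δ • z))]
      have e2 := ft_scaled φ hδ.1 θ.1
      have e3 := ft_scaled φ hδ.1 θ.2
      rw [ft] at e2 e3
      rw [e2, e3, smul_inv_smul₀ hδ.1.ne']
      simp only [Prod.smul_fst, Prod.smul_snd, two_mul, pow_add, mul_inv]
      push_cast
      ring
    simp only [hinner]
    rw [integral_const_mul, Measure.integral_comp_inv_smul_of_nonneg volume
      (fun θ : Phase d => ft φ θ.1 * ft φ θ.2 * (χ (δ • δ • θ) * H (δ • θ))) hδ.1.le, finrank_phase,
      Complex.real_smul, ← mul_assoc, ← Complex.ofReal_mul,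
      inv_mul_cancel₀ (pow_pos hδ.1 _).ne']
    simp
  obtain ⟨A, hA⟩ := hH.bound_zero
  obtain ⟨C, hC⟩ := exists_ft_decay φ (N + (2 * d + 1))
  obtain ⟨D, hD⟩ := exists_schwartz_decay χ 0
  have hlim2 : Filter.Tendsto
      (fun δ : ℝ => ∫ θ : Phase d, ft φ θ.1 * ft φ θ.2 * (χ (δ • δ • θ) * H (δ • θ))) (𝓝[>] 0)
      (𝓝 (∫ θ : Phase d, ft φ θ.1 * ft φ θ.2 * (χ ((0 : ℝ) • (0 : ℝ) • θ) * H ((0 : ℝ) • θ)))) := by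
    refine tendsto_integral_filter_of_dominated_convergence
      (fun θ => (|C| * |C| * (|D| * |A|)) * ((1 + ‖θ‖) ^ (2 * d + 1))⁻¹) ?_ ?_
      (integrable_phase_weight.const_mul _) ?_
    · refine Filter.Eventually.of_forall fun δ => Continuous.aestronglyMeasurable ?_
      have h1 := continuous_ft φ
      have h2 := χ.continuous
      fun_prop
    · filter_upwards [eventually_Ioc] with δ hδ
      refine Filter.Eventually.of_forall fun θ => ?_
      have b1 : ∀ p : Config d, ‖ft φ p‖ ≤ |C| * ((1 + ‖p‖) ^ (N + (2 * d + 1)))⁻¹ := fun p =>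
        (hC p).trans (mul_le_mul_of_nonneg_right (le_abs_self C) (by positivity))
      have b2 : ‖χ (δ • δ • θ)‖ ≤ |D| := by
        refine (hD _).trans ?_
        simpa using le_abs_self D
      have b3 : ‖H (δ • θ)‖ ≤ |A| * (1 + ‖θ‖) ^ N := by
        have h1 := hA () ((0, δ • θ) : Osp d)
        refine h1.trans ?_
        have h2 : wS N ((0, δ • θ) : Osp d) ≤ (1 + ‖θ‖) ^ N := by
          simp only [wS, norm_zero, add_zero, one_mul]
          refine pow_le_pow_left₀ (by positivity) ?_ N
          rw [norm_smul, Real.norm_eq_abs, abs_of_pos hδ.1]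
          nlinarith [norm_nonneg θ, hδ.2]
        exact (mul_le_mul_of_nonneg_right (le_abs_self A) (wS_pos N _).le).trans
          (mul_le_mul_of_nonneg_left h2 (abs_nonneg A))
      have b4 : (1 + ‖θ‖) ≤ (1 + ‖θ.1‖) * (1 + ‖θ.2‖) := by
        rcases max_cases ‖θ.1‖ ‖θ.2‖ with h | h <;> rw [Prod.norm_def, h.1] <;>
          nlinarith [norm_nonneg θ.1, norm_nonneg θ.2]
      have b5 : ((1 + ‖θ.1‖) ^ (N + (2 * d + 1)))⁻¹ * ((1 + ‖θ.2‖) ^ (N + (2 * d + 1)))⁻¹ ≤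
          ((1 + ‖θ‖) ^ (N + (2 * d + 1)))⁻¹ := by
        rw [← mul_inv, ← mul_pow]
        gcongr
      rw [norm_mul, norm_mul, norm_mul]
      calc _ ≤ (|C| * ((1 + ‖θ.1‖) ^ (N + (2 * d + 1)))⁻¹) *
            (|C| * ((1 + ‖θ.2‖) ^ (N + (2 * d + 1)))⁻¹) * (|D| * (|A| * (1 + ‖θ‖) ^ N)) := by
            gcongr
            · exact b1 _
            · exact b1 _
        _ = |C| * |C| * (|D| * |A|) * ((((1 + ‖θ.1‖) ^ (N + (2 * d + 1)))⁻¹ *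
            ((1 + ‖θ.2‖) ^ (N + (2 * d + 1)))⁻¹) * (1 + ‖θ‖) ^ N) := by ring
        _ ≤ |C| * |C| * (|D| * |A|) * (((1 + ‖θ‖) ^ (N + (2 * d + 1)))⁻¹ * (1 + ‖θ‖) ^ N) := by
            gcongr
        _ = _ := by
            rw [pow_add]
            have : (1 + ‖θ‖) ^ N ≠ 0 := by positivity
            field_simp
    · refine Filter.Eventually.of_forall fun θ => ?_
      have h2 := χ.continuous
      have hc : Continuous fun δ : ℝ =>
          ft φ θ.1 * ft φ θ.2 * (χ (δ • δ • θ) * H (δ • θ)) := by fun_prop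
      exact (hc.tendsto 0).mono_left nhdsWithin_le_nhds
  refine tendsto_nhds_unique (hlim.congr' ?_) (hlim2.trans (le_of_eq ?_))
  · filter_upwards [eventually_Ioc] with δ hδ
    exact hstep δ hδ
  · congr 1
    simp only [zero_smul, hχ, one_mul]
    rw [integral_mul_const, Measure.volume_eq_prod, integral_prod_mul (ft φ) (ft φ), integral_ft, hφ]
    push_cast
    ring

/-- The symplectic Fourier transform of a Schwartz function is continuous and rapidly
decreasing. -/
lemma symplecticFourier_schwartz (F : 𝓢(Phase d, ℂ)) :
    Continuous (symplecticFourier F) ∧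
      ∃ C : ℝ, ∀ Y, ‖symplecticFourier F Y‖ ≤ C * ((1 + ‖Y‖) ^ (2 * d + 1))⁻¹ := by
  let E := WithLp 2 (Config d × Config d)
  let F' : 𝓢(E, ℂ) := SchwartzMap.compCLMOfContinuousLinearEquiv ℝ
    (WithLp.prodContinuousLinearEquiv 2 ℝ (Config d) (Config d)) F
  let J : Phase d → E := fun Y => WithLp.toLp 2 (Y.2, -Y.1)
  have hJ : Continuous J :=
    (WithLp.prodContinuousLinearEquiv 2 ℝ (Config d) (Config d)).symm.continuous.comp
      (continuous_snd.prodMk continuous_fst.neg)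
  have key : ∀ Y, symplecticFourier F Y =
      (((2 * Real.pi) ^ d)⁻¹ : ℝ) * 𝓕⁻ F' ((2 * Real.pi)⁻¹ • J Y) := by
    intro Y
    rw [symplecticFourier, SchwartzMap.fourierInv_coe, Real.fourierInv_eq']
    congr 1
    rw [← (WithLp.volume_preserving_toLp (Config d) (Config d)).integral_comp
      (MeasurableEquiv.toLp 2 (Config d × Config d)).measurableEmbedding]
    congr 1; funext Y'
    rw [inner_smul_right, WithLp.prod_inner_apply, smul_eq_mul]
    have hpi : (Real.pi : ℂ) ≠ 0 := by exact_mod_cast Real.pi_ne_zero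
    have h1 : symplecticForm Y Y' = inner ℝ Y'.1 Y.2 + inner ℝ Y'.2 (-Y.1) := by
      rw [symplecticForm, inner_neg_right, real_inner_comm, real_inner_comm Y'.2]
      ring
    rw [h1]
    congr 2
    simp only [J]
    push_cast
    field_simp
  have hnorm : ∀ Y, ‖Y‖ ≤ ‖J Y‖ := by
    intro Y
    have h := WithLp.prod_norm_sq_eq_of_L2 (J Y)
    have h : ‖J Y‖ ^ 2 = ‖Y.2‖ ^ 2 + ‖Y.1‖ ^ 2 := by
      rw [h]; simp [J]
    have h0 := norm_nonneg (J Y)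
    rcases max_cases ‖Y.1‖ ‖Y.2‖ with h' | h' <;> rw [Prod.norm_def, h'.1] <;>
      refine le_of_sq_le_sq ?_ h0 <;> rw [h] <;>
      nlinarith [sq_nonneg ‖Y.1‖, sq_nonneg ‖Y.2‖]
  refine ⟨?_, ?_⟩
  · rw [show symplecticFourier F = _ from funext key]
    exact continuous_const.mul ((𝓕⁻ F').continuous.comp ((continuous_const_smul _).comp hJ))
  · obtain ⟨C, hC⟩ := exists_schwartz_decay (𝓕⁻ F') (2 * d + 1)
    refine ⟨(((2 * Real.pi) ^ d)⁻¹) * (|C| * (2 * Real.pi) ^ (2 * d + 1)), fun Y => ?_⟩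
    have hpi : 1 ≤ 2 * Real.pi := by linarith [Real.pi_gt_three]
    have h1 : 1 + ‖Y‖ ≤ 2 * Real.pi * (1 + ‖(2 * Real.pi)⁻¹ • J Y‖) := by
      rw [norm_smul, Real.norm_eq_abs, abs_of_nonneg (by positivity), mul_add, ← mul_assoc,
        mul_inv_cancel₀ (by positivity)]
      linarith [hnorm Y]
    rw [key, norm_mul, Complex.norm_real, Real.norm_eq_abs, abs_of_nonneg (by positivity), mul_assoc]
    refine mul_le_mul_of_nonneg_left ?_ (by positivity)
    refine (hC _).trans ?_
    calc C * ((1 + ‖(2 * Real.pi)⁻¹ • J Y‖) ^ (2 * d + 1))⁻¹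
        ≤ |C| * ((1 + ‖(2 * Real.pi)⁻¹ • J Y‖) ^ (2 * d + 1))⁻¹ :=
          mul_le_mul_of_nonneg_right (le_abs_self C) (by positivity)
      _ = |C| * (2 * Real.pi) ^ (2 * d + 1) *
          ((2 * Real.pi * (1 + ‖(2 * Real.pi)⁻¹ • J Y‖)) ^ (2 * d + 1))⁻¹ :=
          inv_pow_rescale _ _ (by positivity) _
      _ ≤ _ := by gcongr

end Fourier

/-! ### The product as an integral over amplitudes -/

section Kernel

open MeasureTheory FourierTransform

variable {d : ℕ}

/-- The exchange `((y, z), (η, ζ)) ↦ ((y, η), (z, ζ))`. -/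
def exchange (s : Osp d) : Osp d := ((s.1.1, s.2.1), (s.1.2, s.2.2))

lemma continuous_exchange : Continuous (exchange (d := d)) := by unfold exchange; fun_prop

lemma measurePreserving_exchange : MeasurePreserving (exchange (d := d)) := by
  have hid : MeasurePreserving (id : Config d → Config d) := MeasurePreserving.id _
  have h1 : MeasurePreserving
      (MeasurableEquiv.prodAssoc : (Config d × Config d) × Phase d ≃ᵐ _) :=
    volume_preserving_prodAssoc
  have h2 : MeasurePreserving
      (MeasurableEquiv.prodAssoc : (Config d × Config d) × Config d ≃ᵐ _) :=
    volume_preserving_prodAssoc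
  have h3 : MeasurePreserving (Prod.swap : Config d × Config d → _) := Measure.measurePreserving_swap
  have h4 := (h1.symm _).comp ((hid.prod (h2.comp ((h3.prod hid).comp (h2.symm _)))).comp h1)
  exact h4

lemma exchange_exchange (s : Osp d) : exchange (exchange s) = s := rfl

lemma integral_exchange (T : Osp d → ℂ) : ∫ s, T (exchange s) = ∫ s, T s := by
  let e : Osp d ≃ᵐ Osp d :=
    { toFun := exchange, invFun := exchange, left_inv := exchange_exchange,
      right_inv := exchange_exchange
      measurable_toFun := continuous_exchange.measurable
      measurable_invFun := continuous_exchange.measurable }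
  exact (measurePreserving_exchange (d := d)).integral_comp e.measurableEmbedding T

lemma integrable_config_weight :
    Integrable (fun v : Config d => ((1 + ‖v‖) ^ (2 * d + 1))⁻¹) := by
  have h : Integrable (fun v : Config d => (1 + ‖v‖) ^ (-((2 * d + 1 : ℕ) : ℝ))) :=
    integrable_one_add_norm (by
      rw [finrank_euclideanSpace_fin]; push_cast; linarith [(Nat.cast_nonneg d : (0 : ℝ) ≤ d)])
  refine h.congr (Filter.Eventually.of_forall fun v => ?_)
  simp only
  rw [Real.rpow_neg (by positivity), Real.rpow_natCast]

lemma inv_weight_snd_le (C : ℝ) (N : ℕ) (p q : Config d) :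
    C * ((1 + ‖(p, q)‖) ^ N)⁻¹ ≤ |C| * ((1 + ‖q‖) ^ N)⁻¹ := by
  have hq : ‖q‖ ≤ ‖(p, q)‖ := norm_snd_le (p, q)
  calc C * ((1 + ‖(p, q)‖) ^ N)⁻¹ ≤ |C| * ((1 + ‖(p, q)‖) ^ N)⁻¹ :=
        mul_le_mul_of_nonneg_right (le_abs_self C) (by positivity)
    _ ≤ _ := by gcongr

lemma norm_exp_neg_I_mul (t : ℝ) : ‖Complex.exp (-Complex.I * t)‖ = 1 := by
  have : -Complex.I * t = ((-t : ℝ) : ℂ) * Complex.I := by push_cast; ring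
  rw [this, Complex.norm_exp_ofReal_mul_I]

lemma norm_exp_I_mul (t : ℝ) : ‖Complex.exp (Complex.I * t)‖ = 1 := by
  rw [mul_comm, Complex.norm_exp_ofReal_mul_I]

/-- The partial Fourier transform in `η` of the symplectic Fourier transform is the partial
Fourier transform in the second variable. -/
lemma integral_exp_symplecticFourier (F : 𝓢(Phase d, ℂ)) (p y : Config d) :
    ∫ η, Complex.exp (-Complex.I * (inner ℝ p η : ℝ)) * symplecticFourier F (y, η) =
      ∫ η, Complex.exp (-Complex.I * (inner ℝ y η : ℝ)) * F (p, η) := by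
  obtain ⟨C, hC⟩ := exists_schwartz_decay F (2 * d + 1)
  obtain ⟨hsc, C', hC'⟩ := symplecticFourier_schwartz F
  set K : Config d → ℂ := fun q => ∫ η, Complex.exp (-Complex.I * (inner ℝ y η : ℝ)) * F (q, η)
    with hK
  have hKc : Continuous K := by
    refine continuous_of_dominated (bound := fun η => |C| * ((1 + ‖η‖) ^ (2 * d + 1))⁻¹)
      (fun q => ?_) (fun q => Filter.Eventually.of_forall fun η => ?_)
      (integrable_config_weight.const_mul _) (Filter.Eventually.of_forall fun η => ?_)
    · exact Continuous.aestronglyMeasurable (by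
        have := F.continuous
        fun_prop)
    · rw [norm_mul, norm_exp_neg_I_mul, one_mul]
      exact (hC _).trans (inv_weight_snd_le C _ q η)
    · have := F.continuous
      fun_prop
  have hint : ∀ η : Config d, Integrable fun Y : Phase d =>
      Complex.exp (Complex.I * (symplecticForm (y, η) Y : ℂ)) * F Y := by
    intro η
    refine F.integrable.bdd_mul (c := 1) ?_ ?_
    · refine Continuous.aestronglyMeasurable ?_
      unfold symplecticForm
      fun_prop
    · exact Filter.Eventually.of_forall fun Y => (norm_exp_I_mul _).le
  have hexp : ∀ η q η' : Config d, Complex.exp (Complex.I * (symplecticForm (y, η) (q, η') : ℂ)) =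
      Complex.exp (Complex.I * (inner ℝ η q : ℝ)) *
        Complex.exp (-Complex.I * (inner ℝ y η' : ℝ)) := by
    intro η q η'
    rw [← Complex.exp_add, symplecticForm]
    congr 1; push_cast; ring
  have hKi : Integrable K := by
    have h := (hint 0).integral_prod_left
    refine h.congr (Filter.Eventually.of_forall fun q => ?_)
    simp only [hexp, hK, inner_zero_left, Complex.ofReal_zero, mul_zero, Complex.exp_zero, one_mul]
  have hsF : ∀ η, symplecticFourier F (y, η) =
      (((2 * Real.pi) ^ d)⁻¹ : ℝ) * 𝓕⁻ K ((2 * Real.pi)⁻¹ • η) := by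
    intro η
    rw [symplecticFourier, Measure.volume_eq_prod, integral_prod _ (hint η), Real.fourierInv_eq']
    congr 1
    refine integral_congr_ae (Filter.Eventually.of_forall fun q => ?_)
    simp only [hexp, hK, mul_assoc, smul_eq_mul]
    rw [integral_const_mul]
    congr 2
    rw [inner_smul_right, real_inner_comm]
    have : (Real.pi : ℂ) ≠ 0 := by exact_mod_cast Real.pi_ne_zero
    push_cast
    field_simp
  have hFK : 𝓕⁻ K = fun η => ((2 * Real.pi) ^ d : ℝ) * symplecticFourier F (y, (2 * Real.pi) • η) := by
    funext η
    rw [hsF, smul_smul, inv_mul_cancel₀ (by positivity), one_smul, ← mul_assoc,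
      ← Complex.ofReal_mul, mul_inv_cancel₀ (by positivity)]
    simp
  have hFi : Integrable (𝓕⁻ K) := by
    rw [hFK]
    have hi : Integrable fun η => symplecticFourier F (y, η) :=
      (integrable_config_weight.const_mul |C'|).mono'
        (hsc.comp (Continuous.prodMk_right y)).aestronglyMeasurable
        (Filter.Eventually.of_forall fun η => (hC' _).trans (inv_weight_snd_le C' _ y η))
    exact (hi.comp_smul (R := 2 * Real.pi) (by positivity)).const_mul _
  have hinv : 𝓕 (𝓕⁻ K) p = K p := by
    refine hKi.fourier_fourierInv_eq ?_ hKc.continuousAt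
    have : 𝓕 K = fun η => 𝓕⁻ K (-η) := by
      funext η; rw [Real.fourierInv_eq_fourier_neg, neg_neg]
    rw [this]
    exact hFi.comp_neg
  change _ = K p
  rw [← hinv, Real.fourier_eq']
  have h2 := integral_comp_two_pi_inv (d := d) (fun η =>
    Complex.exp (-Complex.I * (inner ℝ p ((2 * Real.pi) • η) : ℝ)) *
      ((((2 * Real.pi) ^ d)⁻¹ : ℝ) * 𝓕⁻ K η))
  simp only [smul_smul, mul_inv_cancel₀ Real.two_pi_pos.ne', one_smul] at h2
  simp_rw [hsF]
  rw [h2, ← integral_const_mul]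
  refine integral_congr_ae (Filter.Eventually.of_forall fun η => ?_)
  simp only [smul_eq_mul]
  have h3 : ((2 * Real.pi : ℝ) : ℂ) ^ d ≠ 0 :=
    pow_ne_zero _ (by exact_mod_cast Real.two_pi_pos.ne')
  rw [inner_smul_right, real_inner_comm]
  push_cast at h3 ⊢
  have h4 : ∀ a b c : ℂ, a = b →
      (2 * (Real.pi : ℂ)) ^ d * (a * (((2 * (Real.pi : ℂ)) ^ d)⁻¹ * c)) = b * c := by
    intro a b c hab
    rw [hab, mul_left_comm, mul_inv_cancel_left₀ h3]
  apply h4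
  congr 1
  ring

/-- The amplitude of the magnetic Weyl product: after the partial Fourier transforms the product is
the integral of `ek` times this function of `((y, z), (η, ζ))`. -/
def kernelAmp (ε lam : ℝ) (B : Config d → Fin d → Fin d → ℝ) (F G : Phase d → ℂ) (X : Phase d)
    (s : Osp d) : ℂ :=
  Complex.exp (-Complex.I * ((lam * scaledFlux ε B X.1 s.1.1 s.1.2 : ℝ) : ℂ)) *
    (F (X.1 - (ε / 2) • s.1.2, X.2 + s.2.1) * G (X.1 + (ε / 2) • s.1.1, X.2 + s.2.2))

lemma integral_exp_shift (F : Phase d → ℂ) (p y ξ : Config d) :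
    Complex.exp (Complex.I * (inner ℝ ξ y : ℝ)) *
      ∫ η, Complex.exp (-Complex.I * (inner ℝ y η : ℝ)) * F (p, η) =
    ∫ η, Complex.exp (-Complex.I * (inner ℝ y η : ℝ)) * F (p, ξ + η) := by
  rw [← integral_const_mul, ← integral_add_left_eq_self _ ξ]
  refine integral_congr_ae (Filter.Eventually.of_forall fun η => ?_)
  simp only
  rw [← mul_assoc, ← Complex.exp_add, inner_add_right, real_inner_comm]
  congr 2
  push_cast; ring

lemma continuous_twister (ε lam : ℝ) {B : Config d → Fin d → Fin d → ℝ} {x : Config d}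
    (hγ : Continuous fun w : Phase d => scaledFlux ε B x w.1 w.2) :
    Continuous fun t : Osp d => twister ε lam B x t.1 t.2 := by
  have h0 : Continuous fun t : Osp d => (t.1.1, t.2.1) := by fun_prop
  have h1 : Continuous fun t : Osp d => symplecticForm t.1 t.2 := by
    unfold symplecticForm; fun_prop
  unfold twister
  generalize scaledFlux ε B x = γ at hγ ⊢
  exact (continuous_const.mul h1).sub (continuous_const.mul (hγ.comp h0))

/-- Partial Fourier transforms in the momenta of `Y` and `Z` undo one half of the symplectic Fourier
transforms. The terms `ε σ(Y, Z) / 2` of the twister shift the positions at which `F` and `G` are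
evaluated, and `ξ · y`, `ξ · z` shift the momenta. -/
lemma weylIntegral_eq (ε lam : ℝ) (B : Config d → Fin d → Fin d → ℝ) (F G : 𝓢(Phase d, ℂ))
    (X : Phase d) (hγ : Continuous fun w : Phase d => scaledFlux ε B X.1 w.1 w.2)
    (hi : Integrable fun s => ek s * kernelAmp ε lam B F G X s) :
    weylIntegral ε lam B F G X =
      (((2 * Real.pi) ^ (2 * d))⁻¹ : ℝ) * ∫ s, ek s * kernelAmp ε lam B F G X s := by
  rw [weylIntegral]
  congr 1
  obtain ⟨hFc, CF, hCF⟩ := symplecticFourier_schwartz F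
  obtain ⟨hGc, CG, hCG⟩ := symplecticFourier_schwartz G
  have hFi : Integrable (symplecticFourier F) := (integrable_phase_weight.const_mul CF).mono'
    hFc.aestronglyMeasurable (Filter.Eventually.of_forall hCF)
  have hGi : Integrable (symplecticFourier G) := (integrable_phase_weight.const_mul CG).mono'
    hGc.aestronglyMeasurable (Filter.Eventually.of_forall hCG)
  set T : Osp d → ℂ := fun t => Complex.exp (Complex.I * (symplecticForm X (t.1 + t.2) : ℂ)) *
        Complex.exp (Complex.I * (twister ε lam B X.1 t.1 t.2 : ℂ)) *
        symplecticFourier F t.1 * symplecticFourier G t.2 with hT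
  have hTi : Integrable T := by
    have h : Integrable fun t : Osp d => symplecticFourier F t.1 * symplecticFourier G t.2 :=
      hFi.mul_prod hGi
    have hT' : T = fun t => (Complex.exp (Complex.I * (symplecticForm X (t.1 + t.2) : ℂ)) *
        Complex.exp (Complex.I * (twister ε lam B X.1 t.1 t.2 : ℂ))) *
        (symplecticFourier F t.1 * symplecticFourier G t.2) := by
      funext t; simp only [hT, mul_assoc]
    rw [hT']
    refine h.bdd_mul (c := 1) ?_ ?_
    · refine Continuous.aestronglyMeasurable ?_
      have h1 := continuous_twister ε lam hγ
      have h2 : Continuous fun t : Osp d => symplecticForm X (t.1 + t.2) := by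
        unfold symplecticForm; fun_prop
      fun_prop
    · exact Filter.Eventually.of_forall fun t => by
        rw [norm_mul, norm_exp_I_mul, norm_exp_I_mul, one_mul]
  have hTe : Integrable fun s => T (exchange s) :=
    (measurePreserving_exchange (d := d)).integrable_comp_of_integrable hTi
  have e1 : ∫ Y, ∫ Z, T (Y, Z) = ∫ s, T (exchange s) := by
    rw [integral_exchange, Measure.volume_eq_prod (Phase d), integral_prod _ hTi]
  rw [show (∫ Y : Phase d, ∫ Z : Phase d,
      Complex.exp (Complex.I * (symplecticForm X (Y + Z) : ℂ)) *
        Complex.exp (Complex.I * (twister ε lam B X.1 Y Z : ℂ)) *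
        symplecticFourier F Y * symplecticFourier G Z) = ∫ Y, ∫ Z, T (Y, Z) from rfl, e1,
    Measure.volume_eq_prod (Phase d), integral_prod _ hTe, integral_prod _ hi]
  refine integral_congr_ae (Filter.Eventually.of_forall fun w => ?_)
  obtain ⟨y, z⟩ := w
  simp only
  set E := Complex.exp (-Complex.I * ((lam * scaledFlux ε B X.1 y z : ℝ) : ℂ))
  have l1 : ∀ θ : Phase d, T (exchange ((y, z), θ)) =
      (E * (Complex.exp (Complex.I * (inner ℝ X.2 y : ℝ)) *
        Complex.exp (Complex.I * (inner ℝ X.2 z : ℝ)))) *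
      ((Complex.exp (-Complex.I * (inner ℝ (X.1 - (ε / 2) • z) θ.1 : ℝ)) *
          symplecticFourier F (y, θ.1)) *
        (Complex.exp (-Complex.I * (inner ℝ (X.1 + (ε / 2) • y) θ.2 : ℝ)) *
          symplecticFourier G (z, θ.2))) := by
    intro θ
    have : ∀ a b c d' e' f' g' u v : ℂ, a * b = c * (d' * e') * (f' * g') →
        a * b * u * v = c * (d' * e') * (f' * u * (g' * v)) := by
      intro a b c d' e' f' g' u v h; rw [h]; ring
    refine this _ _ _ _ _ _ _ _ _ ?_
    simp only [E, ← Complex.exp_add]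
    congr 1
    simp only [exchange, twister, symplecticForm, Prod.fst_add, Prod.snd_add, inner_add_right,
      inner_sub_left, inner_add_left, inner_smul_left, RCLike.conj_to_real]
    rw [real_inner_comm z θ.1]
    push_cast
    ring
  have l2 : ∀ θ : Phase d, ek ((y, z), θ) * kernelAmp ε lam B F G X ((y, z), θ) =
      E * ((Complex.exp (-Complex.I * (inner ℝ y θ.1 : ℝ)) * F (X.1 - (ε / 2) • z, X.2 + θ.1)) *
        (Complex.exp (-Complex.I * (inner ℝ z θ.2 : ℝ)) * G (X.1 + (ε / 2) • y, X.2 + θ.2))) := by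
    intro θ
    rw [ek_eq_mul, kernelAmp]
    ring
  simp_rw [l1, l2]
  rw [integral_const_mul, integral_const_mul, Measure.volume_eq_prod,
    integral_prod_mul (fun η => Complex.exp (-Complex.I * (inner ℝ (X.1 - (ε / 2) • z) η : ℝ)) *
          symplecticFourier F (y, η))
      (fun ζ => Complex.exp (-Complex.I * (inner ℝ (X.1 + (ε / 2) • y) ζ : ℝ)) *
          symplecticFourier G (z, ζ)),
    integral_prod_mul (fun η => Complex.exp (-Complex.I * (inner ℝ y η : ℝ)) *
        F (X.1 - (ε / 2) • z, X.2 + η))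
      (fun ζ => Complex.exp (-Complex.I * (inner ℝ z ζ : ℝ)) * G (X.1 + (ε / 2) • y, X.2 + ζ)),
    integral_exp_symplecticFourier, integral_exp_symplecticFourier, ← integral_exp_shift,
    ← integral_exp_shift]
  ring

end Kernel

/-! ### Weights and symbol classes -/

section Weights

variable {d : ℕ}

lemma one_le_japanese (ξ : Config d) : 1 ≤ japanese ξ :=
  Real.one_le_sqrt.mpr (by nlinarith [sq_nonneg ‖ξ‖])

lemma japanese_pos (ξ : Config d) : 0 < japanese ξ := zero_lt_one.trans_le (one_le_japanese ξ)

lemma continuous_japanese : Continuous (japanese (d := d)) := by unfold japanese; fun_prop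

lemma japanese_add_le (ξ η : Config d) : japanese (ξ + η) ≤ japanese ξ * (1 + ‖η‖) := by
  unfold japanese
  rw [Real.sqrt_le_left (by positivity), mul_pow, Real.sq_sqrt (by positivity)]
  have h := norm_add_le ξ η
  have h1 : ‖ξ + η‖ ^ 2 ≤ (‖ξ‖ + ‖η‖) ^ 2 := pow_le_pow_left₀ (norm_nonneg _) h 2
  nlinarith [norm_nonneg ξ, norm_nonneg η, mul_nonneg (norm_nonneg η) (sq_nonneg (‖ξ‖ - 1)),
    mul_nonneg (norm_nonneg η) (sq_nonneg ‖ξ‖), mul_nonneg (sq_nonneg ‖η‖) (sq_nonneg ‖ξ‖)]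

/-- Peetre's inequality. -/
lemma japanese_add_rpow_le (m : ℝ) (ξ η : Config d) :
    japanese (ξ + η) ^ m ≤ japanese ξ ^ m * (1 + ‖η‖) ^ |m| := by
  have h1 := one_le_japanese ξ
  have h2 := one_le_japanese (ξ + η)
  have hη := norm_nonneg η
  rcases le_total 0 m with hm | hm
  · rw [abs_of_nonneg hm, ← Real.mul_rpow (by linarith) (by linarith)]
    exact Real.rpow_le_rpow (by linarith) (japanese_add_le ξ η) hm
  · have h := japanese_add_le (ξ + η) (-η)
    rw [add_neg_cancel_right, norm_neg] at h
    rw [abs_of_nonpos hm, Real.rpow_neg (by positivity), ← div_eq_mul_inv,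
      le_div_iff₀ (by positivity), ← Real.mul_rpow (by linarith) (by linarith)]
    exact Real.rpow_le_rpow_of_nonpos (by linarith) h hm

/-- The factor gained by one derivative of a symbol: `1` in `x`, and `⟨ξ⟩^{-ρ}` in `ξ`. -/
def ϖH (ρ : ℝ) : PIdx d → Phase d → ℝ
  | Sum.inl _, _ => 1
  | Sum.inr _, X => japanese X.2 ^ (-ρ)

/-- The weight `⟨ξ⟩^m`. -/
def wH (m : ℝ) (X : Phase d) : ℝ := japanese X.2 ^ m

lemma wH_pos (m : ℝ) (X : Phase d) : 0 < wH m X := Real.rpow_pos_of_pos (japanese_pos _) _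

lemma ϖH_pos (ρ : ℝ) (k : PIdx d) (X : Phase d) : 0 < ϖH ρ k X := by
  cases k
  · exact zero_lt_one
  · exact Real.rpow_pos_of_pos (japanese_pos _) _

lemma japanese_rpow_neg_le_one {ρ : ℝ} (hρ : 0 ≤ ρ) (ξ : Config d) : japanese ξ ^ (-ρ) ≤ 1 :=
  Real.rpow_le_one_of_one_le_of_nonpos (one_le_japanese ξ) (by linarith)

/-- The points `(X, u, (w, θ))`: the product is studied through amplitudes at `u = ε w`. -/
abbrev Big (d : ℕ) : Type := Phase d × (Phase d × Osp d)

/-- Coordinates of `(X, u, (w, θ))`. -/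
abbrev BIdx (d : ℕ) : Type := PIdx d ⊕ (PIdx d ⊕ OIdx d)

/-- The standard basis of the space of points `(X, u, (w, θ))`. -/
def bigBasis (d : ℕ) : Module.Basis (BIdx d) ℝ (Big d) :=
  (phaseBasis d).prod ((phaseBasis d).prod (ospBasis d))

@[simp] lemma bigBasis_inl (j : PIdx d) : bigBasis d (Sum.inl j) = (phaseBasis d j, 0) := by
  simp [bigBasis]

@[simp] lemma bigBasis_inr_inl (j : PIdx d) :
    bigBasis d (Sum.inr (Sum.inl j)) = (0, (phaseBasis d j, 0)) := by
  simp [bigBasis]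

@[simp] lemma bigBasis_inr_inr (j : OIdx d) :
    bigBasis d (Sum.inr (Sum.inr j)) = (0, (0, ospBasis d j)) := by
  simp [bigBasis]

/-- The growth `(1 + |u|)(1 + |w|)` caused by a derivative in `x`, `u` or `w`. -/
def growth (v : Big d) : ℝ := (1 + ‖v.2.1‖) * (1 + ‖v.2.2.1‖)

/-- The factor `(1 + |θ|)⟨ξ⟩^{-ρ}` caused by a derivative in `ξ`. -/
def gain (ρ : ℝ) (v : Big d) : ℝ := (1 + ‖v.2.2.2‖) * japanese v.1.2 ^ (-ρ)

/-- The factor caused by one derivative of an amplitude in the variables `(X, u, (w, θ))`. The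
derivatives in `θ` are bounded, and moreover gain `⟨ξ⟩^{-ρ}`. -/
def ϖB (ρ : ℝ) : BIdx d → Big d → ℝ
  | Sum.inl (Sum.inl _), v => growth v
  | Sum.inl (Sum.inr _), v => gain ρ v
  | Sum.inr (Sum.inl _), v => growth v
  | Sum.inr (Sum.inr (Sum.inl _)), v => growth v
  | Sum.inr (Sum.inr (Sum.inr _)), v => min 1 (gain ρ v)

/-- The weight `((1 + |u|)(1 + |w|)(1 + |θ|))^N ⟨ξ⟩^m`. -/
def wB (N : ℕ) (m : ℝ) (v : Big d) : ℝ := (growth v * (1 + ‖v.2.2.2‖)) ^ N * japanese v.1.2 ^ m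

lemma one_le_growth (v : Big d) : 1 ≤ growth v := by
  unfold growth
  nlinarith [norm_nonneg v.2.1, norm_nonneg v.2.2.1, mul_nonneg (norm_nonneg v.2.1)
    (norm_nonneg v.2.2.1)]

lemma gain_pos (ρ : ℝ) (v : Big d) : 0 < gain ρ v :=
  mul_pos (by positivity) (Real.rpow_pos_of_pos (japanese_pos _) _)

lemma ϖB_pos (ρ : ℝ) (k : BIdx d) (v : Big d) : 0 < ϖB ρ k v := by
  have := one_le_growth v
  rcases k with (k | k) | (k | (k | k)) <;> simp only [ϖB] <;>
    first | linarith | exact gain_pos ρ v | exact lt_min one_pos (gain_pos ρ v)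

lemma one_le_wB_base (v : Big d) : 1 ≤ growth v * (1 + ‖v.2.2.2‖) := by
  nlinarith [one_le_growth v, norm_nonneg v.2.2.2]

lemma wB_pos (N : ℕ) (m : ℝ) (v : Big d) : 0 < wB N m v :=
  mul_pos (pow_pos (zero_lt_one.trans_le (one_le_wB_base v)) N)
    (Real.rpow_pos_of_pos (japanese_pos _) _)

lemma wB_mono {M N : ℕ} (h : M ≤ N) (m : ℝ) (v : Big d) : wB M m v ≤ wB N m v :=
  mul_le_mul_of_nonneg_right (pow_le_pow_right₀ (one_le_wB_base v) h)
    (Real.rpow_pos_of_pos (japanese_pos _) _).le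

lemma wB_mul (M N : ℕ) (m n : ℝ) (v : Big d) : wB M m v * wB N n v = wB (M + N) (m + n) v := by
  unfold wB
  rw [pow_add, Real.rpow_add (japanese_pos _)]
  ring

/-- The amplitudes of order `m` in the variables `(X, u, (w, θ))`. -/
def Amp (ρ m : ℝ) (a : Big d → ℂ) : Prop :=
  ∃ N : ℕ, Cl (bigBasis d) (ϖB ρ) (fun (_ : Unit) v => wB N m v) (fun _ => a)

variable {ρ m n : ℝ} {a b : Big d → ℂ}

lemma Amp.smooth (ha : Amp ρ m a) : ContDiff ℝ ∞ a := ha.choose_spec.smooth ()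

lemma Cl.amp_mono {M N : ℕ} (h : M ≤ N)
    (ha : Cl (bigBasis d) (ϖB ρ) (fun (_ : Unit) v => wB M m v) (fun _ => a)) :
    Cl (bigBasis d) (ϖB ρ) (fun (_ : Unit) v => wB N m v) (fun _ => a) :=
  ha.mono_weight (fun k v => (ϖB_pos ρ k v).le) (fun _ v => (wB_pos M m v).le) (M := 1)
    fun _ v => by rw [one_mul]; exact wB_mono h m v

lemma Amp.mul (ha : Amp ρ m a) (hb : Amp ρ n b) : Amp ρ (m + n) (a * b) := by
  obtain ⟨M, ha⟩ := ha
  obtain ⟨N, hb⟩ := hb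
  exact ⟨M + N, (ha.mul hb).congr (fun _ v => wB_mul M N m n v) fun _ _ => rfl⟩

lemma Amp.sum {α : Type*} (t : Finset α) {f : α → Big d → ℂ} (hf : ∀ j ∈ t, Amp ρ m (f j)) :
    Amp ρ m (fun v => ∑ j ∈ t, f j v) := by
  choose! N hN using hf
  exact ⟨t.sup N, Cl.sum (f := fun j (_ : Unit) => f j) t fun j hj =>
    (hN j hj).amp_mono (Finset.le_sup hj)⟩

lemma Amp.const_mul (ha : Amp ρ m a) (c : ℂ) : Amp ρ m (fun v => c * a v) := by
  obtain ⟨N, ha⟩ := ha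
  exact ⟨N, ha.const_mul (c := fun _ => c) fun _ => le_rfl⟩

/-- A derivative of an amplitude in a direction that costs at most `growth · (1 + |θ|)` and gains
the power `s` of `⟨ξ⟩` is an amplitude. -/
lemma Amp.deriv_of_le (ha : Amp ρ m a) (k : BIdx d) {s : ℝ}
    (h : ∀ v, ϖB ρ k v ≤ wB 1 s v) : Amp ρ (m + s) (dd (bigBasis d k) a) := by
  obtain ⟨N, ha⟩ := ha
  refine ⟨N + 1, (ha.deriv k).mono_weight (fun k v => (ϖB_pos ρ k v).le)
    (fun _ v => mul_nonneg (wB_pos N m v).le (ϖB_pos ρ k v).le) (M := 1) fun _ v => ?_⟩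
  rw [one_mul, ← wB_mul]
  exact mul_le_mul_of_nonneg_left (h v) (wB_pos N m v).le

lemma growth_le_wB (v : Big d) : growth v ≤ wB 1 0 v := by
  rw [wB, pow_one, Real.rpow_zero, mul_one]
  have := one_le_growth v
  nlinarith [norm_nonneg v.2.2.2]

lemma gain_le_wB (ρ : ℝ) (v : Big d) : gain ρ v ≤ wB 1 (-ρ) v := by
  rw [wB, pow_one, gain]
  refine mul_le_mul_of_nonneg_right ?_ (Real.rpow_pos_of_pos (japanese_pos _) _).le
  have := one_le_growth v
  nlinarith [norm_nonneg v.2.2.2]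

/-- The order of the amplitude obtained by a derivative in `X`. -/
def ordH (ρ : ℝ) : PIdx d → ℝ
  | Sum.inl _ => 0
  | Sum.inr _ => -ρ

lemma Amp.deriv_X (ha : Amp ρ m a) (k : PIdx d) :
    Amp ρ (m + ordH ρ k) (dd (bigBasis d (Sum.inl k)) a) := by
  refine ha.deriv_of_le _ fun v => ?_
  cases k
  · exact growth_le_wB v
  · exact gain_le_wB ρ v

lemma Amp.deriv_u (ha : Amp ρ m a) (k : PIdx d) :
    Amp ρ m (dd (bigBasis d (Sum.inr (Sum.inl k))) a) := by
  have h := ha.deriv_of_le (Sum.inr (Sum.inl k)) (s := 0) growth_le_wB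
  rwa [add_zero] at h

lemma Amp.deriv_θ (ha : Amp ρ m a) (k : PIdx d) :
    Amp ρ (m - ρ) (dd (bigBasis d (Sum.inr (Sum.inr (Sum.inr k)))) a) :=
  ha.deriv_of_le _ fun v => (min_le_right _ _).trans (gain_le_wB ρ v)

/-- Multiplication by a coordinate of `w` preserves the order of an amplitude. -/
lemma amp_co_w (k : PIdx d) : Amp ρ 0 (fun v : Big d => (co k v.2.2.1 : ℂ)) := by
  refine ⟨1, ?_⟩
  let c : Big d →L[ℝ] ℝ := (co k).comp ((ContinuousLinearMap.fst ℝ _ _).comp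
    ((ContinuousLinearMap.snd ℝ _ _).comp (ContinuousLinearMap.snd ℝ _ _)))
  have h1 : ∀ v : Big d, 1 + ‖v.2.2.1‖ ≤ wB 1 0 v := fun v => by
    refine le_trans ?_ (growth_le_wB v)
    unfold growth
    nlinarith [norm_nonneg v.2.1, norm_nonneg v.2.2.1]
  have hP : ∀ v : Big d, 1 ≤ wB 1 0 v := fun v => by
    linarith [h1 v, norm_nonneg v.2.2.1]
  refine Cl.clm (C := 1) c (fun _ v => ?_) (fun _ k' v => ?_)
  · rw [one_mul]
    exact (abs_co_le k v.2.2.1).trans (by linarith [h1 v])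
  · rw [one_mul]
    have hpos : 0 ≤ wB 1 0 v * ϖB ρ k' v := mul_nonneg (wB_pos 1 0 v).le (ϖB_pos ρ k' v).le
    have hc : ∀ w : Big d, c w = co k w.2.2.1 := fun _ => rfl
    rcases k' with k' | (k' | (k' | k'))
    · simpa [hc] using hpos
    · simpa [hc] using hpos
    · simp only [hc, bigBasis_inr_inr, ospBasis_inl, co_basis]
      have : 1 ≤ wB 1 0 v * growth v := one_le_mul_of_one_le_of_one_le (hP v) (one_le_growth v)
      split_ifs <;> simp only [abs_one, abs_zero] <;> simp only [ϖB] at hpos ⊢ <;> linarith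
    · simpa [hc] using hpos

end Weights

/-! ### Oscillatory integrals of amplitudes depending on `ε` -/

section Family

variable {d : ℕ} {ρ m : ℝ} {a : Big d → ℂ}

/-- The parameters `(ε, X)`. -/
abbrev Par (d : ℕ) : Type := ℝ × Phase d

/-- The standard basis of the space of parameters `(ε, X)`. -/
def parBasis (d : ℕ) : Module.Basis (Unit ⊕ PIdx d) ℝ (Par d) :=
  (Module.Basis.singleton Unit ℝ).prod (phaseBasis d)

@[simp] lemma parBasis_inl (j : Unit) : parBasis d (Sum.inl j) = (1, 0) := by
  simp [parBasis]

@[simp] lemma parBasis_inr (j : PIdx d) : parBasis d (Sum.inr j) = (0, phaseBasis d j) := by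
  simp [parBasis]

/-- The point `(X, ε w, (w, θ))`. -/
def atPar (p : Par d) (s : Osp d) : Big d := (p.2, p.1 • s.1, s)

lemma contDiff_atPar : ContDiff ℝ ∞ (Function.uncurry (atPar (d := d))) := by
  unfold atPar Function.uncurry
  fun_prop

lemma wB_atPar_le {R : ℝ} (hR : 0 ≤ R) (N : ℕ) (m : ℝ) {p : Par d} (hp : |p.1| ≤ R) (s : Osp d) :
    wB N m (atPar p s) ≤ (1 + R) ^ N * (wH m p.2 * wS (2 * N) s) := by
  have h0 : ‖p.1 • s.1‖ ≤ R * ‖s.1‖ := by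
    rw [norm_smul, Real.norm_eq_abs]
    exact mul_le_mul_of_nonneg_right hp (norm_nonneg _)
  have h1 : growth (atPar p s) * (1 + ‖s.2‖) ≤ (1 + R) * ((1 + ‖s.1‖) * (1 + ‖s.2‖)) ^ 2 := by
    unfold growth
    have hs1 := norm_nonneg s.1
    have hs2 := norm_nonneg s.2
    calc (1 + ‖(atPar p s).2.1‖) * (1 + ‖(atPar p s).2.2.1‖) * (1 + ‖s.2‖)
        ≤ ((1 + R) * (1 + ‖s.1‖)) * (1 + ‖s.1‖) * ((1 + ‖s.2‖) * (1 + ‖s.2‖)) := by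
          refine mul_le_mul (mul_le_mul_of_nonneg_right ?_ (by simp only [atPar]; positivity)) ?_
            (by positivity) (by positivity)
          · simp only [atPar]; nlinarith
          · nlinarith
      _ = _ := by ring
  calc wB N m (atPar p s) = (growth (atPar p s) * (1 + ‖s.2‖)) ^ N * wH m p.2 := rfl
    _ ≤ ((1 + R) * ((1 + ‖s.1‖) * (1 + ‖s.2‖)) ^ 2) ^ N * wH m p.2 := by
        refine mul_le_mul_of_nonneg_right (pow_le_pow_left₀ ?_ h1 N) (wH_pos _ _).le
        exact mul_nonneg (zero_le_one.trans (one_le_growth _)) (by positivity)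
    _ = _ := by rw [mul_pow, ← pow_mul, wS]; ring

lemma hasFDerivAt_atPar (p : Par d) (s : Osp d) :
    HasFDerivAt (atPar p) ((0 : Osp d →L[ℝ] Phase d).prod
      ((p.1 • ContinuousLinearMap.fst ℝ (Phase d) (Phase d)).prod (ContinuousLinearMap.id ℝ _))) s :=
  (hasFDerivAt_const p.2 s).prodMk ((hasFDerivAt_fst.const_smul p.1).prodMk (hasFDerivAt_id s))

/-- Amplitudes restricted to `u = ε w` are amplitudes in `(w, θ)`, locally uniformly in `ε`. -/
lemma Amp.atPar_cl (ha : Amp ρ m a) : ∃ N : ℕ, ∀ R : ℝ,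
    Cl (ospBasis d) ϖS (fun (p : {p : Par d // |p.1| ≤ R}) s => wH m p.1.2 * wS N s)
      (fun p s => a (atPar p.1 s)) := by
  obtain ⟨N, ha⟩ := ha
  refine ⟨2 * N, fun R => ?_⟩
  rcases lt_or_ge R 0 with hR | hR
  · have : IsEmpty {p : Par d // |p.1| ≤ R} :=
      ⟨fun p => absurd p.2 (not_le.mpr (hR.trans_le (abs_nonneg _)))⟩
    exact ⟨fun p => isEmptyElim p, fun _ => ⟨0, fun p => isEmptyElim p⟩⟩
  let c : {p : Par d // |p.1| ≤ R} → OIdx d → BIdx d → ℝ := fun p J k =>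
    match J, k with
    | Sum.inl j, Sum.inr (Sum.inl k) => if k = j then p.1.1 else 0
    | J, Sum.inr (Sum.inr K) => if K = J then 1 else 0
    | _, _ => 0
  have h := ha.comp_affine (e' := ospBasis d) (ϖ' := ϖS) (π := fun _ => ())
    (φ := fun (p : {p : Par d // |p.1| ≤ R}) s => atPar p.1 s)
    (fun k v => (ϖB_pos ρ k v).le) ϖS_nonneg (fun _ v => (wB_pos N m v).le)
    (fun p s => hasFDerivAt_atPar p.1 s) (c := c) (D := (1 + R) * (1 + R)) ?_ ?_
  · refine h.mono_weight ϖS_nonneg (fun _ v => (wB_pos N m _).le) (M := (1 + R) ^ N) fun p s => ?_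
    exact wB_atPar_le hR N m p.2 s
  · intro p J
    rw [Fintype.sum_sum_type, Fintype.sum_sum_type]
    rcases J with j | j
    · simp [c]
    · simp [c]
  · intro p J k s
    have hg : growth (atPar p.1 s) ≤ (1 + R) * (1 + ‖s.1‖) ^ 2 := by
      unfold growth
      have h0 : ‖p.1.1 • s.1‖ ≤ R * ‖s.1‖ := by
        rw [norm_smul, Real.norm_eq_abs]
        exact mul_le_mul_of_nonneg_right p.2 (norm_nonneg _)
      simp only [atPar]
      nlinarith [norm_nonneg s.1, mul_nonneg hR (norm_nonneg s.1)]
    have hg0 := one_le_growth (atPar p.1 s)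
    have hsq : 1 ≤ (1 + ‖s.1‖) ^ 2 := one_le_pow₀ (by linarith [norm_nonneg s.1])
    have hR2 : 1 ≤ (1 + R) * (1 + R) := by nlinarith
    have hD : 0 ≤ (1 + R) * (1 + R) * ϖS J s := mul_nonneg (by linarith) (ϖS_nonneg J s)
    have hmin : min 1 (gain ρ (atPar p.1 s)) ≤ (1 + R) * (1 + R) * ϖS J s :=
      (min_le_left _ _).trans (one_le_mul_of_one_le_of_one_le hR2 (one_le_ϖS J s))
    rcases J with j | j <;> rcases k with k | (k | (k | k)) <;> simp only [c]
    · simpa using hD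
    · split_ifs
      · simp only [ϖB, ϖS]
        calc |p.1.1| * growth (atPar p.1 s) ≤ R * ((1 + R) * (1 + ‖s.1‖) ^ 2) :=
              mul_le_mul p.2 hg (by linarith) hR
          _ ≤ _ := by nlinarith [mul_nonneg (by linarith : 0 ≤ 1 + R) (by linarith : 0 ≤ (1 + ‖s.1‖) ^ 2)]
      · simpa using hD
    · split_ifs
      · simp only [ϖB, ϖS, abs_one, one_mul]
        nlinarith [mul_nonneg hR (by linarith : 0 ≤ (1 + ‖s.1‖) ^ 2),
          mul_nonneg (mul_nonneg hR hR) (by linarith : 0 ≤ (1 + ‖s.1‖) ^ 2)]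
      · simpa using hD
    · rw [if_neg (by simp)]; simpa using hD
    · simpa using hD
    · simpa using hD
    · rw [if_neg (by simp)]; simpa using hD
    · split_ifs
      · simpa [ϖB] using hmin
      · simpa using hD

/-- The growth exponent of an amplitude at `u = ε w` can be chosen independently of `(ε, X)`; only the
constants depend on them. -/
lemma Amp.isAmp (ha : Amp ρ m a) : ∃ N : ℕ, ∀ p : Par d, IsAmp N (fun s => a (atPar p s)) := by
  obtain ⟨N, hN⟩ := ha.atPar_cl
  refine ⟨N, fun p => ?_⟩
  have h := (hN |p.1|).reindex (fun _ : Unit => (⟨p, le_rfl⟩ : {q : Par d // |q.1| ≤ |p.1|}))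
  exact h.mono_weight ϖS_nonneg (fun _ s => mul_nonneg (wH_pos _ _).le (wS_pos N s).le)
    (M := wH m p.2) fun _ _ => le_rfl

/-- The oscillatory integral of `a(X, ε w, (w, θ))`. -/
def oscFam (a : Big d → ℂ) (p : Par d) : ℂ := osc fun s => a (atPar p s)

/-- The derivative in `ε` of an amplitude at `u = ε w`. -/
def euler (a : Big d → ℂ) (v : Big d) : ℂ :=
  ∑ j : PIdx d, co j v.2.2.1 * dd (bigBasis d (Sum.inr (Sum.inl j))) a v

/-- The operator into which `euler` turns under the oscillatory integral. -/
def eulerGain (a : Big d → ℂ) (v : Big d) : ℂ :=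
  ∑ j : PIdx d, -Complex.I * dd (bigBasis d (Sum.inr (Sum.inr (Sum.inr j))))
    (dd (bigBasis d (Sum.inr (Sum.inl j))) a) v

lemma Amp.amp_euler (ha : Amp ρ m a) : Amp ρ m (euler a) :=
  Amp.sum Finset.univ fun j _ => by
    have h := (amp_co_w (ρ := ρ) j).mul (ha.deriv_u j)
    rw [zero_add] at h
    exact h

lemma Amp.amp_eulerGain (ha : Amp ρ m a) : Amp ρ (m - ρ) (eulerGain a) :=
  Amp.sum Finset.univ fun j _ => ((ha.deriv_u j).deriv_θ j).const_mul (-Complex.I)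

lemma dd_comp_atPar_X (ha : ContDiff ℝ ∞ a) (j : PIdx d) (p : Par d) (s : Osp d) :
    dd (parBasis d (Sum.inr j)) (fun p => a (atPar p s)) p =
      dd (bigBasis d (Sum.inl j)) a (atPar p s) := by
  have h : HasFDerivAt (fun p : Par d => atPar p s)
      ((ContinuousLinearMap.snd ℝ ℝ (Phase d)).prod
        (((ContinuousLinearMap.fst ℝ ℝ (Phase d)).smulRight s.1).prod 0)) p :=
    hasFDerivAt_snd.prodMk ((hasFDerivAt_fst.smul_const s.1).prodMk (hasFDerivAt_const s p))
  unfold dd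
  have h' := (diff_of_smooth ha _).hasFDerivAt.comp p h
  rw [HasFDerivAt.fderiv (f := fun p => a (atPar p s)) h']
  simp
  rfl

lemma phase_eq_sum (v : Phase d) : v = ∑ j, co j v • phaseBasis d j := by
  rw [Fintype.sum_sum_type]
  refine Prod.ext ?_ ?_
  · ext i
    simp [Prod.fst_sum, Finset.sum_apply, basisVec, Pi.single_apply]
  · ext i
    simp [Prod.snd_sum, Finset.sum_apply, basisVec, Pi.single_apply]

lemma dd_sum_smul {V κ : Type*} [NormedAddCommGroup V] [NormedSpace ℝ V] [Fintype κ]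
    (f : V → ℂ) (c : κ → ℝ) (e : κ → V) (x : V) :
    dd (∑ k, c k • e k) f x = ∑ k, (c k : ℂ) * dd (e k) f x := by
  simp [dd]

/-- The chain rule along `ε ↦ (X, ε w, (w, θ))`. -/
lemma dd_comp_atPar_eps (ha : ContDiff ℝ ∞ a) (j : Unit) (p : Par d) (s : Osp d) :
    dd (parBasis d (Sum.inl j)) (fun p => a (atPar p s)) p = euler a (atPar p s) := by
  have h : HasFDerivAt (fun p : Par d => atPar p s)
      ((ContinuousLinearMap.snd ℝ ℝ (Phase d)).prod
        (((ContinuousLinearMap.fst ℝ ℝ (Phase d)).smulRight s.1).prod 0)) p :=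
    hasFDerivAt_snd.prodMk ((hasFDerivAt_fst.smul_const s.1).prodMk (hasFDerivAt_const s p))
  have hv : ((0, (s.1, 0)) : Big d) =
      ∑ j, co j s.1 • bigBasis d (Sum.inr (Sum.inl j)) := by
    have := congrArg (fun v : Phase d => ((0, (v, 0)) : Big d)) (phase_eq_sum s.1)
    simp only [bigBasis_inr_inl]
    rw [this]
    simp [Prod.ext_iff, Prod.fst_sum, Prod.snd_sum]
  have h1 : dd (parBasis d (Sum.inl j)) (fun p => a (atPar p s)) p =
      dd ((0, (s.1, 0)) : Big d) a (atPar p s) := by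
    unfold dd
    have h' := (diff_of_smooth ha _).hasFDerivAt.comp p h
    rw [HasFDerivAt.fderiv (f := fun p => a (atPar p s)) h']
    simp
  rw [h1, hv, dd_sum_smul]
  rfl

lemma dd_comp_atPar_θ (ha : ContDiff ℝ ∞ a) (j : PIdx d) (p : Par d) (s : Osp d) :
    dd (ospBasis d (Sum.inr j)) (fun s => a (atPar p s)) s =
      dd (bigBasis d (Sum.inr (Sum.inr (Sum.inr j)))) a (atPar p s) := by
  unfold dd
  have h := (diff_of_smooth ha _).hasFDerivAt.comp s (hasFDerivAt_atPar p s)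
  rw [HasFDerivAt.fderiv (f := fun s => a (atPar p s)) h]
  simp

lemma contDiff_comp_atPar (ha : ContDiff ℝ ∞ a) :
    ContDiff ℝ ∞ (Function.uncurry fun p s => a (atPar p s)) :=
  ha.comp contDiff_atPar

/-- Under the oscillatory integral, multiplication by `w` is a derivative in `θ`: the derivative
in `ε` lowers the order by `ρ`. -/
lemma oscFam_euler (ha : Amp ρ m a) : oscFam (euler a) = oscFam (eulerGain a) := by
  funext p
  unfold oscFam euler eulerGain
  have h1 : ∃ N, ∀ j ∈ (Finset.univ : Finset (PIdx d)), IsAmp N (fun s : Osp d =>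
      dd (bigBasis d (Sum.inr (Sum.inl j))) a (atPar p s)) := by
    choose N hN using fun j => (ha.deriv_u j).isAmp
    exact ⟨Finset.univ.sup N, fun j hj => (hN j p).mono (Finset.le_sup hj)⟩
  obtain ⟨N, hN⟩ := h1
  have hco : ∀ j : PIdx d, IsAmp 1 (fun s : Osp d => (dco (Sum.inr j) s : ℂ)) :=
    fun j => cl_dco (Sum.inr j)
  rw [osc_sum (N := 1 + N), osc_sum (N := N + 2)]
  · refine Finset.sum_congr rfl fun j hj => ?_
    have h2 := osc_dco_mul (hN j hj) (Sum.inr j)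
    simp only [dd_comp_atPar_θ (ha.deriv_u j).smooth] at h2
    exact h2
  · intro j hj
    have h3 := ((hN j hj).deriv (Sum.inr j)).const_mul (-Complex.I)
    simp only [dd_comp_atPar_θ (ha.deriv_u j).smooth] at h3
    exact h3
  · exact fun j hj => (hco j).mul (hN j hj)

lemma exists_wH_le (m R : ℝ) : ∃ M : ℝ, ∀ X : Phase d, ‖X‖ ≤ R → wH m X ≤ M := by
  obtain ⟨M, hM⟩ := (isCompact_closedBall (0 : Phase d) R).bddAbove_image
    (f := wH m) (by
      unfold wH
      exact ((continuous_japanese.comp continuous_snd).rpow_const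
        fun X => Or.inl (japanese_pos _).ne').continuousOn)
  exact ⟨M, fun X hX => hM ⟨X, by simpa using hX, rfl⟩⟩

lemma Amp.atPar_cl_bounded (ha : Amp ρ m a) : ∃ N : ℕ, ∀ R : ℝ,
    Cl (ospBasis d) ϖS (fun (_ : {p : Par d // ‖p‖ ≤ R}) s => wS N s)
      (fun p s => a (atPar p.1 s)) := by
  obtain ⟨N, hN⟩ := ha.atPar_cl
  refine ⟨N, fun R => ?_⟩
  obtain ⟨M, hM⟩ := exists_wH_le (d := d) m R
  have h := (hN R).reindex (fun p : {p : Par d // ‖p‖ ≤ R} =>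
    (⟨p.1, (norm_fst_le p.1).trans p.2⟩ : {p : Par d // |p.1| ≤ R}))
  refine h.mono_weight ϖS_nonneg (fun p s => mul_nonneg (wH_pos _ _).le (wS_pos N s).le) (M := M)
    fun p s => ?_
  exact mul_le_mul_of_nonneg_right (hM _ ((norm_snd_le p.1).trans p.2)) (wS_pos N s).le

/-- Differentiation of the family of oscillatory integrals. -/
lemma Amp.dd_oscFam (ha : Amp ρ m a) : Differentiable ℝ (oscFam a) ∧
    (∀ j, dd (parBasis d (Sum.inr j)) (oscFam a) = oscFam (dd (bigBasis d (Sum.inl j)) a)) ∧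
      ∀ j, dd (parBasis d (Sum.inl j)) (oscFam a) = oscFam (eulerGain a) := by
  obtain ⟨N₀, h0⟩ := ha.atPar_cl_bounded
  obtain ⟨N₁, h1⟩ := ha.amp_euler.atPar_cl_bounded
  choose N₂ h2 using fun j => (ha.deriv_X j).atPar_cl_bounded
  have hm : ∀ {M N : ℕ} {R : ℝ} {b : {p : Par d // ‖p‖ ≤ R} → Osp d → ℂ}, M ≤ N →
      Cl (ospBasis d) ϖS (fun _ s => wS M s) b → Cl (ospBasis d) ϖS (fun _ s => wS N s) b :=
    fun h hb => hb.mono_weight ϖS_nonneg (fun _ s => (wS_pos _ s).le) (M := 1) fun _ s => by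
      rw [one_mul]; exact wS_mono h s
  have key := dd_osc (parBasis d) (contDiff_comp_atPar ha.smooth)
    (N := max N₀ (max N₁ (Finset.univ.sup N₂))) (fun R => hm (le_max_left _ _) (h0 R)) ?_
  · refine ⟨key.1, fun j => ?_, fun j => ?_⟩
    · funext p
      refine (key.2 (Sum.inr j) p).trans ?_
      simp only [dd_comp_atPar_X ha.smooth]
      rfl
    · rw [← oscFam_euler ha]
      funext p
      refine (key.2 (Sum.inl j) p).trans ?_
      simp only [dd_comp_atPar_eps ha.smooth]
      rfl
  · rintro (j | j) R
    · simp only [dd_comp_atPar_eps ha.smooth]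
      exact hm ((le_max_left _ _).trans (le_max_right _ _)) (h1 R)
    · simp only [dd_comp_atPar_X ha.smooth]
      exact hm (((Finset.le_sup (Finset.mem_univ j)).trans (le_max_right _ _)).trans
        (le_max_right _ _)) (h2 j R)

lemma Amp.contDiff_oscFam (ha : Amp ρ m a) : ContDiff ℝ ∞ (oscFam a) := by
  refine contDiff_of_closed_under_dd (parBasis d)
    {h | ∃ (m : ℝ) (a : Big d → ℂ), Amp ρ m a ∧ oscFam a = h} ?_ ?_ ⟨m, a, ha, rfl⟩
  · rintro _ ⟨m, a, ha, rfl⟩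
    exact ha.dd_oscFam.1
  · rintro _ ⟨m, a, ha, rfl⟩ (j | j)
    · exact ⟨_, _, ha.amp_eulerGain, (ha.dd_oscFam.2.2 j).symm⟩
    · exact ⟨_, _, ha.deriv_X j, (ha.dd_oscFam.2.1 j).symm⟩

lemma Amp.norm_oscFam_le (ha : Amp ρ m a) : ∃ C : ℝ, ∀ p : Par d, |p.1| ≤ 1 →
    ‖oscFam a p‖ ≤ C * wH m p.2 := by
  obtain ⟨N, hN⟩ := ha.atPar_cl
  obtain ⟨C, hC⟩ := exists_norm_osc_le (c := fun p : {p : Par d // |p.1| ≤ 1} => wH m p.1.2)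
    (fun p => (wH_pos m p.1.2).le) (hN 1)
  exact ⟨C, fun p hp => hC ⟨p, hp⟩⟩

end Family

/-! ### The amplitude of the magnetic Weyl product -/

section Amplitude

open MeasureTheory

variable {d : ℕ}

lemma contDiff_uncurry_wd {P Q κ : Type*} [NormedAddCommGroup P] [NormedSpace ℝ P]
    [NormedAddCommGroup Q] [NormedSpace ℝ Q] (e : κ → Q) (l : List κ) {a : P → Q → ℂ}
    (ha : ContDiff ℝ ∞ (Function.uncurry a)) :
    ContDiff ℝ ∞ (Function.uncurry fun p => wd e l (a p)) := by
  induction l generalizing a with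
  | nil => exact ha
  | cons k l ih => exact ih (contDiff_uncurry_dd_right ha (e k))

lemma norm_wd_le_iteratedFDeriv {V κ : Type*} [NormedAddCommGroup V] [NormedSpace ℝ V] (e : κ → V)
    (l : List κ) {f : V → ℂ} (hf : ContDiff ℝ ∞ f) (x : V) :
    ‖wd e l f x‖ ≤ (l.map fun k => ‖e k‖).prod * ‖iteratedFDeriv ℝ l.length f x‖ := by
  induction l generalizing f with
  | nil => simp [wd]
  | cons k l ih =>
    have hp : 0 ≤ (l.map fun k => ‖e k‖).prod :=
      List.prod_nonneg (by simp only [List.mem_map]; rintro _ ⟨k, -, rfl⟩; exact norm_nonneg _)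
    have h1 : ‖iteratedFDeriv ℝ l.length (dd (e k) f) x‖ ≤
        ‖e k‖ * ‖iteratedFDeriv ℝ (l.length + 1) f x‖ := by
      have hs : ContDiff ℝ ∞ (fderiv ℝ f) := hf.fderiv_right (m := ∞) (by simp)
      refine (norm_iteratedFDeriv_clm_apply_const (n := l.length) (N := ∞) hs.contDiffAt
        (by exact_mod_cast le_top)).trans ?_
      rw [norm_iteratedFDeriv_fderiv]
    calc ‖wd e (k :: l) f x‖ ≤ (l.map fun k => ‖e k‖).prod *
          ‖iteratedFDeriv ℝ l.length (dd (e k) f) x‖ := ih (contDiff_dd hf _)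
      _ ≤ (l.map fun k => ‖e k‖).prod * (‖e k‖ * ‖iteratedFDeriv ℝ (l.length + 1) f x‖) :=
          mul_le_mul_of_nonneg_left h1 hp
      _ = _ := by simp only [List.map_cons, List.prod_cons, List.length_cons]; ring

lemma config_eq_sum (v : Config d) : v = ∑ j, v j • basisVec j := by
  ext i
  simp [basisVec, Pi.single_apply]

lemma IsMagneticField.smooth_complex {B : Config d → Fin d → Fin d → ℝ} (hB : IsMagneticField B)
    (k l : Fin d) : ContDiff ℝ ∞ (fun x => (B x k l : ℂ)) :=
  Complex.ofRealCLM.contDiff.comp (hB.smooth k l)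

lemma IsMagneticField.cl {B : Config d → Fin d → Fin d → ℝ} (hB : IsMagneticField B)
    (k l : Fin d) : Cl (basisVec : Fin d → Config d) (fun _ _ => 1) (fun (_ : Unit) _ => 1)
      (fun _ x => (B x k l : ℂ)) := by
  refine ⟨fun _ => hB.smooth_complex k l, fun w => ?_⟩
  obtain ⟨C, hC⟩ := hB.bounded k l w.length
  refine ⟨C, fun _ x => (norm_wd_le_iteratedFDeriv _ w (hB.smooth_complex k l) x).trans ?_⟩
  have h1 : ‖iteratedFDeriv ℝ w.length (fun x => (B x k l : ℂ)) x‖ =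
      ‖iteratedFDeriv ℝ w.length (fun x => B x k l) x‖ :=
    Complex.ofRealLI.norm_iteratedFDeriv_comp_left (hB.smooth k l).contDiffAt
      (by exact_mod_cast le_top)
  rw [h1]
  have h2 : ∀ i : Fin d, ‖basisVec i‖ = 1 := fun i => by simp [basisVec]
  simpa [h2] using hC x

/-- The density `∫∫ s B_kl(x + (s - 1/2) u₁ + (s t - 1/2) u₂) ds dt` over the unit square, in terms
of which the flux through the triangle with edges `u₁`, `u₂` is `∑ u₁_k u₂_l β_kl`. -/
def fluxDensity (B : Config d → Fin d → Fin d → ℝ) (k l : Fin d) (x : Config d) (u : Phase d) : ℝ :=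
  ∫ t : unitInterval × unitInterval,
    (t.1 : ℝ) * B (x + ((t.1 : ℝ) - 1 / 2) • u.1 + ((t.1 : ℝ) * t.2 - 1 / 2) • u.2) k l

/-- The factors of the derivatives of the magnetic phase: bounded in `x, u, w` and vanishing in
`ξ, θ`. -/
def ϖP : BIdx d → Big d → ℝ
  | Sum.inl (Sum.inl _), _ => 1
  | Sum.inl (Sum.inr _), _ => 0
  | Sum.inr (Sum.inl _), _ => 1
  | Sum.inr (Sum.inr (Sum.inl _)), _ => 1
  | Sum.inr (Sum.inr (Sum.inr _)), _ => 0

lemma ϖP_nonneg (k : BIdx d) (v : Big d) : 0 ≤ ϖP k v := by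
  rcases k with (k | k) | (k | (k | k)) <;> simp [ϖP]

lemma continuous_ϖP (k : BIdx d) : Continuous (ϖP k) := by
  rcases k with (k | k) | (k | (k | k)) <;> exact continuous_const

lemma abs_basisVec_le (i j : Fin d) : |(basisVec i : Config d) j| ≤ 1 := by
  simp only [basisVec, PiLp.single_apply]
  split_ifs <;> simp

lemma abs_unit_sub_half_le (t : unitInterval) : |(t : ℝ) - 1 / 2| ≤ 1 := by
  rw [abs_le]; constructor <;> linarith [t.2.1, t.2.2]

lemma continuous_unit_integrable {f : unitInterval × unitInterval → ℝ} (hf : Continuous f) :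
    Integrable f := hf.integrable_of_hasCompactSupport (HasCompactSupport.of_compactSpace f)

/-- The point at which the field is evaluated, as a linear function of the variables. -/
def fluxPoint (t : ℝ × ℝ) (v : Big d) : Config d :=
  v.1.1 + (t.1 - 1 / 2) • v.2.1.1 + (t.1 * t.2 - 1 / 2) • v.2.1.2

/-- The density and its derivatives are bounded in all variables, because those of the field are and
the coefficients of `u₁`, `u₂` are bounded on the unit square. -/
lemma cl_fluxDensity {B : Config d → Fin d → Fin d → ℝ} (hB : IsMagneticField B) (k l : Fin d) :
    Cl (bigBasis d) ϖP (fun (_ : Unit) _ => 1)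
      (fun _ v => (fluxDensity B k l v.1.1 v.2.1 : ℂ)) := by
  let S := unitInterval × unitInterval
  let L : ℝ × ℝ → Big d →L[ℝ] Config d := fun t =>
    (ContinuousLinearMap.fst ℝ (Config d) (Config d)).comp (ContinuousLinearMap.fst ℝ _ _) +
    (t.1 - 1 / 2) • (ContinuousLinearMap.fst ℝ (Config d) (Config d)).comp
      ((ContinuousLinearMap.fst ℝ _ _).comp (ContinuousLinearMap.snd ℝ _ _)) +
    (t.1 * t.2 - 1 / 2) • (ContinuousLinearMap.snd ℝ (Config d) (Config d)).comp
      ((ContinuousLinearMap.fst ℝ _ _).comp (ContinuousLinearMap.snd ℝ _ _))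
  have hL : ∀ t v, L t v = fluxPoint t v := fun t v => by simp [L, fluxPoint]
  let val : S → ℝ × ℝ := fun t => (t.1, t.2)
  have h1 := (hB.cl k l).comp_affine (e' := bigBasis d) (ϖ' := ϖP)
    (π := fun _ : Unit × S => ()) (φ := fun p v => fluxPoint (val p.2) v)
    (L := fun p => L (val p.2)) (fun _ _ => zero_le_one) ϖP_nonneg (fun _ _ => zero_le_one)
    (fun p v => by
      have := (L (val p.2)).hasFDerivAt (x := v)
      refine this.congr_of_eventuallyEq (Filter.Eventually.of_forall fun w => (hL _ w).symm))
    (c := fun p K k => L (val p.2) (bigBasis d K) k) (fun p K => config_eq_sum _) (D := 1) ?_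
  · have h2 := h1.const_mul (c := fun p => ((p.2.1 : ℝ) : ℂ)) (M := 1) fun p => by
      rw [Complex.norm_real, Real.norm_eq_abs, abs_of_nonneg p.2.1.2.1]; exact p.2.1.2.2
    have hjoint : ContDiff ℝ ∞ (Function.uncurry fun (t : ℝ × ℝ) (v : Big d) =>
        (t.1 : ℂ) * (B (fluxPoint t v) k l : ℂ)) := by
      have h3 : ContDiff ℝ ∞ fun q : (ℝ × ℝ) × Big d => fluxPoint q.1 q.2 := by
        unfold fluxPoint; fun_prop
      have h4 : ContDiff ℝ ∞ fun q : (ℝ × ℝ) × Big d => (q.1.1 : ℂ) :=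
        Complex.ofRealCLM.contDiff.comp (contDiff_fst.comp contDiff_fst)
      exact h4.mul ((hB.smooth_complex k l).comp h3)
    have h5 := (Cl.integral (μ := (volume : Measure S)) (bigBasis d) (ϖ := ϖP)
      (W := fun (_ : Unit) _ => 1) (g := fun _ => 1)
      (a := fun (_ : Unit) v (t : S) => ((t.1 : ℝ) : ℂ) * (B (fluxPoint (val t) v) k l : ℂ))
      ϖP_nonneg continuous_ϖP (fun _ _ => zero_le_one) (fun _ => continuous_const)
      (integrable_const _) (fun _ => zero_le_one)
      (h2.congr (fun _ _ => (mul_one _).symm) fun _ _ => rfl) ?_).1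
    · refine h5.congr (fun _ _ => rfl) fun _ v => ?_
      rw [fluxDensity, ← integral_complex_ofReal]
      refine integral_congr_ae (Filter.Eventually.of_forall fun t => ?_)
      simp only [fluxPoint, val]
      push_cast
      rfl
    · intro _ w v
      have h6 := (contDiff_uncurry_wd (bigBasis d) w hjoint).continuous
      have hval : Continuous val := (continuous_subtype_val.comp continuous_fst).prodMk
        (continuous_subtype_val.comp continuous_snd)
      exact (h6.comp (hval.prodMk continuous_const)).aestronglyMeasurable
  · rintro ⟨-, t⟩ K j v
    have ht : |(t.1 : ℝ) * t.2 - 1 / 2| ≤ 1 := by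
      have h0 := mul_nonneg t.1.2.1 t.2.2.1
      have h1 := mul_le_one₀ t.1.2.2 t.2.2.1 t.2.2.2
      rw [abs_le]; constructor <;> linarith
    rw [mul_one, one_mul, hL]
    rcases K with (i | i) | ((i | i) | ((i | i) | (i | i)))
    · simpa [fluxPoint, ϖP] using abs_basisVec_le i j
    · simp [fluxPoint, ϖP]
    · simp only [fluxPoint, ϖP, val]
      simpa [abs_mul] using mul_le_one₀ (by simpa using abs_unit_sub_half_le t.1) (abs_nonneg _)
        (abs_basisVec_le i j)
    · simp only [fluxPoint, ϖP, val]
      simpa [abs_mul] using mul_le_one₀ (by simpa using ht) (abs_nonneg _) (abs_basisVec_le i j)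
    all_goals simp [fluxPoint, ϖP]

lemma integral_unitInterval {E : Type*} [NormedAddCommGroup E] [NormedSpace ℝ E] (f : ℝ → E) :
    ∫ s : unitInterval, f s = ∫ s in (0 : ℝ)..1, f s := by
  rw [intervalIntegral.integral_of_le zero_le_one, ← integral_Icc_eq_integral_Ioc]
  exact integral_subtype measurableSet_Icc f

/-- The substitution `t ↦ s t` maps the triangle to the unit square. The edges of the triangle are
`ε y` and `ε z`, and one of the two factors `ε` cancels the `1/ε` of the definition, which is `0`
by convention for `ε = 0`; the right hand side continues it smoothly to all `ε`. -/
lemma scaledFlux_eq {B : Config d → Fin d → Fin d → ℝ} (hB : IsMagneticField B) {ε : ℝ}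
    (hε : ε ≠ 0) (x y z : Config d) : scaledFlux ε B x y z =
      ∑ k, ∑ l, (ε * y k) * z l * fluxDensity B k l x (ε • (y, z)) := by
  have hBc : ∀ k l, Continuous fun x => B x k l := fun k l => (hB.smooth k l).continuous
  set P : ℝ → ℝ → Config d := fun s t => x + (s - 1 / 2) • (ε • y) + (t - 1 / 2) • (ε • z) with hP
  have hflux : flux B (x - (ε / 2) • (y + z)) (x + (ε / 2) • (y - z)) (x + (ε / 2) • (y + z)) =
      ∫ s in (0 : ℝ)..1, ∫ t in (0 : ℝ)..s, ∑ k, ∑ l, B (P s t) k l * (ε * y k) * (ε * z l) := by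
    have hb : x + (ε / 2) • (y - z) - (x - (ε / 2) • (y + z)) = ε • y := by module
    have hc : x + (ε / 2) • (y + z) - (x + (ε / 2) • (y - z)) = ε • z := by module
    have hp : ∀ s t : ℝ, x - (ε / 2) • (y + z) + s • (ε • y) + t • (ε • z) = P s t := fun s t => by
      simp only [hP]; module
    simp only [flux, hb, hc, hp, PiLp.smul_apply, smul_eq_mul]
  have hinner : ∀ s : ℝ, ∫ t in (0 : ℝ)..s, ∑ k, ∑ l, B (P s t) k l * (ε * y k) * (ε * z l) =
      ∫ t : unitInterval, s * ∑ k, ∑ l, B (P s (s * t)) k l * (ε * y k) * (ε * z l) := by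
    intro s
    rw [integral_unitInterval
      (fun t => s * ∑ k, ∑ l, B (P s (s * t)) k l * (ε * y k) * (ε * z l)),
      intervalIntegral.integral_const_mul]
    have := intervalIntegral.smul_integral_comp_mul_left (a := 0) (b := 1)
      (fun t => ∑ k, ∑ l, B (P s t) k l * (ε * y k) * (ε * z l)) s
    rw [mul_zero, mul_one] at this
    exact this.symm
  have hcont : ∀ k l, Continuous fun t : unitInterval × unitInterval =>
      (t.1 : ℝ) * B (P t.1 ((t.1 : ℝ) * t.2)) k l := by
    intro k l
    have : Continuous fun t : unitInterval × unitInterval => P t.1 ((t.1 : ℝ) * t.2) := by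
      simp only [hP]; fun_prop
    exact (by fun_prop : Continuous fun t : unitInterval × unitInterval => (t.1 : ℝ)).mul
      ((hBc k l).comp this)
  have hcont' : ∀ k l, Continuous fun t : unitInterval × unitInterval =>
      ((t.1 : ℝ) * B (P t.1 ((t.1 : ℝ) * t.2)) k l) * ((ε * y k) * (ε * z l)) :=
    fun k l => (hcont k l).mul continuous_const
  have hall : ∀ t : unitInterval × unitInterval,
      (t.1 : ℝ) * ∑ k, ∑ l, B (P t.1 ((t.1 : ℝ) * t.2)) k l * (ε * y k) * (ε * z l) =
      ∑ k, ∑ l, ((t.1 : ℝ) * B (P t.1 ((t.1 : ℝ) * t.2)) k l) * ((ε * y k) * (ε * z l)) := by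
    intro t
    simp only [Finset.mul_sum]
    exact Finset.sum_congr rfl fun k _ => Finset.sum_congr rfl fun l _ => by ring
  rw [scaledFlux, hflux]
  simp_rw [hinner]
  rw [← integral_unitInterval (fun s => ∫ t : unitInterval,
    s * ∑ k, ∑ l, B (P s (s * t)) k l * (ε * y k) * (ε * z l))]
  rw [← integral_prod (fun t : unitInterval × unitInterval =>
    (t.1 : ℝ) * ∑ k, ∑ l, B (P t.1 ((t.1 : ℝ) * t.2)) k l * (ε * y k) * (ε * z l))]
  · rw [← Measure.volume_eq_prod]
    simp_rw [hall]
    rw [integral_finsetSum _ fun k _ => continuous_unit_integrable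
      (continuous_finsetSum _ fun l _ => hcont' k l), Finset.mul_sum]
    refine Finset.sum_congr rfl fun k _ => ?_
    rw [integral_finsetSum _ fun l _ => continuous_unit_integrable
      (hcont' k l), Finset.mul_sum]
    refine Finset.sum_congr rfl fun l _ => ?_
    rw [integral_mul_const]
    change ε⁻¹ * (fluxDensity B k l x (ε • (y, z)) * (ε * y k * (ε * z l))) = _
    field_simp
  · rw [← Measure.volume_eq_prod]
    simp_rw [hall]
    exact continuous_unit_integrable (continuous_finsetSum _ fun k _ =>
      continuous_finsetSum _ fun l _ => hcont' k l)

end Amplitude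

section Amplitude

open MeasureTheory

variable {d : ℕ}

/-- The magnetic phase `- ∑ u₁_k z_l β_kl(x, u)`, where `u = (u₁, u₂)` and `w = (y, z)`. -/
def bigPhase (B : Config d → Fin d → Fin d → ℝ) (v : Big d) : ℝ :=
  -∑ k, ∑ l, v.2.1.1 k * v.2.2.1.2 l * fluxDensity B k l v.1.1 v.2.1

/-- The phase space point at which the first factor is evaluated. -/
def pointL (v : Big d) : Phase d := (v.1.1 - (1 / 2 : ℝ) • v.2.1.2, v.1.2 + v.2.2.2.1)

/-- The phase space point at which the second factor is evaluated. -/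
def pointR (v : Big d) : Phase d := (v.1.1 + (1 / 2 : ℝ) • v.2.1.1, v.1.2 + v.2.2.2.2)

/-- The amplitude of the magnetic Weyl product in the variables `(X, u, (w, θ))`. -/
def bigAmp (B : Config d → Fin d → Fin d → ℝ) (f g : Phase d → ℂ) (v : Big d) : ℂ :=
  Complex.exp (Complex.I * bigPhase B v) * (f (pointL v) * g (pointR v))

/-- The amplitude that results from the partial Fourier transforms is `bigAmp` at `u = ε w`. -/
lemma kernelAmp_eq {B : Config d → Fin d → Fin d → ℝ} (hB : IsMagneticField B) {ε : ℝ}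
    (hε : ε ≠ 0) (f g : Phase d → ℂ) (X : Phase d) (s : Osp d) :
    kernelAmp ε 1 B f g X s = bigAmp B f g (atPar (ε, X) s) := by
  rw [kernelAmp, bigAmp, scaledFlux_eq hB hε]
  congr 1
  · congr 1
    simp only [bigPhase, atPar, one_mul]
    push_cast
    simp [PiLp.smul_apply]
  · simp only [pointL, pointR, atPar, Prod.smul_fst, Prod.smul_snd, smul_smul]
    congr 3 <;> ring_nf

lemma cl_coord_u (k : Fin d) : Cl (bigBasis d) ϖP (fun (_ : Unit) v => 1 + ‖v.2.1‖)
    (fun _ v => (v.2.1.1 k : ℂ)) := by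
  let c : Big d →L[ℝ] ℝ := (co (Sum.inl k)).comp ((ContinuousLinearMap.fst ℝ _ _).comp
    (ContinuousLinearMap.snd ℝ _ _))
  refine Cl.clm (C := 1) c (fun _ v => ?_) (fun _ k' v => ?_)
  · rw [one_mul]
    exact (abs_co_le (Sum.inl k) v.2.1).trans (by linarith)
  · have hc : ∀ w : Big d, c w = w.2.1.1 k := fun _ => rfl
    have h0 := norm_nonneg v.2.1
    rcases k' with (i | i) | ((i | i) | ((i | i) | (i | i)))
    · simp [hc, ϖP]; linarith
    · simp [hc, ϖP]
    · simp only [hc, bigBasis_inr_inl, phaseBasis_inl, ϖP]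
      linarith [abs_basisVec_le i k]
    · simp [hc, ϖP]; linarith
    · simp [hc, ϖP]; linarith
    · simp [hc, ϖP]; linarith
    · simp [hc, ϖP]
    · simp [hc, ϖP]

lemma cl_coord_z (k : Fin d) : Cl (bigBasis d) ϖP (fun (_ : Unit) v => 1 + ‖v.2.2.1‖)
    (fun _ v => (v.2.2.1.2 k : ℂ)) := by
  let c : Big d →L[ℝ] ℝ := (co (Sum.inr k)).comp ((ContinuousLinearMap.fst ℝ _ _).comp
    ((ContinuousLinearMap.snd ℝ _ _).comp (ContinuousLinearMap.snd ℝ _ _)))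
  refine Cl.clm (C := 1) c (fun _ v => ?_) (fun _ k' v => ?_)
  · rw [one_mul]
    exact (abs_co_le (Sum.inr k) v.2.2.1).trans (by linarith)
  · have hc : ∀ w : Big d, c w = w.2.2.1.2 k := fun _ => rfl
    have h0 := norm_nonneg v.2.2.1
    rcases k' with (i | i) | ((i | i) | ((i | i) | (i | i)))
    · simp [hc, ϖP]; linarith
    · simp [hc, ϖP]
    · simp [hc, ϖP]; linarith
    · simp [hc, ϖP]; linarith
    · simp [hc, ϖP]; linarith
    · simp only [hc, bigBasis_inr_inr, ospBasis_inl, phaseBasis_inr, ϖP]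
      linarith [abs_basisVec_le i k]
    · simp [hc, ϖP]
    · simp [hc, ϖP]

lemma cl_bigPhase {B : Config d → Fin d → Fin d → ℝ} (hB : IsMagneticField B) :
    Cl (bigBasis d) ϖP (fun (_ : Unit) v => growth v) (fun _ v => (bigPhase B v : ℂ)) := by
  have h : ∀ k l, Cl (bigBasis d) ϖP (fun (_ : Unit) v => growth v)
      (fun _ v => (v.2.1.1 k : ℂ) * (v.2.2.1.2 l : ℂ) * (fluxDensity B k l v.1.1 v.2.1 : ℂ)) :=
    fun k l => (((cl_coord_u k).mul (cl_coord_z l)).mul (cl_fluxDensity hB k l)).congr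
      (fun _ v => mul_one _) fun _ _ => rfl
  refine ((Cl.sum Finset.univ fun k _ => Cl.sum Finset.univ fun l _ => h k l).neg).congr
    (fun _ _ => rfl) fun _ v => ?_
  rw [bigPhase]
  push_cast
  rfl

lemma ϖP_le (ρ : ℝ) (k : BIdx d) (v : Big d) : growth v * ϖP k v ≤ ϖB ρ k v := by
  have h := (ϖB_pos ρ k v).le
  rcases k with (k | k) | (k | (k | k)) <;> simp only [ϖB, ϖP, mul_one, mul_zero] at h ⊢ <;>
    first | exact le_rfl | exact h

/-- The phase grows like `|u| |w|`, and so do its derivatives; the unimodular exponential is therefore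
an amplitude of order `0`, each derivative of which costs a factor `(1 + |u|)(1 + |w|)`. -/
lemma amp_exp_bigPhase (ρ : ℝ) {B : Config d → Fin d → Fin d → ℝ} (hB : IsMagneticField B) :
    Amp ρ 0 (fun v => Complex.exp (Complex.I * bigPhase B v)) := by
  have hφ := cl_bigPhase hB
  have hs : ContDiff ℝ ∞ (bigPhase B) :=
    Complex.reCLM.contDiff.comp (hφ.smooth ())
  refine ⟨0, (Cl.cexp (ι := Unit) (φ := fun _ => bigPhase B) (fun k v => (ϖB_pos ρ k v).le)
    (fun _ => hs) fun k => ?_).congr (fun _ v => by simp [wB]) fun _ _ => rfl⟩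
  refine (hφ.deriv k).mono ϖP_nonneg (fun k v => ?_) (fun _ v => mul_nonneg
    (zero_le_one.trans (one_le_growth v)) (ϖP_nonneg k v)) (M := 1) fun _ v => ?_
  · refine le_trans ?_ (ϖP_le ρ k v)
    exact le_mul_of_one_le_left (ϖP_nonneg k v) (one_le_growth v)
  · rw [one_mul]; exact ϖP_le ρ k v

/-- A symbol evaluated at a point whose position depends on `(x, u)` and whose momentum is
`ξ + ` part of `θ` is an amplitude of the same order. -/
lemma amp_comp_point {ρ m : ℝ} (hρ : ρ ∈ Set.Icc (0 : ℝ) 1) {f : Phase d → ℂ}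
    (hf : Cl (phaseBasis d) (ϖH ρ) (fun (_ : Unit) X => wH m X) (fun _ => f))
    (L : Big d →L[ℝ] Phase d) (A : Phase d →L[ℝ] Config d)
    (hA : ∀ θ, ‖A θ‖ ≤ ‖θ‖) (hL2 : ∀ v, (L v).2 = v.1.2 + A v.2.2.2)
    (hL1 : ∀ v, (∀ j, (L v).1 j = v.1.1 j + (L (0, (v.2.1, 0))).1 j))
    (hLu : ∀ i j, |(L (0, (phaseBasis d i, 0))).1 j| ≤ 1) :
    Amp ρ m (fun v => f (L v)) := by
  obtain ⟨N, hN⟩ := exists_nat_ge |m|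
  have hnθ : ∀ v : Big d, (1 : ℝ) ≤ 1 + ‖A v.2.2.2‖ := fun v => by linarith [norm_nonneg (A v.2.2.2)]
  have hnθ' : ∀ v : Big d, 1 + ‖A v.2.2.2‖ ≤ 1 + ‖v.2.2.2‖ := fun v => by linarith [hA v.2.2.2]
  -- here `ρ ≤ 1` bounds the loss in the inequality of Peetre by one power of `1 + |θ|`
  have hgain : ∀ v : Big d, japanese (L v).2 ^ (-ρ) ≤ gain ρ v := fun v => by
    rw [hL2]
    refine (japanese_add_rpow_le (-ρ) _ _).trans ?_
    rw [gain, mul_comm, abs_neg, abs_of_nonneg hρ.1]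
    refine mul_le_mul_of_nonneg_right ?_ (Real.rpow_pos_of_pos (japanese_pos _) _).le
    calc (1 + ‖A v.2.2.2‖) ^ ρ ≤ (1 + ‖A v.2.2.2‖) ^ (1 : ℝ) :=
          Real.rpow_le_rpow_of_exponent_le (hnθ v) hρ.2
      _ ≤ _ := by rw [Real.rpow_one]; exact hnθ' v
  have hc1 : ∀ i j : Fin d, |(A (phaseBasis d (Sum.inl i))) j| ≤ 1 := fun i j =>
    (abs_coord_le _ j).trans ((hA _).trans (by simp [basisVec, Prod.norm_def]))
  have hc2 : ∀ i j : Fin d, |(A (phaseBasis d (Sum.inr i))) j| ≤ 1 := fun i j =>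
    (abs_coord_le _ j).trans ((hA _).trans (by simp [basisVec, Prod.norm_def]))
  refine ⟨N, (hf.comp_affine (e' := bigBasis d) (ϖ' := ϖB ρ) (π := fun _ : Unit => ())
    (φ := fun _ v => L v) (L := fun _ => L) (fun k v => (ϖH_pos ρ k v).le)
    (fun k v => (ϖB_pos ρ k v).le) (fun _ v => (wH_pos m v).le) (fun _ v => L.hasFDerivAt)
    (c := fun _ K k => co k (L (bigBasis d K))) (fun _ K => phase_eq_sum _) (D := 1) ?_).mono_weight
      (fun k v => (ϖB_pos ρ k v).le) (fun _ v => (wH_pos m _).le) (M := 1) fun _ v => ?_⟩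
  · rintro - K k v
    rw [one_mul]
    have hK := (ϖB_pos ρ K v).le
    have hg1 := one_le_growth v
    have hj0 : 0 ≤ japanese (L v).2 ^ (-ρ) := (Real.rpow_pos_of_pos (japanese_pos _) _).le
    have hj1 : japanese (L v).2 ^ (-ρ) ≤ min 1 (gain ρ v) :=
      le_min (japanese_rpow_neg_le_one hρ.1 _) (hgain v)
    rcases k with j | j
    · simp only [co_inl, hL1 (bigBasis d K), ϖH, mul_one]
      rcases K with (i | i) | (i | ((i | i) | (i | i)))
      · have h0 : L ((0 : Phase d), ((0 : Phase d), (0 : Osp d))) = 0 := L.map_zero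
        simp only [bigBasis_inl, phaseBasis_inl, ϖB, Prod.fst_zero, h0]
        simpa using (abs_basisVec_le i j).trans hg1
      · have h0 : L ((0 : Phase d), ((0 : Phase d), (0 : Osp d))) = 0 := L.map_zero
        simpa [h0] using hK
      · simp only [bigBasis_inr_inl, ϖB]
        simpa using (hLu i j).trans hg1
      all_goals
        have h0 : L ((0 : Phase d), ((0 : Phase d), (0 : Osp d))) = 0 := L.map_zero
        simpa [h0] using hK
    · change |(L (bigBasis d K)).2 j| * japanese (L v).2 ^ (-ρ) ≤ _
      rw [hL2 (bigBasis d K)]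
      generalize japanese (L v).2 ^ (-ρ) = J at hj0 hj1 ⊢
      rcases K with (i | i) | (i | ((i | i) | (i | i)))
      · simpa using hK
      · simp only [bigBasis_inl, phaseBasis_inr, ϖB]
        have := hj1.trans (min_le_right _ _)
        calc _ ≤ 1 * J :=
              mul_le_mul_of_nonneg_right (by simpa using abs_basisVec_le i j) hj0
          _ ≤ _ := by rw [one_mul]; exact this
      · simpa using hK
      · simpa using hK
      · simpa using hK
      · simp only [bigBasis_inr_inr, ospBasis_inr, ϖB]
        calc _ ≤ 1 * J :=
              mul_le_mul_of_nonneg_right (by simpa using hc1 i j) hj0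
          _ ≤ _ := by rw [one_mul]; exact hj1
      · simp only [bigBasis_inr_inr, ospBasis_inr, ϖB]
        calc _ ≤ 1 * J :=
              mul_le_mul_of_nonneg_right (by simpa using hc2 i j) hj0
          _ ≤ _ := by rw [one_mul]; exact hj1
  · rw [one_mul, wH, hL2, wB, mul_comm]
    refine (japanese_add_rpow_le m _ _).trans ?_
    refine mul_le_mul_of_nonneg_left ?_ (Real.rpow_pos_of_pos (japanese_pos _) _).le
    calc (1 + ‖A v.2.2.2‖) ^ |m| ≤ (1 + ‖A v.2.2.2‖) ^ (N : ℝ) :=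
          Real.rpow_le_rpow_of_exponent_le (hnθ v) hN
      _ = (1 + ‖A v.2.2.2‖) ^ N := Real.rpow_natCast _ _
      _ ≤ (growth v * (1 + ‖v.2.2.2‖)) ^ N := by
          refine pow_le_pow_left₀ (by linarith [hnθ v]) ((hnθ' v).trans ?_) N
          exact le_mul_of_one_le_left (by positivity) (one_le_growth v)

/-- The projection to `X`. -/
def prX (d : ℕ) : Big d →L[ℝ] Phase d := ContinuousLinearMap.fst ℝ (Phase d) (Phase d × Osp d)

/-- The projection to `u`. -/
def prU (d : ℕ) : Big d →L[ℝ] Phase d :=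
  (ContinuousLinearMap.fst ℝ (Phase d) (Osp d)).comp
    (ContinuousLinearMap.snd ℝ (Phase d) (Phase d × Osp d))

/-- The projection to `θ`. -/
def prθ (d : ℕ) : Big d →L[ℝ] Phase d :=
  (ContinuousLinearMap.snd ℝ (Phase d) (Phase d)).comp
    ((ContinuousLinearMap.snd ℝ (Phase d) (Osp d)).comp
      (ContinuousLinearMap.snd ℝ (Phase d) (Phase d × Osp d)))

/-- `pointL` as a linear map. -/
def pointLCLM (d : ℕ) : Big d →L[ℝ] Phase d :=
  ContinuousLinearMap.prod
    ((ContinuousLinearMap.fst ℝ (Config d) (Config d)).comp (prX d) -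
      (1 / 2 : ℝ) • (ContinuousLinearMap.snd ℝ (Config d) (Config d)).comp (prU d))
    ((ContinuousLinearMap.snd ℝ (Config d) (Config d)).comp (prX d) +
      (ContinuousLinearMap.fst ℝ (Config d) (Config d)).comp (prθ d))

/-- `pointR` as a linear map. -/
def pointRCLM (d : ℕ) : Big d →L[ℝ] Phase d :=
  ContinuousLinearMap.prod
    ((ContinuousLinearMap.fst ℝ (Config d) (Config d)).comp (prX d) +
      (1 / 2 : ℝ) • (ContinuousLinearMap.fst ℝ (Config d) (Config d)).comp (prU d))
    ((ContinuousLinearMap.snd ℝ (Config d) (Config d)).comp (prX d) +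
      (ContinuousLinearMap.snd ℝ (Config d) (Config d)).comp (prθ d))

lemma pointLCLM_apply (v : Big d) : pointLCLM d v = pointL v := rfl

lemma pointRCLM_apply (v : Big d) : pointRCLM d v = pointR v := rfl

variable {ρ m₁ m₂ : ℝ} {f g : Phase d → ℂ} {B : Config d → Fin d → Fin d → ℝ}

/-- The amplitude of the product of two symbols. -/
lemma amp_bigAmp (hB : IsMagneticField B) (hρ : ρ ∈ Set.Icc (0 : ℝ) 1)
    (hf : Cl (phaseBasis d) (ϖH ρ) (fun (_ : Unit) X => wH m₁ X) (fun _ => f))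
    (hg : Cl (phaseBasis d) (ϖH ρ) (fun (_ : Unit) X => wH m₂ X) (fun _ => g)) :
    Amp ρ (m₁ + m₂) (bigAmp B f g) := by
  have h1 : Amp ρ m₁ (fun v => f (pointL v)) := by
    refine amp_comp_point hρ hf (pointLCLM d) (ContinuousLinearMap.fst ℝ _ _) norm_fst_le
      (fun v => rfl) (fun v j => ?_) (fun i j => ?_)
    · simp [pointLCLM_apply, pointL]; ring
    · rcases i with i | i
      · simp [pointLCLM_apply, pointL]
      · have := abs_basisVec_le i j
        simp [pointLCLM_apply, pointL, abs_mul]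
        linarith
  have h2 : Amp ρ m₂ (fun v => g (pointR v)) := by
    refine amp_comp_point hρ hg (pointRCLM d) (ContinuousLinearMap.snd ℝ _ _) norm_snd_le
      (fun v => rfl) (fun v j => ?_) (fun i j => ?_)
    · simp [pointRCLM_apply, pointR]
    · rcases i with i | i
      · have := abs_basisVec_le i j
        simp [pointRCLM_apply, pointR, abs_mul]
        linarith
      · simp [pointRCLM_apply, pointR]
  have h3 := (amp_exp_bigPhase ρ hB).mul (h1.mul h2)
  rw [zero_add] at h3
  exact h3

end Amplitude

/-! ### Existence of the product -/

section Existence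

open MeasureTheory

/-- Bounds on the derivatives along words in a basis control the full iterated derivatives. -/
lemma Cl.norm_iteratedFDeriv_le {V κ ι : Type*} [NormedAddCommGroup V] [NormedSpace ℝ V]
    [FiniteDimensional ℝ V] [Fintype κ] (b : Module.Basis κ ℝ V) {W : ι → V → ℝ} {a : ι → V → ℂ}
    (ha : Cl b (fun _ _ => 1) W a) (n : ℕ) :
    ∃ C : ℝ, ∀ i v, ‖iteratedFDeriv ℝ n (a i) v‖ ≤ C * W i v := by
  induction n generalizing a with
  | zero =>
    obtain ⟨C, hC⟩ := ha.bound_zero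
    exact ⟨C, fun i v => by rw [norm_iteratedFDeriv_zero]; exact hC i v⟩
  | succ n ih =>
    choose C hC using fun k => ih ((ha.deriv k).congr (fun _ _ => mul_one _) fun _ _ => rfl)
    let L : κ → ℂ →L[ℝ] (V →L[ℝ] ℂ) := fun k =>
      ContinuousLinearMap.smulRightL ℝ V ℂ (LinearMap.toContinuousLinearMap (b.coord k))
    refine ⟨∑ k, ‖L k‖ * C k, fun i v => ?_⟩
    have hs : ∀ k, ContDiff ℝ ∞ (dd (b k) (a i)) := fun k => contDiff_dd (ha.smooth i) _
    have hf : fderiv ℝ (a i) = fun w => ∑ k, (L k ∘ dd (b k) (a i)) w := by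
      funext w
      rw [clm_eq_sum_basis b (fderiv ℝ (a i) w)]
      rfl
    have hn : ((n : ℕ) : WithTop ℕ∞) ≤ ∞ := by exact_mod_cast le_top
    have hLs : ∀ k ∈ Finset.univ, ContDiff ℝ n (L k ∘ dd (b k) (a i)) := fun k _ =>
      (L k).contDiff.comp ((hs k).of_le hn)
    rw [← norm_iteratedFDeriv_fderiv, hf, iteratedFDeriv_sum hLs, Finset.sum_apply, Finset.sum_mul]
    refine (norm_sum_le _ _).trans (Finset.sum_le_sum fun k _ => ?_)
    rw [mul_assoc]
    exact ((L k).norm_iteratedFDeriv_comp_left (hs k).contDiffAt hn).trans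
      (mul_le_mul_of_nonneg_left (hC k i v) (norm_nonneg _))

/-- A function all of whose derivatives decay faster than any power is a Schwartz function. -/
lemma exists_schwartz_of_cl {V κ : Type*} [NormedAddCommGroup V] [NormedSpace ℝ V]
    [FiniteDimensional ℝ V] [Fintype κ] (b : Module.Basis κ ℝ V) {f : V → ℂ}
    (hf : ∀ N : ℕ, Cl b (fun _ _ => 1) (fun (_ : Unit) v => ((1 + ‖v‖) ^ N)⁻¹) (fun _ => f)) :
    ∃ F : 𝓢(V, ℂ), ⇑F = f := by
  refine ⟨⟨f, (hf 0).smooth (), fun k n => ?_⟩, rfl⟩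
  obtain ⟨C, hC⟩ := (hf k).norm_iteratedFDeriv_le b n
  refine ⟨C, fun x => ?_⟩
  have h := hC () x
  have hx := norm_nonneg x
  have hp : 0 < (1 + ‖x‖) ^ k := by positivity
  calc ‖x‖ ^ k * ‖iteratedFDeriv ℝ n f x‖ ≤ (1 + ‖x‖) ^ k * (C * ((1 + ‖x‖) ^ k)⁻¹) :=
        mul_le_mul (pow_le_pow_left₀ hx (by linarith) k) h (norm_nonneg _) hp.le
    _ = C := by field_simp

variable {d : ℕ} {ρ m m₁ m₂ : ℝ} {f g : Phase d → ℂ} {B : Config d → Fin d → Fin d → ℝ}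

lemma exists_wH_le_pow (m : ℝ) : ∃ M : ℕ, ∀ X : Phase d, wH m X ≤ (1 + ‖X‖) ^ M := by
  obtain ⟨M, hM⟩ := exists_nat_ge |m|
  refine ⟨M, fun X => ?_⟩
  have h := japanese_add_rpow_le m 0 X.2
  have h0 : japanese (0 : Config d) = 1 := by simp [japanese]
  rw [zero_add, h0, Real.one_rpow, one_mul] at h
  have h1 : (1 : ℝ) ≤ 1 + ‖X.2‖ := by linarith [norm_nonneg X.2]
  calc wH m X ≤ (1 + ‖X.2‖) ^ |m| := h
    _ ≤ (1 + ‖X.2‖) ^ (M : ℝ) := Real.rpow_le_rpow_of_exponent_le h1 hM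
    _ = (1 + ‖X.2‖) ^ M := Real.rpow_natCast _ _
    _ ≤ _ := pow_le_pow_left₀ (by linarith) (by linarith [norm_snd_le X]) M

lemma ϖH_le_one (hρ : 0 ≤ ρ) (k : PIdx d) (X : Phase d) : ϖH ρ k X ≤ 1 := by
  cases k
  · exact le_rfl
  · exact japanese_rpow_neg_le_one hρ _

/-- A symbol times a scaled Schwartz function is a Schwartz function. -/
lemma exists_schwartz_cutoff (hρ : 0 ≤ ρ)
    (hf : Cl (phaseBasis d) (ϖH ρ) (fun (_ : Unit) X => wH m X) (fun _ => f))
    (χ : 𝓢(Phase d, ℂ)) {δ : ℝ} (hδ : δ ∈ Set.Ioc (0 : ℝ) 1) :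
    ∃ F : 𝓢(Phase d, ℂ), ⇑F = fun W => χ (δ • W) * f W := by
  obtain ⟨M, hM⟩ := exists_wH_le_pow (d := d) m
  refine exists_schwartz_of_cl (phaseBasis d) fun N => ?_
  have h1 := (cl_scaled (phaseBasis d) χ (N + M)).reindex
    (fun _ : Unit => (⟨δ, hδ.1.le, hδ.2⟩ : Set.Icc (0 : ℝ) 1))
  have h2 : Cl (phaseBasis d) (fun _ _ => 1) (fun (_ : Unit) X => wH m X) (fun _ => f) :=
    hf.mono (fun k v => (ϖH_pos ρ k v).le) (ϖH_le_one hρ) (fun _ v => (wH_pos m v).le) (M := 1)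
      fun _ _ => by rw [one_mul]
  refine (h1.mul h2).mono_weight (fun _ _ => zero_le_one)
    (fun _ v => mul_nonneg (by positivity) (wH_pos m v).le) (M := (δ ^ (N + M))⁻¹) fun _ v => ?_
  have hδ0 := hδ.1
  have h3 : δ * (1 + ‖v‖) ≤ 1 + ‖δ • v‖ := by
    rw [norm_smul, Real.norm_eq_abs, abs_of_pos hδ.1]; linarith [hδ.2]
  calc ((1 + ‖δ • v‖) ^ (N + M))⁻¹ * wH m v
      ≤ ((δ * (1 + ‖v‖)) ^ (N + M))⁻¹ * (1 + ‖v‖) ^ M := by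
        refine mul_le_mul ?_ (hM v) (wH_pos m v).le (by positivity)
        exact inv_anti₀ (by positivity) (pow_le_pow_left₀ (by positivity) h3 _)
    _ = (δ ^ (N + M))⁻¹ * ((1 + ‖v‖) ^ N)⁻¹ := by
        rw [mul_pow, pow_add (1 + ‖v‖)]
        field_simp

/-- A scaled Schwartz function at a point depending affinely on `(w, θ)`, with bounds uniform
in the scaling. -/
lemma cl_scaled_point (χ : 𝓢(Phase d, ℂ)) (N : ℕ) {φ : Osp d → Phase d} {L : Osp d →L[ℝ] Phase d}
    (hφ : ∀ s, HasFDerivAt φ L s) :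
    Cl (ospBasis d) ϖS (fun (δ : Set.Icc (0 : ℝ) 1) s => ((1 + ‖(δ : ℝ) • φ s‖) ^ N)⁻¹)
      (fun δ s => χ ((δ : ℝ) • φ s)) := by
  have h0 : ∀ J k, |co k (L (ospBasis d J))| ≤ ∑ J, ‖L (ospBasis d J)‖ := fun J k =>
    (abs_co_le k _).trans (Finset.single_le_sum (f := fun J => ‖L (ospBasis d J)‖)
      (fun J _ => norm_nonneg _) (Finset.mem_univ J))
  exact (cl_scaled (phaseBasis d) χ N).comp_affine (e' := ospBasis d) (ϖ' := ϖS) (π := id)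
    (φ := fun _ => φ) (L := fun _ => L) (fun _ _ => zero_le_one) ϖS_nonneg
    (fun _ _ => by positivity) (fun _ => hφ) (c := fun _ J k => co k (L (ospBasis d J)))
    (fun _ J => phase_eq_sum _) (D := ∑ J, ‖L (ospBasis d J)‖) fun _ J k s => by
      rw [mul_one]
      exact (h0 J k).trans (le_mul_of_one_le_right (Finset.sum_nonneg fun _ _ => norm_nonneg _)
        (one_le_ϖS J s))

/-- For `ε > 0` the two points at which the factors are evaluated control all integration variables,
so that cut-offs of the factors cut off the integrand. This fails for `ε = 0`, where the points do
not depend on `w`. -/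
lemma norm_le_pointL_pointR {ε : ℝ} (hε : 0 < ε) (hε1 : ε ≤ 1) (X : Phase d) (s : Osp d) :
    ‖s‖ ≤ 2 / ε * (‖pointL (atPar (ε, X) s)‖ + ‖pointR (atPar (ε, X) s)‖ + ‖X‖) := by
  set p := pointL (atPar (ε, X) s)
  set q := pointR (atPar (ε, X) s)
  have hX1 := norm_fst_le X
  have hX2 := norm_snd_le X
  have hp1 := norm_fst_le p
  have hp2 := norm_snd_le p
  have hq1 := norm_fst_le q
  have hq2 := norm_snd_le q
  have h2 : 2 ≤ 2 / ε := by rw [le_div_iff₀ hε]; linarith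
  have hS : ‖p‖ + ‖q‖ + ‖X‖ ≤ 2 / ε * (‖p‖ + ‖q‖ + ‖X‖) :=
    le_mul_of_one_le_left (by positivity) (by linarith)
  have hmul : ∀ (v a b : Config d), (ε / 2) • v = a - b →
      ‖v‖ ≤ 2 / ε * (‖a‖ + ‖b‖) := by
    intro v a b h
    have : v = (2 / ε) • (a - b) := by
      rw [← h, smul_smul]; field_simp; rw [one_smul]
    rw [this, norm_smul, Real.norm_eq_abs, abs_of_pos (by positivity)]
    exact mul_le_mul_of_nonneg_left (norm_sub_le _ _) (by positivity)
  have hy := hmul s.1.1 q.1 X.1 (by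
    simp only [q, pointR, atPar, Prod.smul_fst, smul_smul]; rw [add_sub_cancel_left]; congr 1; ring)
  have hz := hmul s.1.2 X.1 p.1 (by
    simp only [p, pointL, atPar, Prod.smul_snd, smul_smul]; rw [sub_sub_cancel]; congr 1; ring)
  have hη : ‖s.2.1‖ ≤ ‖p.2‖ + ‖X.2‖ := by
    have : s.2.1 = p.2 - X.2 := by simp [p, pointL, atPar]
    rw [this]; exact norm_sub_le _ _
  have hζ : ‖s.2.2‖ ≤ ‖q.2‖ + ‖X.2‖ := by
    have : s.2.2 = q.2 - X.2 := by simp [q, pointR, atPar]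
    rw [this]; exact norm_sub_le _ _
  have hp0 := norm_nonneg p
  have hq0 := norm_nonneg q
  have hmon : ∀ t, t ≤ ‖p‖ + ‖q‖ + ‖X‖ → 2 / ε * t ≤ 2 / ε * (‖p‖ + ‖q‖ + ‖X‖) := fun t ht =>
    mul_le_mul_of_nonneg_left ht (by positivity)
  rw [Prod.norm_def, Prod.norm_def, Prod.norm_def]
  refine max_le (max_le ?_ ?_) (max_le ?_ ?_)
  · exact hy.trans (hmon _ (by linarith))
  · exact hz.trans (hmon _ (by linarith))
  · linarith
  · linarith

lemma continuous_scaledFlux (hB : IsMagneticField B) {ε : ℝ} (hε : ε ≠ 0) (x : Config d) :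
    Continuous fun w : Phase d => scaledFlux ε B x w.1 w.2 := by
  have h : ∀ k l, Continuous fun w : Phase d => fluxDensity B k l x (ε • (w.1, w.2)) := by
    intro k l
    have h1 := Complex.continuous_re.comp ((cl_fluxDensity hB k l).smooth ()).continuous
    have h2 : Continuous fun w : Phase d => (((x, 0), (ε • (w.1, w.2), 0)) : Big d) := by fun_prop
    exact h1.comp h2
  simp_rw [scaledFlux_eq hB hε]
  exact continuous_finsetSum _ fun k _ => continuous_finsetSum _ fun l _ =>
    (by fun_prop : Continuous fun w : Phase d => ε * w.1 k * w.2 l).mul (h k l)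

/-- The product of two symbols exists as an oscillatory integral, with the amplitude `bigAmp`. -/
lemma hasMagneticWeylProduct (hB : IsMagneticField B) (hρ : ρ ∈ Set.Icc (0 : ℝ) 1)
    (hf : Cl (phaseBasis d) (ϖH ρ) (fun (_ : Unit) X => wH m₁ X) (fun _ => f))
    (hg : Cl (phaseBasis d) (ϖH ρ) (fun (_ : Unit) X => wH m₂ X) (fun _ => g))
    {ε : ℝ} (hε : 0 < ε) (hε1 : ε ≤ 1) (X : Phase d) :
    HasMagneticWeylProduct ε 1 B f g X
      ((((2 * Real.pi) ^ (2 * d))⁻¹ : ℝ) * oscFam (bigAmp B f g) (ε, X)) := by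
  intro χ₁ χ₂ hχ₁ hχ₂
  obtain ⟨N, hN⟩ := (amp_bigAmp hB hρ hf hg).isAmp
  have ha := hN (ε, X)
  set φ : Osp d → Phase d := fun s => pointL (atPar (ε, X) s) with hφ
  set ψ : Osp d → Phase d := fun s => pointR (atPar (ε, X) s) with hψ
  have hφd : ∀ s, HasFDerivAt φ _ s := fun s =>
    (pointLCLM d).hasFDerivAt.comp s (hasFDerivAt_atPar (ε, X) s)
  have hψd : ∀ s, HasFDerivAt ψ _ s := fun s =>
    (pointRCLM d).hasFDerivAt.comp s (hasFDerivAt_atPar (ε, X) s)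
  have hφs : ContDiff ℝ ∞ φ := by
    simp only [hφ, pointL, atPar]; fun_prop
  have hψs : ContDiff ℝ ∞ ψ := by
    simp only [hψ, pointR, atPar]; fun_prop
  set a : Osp d → ℂ := fun s => bigAmp B f g (atPar (ε, X) s) with hadef
  set b : ℝ → Osp d → ℂ := fun δ s => a s * (χ₁ (δ • φ s) * χ₂ (δ • ψ s)) with hb
  -- `K = 0` gives the bounds uniform in `δ`, large `K` the decay for fixed `δ > 0`
  have hcl : ∀ K : ℕ, Cl (ospBasis d) ϖS
      (fun (δ : Set.Icc (0 : ℝ) 1) s => ((1 + ‖(δ : ℝ) • φ s‖) ^ K)⁻¹ *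
        ((1 + ‖(δ : ℝ) • ψ s‖) ^ K)⁻¹)
      (fun δ s => χ₁ ((δ : ℝ) • φ s) * χ₂ ((δ : ℝ) • ψ s)) := fun K =>
    (cl_scaled_point χ₁ K hφd).mul (cl_scaled_point χ₂ K hψd)
  -- the points `φ s`, `ψ s` control `s`, so the product of the cut-offs decreases rapidly in `s`
  have hrapid : ∀ δ ∈ Set.Ioc (0 : ℝ) 1, Rapid (b δ) := by
    intro δ hδ
    refine Rapid.mul_cl (b := fun s => χ₁ (δ • φ s) * χ₂ (δ • ψ s)) (fun K => ?_) ha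
    set D : ℝ := 1 + 2 / ε * (δ⁻¹ + ‖X‖) with hD
    have hδ0 := hδ.1
    have hD0 : 0 < D := by positivity
    have hbase : ∀ s : Osp d, 1 + ‖s‖ ≤ D * ((1 + ‖δ • φ s‖) * (1 + ‖δ • ψ s‖)) := by
      intro s
      have h1 := norm_le_pointL_pointR hε hε1 X s
      have h2 : ∀ v : Phase d, ‖v‖ = δ⁻¹ * ‖δ • v‖ := fun v => by
        rw [norm_smul, Real.norm_eq_abs, abs_of_pos hδ0, inv_mul_cancel_left₀ hδ0.ne']
      rw [h2 (pointL _), h2 (pointR _)] at h1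
      set A := ‖δ • φ s‖
      set E := ‖δ • ψ s‖
      have hA : 0 ≤ A := norm_nonneg _
      have hE : 0 ≤ E := norm_nonneg _
      have hX : 0 ≤ ‖X‖ := norm_nonneg _
      have hT : A + E ≤ (1 + A) * (1 + E) := by nlinarith [mul_nonneg hA hE]
      have hT1 : 1 ≤ (1 + A) * (1 + E) := by nlinarith [mul_nonneg hA hE]
      calc 1 + ‖s‖ ≤ 1 + 2 / ε * (δ⁻¹ * A + δ⁻¹ * E + ‖X‖) := by linarith
        _ = 1 + 2 / ε * (δ⁻¹ * (A + E) + ‖X‖ * 1) := by ring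
        _ ≤ (1 + A) * (1 + E) + 2 / ε * (δ⁻¹ * ((1 + A) * (1 + E)) + ‖X‖ * ((1 + A) * (1 + E))) := by
            gcongr
        _ = _ := by rw [hD]; ring
    have h := (hcl (2 * K)).reindex (fun _ : Unit => (⟨δ, hδ.1.le, hδ.2⟩ : Set.Icc (0 : ℝ) 1))
    refine h.mono_weight ϖS_nonneg (fun _ s => by positivity) (M := D ^ (2 * K)) fun _ s => ?_
    have hw : wS K s ≤ (1 + ‖s‖) ^ (2 * K) := by
      rw [wS, pow_mul]
      exact pow_le_pow_left₀ (by positivity) (base_le_norm_sq s) K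
    change ((1 + ‖δ • φ s‖) ^ (2 * K))⁻¹ * ((1 + ‖δ • ψ s‖) ^ (2 * K))⁻¹ ≤ _
    rw [← mul_inv, ← mul_pow, ← div_eq_mul_inv, inv_le_comm₀ (by positivity)
      (div_pos (by positivity) (wS_pos K s)), inv_div, div_le_iff₀ (by positivity), ← mul_pow]
    refine hw.trans (pow_le_pow_left₀ (by positivity) ?_ _)
    rw [mul_comm]; exact hbase s
  have hsm : ContDiff ℝ ∞ (Function.uncurry b) := by
    have h1 : ∀ (χ : 𝓢(Phase d, ℂ)) {φ : Osp d → Phase d}, ContDiff ℝ ∞ φ →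
        ContDiff ℝ ∞ fun p : ℝ × Osp d => χ (p.1 • φ p.2) := fun χ φ hφ =>
      (χ.smooth ⊤).comp (contDiff_fst.smul (hφ.comp contDiff_snd))
    exact (ha.smooth.comp contDiff_snd).mul ((h1 χ₁ hφs).mul (h1 χ₂ hψs))
  have hlim := tendsto_osc (b := b) (N := N) hsm ?_ hrapid
  · have hb0 : b 0 = a := by
      funext s; simp [hb, hχ₁, hχ₂]
    rw [hb0] at hlim
    refine (hlim.const_mul ((((2 * Real.pi) ^ (2 * d))⁻¹ : ℝ) : ℂ)).congr' ?_
    filter_upwards [eventually_Ioc] with δ hδ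
    obtain ⟨F, hF⟩ := exists_schwartz_cutoff hρ.1 hf χ₁ hδ
    obtain ⟨G, hG⟩ := exists_schwartz_cutoff hρ.1 hg χ₂ hδ
    have hk : ∀ s, kernelAmp ε 1 B F G X s = b δ s := by
      intro s
      rw [kernelAmp_eq hB hε.ne', bigAmp, hF, hG]
      simp only [hb, hadef, bigAmp, hφ, hψ]
      ring
    rw [← hF, ← hG, weylIntegral_eq ε 1 B F G X (continuous_scaledFlux hB hε.ne' X.1)]
    · simp_rw [hk]
    · simp_rw [hk]
      exact integrable_ek_mul (hrapid δ hδ).integrable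
  · have h := (Cl.reindex ha (fun _ : Set.Icc (0 : ℝ) 1 => ())).mul (hcl 0)
    exact h.congr (fun _ s => by simp) fun _ _ => rfl

lemma HasMagneticWeylProduct.unique {ε lam : ℝ} {X : Phase d} {v v' : ℂ}
    (h : HasMagneticWeylProduct ε lam B f g X v) (h' : HasMagneticWeylProduct ε lam B f g X v') :
    v = v' := by
  obtain ⟨χ, hχ⟩ := exists_schwartz_one (Phase d)
  exact tendsto_nhds_unique (h χ χ hχ hχ) (h' χ χ hχ hχ)

lemma HasMagneticWeylProduct.magneticWeylProduct_eq {ε lam : ℝ} {X : Phase d} {v : ℂ}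
    (h : HasMagneticWeylProduct ε lam B f g X v) : magneticWeylProduct ε lam B f g X = v := by
  have hex : ∃ v, HasMagneticWeylProduct ε lam B f g X v := ⟨v, h⟩
  rw [magneticWeylProduct, dif_pos hex]
  exact hex.choose_spec.unique h

end Existence

/-! ### Multi-indices and words -/

section Words

variable {d : ℕ}

lemma wd_perm {V κ : Type*} [NormedAddCommGroup V] [NormedSpace ℝ V] (e : κ → V) {l l' : List κ}
    (h : l.Perm l') {f : V → ℂ} (hf : ContDiff ℝ ∞ f) : wd e l f = wd e l' f := by
  induction h generalizing f with
  | nil => rfl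
  | cons k _ ih => exact ih (contDiff_dd hf _)
  | swap k k' l => simp only [wd]; rw [dd_comm hf]
  | trans _ _ ih₁ ih₂ => exact (ih₁ hf).trans (ih₂ hf)

/-- The derived equality test on a sum type is lawful; needed to count letters of words. -/
instance {α β : Type*} [BEq α] [BEq β] [LawfulBEq α] [LawfulBEq β] : LawfulBEq (α ⊕ β) where
  rfl {a} := by
    cases a with
    | inl a => exact beq_self_eq_true a
    | inr a => exact beq_self_eq_true a
  eq_of_beq {a b} h := by
    cases a <;> cases b
    · exact congrArg _ (eq_of_beq h)
    · cases h
    · cases h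
    · exact congrArg _ (eq_of_beq h)

/-- The word whose derivative is `∂_x^a ∂_ξ^α`. -/
def word (a α : Fin d → ℕ) : List (PIdx d) :=
  ((List.finRange d).reverse.flatMap fun i => List.replicate (α i) (Sum.inr i)) ++
    (List.finRange d).reverse.flatMap fun i => List.replicate (a i) (Sum.inl i)

lemma iterate_eq_wd {V κ : Type*} [NormedAddCommGroup V] [NormedSpace ℝ V] (e : κ → V) (k : κ)
    (n : ℕ) (f : V → ℂ) : (dd (e k))^[n] f = wd e (List.replicate n k) f := by
  induction n generalizing f with
  | zero => rfl
  | succ n ih => rw [Function.iterate_succ_apply, ih]; rfl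

lemma foldr_eq_wd {V κ ι : Type*} [NormedAddCommGroup V] [NormedSpace ℝ V] (e : κ → V) (j : ι → κ)
    (n : ι → ℕ) (L : List ι) (f : V → ℂ) :
    L.foldr (fun i h => (dd (e (j i)))^[n i] h) f =
      wd e (L.reverse.flatMap fun i => List.replicate (n i) (j i)) f := by
  induction L with
  | nil => rfl
  | cons i L ih =>
    rw [List.foldr_cons, ih, List.reverse_cons, List.flatMap_append, wd_append, iterate_eq_wd]
    simp

lemma partialDeriv_eq_wd (a α : Fin d → ℕ) (f : Phase d → ℂ) :
    partialDeriv a α f = wd (phaseBasis d) (word a α) f := by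
  have h1 : ∀ i, derivPos (d := d) i = dd (phaseBasis d (Sum.inl i)) := fun i => by
    rw [phaseBasis_inl]; rfl
  have h2 : ∀ i, derivMom (d := d) i = dd (phaseBasis d (Sum.inr i)) := fun i => by
    rw [phaseBasis_inr]; rfl
  rw [partialDeriv, word, wd_append]
  simp only [h1, h2]
  rw [foldr_eq_wd (phaseBasis d) Sum.inl a, foldr_eq_wd (phaseBasis d) Sum.inr α]

lemma count_flatMap_replicate {κ : Type*} [BEq κ] [LawfulBEq κ] (j : Fin d → κ)
    (hj : Function.Injective j) (n : Fin d → ℕ) (i : Fin d) :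
    List.count (j i) ((List.finRange d).reverse.flatMap fun i => List.replicate (n i) (j i)) =
      n i := by
  rw [List.count_flatMap, List.map_reverse, List.sum_reverse, ← Fin.sum_univ_def]
  simp [List.count_replicate, hj.eq_iff]

lemma count_flatMap_replicate_of_ne {κ : Type*} [BEq κ] [LawfulBEq κ] (j : Fin d → κ) (k : κ)
    (hk : ∀ i, j i ≠ k) (n : Fin d → ℕ) :
    List.count k ((List.finRange d).reverse.flatMap fun i => List.replicate (n i) (j i)) = 0 := by
  rw [List.count_eq_zero]
  simp only [List.mem_flatMap, List.mem_replicate, not_exists, not_and]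
  exact fun i _ _ h => hk i h.symm

lemma count_word_inl (a α : Fin d → ℕ) (i : Fin d) : (word a α).count (Sum.inl i) = a i := by
  rw [word, List.count_append, count_flatMap_replicate_of_ne Sum.inr _ (by simp),
    count_flatMap_replicate Sum.inl Sum.inl_injective, zero_add]

lemma count_word_inr (a α : Fin d → ℕ) (i : Fin d) : (word a α).count (Sum.inr i) = α i := by
  rw [word, List.count_append, count_flatMap_replicate_of_ne Sum.inl _ (by simp),
    count_flatMap_replicate Sum.inr Sum.inr_injective, add_zero]

lemma wd_eq_partialDeriv (l : List (PIdx d)) {f : Phase d → ℂ} (hf : ContDiff ℝ ∞ f) :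
    wd (phaseBasis d) l f = partialDeriv (fun i => l.count (Sum.inl i))
      (fun i => l.count (Sum.inr i)) f := by
  rw [partialDeriv_eq_wd]
  refine wd_perm _ (List.perm_iff_count.2 fun k => ?_) hf
  cases k
  · rw [count_word_inl]
  · rw [count_word_inr]

lemma partialDeriv_derivPos (a α : Fin d → ℕ) (j : Fin d) {f : Phase d → ℂ}
    (hf : ContDiff ℝ ∞ f) :
    partialDeriv a α (derivPos j f) = partialDeriv (a + Pi.single j 1) α f := by
  rw [partialDeriv_eq_wd, partialDeriv_eq_wd]
  have : derivPos j f = dd (phaseBasis d (Sum.inl j)) f := by rw [phaseBasis_inl]; rfl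
  rw [this]
  change wd (phaseBasis d) (Sum.inl j :: word a α) f = _
  refine wd_perm _ (List.perm_iff_count.2 fun k => ?_) hf
  rcases k with i | i
  · rw [List.count_cons, count_word_inl, count_word_inl]
    by_cases h : j = i
    · subst h; simp
    · simp [h, Ne.symm h]
  · rw [List.count_cons, count_word_inr, count_word_inr]
    simp

lemma partialDeriv_derivMom (a α : Fin d → ℕ) (j : Fin d) {f : Phase d → ℂ}
    (hf : ContDiff ℝ ∞ f) :
    partialDeriv a α (derivMom j f) = partialDeriv a (α + Pi.single j 1) f := by
  rw [partialDeriv_eq_wd, partialDeriv_eq_wd]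
  have : derivMom j f = dd (phaseBasis d (Sum.inr j)) f := by rw [phaseBasis_inr]; rfl
  rw [this]
  change wd (phaseBasis d) (Sum.inr j :: word a α) f = _
  refine wd_perm _ (List.perm_iff_count.2 fun k => ?_) hf
  rcases k with i | i
  · rw [List.count_cons, count_word_inl, count_word_inl]
    simp
  · rw [List.count_cons, count_word_inr, count_word_inr]
    by_cases h : j = i
    · subst h; simp
    · simp [h, Ne.symm h]

lemma prod_ϖH (ρ : ℝ) (l : List (PIdx d)) (X : Phase d) :
    (l.map fun k => ϖH ρ k X).prod = (japanese X.2 ^ (-ρ)) ^ (∑ i, l.count (Sum.inr i)) := by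
  induction l with
  | nil => simp
  | cons k l ih =>
    rw [List.map_cons, List.prod_cons, ih]
    rcases k with j | j
    · simp [ϖH]
    · have : ∑ i, (Sum.inr j :: l).count (Sum.inr i) = ∑ i, l.count (Sum.inr i) + 1 := by
        simp [List.count_cons, Finset.sum_add_distrib]
      rw [this, pow_succ, mul_comm]
      rfl

lemma wH_mul_prod_ϖH (ρ m : ℝ) (l : List (PIdx d)) (X : Phase d) :
    wH m X * (l.map fun k => ϖH ρ k X).prod =
      japanese X.2 ^ (m - ((∑ i, l.count (Sum.inr i) : ℕ) : ℝ) * ρ) := by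
  rw [prod_ϖH, wH, ← Real.rpow_natCast, ← Real.rpow_mul (japanese_pos _).le,
    ← Real.rpow_add (japanese_pos _)]
  congr 1; ring

variable {ρ m : ℝ} {f : Phase d → ℂ}

/-- Bounding the derivatives for all multi-indices is the same as bounding those along all words in
the coordinate directions, by the symmetry of iterated derivatives. -/
lemma isHormander_iff_cl : IsHormander d ρ m f ↔
    Cl (phaseBasis d) (ϖH ρ) (fun (_ : Unit) X => wH m X) (fun _ => f) := by
  constructor
  · rintro ⟨hs, hb⟩
    refine ⟨fun _ => hs, fun l => ?_⟩
    obtain ⟨C, hC⟩ := hb (fun i => l.count (Sum.inl i)) (fun i => l.count (Sum.inr i))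
    exact ⟨C, fun _ X => by rw [wd_eq_partialDeriv l hs, wH_mul_prod_ϖH]; exact hC X⟩
  · intro h
    refine ⟨h.smooth (), fun a α => ?_⟩
    obtain ⟨C, hC⟩ := h.bound (word a α)
    refine ⟨C, fun X => ?_⟩
    have := hC () X
    rw [wH_mul_prod_ϖH] at this
    simp only [count_word_inr] at this
    rwa [partialDeriv_eq_wd]

end Words

/-! ### Taylor expansion in `ε` -/

section Taylor

variable {d : ℕ} {ρ m : ℝ} {a : Big d → ℂ}

lemma Amp.amp_eulerGain_iterate (ha : Amp ρ m a) (n : ℕ) :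
    Amp ρ (m - n * ρ) (eulerGain^[n] a) := by
  induction n with
  | zero => simpa using ha
  | succ n ih =>
    rw [Function.iterate_succ_apply']
    have := ih.amp_eulerGain
    rwa [show m - n * ρ - ρ = m - ((n + 1 : ℕ) : ℝ) * ρ by push_cast; ring] at this

lemma Amp.amp_euler_iterate (ha : Amp ρ m a) (n : ℕ) : Amp ρ m (euler^[n] a) := by
  induction n with
  | zero => exact ha
  | succ n ih =>
    rw [Function.iterate_succ_apply']
    exact ih.amp_euler

lemma Amp.contDiff_oscFam_eps (ha : Amp ρ m a) (X : Phase d) :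
    ContDiff ℝ ∞ fun t : ℝ => oscFam a (t, X) :=
  ha.contDiff_oscFam.comp (contDiff_id.prodMk contDiff_const)

lemma Amp.deriv_oscFam_eps (ha : Amp ρ m a) (X : Phase d) :
    deriv (fun t : ℝ => oscFam a (t, X)) = fun t => oscFam (eulerGain a) (t, X) := by
  funext t
  have h1 := (diff_of_smooth ha.contDiff_oscFam (t, X)).hasFDerivAt.comp_hasDerivAt t
    ((hasDerivAt_id t).prodMk (hasDerivAt_const t X))
  have h2 := congrFun (ha.dd_oscFam.2.2 ()) (t, X)
  rw [parBasis_inl] at h2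
  exact h1.deriv.trans h2

/-- The derivatives in `ε` in the form that exhibits the gain of `⟨ξ⟩^{-ρ}` for each derivative, which
serves to estimate them. -/
lemma Amp.iteratedDeriv_oscFam_eps (ha : Amp ρ m a) (X : Phase d) (n : ℕ) :
    iteratedDeriv n (fun t : ℝ => oscFam a (t, X)) = fun t => oscFam (eulerGain^[n] a) (t, X) := by
  induction n with
  | zero => simp
  | succ n ih =>
    rw [iteratedDeriv_succ, ih, (ha.amp_eulerGain_iterate n).deriv_oscFam_eps,
      Function.iterate_succ_apply']

/-- The derivatives in `ε` in the form that is obtained by differentiating the amplitude, which serves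
to compute them. -/
lemma Amp.iteratedDeriv_oscFam_eps' (ha : Amp ρ m a) (X : Phase d) (n : ℕ) :
    iteratedDeriv n (fun t : ℝ => oscFam a (t, X)) = fun t => oscFam (euler^[n] a) (t, X) := by
  induction n with
  | zero => simp
  | succ n ih =>
    rw [iteratedDeriv_succ, ih, (ha.amp_euler_iterate n).deriv_oscFam_eps,
      Function.iterate_succ_apply', oscFam_euler (ha.amp_euler_iterate n)]

/-- The remainder of the Taylor expansion in `ε` of a family of oscillatory integrals. -/
def taylorRem (N : ℕ) (a : Big d → ℂ) (ε : ℝ) (X : Phase d) : ℂ :=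
  oscFam a (ε, X) - ∑ n ∈ Finset.range (N + 1),
    ((ε ^ n / n.factorial : ℝ) : ℂ) * oscFam (eulerGain^[n] a) (0, X)

/-- The Taylor remainder of order `N` gains `ε^{N+1}` and `⟨ξ⟩^{-(N+1)ρ}`. -/
lemma Amp.norm_taylorRem_le (ha : Amp ρ m a) (N : ℕ) : ∃ C : ℝ, ∀ ε ∈ Set.Icc (0 : ℝ) 1,
    ∀ X : Phase d, ‖taylorRem N a ε X‖ ≤ C * (ε ^ (N + 1) * wH (m - (N + 1 : ℕ) * ρ) X) := by
  obtain ⟨C, hC⟩ := (ha.amp_eulerGain_iterate (N + 1)).norm_oscFam_le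
  refine ⟨C, fun ε hε X => ?_⟩
  have hg := ha.contDiff_oscFam_eps X
  have hu : UniqueDiffOn ℝ (Set.Icc (0 : ℝ) 1) := uniqueDiffOn_Icc zero_lt_one
  have hit : ∀ n, ∀ t ∈ Set.Icc (0 : ℝ) 1,
      iteratedDerivWithin n (fun t : ℝ => oscFam a (t, X)) (Set.Icc 0 1) t =
        oscFam (eulerGain^[n] a) (t, X) := by
    intro n t ht
    rw [iteratedDerivWithin_eq_iteratedDeriv hu
      ((hg.of_le (by exact_mod_cast le_top : ((n : ℕ) : WithTop ℕ∞) ≤ ∞)).contDiffAt) ht,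
      ha.iteratedDeriv_oscFam_eps]
  -- the derivative of order `N + 1` is the oscillatory integral of an amplitude of order
  -- `m - (N + 1) ρ`
  have h := taylor_mean_remainder_bound (n := N) (C := C * wH (m - (N + 1 : ℕ) * ρ) X) zero_le_one
    (hg.contDiffOn.of_le (by exact_mod_cast le_top)) hε fun y hy => by
      rw [hit _ y hy]
      exact hC (y, X) (by rw [abs_of_nonneg hy.1]; exact hy.2)
  have hT : taylorWithinEval (fun t : ℝ => oscFam a (t, X)) N (Set.Icc 0 1) 0 ε =
      ∑ n ∈ Finset.range (N + 1),
        ((ε ^ n / n.factorial : ℝ) : ℂ) * oscFam (eulerGain^[n] a) (0, X) := by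
    rw [taylor_within_apply]
    refine Finset.sum_congr rfl fun n _ => ?_
    rw [hit n 0 (by simp), sub_zero, Complex.real_smul]
    congr 2; ring
  rw [hT] at h
  have hCw : 0 ≤ C * wH (m - (N + 1 : ℕ) * ρ) X :=
    (norm_nonneg _).trans (hC (0, X) (by simp))
  refine h.trans ?_
  rw [sub_zero, div_le_iff₀ (by positivity)]
  have hf : (1 : ℝ) ≤ (N.factorial : ℝ) := by exact_mod_cast N.factorial_pos
  have h0 : 0 ≤ C * wH (m - (N + 1 : ℕ) * ρ) X * ε ^ (N + 1) :=
    mul_nonneg hCw (pow_nonneg hε.1 _)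
  nlinarith

lemma Amp.dd_oscFam_X (ha : Amp ρ m a) (ε : ℝ) (j : PIdx d) :
    dd (phaseBasis d j) (fun X => oscFam a (ε, X)) =
      fun X => oscFam (dd (bigBasis d (Sum.inl j)) a) (ε, X) := by
  funext X
  have h1 := dd_uncurry_right (a := fun (ε : ℝ) X => oscFam a (ε, X)) ha.contDiff_oscFam
    (phaseBasis d j) ε X
  have h2 := congrFun (ha.dd_oscFam.2.1 j) (ε, X)
  rw [parBasis_inr] at h2
  exact h1.trans h2

lemma dd_eulerGain (ha : ContDiff ℝ ∞ a) (v : Big d) : dd v (eulerGain a) = eulerGain (dd v a) := by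
  have hs : ∀ j : PIdx d, ContDiff ℝ ∞ (dd (bigBasis d (Sum.inr (Sum.inr (Sum.inr j))))
      (dd (bigBasis d (Sum.inr (Sum.inl j))) a)) := fun j => contDiff_dd (contDiff_dd ha _) _
  have h1 : eulerGain a = ∑ j : PIdx d, fun v => -Complex.I *
      dd (bigBasis d (Sum.inr (Sum.inr (Sum.inr j)))) (dd (bigBasis d (Sum.inr (Sum.inl j))) a) v := by
    funext v; rw [Finset.sum_apply]; rfl
  have h2 := wd_sum (fun _ : Unit => v) [()] Finset.univ
    (f := fun j : PIdx d => fun v => -Complex.I *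
      dd (bigBasis d (Sum.inr (Sum.inr (Sum.inr j)))) (dd (bigBasis d (Sum.inr (Sum.inl j))) a) v)
    fun j _ => contDiff_const.mul (hs j)
  simp only [wd] at h2
  rw [h1, h2]
  funext x
  rw [Finset.sum_apply]
  refine Finset.sum_congr rfl fun j _ => ?_
  rw [dd_const_mul _ (hs j), dd_comm (contDiff_dd ha _), dd_comm ha]

lemma dd_eulerGain_iterate (ha : Amp ρ m a) (n : ℕ) (v : Big d) :
    dd v (eulerGain^[n] a) = eulerGain^[n] (dd v a) := by
  induction n with
  | zero => rfl
  | succ n ih =>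
    rw [Function.iterate_succ_apply', Function.iterate_succ_apply',
      dd_eulerGain (ha.amp_eulerGain_iterate n).smooth, ih]

lemma Amp.contDiff_oscFam_X (ha : Amp ρ m a) (ε : ℝ) : ContDiff ℝ ∞ fun X => oscFam a (ε, X) :=
  ha.contDiff_oscFam.comp (contDiff_const.prodMk contDiff_id)

lemma Amp.contDiff_taylorRem (ha : Amp ρ m a) (N : ℕ) (ε : ℝ) :
    ContDiff ℝ ∞ (taylorRem N a ε) :=
  (ha.contDiff_oscFam_X ε).sub (ContDiff.sum fun n _ => contDiff_const.mul
    ((ha.amp_eulerGain_iterate n).contDiff_oscFam_X 0))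

/-- A derivative in `X` of a Taylor remainder is the Taylor remainder of `∂_X a`. Bounds for remainders
therefore imply bounds for their seminorms. -/
lemma Amp.dd_taylorRem (ha : Amp ρ m a) (N : ℕ) (ε : ℝ) (j : PIdx d) :
    dd (phaseBasis d j) (taylorRem N a ε) = taylorRem N (dd (bigBasis d (Sum.inl j)) a) ε := by
  have hs : ∀ n : ℕ, ContDiff ℝ ∞ fun X => oscFam (eulerGain^[n] a) (0, X) := fun n =>
    (ha.amp_eulerGain_iterate n).contDiff_oscFam_X 0
  have h1 : taylorRem N a ε = (fun X => oscFam a (ε, X)) + ∑ n ∈ Finset.range (N + 1),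
      fun X => -((ε ^ n / n.factorial : ℝ) : ℂ) * oscFam (eulerGain^[n] a) (0, X) := by
    funext X
    simp only [taylorRem, Pi.add_apply, Finset.sum_apply, neg_mul, Finset.sum_neg_distrib]
    ring
  have h2 := wd_sum (fun _ : Unit => phaseBasis d j) [()] (Finset.range (N + 1))
    (f := fun n => fun X => -((ε ^ n / n.factorial : ℝ) : ℂ) * oscFam (eulerGain^[n] a) (0, X))
    fun n _ => contDiff_const.mul (hs n)
  simp only [wd] at h2
  rw [h1, dd_add (ha.contDiff_oscFam_X ε)
    (contDiff_finset_sum _ fun n _ => contDiff_const.mul (hs n)), h2, ha.dd_oscFam_X]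
  funext X
  simp only [taylorRem, Pi.add_apply, Finset.sum_apply]
  rw [sub_eq_add_neg, ← Finset.sum_neg_distrib]
  congr 1
  refine Finset.sum_congr rfl fun n _ => ?_
  rw [dd_const_mul _ (hs n), (ha.amp_eulerGain_iterate n).dd_oscFam_X, dd_eulerGain_iterate ha]
  ring

lemma wH_add_ordH (m : ℝ) (k : PIdx d) (X : Phase d) : wH (m + ordH ρ k) X = wH m X * ϖH ρ k X := by
  unfold wH
  rw [Real.rpow_add (japanese_pos _)]
  cases k
  · simp [ordH, ϖH]
  · rfl

/-- The Taylor remainders form a family of symbols, with the gain in `ε` in all seminorms. -/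
lemma Amp.cl_taylorRem (ha : Amp ρ m a) (N : ℕ) :
    Cl (phaseBasis d) (ϖH ρ)
      (fun (ε : Set.Icc (0 : ℝ) 1) X => (ε : ℝ) ^ (N + 1) * wH (m - (N + 1 : ℕ) * ρ) X)
      (fun ε => taylorRem N a ε) := by
  refine ⟨fun ε => ha.contDiff_taylorRem N ε, fun l => ?_⟩
  induction l generalizing a m with
  | nil =>
    obtain ⟨C, hC⟩ := ha.norm_taylorRem_le N
    exact ⟨C, fun ε X => by simpa [wd] using hC ε ε.2 X⟩
  | cons k l ih =>
    obtain ⟨C, hC⟩ := ih (ha.deriv_X k)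
    refine ⟨C, fun ε X => ?_⟩
    have h := hC ε X
    rw [add_sub_right_comm, wH_add_ordH] at h
    simp only [wd, ha.dd_taylorRem, List.map_cons, List.prod_cons]
    refine h.trans (le_of_eq ?_)
    ring

/-- Oscillatory integrals of amplitudes are symbols. -/
lemma Amp.cl_oscFam (ha : Amp ρ m a) {ε : ℝ} (hε : |ε| ≤ 1) :
    Cl (phaseBasis d) (ϖH ρ) (fun (_ : Unit) X => wH m X) (fun _ X => oscFam a (ε, X)) := by
  refine ⟨fun _ => ha.contDiff_oscFam_X ε, fun l => ?_⟩
  induction l generalizing a m with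
  | nil =>
    obtain ⟨C, hC⟩ := ha.norm_oscFam_le
    exact ⟨C, fun _ X => by simpa [wd] using hC (ε, X) hε⟩
  | cons k l ih =>
    obtain ⟨C, hC⟩ := ih (ha.deriv_X k)
    refine ⟨C, fun _ X => ?_⟩
    have h := hC () X
    rw [wH_add_ordH] at h
    simp only [wd, ha.dd_oscFam_X, List.map_cons, List.prod_cons]
    refine h.trans (le_of_eq ?_)
    ring

end Taylor

/-! ### Polynomial differential operators -/

section Symbols

variable {d : ℕ}

/-- The contribution of the monomial with exponents `m` to `applySymbols`. -/
def symTerm (f g : Phase d → ℂ) (X : Phase d) (m : Coord d →₀ ℕ) : ℂ :=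
  ((-Complex.I) ^ (∑ i, m (Sum.inl (Sum.inl i))) * Complex.I ^ (∑ i, m (Sum.inl (Sum.inr i)))
      * partialDeriv (fun i => m (Sum.inl (Sum.inr i))) (fun i => m (Sum.inl (Sum.inl i))) f X)
    * ((-Complex.I) ^ (∑ i, m (Sum.inr (Sum.inl i))) * Complex.I ^ (∑ i, m (Sum.inr (Sum.inr i)))
      * partialDeriv (fun i => m (Sum.inr (Sum.inr i))) (fun i => m (Sum.inr (Sum.inl i))) g X)

variable {f g : Phase d → ℂ} {X : Phase d}

lemma applySymbols_eq_sum (P : Poly d) {s : Finset (Coord d →₀ ℕ)} (hs : P.support ⊆ s) :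
    applySymbols P f g X = ∑ m ∈ s, P.coeff m * symTerm f g X m := by
  rw [← Finset.sum_subset hs fun m _ hm => by
    rw [MvPolynomial.notMem_support_iff.1 hm, zero_mul]]
  exact Finset.sum_congr rfl fun m _ => mul_assoc _ _ _

lemma applySymbols_add (P Q : Poly d) :
    applySymbols (P + Q) f g X = applySymbols P f g X + applySymbols Q f g X := by
  classical
  rw [applySymbols_eq_sum (P + Q) MvPolynomial.support_add,
    applySymbols_eq_sum P Finset.subset_union_left, applySymbols_eq_sum Q Finset.subset_union_right,
    ← Finset.sum_add_distrib]
  exact Finset.sum_congr rfl fun m _ => by rw [MvPolynomial.coeff_add, add_mul]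

lemma applySymbols_zero : applySymbols 0 f g X = 0 := by
  simp [applySymbols]

lemma applySymbols_C_mul (c : ℂ) (P : Poly d) :
    applySymbols (MvPolynomial.C c * P) f g X = c * applySymbols P f g X := by
  have hs : (MvPolynomial.C c * P).support ⊆ P.support := fun m hm => by
    rw [MvPolynomial.mem_support_iff, MvPolynomial.coeff_C_mul] at hm
    exact MvPolynomial.mem_support_iff.2 (right_ne_zero_of_mul hm)
  rw [applySymbols_eq_sum _ hs, applySymbols_eq_sum P subset_rfl, Finset.mul_sum]
  exact Finset.sum_congr rfl fun m _ => by rw [MvPolynomial.coeff_C_mul, mul_assoc]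

lemma applySymbols_sum {α : Type*} (t : Finset α) (P : α → Poly d) :
    applySymbols (∑ j ∈ t, P j) f g X = ∑ j ∈ t, applySymbols (P j) f g X := by
  classical
  induction t using Finset.induction_on with
  | empty => simp [applySymbols_zero]
  | insert j t hj ih => rw [Finset.sum_insert hj, Finset.sum_insert hj, applySymbols_add, ih]

lemma applySymbols_monomial (m : Coord d →₀ ℕ) (c : ℂ) :
    applySymbols (MvPolynomial.monomial m c) f g X = c * symTerm f g X m := by
  classical
  rw [applySymbols_eq_sum _ MvPolynomial.support_monomial_subset, Finset.sum_singleton,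
    MvPolynomial.coeff_monomial, if_pos rfl]

lemma applySymbols_one : applySymbols 1 f g X = f X * g X := by
  have h : (1 : Poly d) = MvPolynomial.monomial 0 1 := rfl
  have h0 : ∀ f : Phase d → ℂ, partialDeriv (fun _ => 0) (fun _ => 0) f = f := fun f => by
    have hw : word (d := d) (fun _ => 0) (fun _ => 0) = [] := by
      rw [List.eq_nil_iff_forall_not_mem]; simp [word]
    rw [partialDeriv_eq_wd, hw]
    rfl
  rw [h, applySymbols_monomial, symTerm]
  simp [h0]

lemma applySymbols_X_mul {i : Coord d} {c : ℂ} {f' g' : Phase d → ℂ}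
    (h : ∀ m, symTerm f g X (m + Finsupp.single i 1) = c * symTerm f' g' X m) (P : Poly d) :
    applySymbols (MvPolynomial.X i * P) f g X = c * applySymbols P f' g' X := by
  induction P using MvPolynomial.induction_on' with
  | monomial m a =>
    rw [mul_comm, MvPolynomial.X, MvPolynomial.monomial_mul, mul_one, applySymbols_monomial,
      applySymbols_monomial, h]
    ring
  | add P Q hP hQ => rw [mul_add, applySymbols_add, applySymbols_add, hP, hQ, mul_add]

lemma applySymbols_yVar_mul (hf : ContDiff ℝ ∞ f) (i : Fin d) (P : Poly d) :
    applySymbols (yVar i * P) f g X = -Complex.I * applySymbols P (derivMom i f) g X := by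
  refine applySymbols_X_mul (fun m => ?_) P
  have h1 : (fun j => (m + Finsupp.single (Sum.inl (Sum.inl i)) 1 : Coord d →₀ ℕ) (Sum.inl (Sum.inl j))) =
      (fun j => m (Sum.inl (Sum.inl j))) + Pi.single i 1 := by
    funext j; simp [Finsupp.single_apply, Pi.single_apply, eq_comm]
  have h2 := congrArg (fun v => ∑ j, v j) h1
  simp only [Pi.add_apply, Finset.sum_add_distrib, Finset.sum_pi_single', Finset.mem_univ,
    if_true] at h2
  unfold symTerm
  rw [h2, h1, partialDeriv_derivMom _ _ _ hf]
  simp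
  ring

lemma applySymbols_etaVar_mul (hf : ContDiff ℝ ∞ f) (i : Fin d) (P : Poly d) :
    applySymbols (etaVar i * P) f g X = Complex.I * applySymbols P (derivPos i f) g X := by
  refine applySymbols_X_mul (fun m => ?_) P
  have h1 : (fun j => (m + Finsupp.single (Sum.inl (Sum.inr i)) 1 : Coord d →₀ ℕ) (Sum.inl (Sum.inr j))) =
      (fun j => m (Sum.inl (Sum.inr j))) + Pi.single i 1 := by
    funext j; simp [Finsupp.single_apply, Pi.single_apply, eq_comm]
  have h2 := congrArg (fun v => ∑ j, v j) h1
  simp only [Pi.add_apply, Finset.sum_add_distrib, Finset.sum_pi_single', Finset.mem_univ,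
    if_true] at h2
  unfold symTerm
  rw [h2, h1, partialDeriv_derivPos _ _ _ hf]
  simp
  ring

lemma applySymbols_zVar_mul (hg : ContDiff ℝ ∞ g) (i : Fin d) (P : Poly d) :
    applySymbols (zVar i * P) f g X = -Complex.I * applySymbols P f (derivMom i g) X := by
  refine applySymbols_X_mul (fun m => ?_) P
  have h1 : (fun j => (m + Finsupp.single (Sum.inr (Sum.inl i)) 1 : Coord d →₀ ℕ) (Sum.inr (Sum.inl j))) =
      (fun j => m (Sum.inr (Sum.inl j))) + Pi.single i 1 := by
    funext j; simp [Finsupp.single_apply, Pi.single_apply, eq_comm]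
  have h2 := congrArg (fun v => ∑ j, v j) h1
  simp only [Pi.add_apply, Finset.sum_add_distrib, Finset.sum_pi_single', Finset.mem_univ,
    if_true] at h2
  unfold symTerm
  rw [h2, h1, partialDeriv_derivMom _ _ _ hg]
  simp
  ring

lemma applySymbols_zetaVar_mul (hg : ContDiff ℝ ∞ g) (i : Fin d) (P : Poly d) :
    applySymbols (zetaVar i * P) f g X = Complex.I * applySymbols P f (derivPos i g) X := by
  refine applySymbols_X_mul (fun m => ?_) P
  have h1 : (fun j => (m + Finsupp.single (Sum.inr (Sum.inr i)) 1 : Coord d →₀ ℕ) (Sum.inr (Sum.inr j))) =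
      (fun j => m (Sum.inr (Sum.inr j))) + Pi.single i 1 := by
    funext j; simp [Finsupp.single_apply, Pi.single_apply, eq_comm]
  have h2 := congrArg (fun v => ∑ j, v j) h1
  simp only [Pi.add_apply, Finset.sum_add_distrib, Finset.sum_pi_single', Finset.mem_univ,
    if_true] at h2
  unfold symTerm
  rw [h2, h1, partialDeriv_derivPos _ _ _ hg]
  simp
  ring

lemma contDiff_derivPos (hf : ContDiff ℝ ∞ f) (i : Fin d) : ContDiff ℝ ∞ (derivPos i f) :=
  contDiff_dd hf _

lemma contDiff_derivMom (hf : ContDiff ℝ ∞ f) (i : Fin d) : ContDiff ℝ ∞ (derivMom i f) :=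
  contDiff_dd hf _

end Symbols

/-! ### The terms of the expansion are symbols -/

section Terms

variable {d : ℕ} {ρ m : ℝ} {f g : Phase d → ℂ} {B : Config d → Fin d → Fin d → ℝ}

/-- The symbol classes, in terms of words of derivatives. -/
def Sym (ρ m : ℝ) (f : Phase d → ℂ) : Prop :=
  Cl (phaseBasis d) (ϖH ρ) (fun (_ : Unit) X => wH m X) (fun _ => f)

lemma Sym.smooth (hf : Sym ρ m f) : ContDiff ℝ ∞ f := Cl.smooth hf ()

lemma Sym.derivPos (hf : Sym ρ m f) (i : Fin d) : Sym ρ m (derivPos i f) := by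
  have h := Cl.deriv hf (Sum.inl i)
  rw [phaseBasis_inl] at h
  exact h.congr (fun _ X => by simp [ϖH]) fun _ _ => rfl

lemma Sym.derivMom (hf : Sym ρ m f) (i : Fin d) : Sym ρ (m - ρ) (derivMom i f) := by
  have h := Cl.deriv hf (Sum.inr i)
  rw [phaseBasis_inr] at h
  exact h.congr (fun _ X => by
    rw [sub_eq_add_neg]; exact (wH_add_ordH (ρ := ρ) m (Sum.inr i) X).symm) fun _ _ => rfl

lemma Sym.mul {m₁ m₂ : ℝ} (hf : Sym ρ m₁ f) (hg : Sym ρ m₂ g) : Sym ρ (m₁ + m₂) (f * g) :=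
  (Cl.mul hf hg).congr (fun _ X => by
    unfold wH; rw [Real.rpow_add (japanese_pos _)]) fun _ _ => rfl

lemma Sym.sum {α : Type*} (t : Finset α) {F : α → Phase d → ℂ} (hF : ∀ j ∈ t, Sym ρ m (F j)) :
    Sym ρ m (fun X => ∑ j ∈ t, F j X) :=
  Cl.sum (f := fun j (_ : Unit) => F j) t hF

lemma Sym.const_mul (hf : Sym ρ m f) (c : ℂ) : Sym ρ m (fun X => c * f X) :=
  Cl.const_mul hf (c := fun _ => c) fun _ => le_rfl

lemma sym_const (c : ℂ) : Sym ρ 0 (fun _ : Phase d => c) :=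
  (Cl.const (fun k v => (ϖH_pos ρ k v).le) (c := fun _ : Unit => c) fun _ => le_rfl).congr
    (fun _ X => by simp [wH]) fun _ _ => rfl

lemma Sym.mono {m m' : ℝ} (h : m ≤ m') (hf : Sym ρ m f) : Sym ρ m' f :=
  Cl.mono_weight hf (fun k v => (ϖH_pos ρ k v).le) (fun _ v => (wH_pos m v).le) (M := 1)
    fun _ X => by
      rw [one_mul]; exact Real.rpow_le_rpow_of_exponent_le (one_le_japanese _) h

/-- Multiplication by the family `L` of polynomials increases the order in `⟨ξ⟩^{-ρ}` of polynomial
differential operators by `r`. -/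
def SymMul (ρ : ℝ) (r : ℕ) (L : Config d → Poly d) : Prop :=
  ∀ (s : ℕ) (P : Config d → Poly d),
    (∀ (m₁ m₂ : ℝ) (f g : Phase d → ℂ), Sym ρ m₁ f → Sym ρ m₂ g →
      Sym ρ (m₁ + m₂ - s * ρ) (fun X => applySymbols (P X.1) f g X)) →
    ∀ (m₁ m₂ : ℝ) (f g : Phase d → ℂ), Sym ρ m₁ f → Sym ρ m₂ g →
      Sym ρ (m₁ + m₂ - ((r + s : ℕ) : ℝ) * ρ) (fun X => applySymbols (L X.1 * P X.1) f g X)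

lemma SymMul.mul {r s : ℕ} {L M : Config d → Poly d} (hL : SymMul ρ r L) (hM : SymMul ρ s M) :
    SymMul ρ (r + s) (fun x => L x * M x) := by
  intro t P hP m₁ m₂ f g hf hg
  have h := hL (s + t) (fun x => M x * P x) (fun m₁ m₂ f g hf hg => hM t P hP m₁ m₂ f g hf hg)
    m₁ m₂ f g hf hg
  rw [← add_assoc] at h
  simp only [mul_assoc]
  exact h

lemma SymMul.sum {α : Type*} (t : Finset α) {r : ℕ} {L : α → Config d → Poly d}
    (hL : ∀ j ∈ t, SymMul ρ r (L j)) : SymMul ρ r (fun x => ∑ j ∈ t, L j x) := by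
  intro s P hP m₁ m₂ f g hf hg
  simp only [Finset.sum_mul, applySymbols_sum]
  exact Sym.sum t fun j hj => hL j hj s P hP m₁ m₂ f g hf hg

lemma SymMul.C {c : Config d → ℂ} (hc : Sym ρ 0 (fun X : Phase d => c X.1)) :
    SymMul ρ 0 (fun x => MvPolynomial.C (c x)) := by
  intro s P hP m₁ m₂ f g hf hg
  simp only [applySymbols_C_mul]
  have h := hc.mul (hP m₁ m₂ f g hf hg)
  rw [zero_add] at h ⊢
  exact h

lemma SymMul.one : SymMul ρ 0 (fun _ : Config d => (1 : Poly d)) := by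
  have := SymMul.C (ρ := ρ) (d := d) (c := fun _ => 1) (sym_const 1)
  simpa using this

lemma SymMul.pow {r : ℕ} {L : Config d → Poly d} (hL : SymMul ρ r L) (n : ℕ) :
    SymMul ρ (r * n) (fun x => L x ^ n) := by
  induction n with
  | zero => simpa using SymMul.one
  | succ n ih =>
    simp only [pow_succ]
    exact ih.mul hL

lemma SymMul.prod {α : Type*} (t : Finset α) {r : α → ℕ} {L : α → Config d → Poly d}
    (hL : ∀ j ∈ t, SymMul ρ (r j) (L j)) : SymMul ρ (∑ j ∈ t, r j) (fun x => ∏ j ∈ t, L j x) := by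
  classical
  induction t using Finset.induction_on with
  | empty => simpa using SymMul.one
  | insert j t hj ih =>
    simp only [Finset.sum_insert hj, Finset.prod_insert hj]
    exact (hL j (Finset.mem_insert_self j t)).mul
      (ih fun k hk => hL k (Finset.mem_insert_of_mem hk))

lemma symMul_yVar (i : Fin d) : SymMul ρ 1 (fun _ => yVar i) := by
  intro s P hP m₁ m₂ f g hf hg
  simp only [applySymbols_yVar_mul hf.smooth]
  have h := (hP _ m₂ _ g (hf.derivMom i) hg).const_mul (-Complex.I)
  rwa [show m₁ - ρ + m₂ - s * ρ = m₁ + m₂ - ((1 + s : ℕ) : ℝ) * ρ by push_cast; ring] at h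

lemma symMul_zVar (i : Fin d) : SymMul ρ 1 (fun _ => zVar i) := by
  intro s P hP m₁ m₂ f g hf hg
  simp only [applySymbols_zVar_mul hg.smooth]
  have h := (hP m₁ _ f _ hf (hg.derivMom i)).const_mul (-Complex.I)
  rwa [show m₁ + (m₂ - ρ) - s * ρ = m₁ + m₂ - ((1 + s : ℕ) : ℝ) * ρ by push_cast; ring] at h

lemma symMul_etaVar (i : Fin d) : SymMul ρ 0 (fun _ => etaVar i) := by
  intro s P hP m₁ m₂ f g hf hg
  simp only [applySymbols_etaVar_mul hf.smooth]
  rw [zero_add]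
  exact (hP m₁ m₂ _ g (hf.derivPos i) hg).const_mul Complex.I

lemma symMul_zetaVar (i : Fin d) : SymMul ρ 0 (fun _ => zetaVar i) := by
  intro s P hP m₁ m₂ f g hf hg
  simp only [applySymbols_zetaVar_mul hg.smooth]
  rw [zero_add]
  exact (hP m₁ m₂ f _ hf (hg.derivPos i)).const_mul Complex.I

/-- Each monomial of `𝓛_0` contains one derivative in momentum. -/
lemma symMul_polyL0 : SymMul ρ 1 (fun _ => polyL0 d) := by
  have h1 : ∀ i : Fin d, SymMul ρ 1 (fun _ => etaVar i * zVar i - yVar i * zetaVar i) := by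
    intro i
    have h2 := (symMul_etaVar (ρ := ρ) i).mul (symMul_zVar i)
    have h3 := (SymMul.C (ρ := ρ) (c := fun _ => -1) (sym_const _)).mul
      ((symMul_yVar i).mul (symMul_zetaVar i))
    have h4 := SymMul.sum (ρ := ρ) (r := 1) Finset.univ (L := fun b : Bool =>
      if b then (fun _ => etaVar i * zVar i)
        else (fun _ => MvPolynomial.C (-1) * (yVar i * zetaVar i))) fun b _ => by
      cases b
      · exact h3
      · exact h2
    simpa [sub_eq_add_neg] using h4
  have h := (SymMul.C (ρ := ρ) (c := fun _ => 1 / 2) (sym_const _)).mul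
    (SymMul.sum Finset.univ fun i _ => h1 i)
  exact h

lemma iteratedFDeriv_eq_foldr {V : Type*} [NormedAddCommGroup V] [NormedSpace ℝ V] {f : V → ℂ}
    (hf : ContDiff ℝ ∞ f) (n : ℕ) (v : Fin n → V) (x : V) :
    iteratedFDeriv ℝ n f x v = (List.ofFn v).foldr dd f x := by
  induction n generalizing x with
  | zero => simp
  | succ n ih =>
    rw [List.ofFn_succ, List.foldr_cons, iteratedFDeriv_succ_apply_left]
    have h : (fun x => (List.ofFn fun i : Fin n => v i.succ).foldr dd f x) =
        fun x => iteratedFDeriv ℝ n f x (Fin.tail v) := funext fun x => (ih _ x).symm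
    have hd : DifferentiableAt ℝ (iteratedFDeriv ℝ n f) x :=
      (hf.differentiable_iteratedFDeriv (by exact_mod_cast ENat.natCast_lt_top n)) x
    change _ = fderiv ℝ (fun x => (List.ofFn fun i : Fin n => v i.succ).foldr dd f x) x (v 0)
    rw [h]
    have h3 : HasFDerivAt (fun x => iteratedFDeriv ℝ n f x (Fin.tail v)) _ x :=
      (ContinuousMultilinearMap.apply ℝ (fun _ : Fin n => V) ℂ (Fin.tail v)).hasFDerivAt.comp x
        hd.hasFDerivAt
    rw [h3.fderiv]
    rfl

lemma IsMagneticField.ofReal_iteratedFDeriv (hB : IsMagneticField B) (k l : Fin d) (n : ℕ)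
    (v : Fin n → Config d) (x : Config d) :
    ((iteratedFDeriv ℝ n (fun x => B x k l) x v : ℝ) : ℂ) =
      (List.ofFn v).foldr dd (fun x => (B x k l : ℂ)) x := by
  rw [← iteratedFDeriv_eq_foldr (hB.smooth_complex k l)]
  have h := Complex.ofRealCLM.iteratedFDeriv_comp_left (hB.smooth k l).contDiffAt (x := x) (i := n)
    (by exact_mod_cast le_top)
  change _ = iteratedFDeriv ℝ n (Complex.ofRealCLM ∘ fun x => B x k l) x v
  rw [h]
  rfl

/-- Bounded functions of `x` with bounded derivatives are symbols of order zero. -/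
lemma sym_of_config {c : Config d → ℂ} (hc : Cl (basisVec : Fin d → Config d) (fun _ _ => 1)
    (fun (_ : Unit) _ => 1) (fun _ => c)) : Sym ρ 0 (fun X : Phase d => c X.1) := by
  refine (hc.comp_affine (e' := phaseBasis d) (ϖ' := ϖH ρ) (π := fun _ : Unit => ())
    (φ := fun _ X => X.1) (L := fun _ => ContinuousLinearMap.fst ℝ (Config d) (Config d))
    (fun _ _ => zero_le_one) (fun k v => (ϖH_pos ρ k v).le) (fun _ _ => zero_le_one)
    (fun _ _ => hasFDerivAt_fst) (c := fun _ K k => (phaseBasis d K).1 k)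
    (fun _ K => config_eq_sum _) (D := 1) ?_).congr (fun _ X => by simp [wH]) fun _ _ => rfl
  rintro - (i | i) k X
  · simpa [ϖH] using abs_basisVec_le i k
  · simpa using (ϖH_pos ρ (Sum.inr i) X).le

/-- The coefficients of `𝓛_j` are bounded functions of `x` with bounded derivatives, so they do not
change the order. -/
lemma symMul_coeff (hB : IsMagneticField B) (k l : Fin d) (n : ℕ) (mm : Fin n → Fin d) (q : ℝ → ℝ)
    (hq : ∃ a : ℝ, ∀ t, q t = a * t) :
    SymMul ρ 0 (fun x : Config d => MvPolynomial.C
      ((q (iteratedFDeriv ℝ n (fun x => B x k l) x fun s => basisVec (mm s)) : ℝ) : ℂ)) := by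
  obtain ⟨a, ha⟩ := hq
  have h : ∀ L : List (Fin d), Cl (basisVec : Fin d → Config d) (fun _ _ => 1)
      (fun (_ : Unit) _ => 1)
      (fun _ => (L.map basisVec).foldr dd (fun x => (B x k l : ℂ))) := by
    intro L
    induction L with
    | nil => exact hB.cl k l
    | cons i L ih => exact (ih.deriv i).congr (fun _ _ => mul_one _) fun _ _ => rfl
  refine SymMul.C ?_
  have h2 := (sym_of_config (ρ := ρ) (h (List.ofFn mm))).const_mul (a : ℂ)
  refine Cl.congr h2 (fun _ _ => rfl) fun _ X => ?_
  rw [ha, Complex.ofReal_mul, hB.ofReal_iteratedFDeriv, List.map_ofFn]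
  rfl

/-- Each monomial of `𝓛_j` contains `j + 1` factors among the `y` and `z`, that is `j + 1` derivatives
in momentum. -/
lemma symMul_polyL (hB : IsMagneticField B) {j : ℕ} (hj : 1 ≤ j) :
    SymMul ρ (j + 1) (fun x => polyL B j x) := by
  unfold polyL
  refine SymMul.sum _ fun k _ => SymMul.sum _ fun l _ => SymMul.sum _ fun mm _ =>
    SymMul.sum _ fun c _ => ?_
  have h1 := symMul_coeff (ρ := ρ) hB k l (j - 1) mm (fun t => 1 / (j.factorial : ℝ) * t
        * (-1 / 2) ^ (j + 1) * (1 / ((j : ℝ) + 1) ^ 2) * ((j + 1).choose c : ℝ)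
        * ((1 - (-1) ^ (j + 1)) * (c : ℝ) - (1 - (-1) ^ c) * ((j : ℝ) + 1)))
      ⟨1 / (j.factorial : ℝ)
        * (-1 / 2) ^ (j + 1) * (1 / ((j : ℝ) + 1) ^ 2) * ((j + 1).choose c : ℝ)
        * ((1 - (-1) ^ (j + 1)) * (c : ℝ) - (1 - (-1) ^ c) * ((j : ℝ) + 1)), fun t => by ring⟩
  have h2 := ((h1.mul (symMul_yVar k)).mul (symMul_zVar l)).mul
    (SymMul.prod (ρ := ρ) (r := fun _ => 1) Finset.univ
      (L := fun (s : Fin (j - 1)) _ => if (s : ℕ) + 1 < c then yVar (mm s) else zVar (mm s))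
      fun s _ => by split_ifs; exacts [symMul_yVar _, symMul_zVar _])
  have h3 : 0 + 1 + 1 + ∑ _s : Fin (j - 1), 1 = j + 1 := by simp; omega
  rw [h3] at h2
  exact h2

/-- The polynomial of the term `(n, k)` has order `n + k`. -/
lemma symMul_polyT (hB : IsMagneticField B) (n k : ℕ) :
    SymMul ρ (n + k) (fun x => polyT B n k x) := by
  unfold polyT
  refine SymMul.sum _ fun κ hκ => ?_
  rw [indexTuples, Finset.mem_filter] at hκ
  have h := ((SymMul.C (ρ := ρ) (d := d) (c := fun _ => Complex.I ^ (k + κ 0) /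
    ((∏ j : Fin (n + 1), (κ j).factorial : ℕ) : ℂ)) (sym_const _)).mul
      (symMul_polyL0.pow (κ 0))).mul
    (SymMul.prod (ρ := ρ) Finset.univ fun (j : Fin n) _ =>
      (symMul_polyL hB (Nat.le_add_left 1 j)).pow (κ j.succ))
  have h3 : 0 + 1 * κ 0 + ∑ j : Fin n, ((j : ℕ) + 1 + 1) * κ j.succ = n + k := by
    have e : ∑ j : Fin n, ((j : ℕ) + 1 + 1) * κ j.succ =
        ∑ j : Fin n, ((j : ℕ) + 1) * κ j.succ + ∑ j : Fin n, κ j.succ := by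
      rw [← Finset.sum_add_distrib]
      exact Finset.sum_congr rfl fun j _ => by ring
    have h1 := hκ.2.1
    have h2 := hκ.2.2
    rw [e]
    omega
  rw [h3] at h
  exact h

lemma sym_expansionTerm {m₁ m₂ : ℝ} (hB : IsMagneticField B) (hf : Sym ρ m₁ f) (hg : Sym ρ m₂ g)
    (n k : ℕ) : Sym ρ (m₁ + m₂ - ((n : ℝ) + k) * ρ) (expansionTerm B f g n k) := by
  have h := symMul_polyT (ρ := ρ) hB n k 0 (fun _ => 1) (fun m₁ m₂ f g hf hg => by
    simp only [applySymbols_one]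
    have := hf.mul hg
    rwa [show m₁ + m₂ = m₁ + m₂ - ((0 : ℕ) : ℝ) * ρ by simp] at this) m₁ m₂ f g hf hg
  simp only [mul_one, add_zero, Nat.cast_add] at h
  exact h

end Terms

/-! ### Taylor series and truncated exponentials -/

section TaylorSeries

open PowerSeries

/-- The Taylor series at `0` of a function of a real variable. -/
def taylor (φ : ℝ → ℂ) : PowerSeries ℂ :=
  PowerSeries.mk fun k => iteratedDeriv k φ 0 / (k.factorial : ℂ)

lemma coeff_taylor (φ : ℝ → ℂ) (k : ℕ) :
    coeff k (taylor φ) = iteratedDeriv k φ 0 / (k.factorial : ℂ) := by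
  simp [taylor]

lemma contDiff_deriv {φ : ℝ → ℂ} (hφ : ContDiff ℝ ∞ φ) : ContDiff ℝ ∞ (deriv φ) :=
  (contDiff_infty_iff_deriv.1 hφ).2

lemma derivative_taylor (φ : ℝ → ℂ) : d⁄dX ℂ (taylor φ) = taylor (deriv φ) := by
  ext k
  rw [coeff_derivative, coeff_taylor, coeff_taylor, iteratedDeriv_succ']
  have h1 : (k.factorial : ℂ) ≠ 0 := by exact_mod_cast k.factorial_ne_zero
  have h2 : (k : ℂ) + 1 ≠ 0 := by exact_mod_cast k.succ_ne_zero
  rw [Nat.factorial_succ]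
  push_cast
  field_simp

lemma taylor_add {φ ψ : ℝ → ℂ} (hφ : ContDiff ℝ ∞ φ) (hψ : ContDiff ℝ ∞ ψ) :
    taylor (φ + ψ) = taylor φ + taylor ψ := by
  ext k
  rw [map_add, coeff_taylor, coeff_taylor, coeff_taylor, iteratedDeriv_add
    (hφ.contDiffAt.of_le (by exact_mod_cast le_top))
    (hψ.contDiffAt.of_le (by exact_mod_cast le_top)), add_div]

lemma coeff_eq_of_derivative {n : ℕ} {U V : PowerSeries ℂ}
    (h : coeff n (d⁄dX ℂ U) = coeff n (d⁄dX ℂ V)) : coeff (n + 1) U = coeff (n + 1) V := by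
  rw [coeff_derivative, coeff_derivative] at h
  exact mul_right_cancel₀ (by exact_mod_cast n.succ_ne_zero : (n : ℂ) + 1 ≠ 0) h

lemma taylor_mul {φ ψ : ℝ → ℂ} (hφ : ContDiff ℝ ∞ φ) (hψ : ContDiff ℝ ∞ ψ) :
    taylor (φ * ψ) = taylor φ * taylor ψ := by
  ext n
  induction n generalizing φ ψ with
  | zero => simp [taylor]
  | succ n ih =>
    refine coeff_eq_of_derivative ?_
    have h : deriv (φ * ψ) = deriv φ * ψ + φ * deriv ψ := by
      funext t
      exact deriv_mul (hφ.differentiable (by simp) t) (hψ.differentiable (by simp) t)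
    have hφ' := contDiff_deriv hφ
    have hψ' := contDiff_deriv hψ
    rw [derivative_taylor, h,
      taylor_add (φ := deriv φ * ψ) (ψ := φ * deriv ψ) (hφ'.mul hψ) (hφ.mul hψ'), map_add, ih hφ' hψ, ih hφ hψ',
      Derivation.leibniz, derivative_taylor, derivative_taylor, map_add, smul_eq_mul, smul_eq_mul,
      add_comm, mul_comm (taylor ψ)]

/-- The Taylor series of `exp φ` solves the differential equation `U' = φ' U`. -/
lemma derivative_taylor_exp {φ : ℝ → ℂ} (hφ : ContDiff ℝ ∞ φ) :
    d⁄dX ℂ (taylor fun t => Complex.exp (φ t)) =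
      d⁄dX ℂ (taylor φ) * taylor fun t => Complex.exp (φ t) := by
  have he : ContDiff ℝ ∞ fun t => Complex.exp (φ t) := hφ.cexp
  rw [derivative_taylor, derivative_taylor, ← taylor_mul (contDiff_deriv hφ) he]
  congr 1
  funext t
  rw [Pi.mul_apply, mul_comm]
  exact ((hφ.differentiable (by simp) t).hasDerivAt.cexp).deriv

/-- Solutions of `U' = A' U` are determined modulo `X^{n+1}` by `A'` modulo `X^n`. -/
lemma coeff_eq_of_ode {n : ℕ} {U V a b : PowerSeries ℂ} (h0 : coeff 0 U = coeff 0 V)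
    (hU : X ^ n ∣ d⁄dX ℂ U - a * U) (hV : X ^ n ∣ d⁄dX ℂ V - b * V) (hab : X ^ n ∣ a - b) :
    ∀ k ≤ n, coeff k U = coeff k V := by
  intro k
  induction k using Nat.strong_induction_on with
  | _ k ih =>
    intro hk
    rcases k with - | k
    · exact h0
    refine coeff_eq_of_derivative ?_
    rw [X_pow_dvd_iff] at hU hV hab
    have h1 := hU k (by omega)
    have h2 := hV k (by omega)
    rw [map_sub, sub_eq_zero] at h1 h2
    rw [h1, h2, coeff_mul, coeff_mul]
    refine Finset.sum_congr rfl fun p hp => ?_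
    have hp' := Finset.HasAntidiagonal.mem_antidiagonal.1 hp
    have h3 := hab p.1 (by omega)
    rw [map_sub, sub_eq_zero] at h3
    rw [h3, ih p.2 (by omega) (by omega)]

/-- The truncated exponential `∑_{k ≤ n} (c X^j)^k / k!`. -/
def expTrunc (n j : ℕ) (c : ℂ) : PowerSeries ℂ :=
  ∑ k ∈ Finset.range (n + 1), C (c ^ k / (k.factorial : ℂ)) * X ^ (j * k)

lemma derivative_C_mul_X_pow (c : ℂ) (k : ℕ) :
    d⁄dX ℂ (C c * X ^ k : PowerSeries ℂ) = C (c * k) * X ^ (k - 1) := by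
  rw [Derivation.leibniz, derivative_C, smul_zero, add_zero, Derivation.leibniz_pow, derivative_X,
    smul_eq_mul, smul_eq_mul, mul_one, nsmul_eq_mul, map_mul, map_natCast, mul_assoc]

/-- The truncated exponential of `c X^{j+1}` solves `U' = (c X^{j+1})' U` modulo `X^n`. -/
lemma derivative_expTrunc (n j : ℕ) (c : ℂ) :
    X ^ n ∣ d⁄dX ℂ (expTrunc n (j + 1) c) -
      (C (c * (j + 1 : ℕ)) * X ^ j) * expTrunc n (j + 1) c := by
  have h1 : d⁄dX ℂ (expTrunc n (j + 1) c) =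
      ∑ k ∈ Finset.range n, (C (c * (j + 1 : ℕ)) * X ^ j) *
        (C (c ^ k / (k.factorial : ℂ)) * X ^ ((j + 1) * k)) := by
    rw [expTrunc, map_sum, Finset.sum_range_succ']
    simp only [derivative_C_mul_X_pow]
    simp only [mul_zero, Nat.cast_zero, map_zero, zero_mul, add_zero]
    refine Finset.sum_congr rfl fun k _ => ?_
    have e1 : (j + 1) * (k + 1) - 1 = j + (j + 1) * k := by
      rw [mul_add, mul_one, ← add_assoc, Nat.add_sub_cancel]; ring
    have h2 : (k.factorial : ℂ) ≠ 0 := by exact_mod_cast k.factorial_ne_zero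
    have h3 : (k : ℂ) + 1 ≠ 0 := by exact_mod_cast k.succ_ne_zero
    have e2 : c ^ (k + 1) / ((k + 1).factorial : ℂ) * ((j + 1) * (k + 1) : ℕ) =
        (c * (j + 1 : ℕ)) * (c ^ k / (k.factorial : ℂ)) := by
      rw [Nat.factorial_succ]
      push_cast
      field_simp
      ring
    rw [e1, e2, pow_add, map_mul]
    ring
  rw [h1, expTrunc, Finset.sum_range_succ, mul_add, ← Finset.mul_sum, sub_add_cancel_left,
    dvd_neg]
  refine Dvd.dvd.mul_left (Dvd.dvd.mul_left (pow_dvd_pow _ ?_) _) _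
  nlinarith

/-- The product of the truncated exponentials solves the equation with the sum of the coefficients. -/
lemma derivative_prod_expTrunc (n : ℕ) {ι : Type*} (t : Finset ι) (j : ι → ℕ) (c : ι → ℂ) :
    X ^ n ∣ d⁄dX ℂ (∏ i ∈ t, expTrunc n (j i + 1) (c i)) -
      (∑ i ∈ t, C (c i * (j i + 1 : ℕ)) * X ^ j i) * ∏ i ∈ t, expTrunc n (j i + 1) (c i) := by
  classical
  induction t using Finset.induction_on with
  | empty =>
    simp
  | insert i t hi ih =>
    rw [Finset.prod_insert hi, Finset.sum_insert hi, Derivation.leibniz]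
    have h := (ih.mul_left (expTrunc n (j i + 1) (c i))).add
      ((derivative_expTrunc n (j i) (c i)).mul_left (∏ i ∈ t, expTrunc n (j i + 1) (c i)))
    convert h using 1
    simp only [smul_eq_mul]
    ring

/-- If `φ(t) ∼ ∑_{j ≥ 1} c_j t^j`, then `exp φ(t)` is the product of the truncated exponentials of
the `c_j t^j` up to terms of order `n + 1`. -/
lemma coeff_taylor_exp {φ : ℝ → ℂ} (hφ : ContDiff ℝ ∞ φ) (h0 : φ 0 = 0) (n : ℕ) :
    ∀ k ≤ n, coeff k (taylor fun t => Complex.exp (φ t)) =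
      coeff k (∏ j : Fin n, expTrunc n ((j : ℕ) + 1) (coeff ((j : ℕ) + 1) (taylor φ))) := by
  refine coeff_eq_of_ode ?_ (a := d⁄dX ℂ (taylor φ)) ?_
    (derivative_prod_expTrunc n Finset.univ (fun j : Fin n => (j : ℕ)) _) ?_
  · rw [coeff_zero_eq_constantCoeff, map_prod]
    have h1 : ∀ j : Fin n, constantCoeff
        (expTrunc n ((j : ℕ) + 1) (coeff ((j : ℕ) + 1) (taylor φ))) = 1 := fun j => by
      rw [expTrunc, map_sum, Finset.sum_range_succ']
      simp
    rw [Finset.prod_congr rfl fun j _ => h1 j, ← coeff_zero_eq_constantCoeff, coeff_taylor]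
    simp [h0]
  · rw [derivative_taylor_exp hφ, sub_self]
    exact dvd_zero _
  · rw [X_pow_dvd_iff]
    intro k hk
    rw [map_sub, map_sum, sub_eq_zero, coeff_derivative]
    simp only [coeff_C_mul, coeff_X_pow, mul_ite, mul_one, mul_zero]
    rw [Finset.sum_eq_single ⟨k, hk⟩]
    · simp
    · intro j _ hj
      rw [if_neg]
      rintro rfl
      exact hj rfl
    · simp

lemma prod_expTrunc (n : ℕ) (c : Fin n → ℂ) :
    ∏ j : Fin n, expTrunc n ((j : ℕ) + 1) (c j) =
      ∑ κ ∈ Fintype.piFinset fun _ : Fin n => Finset.range (n + 1),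
        C (∏ j : Fin n, c j ^ κ j / ((κ j).factorial : ℂ)) *
          X ^ (∑ j : Fin n, ((j : ℕ) + 1) * κ j) := by
  unfold expTrunc
  rw [Finset.prod_univ_sum]
  refine Finset.sum_congr rfl fun κ _ => ?_
  rw [Finset.prod_mul_distrib, map_prod, Finset.prod_pow_eq_pow_sum]

lemma coeff_C_mul_X_pow_mul (c : ℂ) (e n : ℕ) (F : PowerSeries ℂ) :
    coeff n (C c * X ^ e * F) = if e ≤ n then c * coeff (n - e) F else 0 := by
  rw [mul_assoc, coeff_C_mul]
  split_ifs with h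
  · rw [coeff_X_pow_mul', if_pos h]
  · rw [coeff_X_pow_mul', if_neg h, mul_zero]

/-- The tuples `(k_0, …, k_n)` with `k_0 + ∑ j k_j = n`. -/
def degreeTuples (n : ℕ) : Finset (Fin (n + 1) → ℕ) :=
  (Fintype.piFinset fun _ : Fin (n + 1) => Finset.range (n + 1)).filter fun κ =>
    κ 0 + ∑ j : Fin n, ((j : ℕ) + 1) * κ j.succ = n

/-- The entry `k_0` of a tuple is determined by the other ones. -/
lemma sum_degreeTuples {M : Type*} [AddCommMonoid M] (n : ℕ) (G : (Fin (n + 1) → ℕ) → M) :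
    ∑ κ ∈ degreeTuples n, G κ = ∑ κ ∈ Fintype.piFinset fun _ : Fin n => Finset.range (n + 1),
      if ∑ j : Fin n, ((j : ℕ) + 1) * κ j ≤ n then
        G (Fin.cons (n - ∑ j : Fin n, ((j : ℕ) + 1) * κ j) κ) else 0 := by
  rw [← Finset.sum_filter]
  refine Finset.sum_bij' (fun κ _ => Fin.tail κ)
    (fun κ _ => Fin.cons (n - ∑ j : Fin n, ((j : ℕ) + 1) * κ j) κ) ?_ ?_ ?_ ?_ ?_
  · intro κ hκ
    rw [degreeTuples, Finset.mem_filter, Fintype.mem_piFinset] at hκ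
    rw [Finset.mem_filter, Fintype.mem_piFinset]
    exact ⟨fun j => hκ.1 j.succ, by simp only [Fin.tail]; omega⟩
  · intro κ hκ
    rw [Finset.mem_filter, Fintype.mem_piFinset] at hκ
    rw [degreeTuples, Finset.mem_filter, Fintype.mem_piFinset]
    refine ⟨fun j => ?_, ?_⟩
    · refine Fin.cases ?_ (fun j => ?_) j
      · rw [Fin.cons_zero, Finset.mem_range]; omega
      · rw [Fin.cons_succ]; exact hκ.1 j
    · simp only [Fin.cons_zero, Fin.cons_succ]; omega
  · intro κ hκ
    rw [degreeTuples, Finset.mem_filter] at hκ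
    have : n - ∑ j : Fin n, ((j : ℕ) + 1) * κ j.succ = κ 0 := by omega
    simp only [Fin.tail, this]
    exact Fin.cons_self_tail κ
  · intro κ _
    exact Fin.tail_cons _ _
  · intro κ hκ
    rw [degreeTuples, Finset.mem_filter] at hκ
    have : n - ∑ j : Fin n, ((j : ℕ) + 1) * κ j.succ = κ 0 := by omega
    simp only [Fin.tail, this]
    exact congrArg G (Fin.cons_self_tail κ).symm

/-- The coefficients of the product of `exp φ` and `F` in terms of those of `φ` and `F`. -/
lemma coeff_taylor_exp_mul {φ : ℝ → ℂ} (hφ : ContDiff ℝ ∞ φ) (h0 : φ 0 = 0) (F : PowerSeries ℂ)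
    (n : ℕ) :
    coeff n (taylor (fun t => Complex.exp (φ t)) * F) =
      ∑ κ ∈ degreeTuples n, (∏ j : Fin n,
        coeff ((j : ℕ) + 1) (taylor φ) ^ κ j.succ / ((κ j.succ).factorial : ℂ)) *
          coeff (κ 0) F := by
  have h1 : coeff n (taylor (fun t => Complex.exp (φ t)) * F) =
      coeff n ((∏ j : Fin n, expTrunc n ((j : ℕ) + 1) (coeff ((j : ℕ) + 1) (taylor φ))) * F) := by
    rw [coeff_mul, coeff_mul]
    refine Finset.sum_congr rfl fun p hp => ?_
    rw [coeff_taylor_exp hφ h0 n p.1 (by have := Finset.HasAntidiagonal.mem_antidiagonal.1 hp; omega)]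
  rw [h1, prod_expTrunc, Finset.sum_mul, map_sum, sum_degreeTuples]
  refine Finset.sum_congr rfl fun κ _ => ?_
  rw [coeff_C_mul_X_pow_mul]
  simp only [Fin.cons_zero, Fin.cons_succ]

/-- The tuples of degree `n` are those of degree `(n, k)` for the various `k`. -/
lemma sum_indexTuples {M : Type*} [AddCommMonoid M] (n : ℕ) (G : (Fin (n + 1) → ℕ) → M) :
    ∑ k ∈ Finset.range (n + 1), ∑ κ ∈ indexTuples n k, G κ = ∑ κ ∈ degreeTuples n, G κ := by
  rw [← Finset.sum_fiberwise_of_maps_to (s := degreeTuples n) (t := Finset.range (n + 1))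
    (g := fun κ => ∑ j : Fin n, κ j.succ)]
  · refine Finset.sum_congr rfl fun k _ => Finset.sum_congr ?_ fun _ _ => rfl
    rw [indexTuples, degreeTuples, Finset.filter_filter]
  · intro κ hκ
    rw [degreeTuples, Finset.mem_filter] at hκ
    have : ∑ j : Fin n, κ j.succ ≤ ∑ j : Fin n, ((j : ℕ) + 1) * κ j.succ :=
      Finset.sum_le_sum fun j _ => Nat.le_mul_of_pos_left _ (Nat.succ_pos _)
    rw [Finset.mem_range]
    omega

end TaylorSeries

/-! ### The Taylor coefficients of the magnetic phase -/

section PhaseCoefficients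

open MeasureTheory Finset.HasAntidiagonal

variable {d : ℕ}

lemma taylor_sum {ι : Type*} (s : Finset ι) {φ : ι → ℝ → ℂ} (hφ : ∀ i ∈ s, ContDiff ℝ ∞ (φ i)) :
    taylor (fun t => ∑ i ∈ s, φ i t) = ∑ i ∈ s, taylor (φ i) := by
  classical
  induction s using Finset.induction_on with
  | empty =>
    ext k
    rw [coeff_taylor]
    simp
  | insert i s hi ih =>
    have hs : ∀ i ∈ s, ContDiff ℝ ∞ (φ i) := fun j hj => hφ j (Finset.mem_insert_of_mem hj)
    simp only [Finset.sum_insert hi]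
    rw [← ih hs]
    exact taylor_add (hφ i (Finset.mem_insert_self i s)) (ContDiff.sum hs)

lemma taylor_const (c : ℂ) : taylor (fun _ => c) = PowerSeries.C c := by
  ext k
  rw [coeff_taylor, iteratedDeriv_const, PowerSeries.coeff_C]
  split_ifs with h <;> simp [h]

lemma taylor_const_mul (c : ℂ) {φ : ℝ → ℂ} (hφ : ContDiff ℝ ∞ φ) :
    taylor (fun t => c * φ t) = PowerSeries.C c * taylor φ := by
  rw [← taylor_const]
  exact taylor_mul contDiff_const hφ

lemma taylor_ofReal : taylor (fun t => (t : ℂ)) = PowerSeries.X := by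
  refine PowerSeries.derivative.ext ?_ ?_
  · rw [derivative_taylor, PowerSeries.derivative_X]
    have h : deriv (fun t : ℝ => (t : ℂ)) = fun _ => 1 := by
      funext t
      exact Complex.ofRealCLM.hasDerivAt.deriv
    rw [h, taylor_const, map_one]
  · rw [← PowerSeries.coeff_zero_eq_constantCoeff, coeff_taylor]
    simp

lemma coeff_succ_taylor_mul {φ : ℝ → ℂ} (hφ : ContDiff ℝ ∞ φ) (m : ℕ) :
    PowerSeries.coeff (m + 1) (taylor (fun t => (t : ℂ) * φ t)) =
      PowerSeries.coeff m (taylor φ) := by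
  have h : taylor (fun t => (t : ℂ) * φ t) = PowerSeries.X * taylor φ := by
    rw [← taylor_ofReal]
    exact taylor_mul Complex.ofRealCLM.contDiff hφ
  rw [h, PowerSeries.coeff_succ_X_mul]

/-- A binomial formula for iterated derivatives. -/
lemma iteratedDeriv_binomial {h : ℕ → ℕ → ℝ → ℂ}
    (hd : ∀ p q t, HasDerivAt (h p q) (h (p + 1) q t + h p (q + 1) t) t) (m : ℕ) :
    iteratedDeriv m (h 0 0) = fun t => ∑ ij ∈ antidiagonal m, (m.choose ij.1 : ℂ) * h ij.1 ij.2 t := by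
  induction m with
  | zero => funext t; simp
  | succ m ih =>
    funext t
    rw [iteratedDeriv_succ, ih, Finset.sum_antidiagonal_choose_succ_mul (fun p q => h p q t)]
    have h1 := HasDerivAt.fun_sum (u := antidiagonal m) fun ij _ =>
      (hd ij.1 ij.2 t).const_mul (m.choose ij.1 : ℂ)
    rw [h1.deriv, ← Finset.sum_add_distrib]
    refine Finset.sum_congr rfl fun ij hij => ?_
    have h2 : m.choose ij.2 = m.choose ij.1 :=
      Nat.choose_symm_of_eq_add (by have := mem_antidiagonal.1 hij; omega)
    rw [h2]
    ring

lemma hasDerivAt_integral_of_compact {T : Type*} [TopologicalSpace T] [CompactSpace T]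
    [MeasurableSpace T] [OpensMeasurableSpace T] [SecondCountableTopology T] {μ : Measure T}
    [IsFiniteMeasure μ] {F F' : ℝ → T → ℂ}
    (hF : Continuous (Function.uncurry F)) (hF' : Continuous (Function.uncurry F'))
    (hd : ∀ ε t, HasDerivAt (fun ε => F ε t) (F' ε t) ε) (ε : ℝ) :
    HasDerivAt (fun ε => ∫ t, F ε t ∂μ) (∫ t, F' ε t ∂μ) ε := by
  obtain ⟨C, hC⟩ := ((isCompact_closedBall ε 1).prod isCompact_univ).exists_bound_of_continuousOn
    hF'.continuousOn
  have hc : ∀ ε, Continuous (F ε) := fun ε => hF.comp (continuous_const.prodMk continuous_id)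
  have hc' : ∀ ε, Continuous (F' ε) := fun ε => hF'.comp (continuous_const.prodMk continuous_id)
  obtain ⟨D, hD⟩ := isCompact_univ.exists_bound_of_continuousOn (hc ε).continuousOn
  refine (hasDerivAt_integral_of_dominated_loc_of_deriv_le (bound := fun _ => C)
    (Metric.ball_mem_nhds ε one_pos) ?_ ?_ (hc' ε).aestronglyMeasurable ?_
    (integrable_const C) ?_).2
  · exact Filter.Eventually.of_forall fun ε => (hc ε).aestronglyMeasurable
  · exact Integrable.of_bound (hc ε).aestronglyMeasurable D
      (Filter.Eventually.of_forall fun t => hD t (Set.mem_univ t))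
  · exact Filter.Eventually.of_forall fun t δ hδ =>
      hC (δ, t) ⟨Metric.ball_subset_closedBall hδ, Set.mem_univ t⟩
  · exact Filter.Eventually.of_forall fun t δ _ => hd δ t

lemma contDiff_dd_iterate {V : Type*} [NormedAddCommGroup V] [NormedSpace ℝ V] {f : V → ℂ}
    (hf : ContDiff ℝ ∞ f) (v : V) (n : ℕ) : ContDiff ℝ ∞ ((dd v)^[n] f) := by
  induction n with
  | zero => exact hf
  | succ n ih => rw [Function.iterate_succ_apply']; exact contDiff_dd ih v

lemma dd_iterate_comm {V : Type*} [NormedAddCommGroup V] [NormedSpace ℝ V] {f : V → ℂ}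
    (hf : ContDiff ℝ ∞ f) (v w : V) (n : ℕ) : dd w ((dd v)^[n] f) = (dd v)^[n] (dd w f) := by
  induction n with
  | zero => rfl
  | succ n ih =>
    rw [Function.iterate_succ_apply', Function.iterate_succ_apply',
      dd_comm (contDiff_dd_iterate hf v n), ih]

lemma foldr_dd_ofFn_ite {V : Type*} [NormedAddCommGroup V] [NormedSpace ℝ V] {f : V → ℂ}
    (y z : V) {m p : ℕ} (hp : p ≤ m) :
    (List.ofFn fun s : Fin m => if (s : ℕ) < p then y else z).foldr dd f =
      (dd y)^[p] ((dd z)^[m - p] f) := by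
  induction m generalizing p with
  | zero => obtain rfl : p = 0 := by omega
            rfl
  | succ m ih =>
    rw [List.ofFn_succ, List.foldr_cons]
    rcases p with - | p
    · have := ih (p := 0) (Nat.zero_le m)
      simp only [Nat.not_lt_zero, if_false] at this ⊢
      rw [this, Nat.sub_zero, Nat.sub_zero, Function.iterate_succ_apply']
      rfl
    · have := ih (p := p) (by omega)
      simp only [Fin.val_zero, Nat.zero_lt_succ, if_true, Fin.val_succ, Nat.succ_lt_succ_iff]
      rw [this, Nat.add_sub_add_right, Function.iterate_succ_apply' (dd y) p]

/-- The integrals that produce the coefficients of the polynomials `𝓛_j`. -/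
lemma integral_unit_square_pow (p q : ℕ) :
    ∫ t : unitInterval × unitInterval,
      (t.1 : ℝ) * ((t.1 : ℝ) - 1 / 2) ^ p * ((t.1 : ℝ) * t.2 - 1 / 2) ^ q =
    (((1 / 2) ^ (p + q + 2) - (-1 / 2) ^ (p + q + 2)) / (p + q + 2) -
      (-1 / 2) ^ (q + 1) * (((1 / 2) ^ (p + 1) - (-1 / 2) ^ (p + 1)) / (p + 1))) / (q + 1) := by
  have hq : (q : ℝ) + 1 ≠ 0 := by positivity
  have hp : (p : ℝ) + 1 ≠ 0 := by positivity
  have hpq : (p : ℝ) + q + 2 ≠ 0 := by positivity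
  have hinner : ∀ s : ℝ, ∫ t in (0 : ℝ)..1, s * (s - 1 / 2) ^ p * (s * t - 1 / 2) ^ q =
      (s - 1 / 2) ^ p * ((s - 1 / 2) ^ (q + 1) - (-1 / 2) ^ (q + 1)) / (q + 1) := by
    intro s
    have h1 : ∀ t : ℝ, HasDerivAt
        (fun t => (s - 1 / 2) ^ p * (s * t - 1 / 2) ^ (q + 1) / ((q : ℝ) + 1))
        (s * (s - 1 / 2) ^ p * (s * t - 1 / 2) ^ q) t := by
      intro t
      have h2 := ((((hasDerivAt_id t).const_mul s).sub_const (1 / 2)).pow (q + 1)).const_mul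
        ((s - 1 / 2) ^ p) |>.div_const ((q : ℝ) + 1)
      refine h2.congr_deriv ?_
      simp only [id, mul_one, Nat.add_sub_cancel]
      push_cast
      field_simp
    rw [intervalIntegral.integral_eq_sub_of_hasDerivAt (fun t _ => h1 t)
      (Continuous.intervalIntegrable (by fun_prop) _ _)]
    have e : s * 0 - 1 / 2 = -1 / 2 := by ring
    rw [mul_one, e]
    ring
  rw [Measure.volume_eq_prod, integral_prod _ (by
    rw [← Measure.volume_eq_prod]
    exact continuous_unit_integrable (by fun_prop))]
  simp_rw [fun s : unitInterval => integral_unitInterval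
    (fun t => (s : ℝ) * ((s : ℝ) - 1 / 2) ^ p * ((s : ℝ) * t - 1 / 2) ^ q), hinner]
  rw [integral_unitInterval
    (fun s => (s - 1 / 2) ^ p * ((s - 1 / 2) ^ (q + 1) - (-1 / 2) ^ (q + 1)) / ((q : ℝ) + 1))]
  have h1 : ∀ s : ℝ, HasDerivAt (fun s => ((s - 1 / 2) ^ (p + q + 2) / (p + q + 2) -
      (-1 / 2) ^ (q + 1) * ((s - 1 / 2) ^ (p + 1) / (p + 1))) / ((q : ℝ) + 1))
      ((s - 1 / 2) ^ p * ((s - 1 / 2) ^ (q + 1) - (-1 / 2) ^ (q + 1)) / ((q : ℝ) + 1)) s := by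
    intro s
    have h2 := ((hasDerivAt_id s).sub_const (1 / 2 : ℝ))
    have h3 := ((h2.pow (p + q + 2)).div_const ((p : ℝ) + q + 2)).sub
      (((h2.pow (p + 1)).div_const ((p : ℝ) + 1)).const_mul ((-1 / 2) ^ (q + 1)))
      |>.div_const ((q : ℝ) + 1)
    refine h3.congr_deriv ?_
    simp only [id, mul_one, Nat.add_sub_cancel]
    rw [show p + q + 2 - 1 = p + (q + 1) by omega, pow_add]
    push_cast
    field_simp
  rw [intervalIntegral.integral_eq_sub_of_hasDerivAt (fun t _ => h1 t)
      (Continuous.intervalIntegrable (by fun_prop) _ _)]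
  norm_num
  ring

/-- The moments of the unit square, weighted with the binomial coefficients of `(∂_y + ∂_z)^{p+q}` and
`1 / (p + q)!`, are the coefficients in the definition of `𝓛_j`, where `j = p + q + 1` and
`c = p + 1`, up to the sign of the magnetic phase. -/
lemma coefficient_identity (p q : ℕ) :
    -(1 / ((p + q).factorial : ℝ)) * ((p + q).choose p *
      ∫ t : unitInterval × unitInterval,
        (t.1 : ℝ) * ((t.1 : ℝ) - 1 / 2) ^ p * ((t.1 : ℝ) * t.2 - 1 / 2) ^ q) =
    1 / ((p + q + 1).factorial : ℝ) * (-1 / 2) ^ (p + q + 1 + 1)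
        * (1 / (((p + q + 1 : ℕ) : ℝ) + 1) ^ 2) * ((p + q + 1 + 1).choose (p + 1) : ℝ)
        * ((1 - (-1) ^ (p + q + 1 + 1)) * ((p + 1 : ℕ) : ℝ)
          - (1 - (-1) ^ (p + 1)) * (((p + q + 1 : ℕ) : ℝ) + 1)) := by
  have hc : ((p + q + 1 + 1).choose (p + 1) : ℝ) * ((p + 1) * (q + 1)) =
      (p + q + 2) * (p + q + 1) * (p + q).choose p := by
    rw [Nat.cast_choose ℝ (by omega : p + 1 ≤ p + q + 1 + 1),
      Nat.cast_choose ℝ (by omega : p ≤ p + q), show p + q + 1 + 1 - (p + 1) = q + 1 by omega,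
      show p + q - p = q by omega]
    have h1 : (p.factorial : ℝ) ≠ 0 := by positivity
    have h2 : (q.factorial : ℝ) ≠ 0 := by positivity
    simp only [Nat.factorial_succ]
    push_cast
    field_simp
    ring
  have hq : (q : ℝ) + 1 ≠ 0 := by positivity
  have hp : (p : ℝ) + 1 ≠ 0 := by positivity
  have hpq : (p : ℝ) + q + 2 ≠ 0 := by positivity
  have hpq1 : (p : ℝ) + q + 1 ≠ 0 := by positivity
  have hc' : ((p + q + 1 + 1).choose (p + 1) : ℝ) =
      (p + q + 2) * (p + q + 1) * (p + q).choose p / ((p + 1) * (q + 1)) := by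
    rw [← hc]; field_simp
  rw [integral_unit_square_pow, hc', Nat.factorial_succ]
  have e1 : ∀ n : ℕ, (1 / 2 : ℝ) ^ n = (-1) ^ n * (-1 / 2) ^ n := fun n => by
    rw [← mul_pow]; norm_num
  rw [e1 (p + q + 2), e1 (p + 1)]
  have hf : ((p + q).factorial : ℝ) ≠ 0 := by positivity
  push_cast
  have e3 : p + q + 1 + 1 = (q + 1) + (p + 1) := by ring
  have e4 : (p : ℝ) + q + 1 + 1 = p + q + 2 := by ring
  rw [e3, e4, pow_add (-1 / 2 : ℝ)]
  field_simp
  ring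

variable {B : Config d → Fin d → Fin d → ℝ}

/-- The moments `∫∫ s (s - 1/2)^p (s t - 1/2)^q ∂_y^p ∂_z^q h(x + ε v_{s,t}) ds dt` over the unit
square, where `v_{s,t} = (s - 1/2) y + (s t - 1/2) z`. -/
def fluxMoment (h : Config d → ℂ) (x y z : Config d) (p q : ℕ) (ε : ℝ) : ℂ :=
  ∫ t : unitInterval × unitInterval,
    (((t.1 : ℝ) * ((t.1 : ℝ) - 1 / 2) ^ p * ((t.1 : ℝ) * t.2 - 1 / 2) ^ q : ℝ) : ℂ) *
      (dd y)^[p] ((dd z)^[q] h)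
        (x + ε • (((t.1 : ℝ) - 1 / 2) • y + ((t.1 : ℝ) * t.2 - 1 / 2) • z))

/-- The derivative in `ε` is the derivative of `h` along `(s - 1/2) y + (s t - 1/2) z`, and thus the sum
of two moments of the next order. -/
lemma hasDerivAt_fluxMoment {h : Config d → ℂ} (hh : ContDiff ℝ ∞ h) (x y z : Config d) (p q : ℕ)
    (ε : ℝ) : HasDerivAt (fluxMoment h x y z p q)
      (fluxMoment h x y z (p + 1) q ε + fluxMoment h x y z p (q + 1) ε) ε := by
  have hs : ∀ p q, ContDiff ℝ ∞ ((dd y)^[p] ((dd z)^[q] h)) := fun p q =>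
    contDiff_dd_iterate (contDiff_dd_iterate hh z q) y p
  have hc : ∀ p q, Continuous (Function.uncurry fun (ε : ℝ) (t : unitInterval × unitInterval) =>
      (((t.1 : ℝ) * ((t.1 : ℝ) - 1 / 2) ^ p * ((t.1 : ℝ) * t.2 - 1 / 2) ^ q : ℝ) : ℂ) *
      (dd y)^[p] ((dd z)^[q] h)
        (x + ε • (((t.1 : ℝ) - 1 / 2) • y + ((t.1 : ℝ) * t.2 - 1 / 2) • z))) := by
    intro p q
    have h1 := (hs p q).continuous
    unfold Function.uncurry
    fun_prop
  have hint : ∀ p q, Integrable (fun t : unitInterval × unitInterval =>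
      (((t.1 : ℝ) * ((t.1 : ℝ) - 1 / 2) ^ p * ((t.1 : ℝ) * t.2 - 1 / 2) ^ q : ℝ) : ℂ) *
      (dd y)^[p] ((dd z)^[q] h)
        (x + ε • (((t.1 : ℝ) - 1 / 2) • y + ((t.1 : ℝ) * t.2 - 1 / 2) • z))) := fun p q =>
    ((hc p q).comp (continuous_const.prodMk continuous_id)).integrable_of_hasCompactSupport
      (HasCompactSupport.of_compactSpace _)
  unfold fluxMoment
  rw [← integral_add (hint _ _) (hint _ _)]
  refine hasDerivAt_integral_of_compact (hc p q) (F' := fun ε t =>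
    (((t.1 : ℝ) * ((t.1 : ℝ) - 1 / 2) ^ (p + 1) * ((t.1 : ℝ) * t.2 - 1 / 2) ^ q : ℝ) : ℂ) *
      (dd y)^[p + 1] ((dd z)^[q] h)
        (x + ε • (((t.1 : ℝ) - 1 / 2) • y + ((t.1 : ℝ) * t.2 - 1 / 2) • z)) +
    (((t.1 : ℝ) * ((t.1 : ℝ) - 1 / 2) ^ p * ((t.1 : ℝ) * t.2 - 1 / 2) ^ (q + 1) : ℝ) : ℂ) *
      (dd y)^[p] ((dd z)^[q + 1] h)
        (x + ε • (((t.1 : ℝ) - 1 / 2) • y + ((t.1 : ℝ) * t.2 - 1 / 2) • z)))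
    ((hc (p + 1) q).add (hc p (q + 1))) (fun δ t => ?_) ε
  set a : ℝ := (t.1 : ℝ) - 1 / 2
  set b : ℝ := (t.1 : ℝ) * t.2 - 1 / 2
  have h1 : HasDerivAt (fun δ : ℝ => x + δ • (a • y + b • z)) (a • y + b • z) δ := by
    simpa using ((hasDerivAt_id δ).smul_const (a • y + b • z)).const_add x
  have h2 := ((diff_of_smooth (hs p q) _).hasFDerivAt.comp_hasDerivAt δ h1).const_mul
    (((t.1 : ℝ) * a ^ p * b ^ q : ℝ) : ℂ)
  refine h2.congr_deriv ?_
  rw [map_add, map_smul, map_smul, Function.iterate_succ_apply' (dd y),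
    Function.iterate_succ_apply' (dd z), ← dd_iterate_comm (contDiff_dd_iterate hh z q)]
  change _ * (a • dd y ((dd y)^[p] ((dd z)^[q] h)) _ + b • dd z ((dd y)^[p] ((dd z)^[q] h)) _) = _
  rw [Complex.real_smul, Complex.real_smul]
  push_cast
  ring

lemma fluxDensity_eq_fluxMoment (k l : Fin d) (x : Config d) (w : Phase d) (ε : ℝ) :
    (fluxDensity B k l x (ε • w) : ℂ) = fluxMoment (fun x => (B x k l : ℂ)) x w.1 w.2 0 0 ε := by
  rw [fluxDensity, fluxMoment, ← integral_complex_ofReal]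
  refine integral_congr_ae (Filter.Eventually.of_forall fun t => ?_)
  simp only [pow_zero, mul_one, Function.iterate_zero, id, Prod.smul_fst, Prod.smul_snd]
  have e : x + ((t.1 : ℝ) - 1 / 2) • ε • w.1 + ((t.1 : ℝ) * t.2 - 1 / 2) • ε • w.2 =
      x + ε • (((t.1 : ℝ) - 1 / 2) • w.1 + ((t.1 : ℝ) * t.2 - 1 / 2) • w.2) := by module
  rw [e, Complex.ofReal_mul]

lemma contDiff_fluxMoment {h : Config d → ℂ} (hh : ContDiff ℝ ∞ h) (x y z : Config d) (p q : ℕ) :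
    ContDiff ℝ ∞ (fluxMoment h x y z p q) := by
  have key : ∀ n : ℕ, ∀ p q, ContDiff ℝ n (fluxMoment h x y z p q) := by
    intro n
    induction n with
    | zero =>
      intro p q
      rw [Nat.cast_zero, contDiff_zero, continuous_iff_continuousAt]
      exact fun ε => (hasDerivAt_fluxMoment hh x y z p q ε).continuousAt
    | succ n ih =>
      intro p q
      rw [Nat.cast_succ, contDiff_succ_iff_deriv]
      refine ⟨fun ε => (hasDerivAt_fluxMoment hh x y z p q ε).differentiableAt, by simp, ?_⟩
      rw [funext fun ε => (hasDerivAt_fluxMoment hh x y z p q ε).deriv]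
      exact (ih _ _).add (ih _ _)
  exact contDiff_infty.2 fun n => key n p q

lemma fluxMoment_zero (h : Config d → ℂ) (x y z : Config d) (p q : ℕ) :
    fluxMoment h x y z p q 0 = ((∫ t : unitInterval × unitInterval,
      (t.1 : ℝ) * ((t.1 : ℝ) - 1 / 2) ^ p * ((t.1 : ℝ) * t.2 - 1 / 2) ^ q : ℝ) : ℂ) *
        (dd y)^[p] ((dd z)^[q] h) x := by
  simp only [fluxMoment, zero_smul, add_zero]
  rw [integral_mul_const, integral_complex_ofReal]

/-- The Taylor coefficients of the flux density along `u = ε (y, z)`. -/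
lemma phase_coeff_eq (h : Config d → ℂ) (hh : ContDiff ℝ ∞ h) (x y z : Config d) (m : ℕ) :
    PowerSeries.coeff m (taylor (fluxMoment h x y z 0 0)) =
      -∑ ij ∈ antidiagonal m, ((1 / ((m + 1).factorial : ℝ) * (-1 / 2) ^ (m + 1 + 1)
        * (1 / (((m + 1 : ℕ) : ℝ) + 1) ^ 2) * ((m + 1 + 1).choose (ij.1 + 1) : ℝ)
        * ((1 - (-1) ^ (m + 1 + 1)) * ((ij.1 + 1 : ℕ) : ℝ)
          - (1 - (-1) ^ (ij.1 + 1)) * (((m + 1 : ℕ) : ℝ) + 1)) : ℝ) : ℂ) *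
        (dd y)^[ij.1] ((dd z)^[ij.2] h) x := by
  rw [coeff_taylor, iteratedDeriv_binomial (hasDerivAt_fluxMoment hh x y z), Finset.sum_div,
    ← Finset.sum_neg_distrib]
  refine Finset.sum_congr rfl fun ij hij => ?_
  obtain rfl := mem_antidiagonal.1 hij
  rw [← coefficient_identity, fluxMoment_zero]
  push_cast
  ring

/-- The sum over `m_1, …, m_j` in `𝓛_{j+1}` assembles the coordinate derivatives into derivatives along
the vectors `y` and `z`. -/
lemma sum_iteratedFDeriv_mul_prod (hB : IsMagneticField B) (k l : Fin d) (x y z : Config d)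
    {m c : ℕ} (hc : c + 1 ≤ m + 1) :
    ∑ mm : Fin m → Fin d,
      ((iteratedFDeriv ℝ m (fun x => B x k l) x (fun s => basisVec (mm s)) : ℝ) : ℂ) *
        ∏ s : Fin m, (if (s : ℕ) + 1 < c + 1 then (y (mm s) : ℂ) else (z (mm s) : ℂ)) =
      (dd y)^[c] ((dd z)^[m - c] (fun x => (B x k l : ℂ))) x := by
  have h1 : (fun s : Fin m => if (s : ℕ) < c then y else z) =
      fun s : Fin m => ∑ i : Fin d, (if (s : ℕ) < c then y i else z i) • basisVec i := by
    funext s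
    split_ifs <;> exact config_eq_sum _
  rw [← foldr_dd_ofFn_ite y z (by omega : c ≤ m), ← hB.ofReal_iteratedFDeriv, h1]
  have h2 := (iteratedFDeriv ℝ m (fun x => B x k l) x).toMultilinearMap.map_sum
    (fun (s : Fin m) (i : Fin d) => (if (s : ℕ) < c then y i else z i) • basisVec i)
  have h3 : ∀ r : Fin m → Fin d, (iteratedFDeriv ℝ m (fun x => B x k l) x).toMultilinearMap
      (fun s => (if (s : ℕ) < c then y (r s) else z (r s)) • basisVec (r s)) =
      (∏ s : Fin m, if (s : ℕ) < c then y (r s) else z (r s)) *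
        iteratedFDeriv ℝ m (fun x => B x k l) x (fun s => basisVec (r s)) := fun r =>
    (iteratedFDeriv ℝ m (fun x => B x k l) x).toMultilinearMap.map_smul_univ _ _
  simp only [h3] at h2
  change _ = (((iteratedFDeriv ℝ m (fun x => B x k l) x).toMultilinearMap _ : ℝ) : ℂ)
  rw [h2, Complex.ofReal_sum]
  refine Finset.sum_congr rfl fun r _ => ?_
  rw [Complex.ofReal_mul, Complex.ofReal_prod, mul_comm]
  congr 1
  refine Finset.prod_congr rfl fun s _ => ?_
  simp only [add_lt_add_iff_right]
  split_ifs <;> rfl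

lemma sum_Icc_eq_sum_antidiagonal {M : Type*} [AddCommMonoid M] (m : ℕ) (G : ℕ → M) :
    ∑ c ∈ Finset.Icc 1 (m + 1), G c = ∑ ij ∈ antidiagonal m, G (ij.1 + 1) := by
  refine Finset.sum_nbij' (fun c => (c - 1, m + 1 - c)) (fun p => p.1 + 1) ?_ ?_ ?_ ?_ ?_
  · intro c hc
    rw [Finset.mem_Icc] at hc
    exact mem_antidiagonal.2 (by simp only; omega)
  · intro p hp
    have := mem_antidiagonal.1 hp
    exact Finset.mem_Icc.2 (by omega)
  · intro c hc
    rw [Finset.mem_Icc] at hc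
    simp only; omega
  · intro p hp
    have := mem_antidiagonal.1 hp
    refine Prod.ext ?_ ?_ <;> simp only <;> omega
  · intro c hc
    rw [Finset.mem_Icc] at hc
    simp only
    congr 1; omega

/-- Substituting numbers for `y` and `z` in `𝓛_j` gives the Taylor coefficients of the phase. -/
lemma algHom_polyL (hB : IsMagneticField B) (m : ℕ) (X : Phase d) (s : Osp d)
    (χ : Poly d →ₐ[ℂ] Poly d)
    (hy : ∀ i, χ (yVar i) = MvPolynomial.C (s.1.1 i : ℂ))
    (hz : ∀ i, χ (zVar i) = MvPolynomial.C (s.1.2 i : ℂ)) :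
    χ (polyL B (m + 1) X.1) = MvPolynomial.C (PowerSeries.coeff (m + 1)
      (taylor fun ε => (bigPhase B (atPar (ε, X) s) : ℂ))) := by
  set y := s.1.1
  set z := s.1.2
  have hχ : χ (polyL B (m + 1) X.1) = MvPolynomial.C (∑ k : Fin d, ∑ l : Fin d,
      ∑ mm : Fin m → Fin d, ∑ c ∈ Finset.Icc 1 (m + 1),
      (((1 / ((m + 1).factorial : ℝ)
        * iteratedFDeriv ℝ m (fun x => B x k l) X.1 (fun s => basisVec (mm s))
        * (-1 / 2) ^ (m + 1 + 1) * (1 / (((m + 1 : ℕ) : ℝ) + 1) ^ 2)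
        * ((m + 1 + 1).choose c : ℝ)
        * ((1 - (-1) ^ (m + 1 + 1)) * (c : ℝ) - (1 - (-1) ^ c) * (((m + 1 : ℕ) : ℝ) + 1)) : ℝ)) : ℂ)
      * (y k : ℂ) * (z l : ℂ)
      * ∏ s : Fin m, (if (s : ℕ) + 1 < c then (y (mm s) : ℂ) else (z (mm s) : ℂ))) := by
    simp only [polyL, map_sum]
    refine Finset.sum_congr rfl fun k _ => Finset.sum_congr rfl fun l _ =>
      Finset.sum_congr rfl fun mm _ => Finset.sum_congr rfl fun c _ => ?_
    simp only [map_mul, map_prod, hy, hz]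
    congr 1
    · rw [MvPolynomial.algHom_C]
      rfl
    · refine Finset.prod_congr rfl fun s _ => ?_
      split_ifs
      · exact hy _
      · exact hz _
  rw [hχ]
  congr 1
  have hsm : ∀ k l, ContDiff ℝ ∞ (fluxMoment (fun x => (B x k l : ℂ)) X.1 y z 0 0) := fun k l =>
    contDiff_fluxMoment (hB.smooth_complex k l) _ _ _ _ _
  have hφ : (fun ε : ℝ => (bigPhase B (atPar (ε, X) s) : ℂ)) = fun ε : ℝ => ∑ k, ∑ l,
      (-((y k : ℂ) * z l)) * ((ε : ℂ) * fluxMoment (fun x => (B x k l : ℂ)) X.1 y z 0 0 ε) := by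
    funext ε
    simp only [bigPhase, atPar, y, z, ← fluxDensity_eq_fluxMoment _ _ X.1 s.1 ε]
    push_cast
    rw [← Finset.sum_neg_distrib]
    refine Finset.sum_congr rfl fun k _ => ?_
    rw [← Finset.sum_neg_distrib]
    refine Finset.sum_congr rfl fun l _ => ?_
    simp only [Prod.smul_fst, PiLp.smul_apply, smul_eq_mul]
    push_cast
    ring
  have hsm2 : ∀ k l, ContDiff ℝ ∞ fun ε : ℝ =>
      (ε : ℂ) * fluxMoment (fun x => (B x k l : ℂ)) X.1 y z 0 0 ε := fun k l =>
    Complex.ofRealCLM.contDiff.mul (hsm k l)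
  rw [hφ, taylor_sum _ fun k _ => ContDiff.sum fun l _ => contDiff_const.mul (hsm2 k l), map_sum]
  refine Finset.sum_congr rfl fun k _ => ?_
  rw [taylor_sum _ fun l _ => contDiff_const.mul (hsm2 k l), map_sum]
  refine Finset.sum_congr rfl fun l _ => ?_
  rw [taylor_const_mul _ (hsm2 k l), PowerSeries.coeff_C_mul, coeff_succ_taylor_mul (hsm k l),
    phase_coeff_eq _ (hB.smooth_complex k l), neg_mul_neg, Finset.sum_comm,
    sum_Icc_eq_sum_antidiagonal, Finset.mul_sum]
  refine Finset.sum_congr rfl fun ij hij => ?_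
  have hij' := mem_antidiagonal.1 hij
  have e : ij.2 = m - ij.1 := by omega
  rw [e, ← sum_iteratedFDeriv_mul_prod hB k l X.1 y z (by omega), Finset.mul_sum, Finset.mul_sum]
  refine Finset.sum_congr rfl fun mm _ => ?_
  push_cast
  ring

end PhaseCoefficients

/-! ### Oscillatory integrals of partially applied symbols -/

section PartialSymbols

variable {d : ℕ} {ρ m₁ m₂ : ℝ} {f g : Phase d → ℂ} {X : Phase d}

/-- The translate `f(x, ξ + η)`. -/
def shiftMom (η : Config d) (f : Phase d → ℂ) : Phase d → ℂ := fun X => f (X + (0, η))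

lemma contDiff_shiftMom (hf : ContDiff ℝ ∞ f) (η : Config d) : ContDiff ℝ ∞ (shiftMom η f) :=
  hf.comp (contDiff_id.add contDiff_const)

lemma derivPos_shiftMom (i : Fin d) (η : Config d) (f : Phase d → ℂ) :
    derivPos i (shiftMom η f) = shiftMom η (derivPos i f) := by
  funext X
  unfold derivPos shiftMom
  rw [fderiv_comp_add_right]

/-- The substitution of the numbers `w = (y, z)` for the coordinates `y, z`; the coordinates
`η, ζ` are kept. -/
def substYZ (w : Phase d) : Poly d →ₐ[ℂ] Poly d :=
  MvPolynomial.aeval fun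
    | Sum.inl (Sum.inl i) => MvPolynomial.C (w.1 i : ℂ)
    | Sum.inl (Sum.inr i) => etaVar i
    | Sum.inr (Sum.inl i) => MvPolynomial.C (w.2 i : ℂ)
    | Sum.inr (Sum.inr i) => zetaVar i

lemma substYZ_yVar (w : Phase d) (i : Fin d) :
    substYZ w (yVar i) = MvPolynomial.C (w.1 i : ℂ) := by
  rw [substYZ, yVar, MvPolynomial.aeval_X]

lemma substYZ_etaVar (w : Phase d) (i : Fin d) : substYZ w (etaVar i) = etaVar i := by
  rw [substYZ, etaVar, MvPolynomial.aeval_X]; rfl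

lemma substYZ_zVar (w : Phase d) (i : Fin d) :
    substYZ w (zVar i) = MvPolynomial.C (w.2 i : ℂ) := by
  rw [substYZ, zVar, MvPolynomial.aeval_X]

lemma substYZ_zetaVar (w : Phase d) (i : Fin d) : substYZ w (zetaVar i) = zetaVar i := by
  rw [substYZ, zetaVar, MvPolynomial.aeval_X]; rfl

/-- The partial action of a polynomial: `y, z` are numbers, `η, ζ` act as derivatives in `x`, and
the momenta are translated by `θ`. -/
def partialSymbol (P : Poly d) (f g : Phase d → ℂ) (X : Phase d) (s : Osp d) : ℂ :=
  applySymbols (substYZ s.1 P) (shiftMom s.2.1 f) (shiftMom s.2.2 g) X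

lemma partialSymbol_add (P Q : Poly d) :
    partialSymbol (P + Q) f g X = partialSymbol P f g X + partialSymbol Q f g X := by
  funext s
  rw [Pi.add_apply, partialSymbol, map_add, applySymbols_add]
  rfl

lemma partialSymbol_sum {α : Type*} (t : Finset α) (P : α → Poly d) (s : Osp d) :
    partialSymbol (∑ j ∈ t, P j) f g X s = ∑ j ∈ t, partialSymbol (P j) f g X s := by
  rw [partialSymbol, map_sum, applySymbols_sum]
  rfl

lemma partialSymbol_mul_of_subst {Q : Poly d} {s : Osp d} {c : ℂ}
    (hQ : substYZ s.1 Q = MvPolynomial.C c) (P : Poly d) :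
    partialSymbol (Q * P) f g X s = c * partialSymbol P f g X s := by
  rw [partialSymbol, map_mul, hQ, applySymbols_C_mul]
  rfl

lemma partialSymbol_C_mul (c : ℂ) (P : Poly d) :
    partialSymbol (MvPolynomial.C c * P) f g X = fun s => c * partialSymbol P f g X s := by
  funext s
  exact partialSymbol_mul_of_subst (MvPolynomial.algHom_C _ _) P

lemma partialSymbol_yVar_mul (i : Fin d) (P : Poly d) : partialSymbol (yVar i * P) f g X =
    fun s => (s.1.1 i : ℂ) * partialSymbol P f g X s := by
  funext s
  exact partialSymbol_mul_of_subst (substYZ_yVar _ i) P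

lemma partialSymbol_zVar_mul (i : Fin d) (P : Poly d) : partialSymbol (zVar i * P) f g X =
    fun s => (s.1.2 i : ℂ) * partialSymbol P f g X s := by
  funext s
  exact partialSymbol_mul_of_subst (substYZ_zVar _ i) P

lemma partialSymbol_etaVar_mul (hf : ContDiff ℝ ∞ f) (i : Fin d) (P : Poly d) :
    partialSymbol (etaVar i * P) f g X =
      fun s => Complex.I * partialSymbol P (derivPos i f) g X s := by
  funext s
  rw [partialSymbol, map_mul, substYZ_etaVar, applySymbols_etaVar_mul (contDiff_shiftMom hf _),
    derivPos_shiftMom]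
  rfl

lemma partialSymbol_zetaVar_mul (hg : ContDiff ℝ ∞ g) (i : Fin d) (P : Poly d) :
    partialSymbol (zetaVar i * P) f g X =
      fun s => Complex.I * partialSymbol P f (derivPos i g) X s := by
  funext s
  rw [partialSymbol, map_mul, substYZ_zetaVar, applySymbols_zetaVar_mul (contDiff_shiftMom hg _),
    derivPos_shiftMom]
  rfl

lemma partialSymbol_one (f g : Phase d → ℂ) (X : Phase d) (s : Osp d) : partialSymbol 1 f g X s =
    f (X + (0, s.2.1)) * g (X + (0, s.2.2)) := by
  rw [partialSymbol, map_one, applySymbols_one]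
  rfl

/-- The operator `i 𝓛_0` acts as the derivative along `(-z/2, y/2)`. -/
lemma partialSymbol_polyL0_mul (hf : ContDiff ℝ ∞ f) (hg : ContDiff ℝ ∞ g) (P : Poly d)
    (s : Osp d) :
    partialSymbol (MvPolynomial.C Complex.I * polyL0 d * P) f g X s =
      ∑ i, (((1 / 2 * s.1.1 i : ℝ) : ℂ) * partialSymbol P f (derivPos i g) X s +
        ((-(1 / 2) * s.1.2 i : ℝ) : ℂ) * partialSymbol P (derivPos i f) g X s) := by
  have h : MvPolynomial.C Complex.I * polyL0 d * P = ∑ i : Fin d,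
      (MvPolynomial.C (Complex.I / 2) * (etaVar i * (zVar i * P)) +
        MvPolynomial.C (-Complex.I / 2) * (yVar i * (zetaVar i * P))) := by
    rw [polyL0, ← mul_assoc, ← map_mul, Finset.mul_sum, Finset.sum_mul]
    refine Finset.sum_congr rfl fun i _ => ?_
    rw [show -Complex.I / 2 = -(Complex.I * (1 / 2)) by ring,
      show Complex.I / 2 = Complex.I * (1 / 2) by ring, map_neg]
    ring
  rw [h, partialSymbol_sum]
  refine Finset.sum_congr rfl fun i _ => ?_
  rw [partialSymbol_add, Pi.add_apply, partialSymbol_C_mul, partialSymbol_C_mul,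
    partialSymbol_etaVar_mul hf, partialSymbol_yVar_mul, partialSymbol_zetaVar_mul hg,
    partialSymbol_zVar_mul]
  push_cast
  linear_combination (1 / 2 * (s.1.2 i : ℂ) * partialSymbol P (derivPos i f) g X s
    - 1 / 2 * (s.1.1 i : ℂ) * partialSymbol P f (derivPos i g) X s) * Complex.I_sq

end PartialSymbols

/-! ### The oscillatory integral of the partial action -/

section PartialOsc

variable {d : ℕ} {ρ m₁ m₂ : ℝ} {f g : Phase d → ℂ} {X : Phase d}
  {B : Config d → Fin d → Fin d → ℝ}

/-- `Ψ = partialSymbol P f g X` is an amplitude, its derivatives in `η` and `ζ` are obtained by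
differentiating `f` and `g`, and its oscillatory integral is the full action of `P`. -/
structure PartialSymbolSpec (P : Poly d) (f g : Phase d → ℂ) (X : Phase d) : Prop where
  isAmp : ∃ N, IsAmp N (partialSymbol P f g X)
  dd_eta : ∀ i, dd (ospBasis d (Sum.inr (Sum.inl i))) (partialSymbol P f g X) =
    partialSymbol P (derivMom i f) g X
  dd_zeta : ∀ i, dd (ospBasis d (Sum.inr (Sum.inr i))) (partialSymbol P f g X) =
    partialSymbol P f (derivMom i g) X
  osc_eq : osc (partialSymbol P f g X) = ((2 * Real.pi) ^ (2 * d) : ℝ) * applySymbols P f g X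

/-- At `ε = 0` the flux vanishes and the positions are not shifted. -/
lemma bigAmp_atPar_zero (s : Osp d) : bigAmp B f g (atPar (0, X) s) =
    f (X + (0, s.2.1)) * g (X + (0, s.2.2)) := by
  have hL : pointL (atPar (0, X) s) = X + (0, s.2.1) := by
    ext <;> simp [pointL, atPar]
  have hR : pointR (atPar (0, X) s) = X + (0, s.2.2) := by
    ext <;> simp [pointR, atPar]
  rw [bigAmp, hL, hR]
  simp [bigPhase, atPar]

lemma contDiff_shift_eta (hf : ContDiff ℝ ∞ f) (X : Phase d) :
    ContDiff ℝ ∞ fun s : Osp d => f (X + (0, s.2.1)) := by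
  have h : ContDiff ℝ ∞ fun s : Osp d => X + ((0, s.2.1) : Phase d) := by fun_prop
  exact hf.comp h

lemma contDiff_shift_zeta (hf : ContDiff ℝ ∞ f) (X : Phase d) :
    ContDiff ℝ ∞ fun s : Osp d => f (X + (0, s.2.2)) := by
  have h : ContDiff ℝ ∞ fun s : Osp d => X + ((0, s.2.2) : Phase d) := by fun_prop
  exact hf.comp h

lemma dd_shift_eta (hf : ContDiff ℝ ∞ f) (X : Phase d) (v : Osp d) :
    dd v (fun s : Osp d => f (X + (0, s.2.1))) =
      fun s => fderiv ℝ f (X + (0, s.2.1)) (0, v.2.1) := by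
  funext s
  have h1 : HasFDerivAt (fun s : Osp d => X + ((0, s.2.1) : Phase d))
      ((0 : Osp d →L[ℝ] Config d).prod ((ContinuousLinearMap.fst ℝ _ _).comp
        (ContinuousLinearMap.snd ℝ (Phase d) (Phase d)))) s :=
    ((hasFDerivAt_const (0 : Config d) s).prodMk
      ((ContinuousLinearMap.fst ℝ (Config d) (Config d)).comp
        (ContinuousLinearMap.snd ℝ (Phase d) (Phase d))).hasFDerivAt).const_add X
  have h2 := (diff_of_smooth hf (X + (0, s.2.1))).hasFDerivAt.comp s h1
  change fderiv ℝ (f ∘ fun s : Osp d => X + ((0, s.2.1) : Phase d)) s v = _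
  rw [h2.fderiv]
  rfl

lemma dd_shift_zeta (hf : ContDiff ℝ ∞ f) (X : Phase d) (v : Osp d) :
    dd v (fun s : Osp d => f (X + (0, s.2.2))) =
      fun s => fderiv ℝ f (X + (0, s.2.2)) (0, v.2.2) := by
  funext s
  have h1 : HasFDerivAt (fun s : Osp d => X + ((0, s.2.2) : Phase d))
      ((0 : Osp d →L[ℝ] Config d).prod ((ContinuousLinearMap.snd ℝ _ _).comp
        (ContinuousLinearMap.snd ℝ (Phase d) (Phase d)))) s :=
    ((hasFDerivAt_const (0 : Config d) s).prodMk
      ((ContinuousLinearMap.snd ℝ (Config d) (Config d)).comp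
        (ContinuousLinearMap.snd ℝ (Phase d) (Phase d))).hasFDerivAt).const_add X
  have h2 := (diff_of_smooth hf (X + (0, s.2.2))).hasFDerivAt.comp s h1
  change fderiv ℝ (f ∘ fun s : Osp d => X + ((0, s.2.2) : Phase d)) s v = _
  rw [h2.fderiv]
  rfl

/-- Fourier inversion for the amplitude at `ε = 0`. -/
lemma partialSymbolSpec_one (hB : IsMagneticField B) (hρ : ρ ∈ Set.Icc (0 : ℝ) 1)
    (hf : Sym ρ m₁ f) (hg : Sym ρ m₂ g) (X : Phase d) : PartialSymbolSpec 1 f g X := by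
  have h1 : ∀ f g : Phase d → ℂ, partialSymbol 1 f g X =
      (fun s : Osp d => f (X + (0, s.2.1))) * (fun s => g (X + (0, s.2.2))) := fun f g =>
    funext fun s => partialSymbol_one f g X s
  obtain ⟨N, hN⟩ := (amp_bigAmp hB hρ hf hg).isAmp
  have hamp : IsAmp N (partialSymbol 1 f g X) := by
    have := hN (0, X)
    simp only [bigAmp_atPar_zero] at this
    rw [h1]
    exact this
  refine ⟨⟨N, hamp⟩, fun i => ?_, fun i => ?_, ?_⟩
  · rw [h1, h1, dd_mul (contDiff_shift_eta hf.smooth X) (contDiff_shift_zeta hg.smooth X),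
      dd_shift_eta hf.smooth, dd_shift_zeta hg.smooth]
    funext s
    simp [derivMom]
    exact Or.inr (map_zero _)
  · rw [h1, h1, dd_mul (contDiff_shift_eta hf.smooth X) (contDiff_shift_zeta hg.smooth X),
      dd_shift_eta hf.smooth, dd_shift_zeta hg.smooth]
    funext s
    simp [derivMom]
    exact Or.inl (map_zero _)
  · rw [applySymbols_one]
    rw [h1] at hamp ⊢
    have := osc_momentum (H := fun θ : Phase d => f (X + (0, θ.1)) * g (X + (0, θ.2))) hamp
    have h0 : X + ((0, 0) : Phase d) = X := add_zero X
    simp only [Prod.fst_zero, Prod.snd_zero, h0] at this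
    exact this

lemma PartialSymbolSpec.C_mul {P : Poly d} (h : PartialSymbolSpec P f g X) (c : ℂ) :
    PartialSymbolSpec (MvPolynomial.C c * P) f g X := by
  obtain ⟨N, hN⟩ := h.isAmp
  refine ⟨⟨N, ?_⟩, fun i => ?_, fun i => ?_, ?_⟩
  · rw [partialSymbol_C_mul]; exact hN.const_mul c
  · rw [partialSymbol_C_mul, partialSymbol_C_mul, dd_const_mul c hN.smooth, h.dd_eta]
  · rw [partialSymbol_C_mul, partialSymbol_C_mul, dd_const_mul c hN.smooth, h.dd_zeta]
  · rw [partialSymbol_C_mul, osc_const_mul hN, h.osc_eq, applySymbols_C_mul]; ring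

lemma PartialSymbolSpec.add {P Q : Poly d} (hP : PartialSymbolSpec P f g X)
    (hQ : PartialSymbolSpec Q f g X) : PartialSymbolSpec (P + Q) f g X := by
  obtain ⟨N, hN⟩ := hP.isAmp
  obtain ⟨M, hM⟩ := hQ.isAmp
  have h1 := hN.mono (le_max_left N M)
  have h2 := hM.mono (le_max_right N M)
  refine ⟨⟨max N M, ?_⟩, fun i => ?_, fun i => ?_, ?_⟩
  · rw [partialSymbol_add]; exact Cl.add h1 h2
  · rw [partialSymbol_add, partialSymbol_add, dd_add h1.smooth h2.smooth, hP.dd_eta, hQ.dd_eta]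
  · rw [partialSymbol_add, partialSymbol_add, dd_add h1.smooth h2.smooth, hP.dd_zeta, hQ.dd_zeta]
  · rw [partialSymbol_add, osc_add h1 h2, hP.osc_eq, hQ.osc_eq, applySymbols_add]; ring

lemma dd_dco_inr (J K : PIdx d) :
    dd (ospBasis d (Sum.inr J)) (fun s => (dco (Sum.inr K) s : ℂ)) = 0 := by
  funext s
  have h := (Complex.ofRealCLM.comp (dco (Sum.inr K : OIdx d))).hasFDerivAt (x := s)
  change fderiv ℝ (Complex.ofRealCLM.comp (dco (Sum.inr K : OIdx d))) s _ = _
  rw [h.fderiv]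
  simp

lemma isAmp_dco_mul {N : ℕ} {b : Osp d → ℂ} (hb : IsAmp N b) (K : OIdx d) :
    IsAmp (1 + N) (fun s => (dco K s : ℂ) * b s) :=
  IsAmp.mul (M := 1) (cl_dco (ι := Unit) K) hb

lemma dd_dco_mul {b : Osp d → ℂ} (hb : ContDiff ℝ ∞ b) (J K : PIdx d) :
    dd (ospBasis d (Sum.inr J)) (fun s => (dco (Sum.inr K) s : ℂ) * b s) =
      fun s => (dco (Sum.inr K) s : ℂ) * dd (ospBasis d (Sum.inr J)) b s := by
  have h : ContDiff ℝ ∞ fun s : Osp d => (dco (Sum.inr K) s : ℂ) :=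
    Complex.ofRealCLM.contDiff.comp (dco (Sum.inr K : OIdx d)).contDiff
  have := dd_mul h hb (ospBasis d (Sum.inr J))
  rw [dd_dco_inr, zero_mul, zero_add] at this
  exact this

/-- Under the oscillatory integral `y` and `z` become `-i ∂_η` and `-i ∂_ζ`, and constants in
`η, ζ` are evaluated at the origin: the oscillatory integral of the partial action of a polynomial
is its full action. -/
lemma partialSymbolSpec (hB : IsMagneticField B) (hρ : ρ ∈ Set.Icc (0 : ℝ) 1) (P : Poly d)
    (hf : Sym ρ m₁ f) (hg : Sym ρ m₂ g) (X : Phase d) : PartialSymbolSpec P f g X := by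
  induction P using MvPolynomial.induction_on generalizing f g m₁ m₂ with
  | C c =>
    have := (partialSymbolSpec_one hB hρ hf hg X).C_mul c
    rwa [mul_one] at this
  | add P Q hP hQ => exact (hP hf hg).add (hQ hf hg)
  | mul_X P i ih =>
    rw [mul_comm]
    have h := ih hf hg
    obtain ⟨N, hN⟩ := h.isAmp
    rcases i with (i | i) | (i | i)
    · change PartialSymbolSpec (yVar i * P) f g X
      have e : ∀ f g : Phase d → ℂ, partialSymbol (yVar i * P) f g X =
          fun s => (dco (Sum.inr (Sum.inl i)) s : ℂ) * partialSymbol P f g X s := fun f g =>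
        partialSymbol_yVar_mul i P
      refine ⟨⟨1 + N, ?_⟩, fun j => ?_, fun j => ?_, ?_⟩
      · rw [e]; exact isAmp_dco_mul hN _
      · rw [e, e, dd_dco_mul hN.smooth, h.dd_eta]
      · rw [e, e, dd_dco_mul hN.smooth, h.dd_zeta]
      · obtain ⟨M, hM⟩ := (ih (hf.derivMom i) hg).isAmp
        rw [e, osc_dco_mul hN, h.dd_eta, osc_const_mul hM, (ih (hf.derivMom i) hg).osc_eq,
          applySymbols_yVar_mul hf.smooth]
        ring
    · change PartialSymbolSpec (etaVar i * P) f g X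
      have h' := ih (hf.derivPos i) hg
      obtain ⟨M, hM⟩ := h'.isAmp
      refine ⟨⟨M, ?_⟩, fun j => ?_, fun j => ?_, ?_⟩
      · rw [partialSymbol_etaVar_mul hf.smooth]; exact hM.const_mul _
      · rw [partialSymbol_etaVar_mul hf.smooth,
          partialSymbol_etaVar_mul (contDiff_derivMom hf.smooth j), dd_const_mul _ hM.smooth,
          h'.dd_eta]
        rw [show derivMom j (derivPos i f) = derivPos i (derivMom j f) from
          dd_comm hf.smooth _ _]
      · rw [partialSymbol_etaVar_mul hf.smooth, partialSymbol_etaVar_mul hf.smooth,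
          dd_const_mul _ hM.smooth, h'.dd_zeta]
      · rw [partialSymbol_etaVar_mul hf.smooth, osc_const_mul hM, h'.osc_eq,
          applySymbols_etaVar_mul hf.smooth]
        ring
    · change PartialSymbolSpec (zVar i * P) f g X
      have e : ∀ f g : Phase d → ℂ, partialSymbol (zVar i * P) f g X =
          fun s => (dco (Sum.inr (Sum.inr i)) s : ℂ) * partialSymbol P f g X s := fun f g =>
        partialSymbol_zVar_mul i P
      refine ⟨⟨1 + N, ?_⟩, fun j => ?_, fun j => ?_, ?_⟩
      · rw [e]; exact isAmp_dco_mul hN _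
      · rw [e, e, dd_dco_mul hN.smooth, h.dd_eta]
      · rw [e, e, dd_dco_mul hN.smooth, h.dd_zeta]
      · obtain ⟨M, hM⟩ := (ih hf (hg.derivMom i)).isAmp
        rw [e, osc_dco_mul hN, h.dd_zeta, osc_const_mul hM, (ih hf (hg.derivMom i)).osc_eq,
          applySymbols_zVar_mul hg.smooth]
        ring
    · change PartialSymbolSpec (zetaVar i * P) f g X
      have h' := ih hf (hg.derivPos i)
      obtain ⟨M, hM⟩ := h'.isAmp
      refine ⟨⟨M, ?_⟩, fun j => ?_, fun j => ?_, ?_⟩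
      · rw [partialSymbol_zetaVar_mul hg.smooth]; exact hM.const_mul _
      · rw [partialSymbol_zetaVar_mul hg.smooth, partialSymbol_zetaVar_mul hg.smooth,
          dd_const_mul _ hM.smooth, h'.dd_eta]
      · rw [partialSymbol_zetaVar_mul hg.smooth,
          partialSymbol_zetaVar_mul (contDiff_derivMom hg.smooth j), dd_const_mul _ hM.smooth,
          h'.dd_zeta]
        rw [show derivMom j (derivPos i g) = derivPos i (derivMom j g) from
          dd_comm hg.smooth _ _]
      · rw [partialSymbol_zetaVar_mul hg.smooth, osc_const_mul hM, h'.osc_eq,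
          applySymbols_zetaVar_mul hg.smooth]
        ring

/-! ### The Taylor coefficients of the amplitude -/

/-- The product of the two symbols along the curve `ε ↦ (X, ε w, (w, θ))`. -/
def curveProd (f g : Phase d → ℂ) (X : Phase d) (s : Osp d) (ε : ℝ) : ℂ :=
  f (pointL (atPar (ε, X) s)) * g (pointR (atPar (ε, X) s))

lemma contDiff_atPar_eps (X : Phase d) (s : Osp d) : ContDiff ℝ ∞ fun ε : ℝ => atPar (ε, X) s := by
  unfold atPar
  fun_prop

lemma contDiff_curveProd (hf : ContDiff ℝ ∞ f) (hg : ContDiff ℝ ∞ g) (X : Phase d) (s : Osp d) :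
    ContDiff ℝ ∞ (curveProd f g X s) :=
  (hf.comp ((pointLCLM d).contDiff.comp (contDiff_atPar_eps X s))).mul
    (hg.comp ((pointRCLM d).contDiff.comp (contDiff_atPar_eps X s)))

lemma fderiv_pos_eq_sum (f : Phase d → ℂ) (W : Phase d) (c : ℝ) (v : Config d) :
    fderiv ℝ f W (c • v, 0) = ∑ i, ((c * v i : ℝ) : ℂ) * derivPos i f W := by
  have h : ((c • v, 0) : Phase d) = ∑ i, (c * v i) • ((basisVec i, 0) : Phase d) := by
    refine Prod.ext ?_ ?_
    · rw [Prod.fst_sum]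
      simp only [Prod.smul_fst, mul_smul, ← Finset.smul_sum]
      rw [← config_eq_sum]
    · rw [Prod.snd_sum]
      simp
  rw [h, map_sum]
  refine Finset.sum_congr rfl fun i _ => ?_
  rw [map_smul, Complex.real_smul]
  rfl

/-- Along the curve the two positions move with the velocities `-z/2` and `y/2`. -/
lemma deriv_curveProd (hf : ContDiff ℝ ∞ f) (hg : ContDiff ℝ ∞ g) (X : Phase d) (s : Osp d) :
    deriv (curveProd f g X s) = fun ε =>
      ∑ i, (((1 / 2 * s.1.1 i : ℝ) : ℂ) * curveProd f (derivPos i g) X s ε +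
        ((-(1 / 2) * s.1.2 i : ℝ) : ℂ) * curveProd (derivPos i f) g X s ε) := by
  funext ε
  have hL : HasDerivAt (fun ε : ℝ => pointL (atPar (ε, X) s)) ((-(1 / 2 : ℝ)) • s.1.2, 0) ε := by
    have h1 : HasDerivAt (fun ε : ℝ => X.1 - (1 / 2 : ℝ) • (ε • s.1.2)) ((-(1 / 2 : ℝ)) • s.1.2) ε := by
      simpa using (((hasDerivAt_id ε).smul_const s.1.2).const_smul (1 / 2 : ℝ)).const_sub X.1
    exact h1.prodMk (hasDerivAt_const ε (X.2 + s.2.1))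
  have hR : HasDerivAt (fun ε : ℝ => pointR (atPar (ε, X) s)) ((1 / 2 : ℝ) • s.1.1, 0) ε := by
    have h1 : HasDerivAt (fun ε : ℝ => X.1 + (1 / 2 : ℝ) • (ε • s.1.1)) ((1 / 2 : ℝ) • s.1.1) ε := by
      simpa using (((hasDerivAt_id ε).smul_const s.1.1).const_smul (1 / 2 : ℝ)).const_add X.1
    exact h1.prodMk (hasDerivAt_const ε (X.2 + s.2.2))
  have h2 := ((diff_of_smooth hf _).hasFDerivAt.comp_hasDerivAt ε hL).mul
    ((diff_of_smooth hg _).hasFDerivAt.comp_hasDerivAt ε hR)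
  refine h2.deriv.trans ?_
  rw [fderiv_pos_eq_sum, fderiv_pos_eq_sum, Finset.sum_add_distrib, add_comm, Finset.mul_sum,
    Finset.sum_mul]
  congr 1
  · refine Finset.sum_congr rfl fun i _ => ?_
    simp only [curveProd, Function.comp_apply]
    ring
  · refine Finset.sum_congr rfl fun i _ => ?_
    simp only [curveProd, Function.comp_apply]
    ring

/-- The product of the two symbols has the Taylor series `exp(i ε 𝓛_0)`. -/
lemma coeff_taylor_curveProd (hf : ContDiff ℝ ∞ f) (hg : ContDiff ℝ ∞ g) (X : Phase d) (s : Osp d)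
    (k : ℕ) : PowerSeries.coeff k (taylor (curveProd f g X s)) =
      partialSymbol ((MvPolynomial.C Complex.I * polyL0 d) ^ k) f g X s / (k.factorial : ℂ) := by
  rw [coeff_taylor]
  congr 1
  induction k generalizing f g with
  | zero =>
    have hL : pointL (atPar (0, X) s) = X + (0, s.2.1) := by ext <;> simp [pointL, atPar]
    have hR : pointR (atPar (0, X) s) = X + (0, s.2.2) := by ext <;> simp [pointR, atPar]
    rw [iteratedDeriv_zero, pow_zero, partialSymbol_one, curveProd, hL, hR]
  | succ k ih =>
    have hs : ∀ i, ContDiff ℝ k fun ε =>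
        ((1 / 2 * s.1.1 i : ℝ) : ℂ) * curveProd f (derivPos i g) X s ε := fun i =>
      (contDiff_const.mul (contDiff_curveProd hf (contDiff_derivPos hg i) X s)).of_le
        (by exact_mod_cast le_top)
    have hs' : ∀ i, ContDiff ℝ k fun ε =>
        ((-(1 / 2) * s.1.2 i : ℝ) : ℂ) * curveProd (derivPos i f) g X s ε := fun i =>
      (contDiff_const.mul (contDiff_curveProd (contDiff_derivPos hf i) hg X s)).of_le
        (by exact_mod_cast le_top)
    rw [iteratedDeriv_succ', deriv_curveProd hf hg, pow_succ', partialSymbol_polyL0_mul hf hg,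
      iteratedDeriv_fun_sum fun i _ => ((hs i).add (hs' i)).contDiffAt]
    refine Finset.sum_congr rfl fun i _ => ?_
    rw [iteratedDeriv_fun_add (hs i).contDiffAt (hs' i).contDiffAt,
      iteratedDeriv_const_mul_field, iteratedDeriv_const_mul_field,
      ih hf (contDiff_derivPos hg i), ih (contDiff_derivPos hf i) hg]

/-- `euler` is the derivative in `ε` along `ε ↦ (X, ε w, (w, θ))`. -/
lemma iteratedDeriv_comp_atPar {a : Big d → ℂ} {m : ℝ} (ha : Amp ρ m a) (X : Phase d) (s : Osp d)
    (n : ℕ) : iteratedDeriv n (fun ε : ℝ => a (atPar (ε, X) s)) =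
      fun ε => euler^[n] a (atPar (ε, X) s) := by
  induction n with
  | zero => simp
  | succ n ih =>
    rw [iteratedDeriv_succ, ih, Function.iterate_succ_apply']
    funext ε
    have hs := (ha.amp_euler_iterate n).smooth
    have h1 : ContDiff ℝ ∞ fun p : Par d => euler^[n] a (atPar p s) :=
      (contDiff_comp_atPar hs).comp (contDiff_id.prodMk contDiff_const)
    have h2 := (diff_of_smooth h1 (ε, X)).hasFDerivAt.comp_hasDerivAt ε
      ((hasDerivAt_id ε).prodMk (hasDerivAt_const ε X))
    have h3 := dd_comp_atPar_eps hs () (ε, X) s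
    rw [parBasis_inl] at h3
    exact h2.deriv.trans h3

end PartialOsc

/-! ### The coefficients of the expansion -/

section Coefficients

variable {d : ℕ} {ρ m₁ m₂ : ℝ} {f g : Phase d → ℂ} {X : Phase d}
  {B : Config d → Fin d → Fin d → ℝ}

lemma contDiff_phase (hB : IsMagneticField B) (X : Phase d) (s : Osp d) :
    ContDiff ℝ ∞ fun ε : ℝ => (bigPhase B (atPar (ε, X) s) : ℂ) :=
  ((cl_bigPhase hB).smooth ()).comp (contDiff_atPar_eps X s)

/-- For numbers `y` and `z` the factors `𝓛_j`, `j ≥ 1`, are numbers, namely the Taylor coefficients of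
the phase. -/
lemma partialSymbol_term (hB : IsMagneticField B) (n : ℕ) (κ : Fin (n + 1) → ℕ) (c : ℂ) (P : Poly d)
    (f g : Phase d → ℂ) (X : Phase d) (s : Osp d) :
    partialSymbol (MvPolynomial.C c * P * ∏ j : Fin n, polyL B ((j : ℕ) + 1) X.1 ^ κ j.succ) f g X s =
      c * (∏ j : Fin n, PowerSeries.coeff ((j : ℕ) + 1)
        (taylor fun ε => (bigPhase B (atPar (ε, X) s) : ℂ)) ^ κ j.succ) *
          partialSymbol P f g X s := by
  have h : substYZ s.1 (∏ j : Fin n, polyL B ((j : ℕ) + 1) X.1 ^ κ j.succ) =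
      MvPolynomial.C (∏ j : Fin n, PowerSeries.coeff ((j : ℕ) + 1)
        (taylor fun ε => (bigPhase B (atPar (ε, X) s) : ℂ)) ^ κ j.succ) := by
    rw [map_prod, map_prod]
    refine Finset.prod_congr rfl fun j _ => ?_
    rw [map_pow, map_pow, algHom_polyL hB j X s _ (substYZ_yVar s.1) (substYZ_zVar s.1)]
  rw [mul_comm, partialSymbol_mul_of_subst h, partialSymbol_C_mul]
  ring

/-- The `n`-th derivative in `ε` of the amplitude at `ε = 0` is the partial action of the polynomial
of order `n`. -/
lemma iteratedDeriv_bigAmp (hB : IsMagneticField B) (hf : ContDiff ℝ ∞ f) (hg : ContDiff ℝ ∞ g)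
    (X : Phase d) (s : Osp d) (n : ℕ) :
    iteratedDeriv n (fun ε : ℝ => bigAmp B f g (atPar (ε, X) s)) 0 = (n.factorial : ℂ) *
      partialSymbol (∑ k ∈ Finset.range (n + 1), polyT B n k X.1) f g X s := by
  set φ : ℝ → ℂ := fun ε => (bigPhase B (atPar (ε, X) s) : ℂ) with hφ
  have hφs : ContDiff ℝ ∞ φ := contDiff_phase hB X s
  have hiφ : ContDiff ℝ ∞ fun ε => Complex.I * φ ε := contDiff_const.mul hφs
  have h1 : taylor (fun ε : ℝ => bigAmp B f g (atPar (ε, X) s)) =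
      taylor (fun ε => Complex.exp (Complex.I * φ ε)) * taylor (curveProd f g X s) :=
    taylor_mul hiφ.cexp (contDiff_curveProd hf hg X s)
  -- at `ε = 0` the factor `u` of the phase vanishes
  have h0 : Complex.I * φ 0 = 0 := by simp [hφ, bigPhase, atPar]
  have hn : (n.factorial : ℂ) ≠ 0 := by exact_mod_cast n.factorial_ne_zero
  have h2 := coeff_taylor (fun ε : ℝ => bigAmp B f g (atPar (ε, X) s)) n
  rw [eq_div_iff hn] at h2
  rw [← h2, mul_comm, h1, coeff_taylor_exp_mul hiφ h0, ← sum_indexTuples, partialSymbol_sum]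
  congr 1
  refine Finset.sum_congr rfl fun k _ => ?_
  rw [polyT, partialSymbol_sum]
  refine Finset.sum_congr rfl fun κ hκ => ?_
  rw [indexTuples, Finset.mem_filter] at hκ
  rw [partialSymbol_term hB n κ, coeff_taylor_curveProd hf hg, mul_pow, ← map_pow,
    partialSymbol_C_mul, Finset.prod_div_distrib, taylor_const_mul _ hφs]
  simp only [PowerSeries.coeff_C_mul, mul_pow]
  rw [Finset.prod_mul_distrib, Finset.prod_pow_eq_pow_sum, hκ.2.2, Fin.prod_univ_succ]
  have h3 : ∏ j : Fin n, ((κ j.succ).factorial : ℂ) ≠ 0 :=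
    Finset.prod_ne_zero_iff.2 fun j _ => by exact_mod_cast (κ j.succ).factorial_ne_zero
  have h4 : ((κ 0).factorial : ℂ) ≠ 0 := by exact_mod_cast (κ 0).factorial_ne_zero
  push_cast
  rw [pow_add]
  field_simp
  exact mul_comm _ _

/-- The `n`-th derivative in `ε` of the oscillatory integral at `ε = 0`. -/
lemma oscFam_euler_iterate_zero (hB : IsMagneticField B) (hρ : ρ ∈ Set.Icc (0 : ℝ) 1)
    (hf : Sym ρ m₁ f) (hg : Sym ρ m₂ g) (X : Phase d) (n : ℕ) :
    oscFam (euler^[n] (bigAmp B f g)) (0, X) =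
      ((2 * Real.pi) ^ (2 * d) : ℝ) * ((n.factorial : ℂ) *
        ∑ k ∈ Finset.range (n + 1), expansionTerm B f g n k X) := by
  have ha := amp_bigAmp hB hρ hf hg
  have h1 : (fun s => euler^[n] (bigAmp B f g) (atPar (0, X) s)) = fun s => (n.factorial : ℂ) *
      partialSymbol (∑ k ∈ Finset.range (n + 1), polyT B n k X.1) f g X s := by
    funext s
    rw [← iteratedDeriv_bigAmp hB hf.smooth hg.smooth, iteratedDeriv_comp_atPar ha]
  have h2 := partialSymbolSpec hB hρ (∑ k ∈ Finset.range (n + 1), polyT B n k X.1) hf hg X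
  obtain ⟨N, hN⟩ := h2.isAmp
  rw [oscFam, h1, osc_const_mul hN, h2.osc_eq, applySymbols_sum]
  simp only [expansionTerm]
  ring

end Coefficients

/-! ### The expansion and its remainder -/

section Expansion

variable {d : ℕ} {ρ m m₁ m₂ : ℝ} {f g : Phase d → ℂ} {B : Config d → Fin d → Fin d → ℝ}

lemma isHormander_iff_sym : IsHormander d ρ m f ↔ Sym ρ m f := isHormander_iff_cl

/-- The remainder of the expansion of the product is the Taylor remainder of the oscillatory
integral. -/
lemma remainder_eq (hB : IsMagneticField B) (hρ : ρ ∈ Set.Icc (0 : ℝ) 1) (hf : Sym ρ m₁ f)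
    (hg : Sym ρ m₂ g) {ε : ℝ} (hε : 0 < ε) (hε1 : ε ≤ 1) (N : ℕ) (X : Phase d) :
    magneticWeylProduct ε 1 B f g X - ∑ n ∈ Finset.range (N + 1), (ε : ℂ) ^ n *
      ∑ k ∈ Finset.range (n + 1), expansionTerm B f g n k X =
    ((((2 * Real.pi) ^ (2 * d))⁻¹ : ℝ) : ℂ) * taylorRem N (bigAmp B f g) ε X := by
  have ha := amp_bigAmp hB hρ hf hg
  rw [(hasMagneticWeylProduct hB hρ hf hg hε hε1 X).magneticWeylProduct_eq, taylorRem, mul_sub,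
    Finset.mul_sum]
  congr 1
  refine Finset.sum_congr rfl fun n _ => ?_
  have h1 : oscFam (eulerGain^[n] (bigAmp B f g)) (0, X) =
      oscFam (euler^[n] (bigAmp B f g)) (0, X) :=
    congrFun ((ha.iteratedDeriv_oscFam_eps X n).symm.trans (ha.iteratedDeriv_oscFam_eps' X n)) 0
  rw [h1, oscFam_euler_iterate_zero hB hρ hf hg]
  have hn : (n.factorial : ℂ) ≠ 0 := by exact_mod_cast n.factorial_ne_zero
  have hpi : (Real.pi : ℂ) ≠ 0 := by exact_mod_cast Real.pi_ne_zero
  push_cast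
  field_simp

/-- The remainders form a family of symbols with the weight `ε^{N+1} ⟨ξ⟩^{m₁+m₂-(N+1)ρ}`. This contains
their membership in the symbol class for each `ε` as well as the uniform bounds. -/
lemma cl_remainder (hB : IsMagneticField B) (hρ : ρ ∈ Set.Icc (0 : ℝ) 1) (hf : Sym ρ m₁ f)
    (hg : Sym ρ m₂ g) (N : ℕ) :
    Cl (phaseBasis d) (ϖH ρ)
      (fun (ε : Set.Ioc (0 : ℝ) 1) X => (ε : ℝ) ^ (N + 1) * wH (m₁ + m₂ - ((N : ℝ) + 1) * ρ) X)
      (fun ε X => magneticWeylProduct ε 1 B f g X - ∑ n ∈ Finset.range (N + 1), ((ε : ℝ) : ℂ) ^ n *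
        ∑ k ∈ Finset.range (n + 1), expansionTerm B f g n k X) := by
  have h := ((amp_bigAmp hB hρ hf hg).cl_taylorRem N).reindex
    (fun ε : Set.Ioc (0 : ℝ) 1 => (⟨ε, ε.2.1.le, ε.2.2⟩ : Set.Icc (0 : ℝ) 1))
  refine (h.const_mul (c := fun _ => ((((2 * Real.pi) ^ (2 * d))⁻¹ : ℝ) : ℂ))
    fun _ => le_rfl).congr (fun ε X => ?_) fun ε X =>
      (remainder_eq hB hρ hf hg ε.2.1 ε.2.2 N X).symm
  push_cast
  rfl

lemma sym_remainder (hB : IsMagneticField B) (hρ : ρ ∈ Set.Icc (0 : ℝ) 1) (hf : Sym ρ m₁ f)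
    (hg : Sym ρ m₂ g) {ε : ℝ} (hε : 0 < ε) (hε1 : ε ≤ 1) (N : ℕ) :
    Sym ρ (m₁ + m₂ - ((N : ℝ) + 1) * ρ)
      (fun X => magneticWeylProduct ε 1 B f g X - ∑ n ∈ Finset.range (N + 1), (ε : ℂ) ^ n *
        ∑ k ∈ Finset.range (n + 1), expansionTerm B f g n k X) :=
  ((cl_remainder hB hρ hf hg N).reindex fun _ : Unit =>
    (⟨ε, hε, hε1⟩ : Set.Ioc (0 : ℝ) 1)).mono_weight (fun k v => (ϖH_pos ρ k v).le)
      (fun _ X => mul_nonneg (pow_nonneg hε.le _) (wH_pos _ X).le) (M := ε ^ (N + 1))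
      fun _ _ => le_rfl

lemma sym_sum_expansionTerm (hB : IsMagneticField B) (hρ : ρ ∈ Set.Icc (0 : ℝ) 1) (hf : Sym ρ m₁ f)
    (hg : Sym ρ m₂ g) (n : ℕ) : Sym ρ (m₁ + m₂ - (n : ℝ) * ρ)
      (fun X => ∑ k ∈ Finset.range (n + 1), expansionTerm B f g n k X) :=
  Sym.sum _ fun k _ => (sym_expansionTerm hB hf hg n k).mono (by
    have := mul_nonneg (Nat.cast_nonneg (α := ℝ) k) hρ.1
    linarith)

lemma sym_magneticWeylProduct (hB : IsMagneticField B) (hρ : ρ ∈ Set.Icc (0 : ℝ) 1)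
    (hf : Sym ρ m₁ f) (hg : Sym ρ m₂ g) {ε : ℝ} (hε : 0 < ε) (hε1 : ε ≤ 1) :
    Sym ρ (m₁ + m₂) (magneticWeylProduct ε 1 B f g) := by
  have h := Sym.const_mul ((amp_bigAmp hB hρ hf hg).cl_oscFam (ε := ε)
    (by rwa [abs_of_pos hε])) ((((2 * Real.pi) ^ (2 * d))⁻¹ : ℝ) : ℂ)
  refine Cl.congr h (fun _ _ => rfl) fun _ X => ?_
  exact (hasMagneticWeylProduct hB hρ hf hg hε hε1 X).magneticWeylProduct_eq.symm

lemma norm_partialDeriv_remainder_le (hB : IsMagneticField B) (hρ : ρ ∈ Set.Icc (0 : ℝ) 1)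
    (hf : Sym ρ m₁ f) (hg : Sym ρ m₂ g) (N : ℕ) (a α : Fin d → ℕ) :
    ∃ C : ℝ, ∀ ε : ℝ, 0 < ε → ε ≤ 1 → ∀ X : Phase d,
      ‖partialDeriv a α (fun X => magneticWeylProduct ε 1 B f g X -
          ∑ n ∈ Finset.range (N + 1), (ε : ℂ) ^ n *
            ∑ k ∈ Finset.range (n + 1), expansionTerm B f g n k X) X‖ ≤
        C * ε ^ (N + 1) * japanese X.2 ^
          (m₁ + m₂ - ((N : ℝ) + 1) * ρ - ((∑ i, α i : ℕ) : ℝ) * ρ) := by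
  obtain ⟨C, hC⟩ := (cl_remainder hB hρ hf hg N).bound (word a α)
  refine ⟨C, fun ε hε hε1 X => ?_⟩
  have h := hC ⟨ε, hε, hε1⟩ X
  rw [partialDeriv_eq_wd]
  refine h.trans (le_of_eq ?_)
  rw [mul_assoc (ε ^ (N + 1)), wH_mul_prod_ϖH]
  simp only [count_word_inr]
  ring

end Expansion

end MagneticWeyl

end

theorem mainTheorem2 {d : ℕ} (B : MagneticWeyl.Config d → Fin d → Fin d → ℝ)
    (hB : MagneticWeyl.IsMagneticField B) (ρ m₁ m₂ : ℝ) (hρ : ρ ∈ Set.Icc (0 : ℝ) 1)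
    (f g : MagneticWeyl.Phase d → ℂ)
    (hf : MagneticWeyl.IsHormander d ρ m₁ f) (hg : MagneticWeyl.IsHormander d ρ m₂ g) :
    -- the two-parameter terms and the `n`-th order terms in `ε` lie in the right symbol classes
    (∀ n k : ℕ, MagneticWeyl.IsHormander d ρ (m₁ + m₂ - ((n : ℝ) + k) * ρ)
      (MagneticWeyl.expansionTerm B f g n k)) ∧
    (∀ n : ℕ, MagneticWeyl.IsHormander d ρ (m₁ + m₂ - (n : ℝ) * ρ)
      (fun X => ∑ k ∈ Finset.range (n + 1), MagneticWeyl.expansionTerm B f g n k X)) ∧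
    -- for `λ = 1` the product exists as an oscillatory integral and is a symbol, and so are the
    -- remainders of the expansion in `ε`
    (∀ ε : ℝ, 0 < ε → ε ≤ 1 →
      (∀ X, MagneticWeyl.HasMagneticWeylProduct ε 1 B f g X
        (MagneticWeyl.magneticWeylProduct ε 1 B f g X)) ∧
      MagneticWeyl.IsHormander d ρ (m₁ + m₂) (MagneticWeyl.magneticWeylProduct ε 1 B f g) ∧
      ∀ N : ℕ, MagneticWeyl.IsHormander d ρ (m₁ + m₂ - ((N : ℝ) + 1) * ρ)
        (fun X => MagneticWeyl.magneticWeylProduct ε 1 B f g X -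
          ∑ n ∈ Finset.range (N + 1), (ε : ℂ) ^ n *
            ∑ k ∈ Finset.range (n + 1), MagneticWeyl.expansionTerm B f g n k X)) ∧
    -- the remainders are `O(ε^{N+1})` in every seminorm of their symbol class
    (∀ (N : ℕ) (a α : Fin d → ℕ), ∃ C : ℝ, ∀ ε : ℝ, 0 < ε → ε ≤ 1 →
      ∀ X : MagneticWeyl.Phase d,
        ‖MagneticWeyl.partialDeriv a α
          (fun X => MagneticWeyl.magneticWeylProduct ε 1 B f g X -
            ∑ n ∈ Finset.range (N + 1), (ε : ℂ) ^ n *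
              ∑ k ∈ Finset.range (n + 1), MagneticWeyl.expansionTerm B f g n k X) X‖ ≤
          C * ε ^ (N + 1) * MagneticWeyl.japanese X.2 ^
            (m₁ + m₂ - ((N : ℝ) + 1) * ρ - ((∑ i, α i : ℕ) : ℝ) * ρ)) := by
  have hf' := MagneticWeyl.isHormander_iff_sym.1 hf
  have hg' := MagneticWeyl.isHormander_iff_sym.1 hg
  refine ⟨fun n k => MagneticWeyl.isHormander_iff_sym.2
      (MagneticWeyl.sym_expansionTerm hB hf' hg' n k), fun n => MagneticWeyl.isHormander_iff_sym.2
      (MagneticWeyl.sym_sum_expansionTerm hB hρ hf' hg' n), fun ε hε hε1 => ⟨fun X => ?_,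
      MagneticWeyl.isHormander_iff_sym.2
        (MagneticWeyl.sym_magneticWeylProduct hB hρ hf' hg' hε hε1), fun N =>
      MagneticWeyl.isHormander_iff_sym.2 ?_⟩,
    MagneticWeyl.norm_partialDeriv_remainder_le hB hρ hf' hg'⟩
  · have h := MagneticWeyl.hasMagneticWeylProduct hB hρ hf' hg' hε hε1 X
    rw [h.magneticWeylProduct_eq]
    exact h
  · exact MagneticWeyl.sym_remainder hB hρ hf' hg' hε hε1 N
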